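/- **Conformal field theories.** Fix a compact oriented surface $S$ of genus $g\ge 1$. An F-bundle functor assigns to every Riemann surface $A$ a complex vector bundle $\Phi(A)$, filtered by finite-dimensional sub-bundles, with infinite-dimensional fibre $F$, functorially for conformal maps, compatibly with restriction to open sets and depending smoothly on the conformal map; a local coordinate identifies nearby fibres with $F$. A rational conformal field theory of central charge $c\in\mathbb R$ on surfaces of type $S$ consists of such a functor; an invariant identity field $1$; a state, i.e. for all compact Riemann surfaces $A\cong S$, all compatible smooth metrics $G$ and all $N\ge 0$ an $N$-point function $\langle\varphi_1\cdots\varphi_N\rangle_{A,G}\in\mathbb C$ for fields $\varphi_i\in\Phi(A)_{p_i}$ at pairwise different positions, which is symmetric, $\mathbb C$-linear in each field, smooth in the conformal structure, the metric and the positions, unchanged by inserting $1$, and invariant under orientation preserving isometries; and a smooth section $T$ of $\Phi(A)\otimes\mathrm{Sym}^2TA$ (depending on $G$) such that * if a metric $G_t$ varies smoothly and its conformal class is fixed near the positions, then $\frac{d}{dt}\langle\varphi\ldots\rangle_{G_t}=\int\langle (T,\dot G_t)\,\varphi\ldots\rangle_{G_t}\,d\mathrm{vol}_{G_t}$; * $(T,G)=-\frac{c}{48\pi}\mathcal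 R\cdot 1$, where $\mathcal R$ is the scalar curvature. In a conformal coordinate $z$ with $G=\rho\,|dz|^2$ let $T_{zz}=-2\cdot\frac{\rho^2}{4}(T,d\bar z^2)$ (so the energy momentum tensor is $-2T$, with indices lowered by $G$). The Virasoro field $T(z)$ is defined by $\frac1{2\pi}T(z)=T_{zz}-\frac{c}{24\pi}\bigl(\partial_z\Gamma-\tfrac12\Gamma^2\bigr)\cdot 1$, $\Gamma=\partial_z\log\rho$. **The singular state.** Fix $a\in\mathbb C\setminus\{0\}$. For pairwise different $X=(X_1,\dots,X_n)$, $n=2g+1$, let $\Sigma_X$ be the compact hyperelliptic Riemann surface $y^2=p(x)=a\prod_j(x-X_j)$ with its one point at infinity. For $\delta>0$ let $G_{\delta,X}$ be the lift to $\Sigma_X$ of $\prod_j\rho\!\left(\tfrac{|x-X_j|}{\delta}\right)\sigma(\delta|x|)\,|dx|^2$, where $\rho,\sigma:(0,\infty)\to(0,\infty)$ are fixed smooth functions with $\rho(s)=1$ for $s\ge1$, $\rho(s)=\text{const}/s$ for $s\le\frac12$, $\sigma(s)=1$ for $s\le 1$, $\sigma(s)=\text{const}/s^3$ for $s\ge2$.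 For small $\delta$ this is a smooth metric; it equals $|dx|^2$ where $|x-X_j|\ge\delta$ for all $j$ and $|x|\le1/\delta$, and as $\delta\searrow0$ it tends to the singular metric that is $|dx|^2$ away from the branch points. Let $Z(\delta)\in\mathbb C$ be a renormalisation factor, independent of $X$ and of the fields, such that $$\langle\varphi_1\cdots\varphi_N\rangle_{\mathrm{sing}}:=\lim_{\delta\searrow0}Z(\delta)\,\langle\varphi_1\cdots\varphi_N\rangle_{\Sigma_X,G_{\delta,X}}$$ exists for all $X$, all $N$ and all fields at pairwise different positions other than the ramification points and infinity. **Theorem.** Consider a rational conformal field theory on surfaces of the type of $\Sigma_{X^0}$, and $\rho,\sigma,Z$ as above. Let $v_1,\dots,v_N\in F$ and $x_1,\dots,x_N\in\mathbb C$. For every $X$ let $P_i(X)\in\Sigma_X$ be an affine point over $x_i$ whose $y$-coordinate is continuous at $X=X^0$, with $P_1(X^0),\dots,P_N(X^0)$ pairwise different, and let $\varphi_i$ be the field $v_i$ placed at $P_i(X)$ by means of the coordinate $x$. For each $j$ let $U_j$ be the part of $\Sigma_{X^0}$ over a disc $|x-X_j^0|<r_j$ that contains no other branch point and no $x_i$,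 and let $\gamma_j$ be a $C^1$ closed path in $U_j$ minus the ramification point over $X_j^0$ that circles this ramification point once, counterclockwise (so its projection to the $x$-plane circles $X_j^0$ twice). Then $X\mapsto\langle\varphi_1\cdots\varphi_N\rangle_{\mathrm{sing}}$ is real differentiable at $X^0$, and its holomorphic differential $d=\sum_j\xi_j\frac{\partial}{\partial X_j}$, $\xi_j=dX_j$ (the $(1,0)$-part of the differential), is $$d\langle\varphi_1\cdots\varphi_N\rangle_{\mathrm{sing}}=\sum_{j=1}^{n}\left(\frac1{2\pi i}\oint_{\gamma_j}\langle T(x)\,\varphi_1\cdots\varphi_N\rangle_{\mathrm{sing}}\,dx\right)\xi_j .$$ The integrals exist. Here $T(x)$ is the Virasoro field in the coordinate $x$ for the singular metric near $\gamma_j$, i.e. for $G_{\delta_0,X^0}$ with any sufficiently small $\delta_0$. -/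

import Mathlib

open scoped Manifold ContDiff Topology
open Filter MeasureTheory

universe u

noncomputable section

/-- A Riemann surface: a Hausdorff space with a complex analytic atlas modelled on `ℂ`. -/
structure RiemannSurface where
  carrier : Type
  [top : TopologicalSpace carrier]
  [t2 : T2Space carrier]
  [charted : ChartedSpace ℂ carrier]
  [mfd : IsManifold 𝓘(ℂ) ω carrier]

instance : CoeSort RiemannSurface Type := ⟨RiemannSurface.carrier⟩

attribute [instance] RiemannSurface.top RiemannSurface.t2 RiemannSurface.charted
  RiemannSurface.mfd

/-- The polynomial `p(x) = a ∏ (x - X j)`. -/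
def hPoly {n : ℕ} (a : ℂ) (X : Fin n → ℂ) (x : ℂ) : ℂ := a * ∏ j, (x - X j)

/-- The polynomial `p(x) / (x - X j)`. -/
def hCofactor {n : ℕ} (a : ℂ) (X : Fin n → ℂ) (j : Fin n) (x : ℂ) : ℂ :=
  a * ∏ k ∈ Finset.univ.erase j, (x - X k)

/-- The polynomial `∏ (1 - X j s)`, so that `p(x) = a xⁿ ∏ (1 - X j x⁻¹)`. -/
def hReverse {n : ℕ} (X : Fin n → ℂ) (s : ℂ) : ℂ := ∏ j, (1 - X j * s)

/-- The affine curve `y² = p(x)`; a point is the pair `(x, y)`. -/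
abbrev AffineCurve {n : ℕ} (a : ℂ) (X : Fin n → ℂ) : Type :=
  {P : ℂ × ℂ // P.2 ^ 2 = hPoly a X P.1}

section Charts

lemma csqrt_sq (z : ℂ) : Complex.sqrt z ^ 2 = z := by
  simp [Complex.sqrt]

lemma csqrt_ne_zero {z : ℂ} (hz : z ≠ 0) : Complex.sqrt z ≠ 0 := by
  intro h; apply hz; rw [← csqrt_sq z, h]; simp

lemma csqrt_re_pos {z : ℂ} (hz : z ∈ Complex.slitPlane) : 0 < (Complex.sqrt z).re := by
  rw [_root_.sqrt_eq_exp (Complex.slitPlane_ne_zero hz), Complex.exp_re]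
  have h := Complex.mem_slitPlane_iff_arg.1 hz
  have h1 := Complex.neg_pi_lt_arg z
  have h2 := lt_of_le_of_ne (Complex.arg_le_pi z) h.1
  have : (Complex.log z / 2).im = z.arg / 2 := by
    rw [← Complex.log_im]; simp
  rw [this]
  exact mul_pos (Real.exp_pos _) (Real.cos_pos_of_mem_Ioo ⟨by linarith, by linarith⟩)

lemma sq_mem_slitPlane {w : ℂ} (hw : 0 < w.re) : w ^ 2 ∈ Complex.slitPlane := by
  rw [Complex.mem_slitPlane_iff]
  by_cases h : w.im = 0
  · left; simp [pow_two, h]; positivity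
  · right; simp only [pow_two, Complex.mul_im]
    have : w.re * w.im + w.im * w.re = 2 * (w.re * w.im) := by ring
    rw [this]; exact mul_ne_zero two_ne_zero (mul_ne_zero hw.ne' h)

lemma csqrt_of_sq {w : ℂ} (hw : 0 < w.re) : Complex.sqrt (w ^ 2) = w := by
  have h := csqrt_re_pos (sq_mem_slitPlane hw)
  rcases sq_eq_sq_iff_eq_or_eq_neg.1 (csqrt_sq (w ^ 2)) with h1 | h1
  · exact h1
  · rw [h1] at h; simp at h; linarith

variable {n : ℕ} (a : ℂ) (X : Fin n → ℂ)

lemma differentiable_hPoly : Differentiable ℂ (hPoly a X) := by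
  unfold hPoly; fun_prop

lemma differentiable_hCofactor (j : Fin n) : Differentiable ℂ (hCofactor a X j) := by
  unfold hCofactor; fun_prop

lemma differentiable_hReverse : Differentiable ℂ (hReverse X) := by
  unfold hReverse; fun_prop

lemma hPoly_eq_mul (j : Fin n) (x : ℂ) : hPoly a X x = (x - X j) * hCofactor a X j x := by
  unfold hPoly hCofactor
  rw [← Finset.mul_prod_erase Finset.univ (fun k => x - X k) (Finset.mem_univ j)]; ring

lemma hPoly_inv (u : ℂ) (hu : u ≠ 0) : hPoly a X (u⁻¹) = a * (u⁻¹) ^ n * hReverse X u := by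
  unfold hPoly hReverse
  have : ∀ j, u⁻¹ - X j = u⁻¹ * (1 - X j * u) := fun j => by field_simp
  simp_rw [this, Finset.prod_mul_distrib]
  simp; ring

lemma isClosed_affine : IsClosed {P : ℂ × ℂ | P.2 ^ 2 = hPoly a X P.1} :=
  isClosed_eq (by fun_prop) ((differentiable_hPoly a X).continuous.comp continuous_fst)

instance : LocallyCompactSpace (AffineCurve a X) :=
  (isClosed_affine a X).isClosedEmbedding_subtypeVal.locallyCompactSpace

variable {a X}

/-- The coordinate `x` near a point with `y ≠ 0`. -/
def xChartAffine (P₀ : AffineCurve a X) (h : P₀.1.2 ≠ 0) :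
    OpenPartialHomeomorph (AffineCurve a X) ℂ where
  toFun P := P.1.1
  invFun x := ⟨(x, P₀.1.2 * Complex.sqrt (hPoly a X x / hPoly a X P₀.1.1)), by
    have h0 : hPoly a X P₀.1.1 ≠ 0 := by rw [← P₀.2]; exact pow_ne_zero 2 h
    simp only [mul_pow, csqrt_sq]; rw [P₀.2]; field_simp⟩
  source := {P | 0 < (P.1.2 / P₀.1.2).re}
  target := {x | hPoly a X x / hPoly a X P₀.1.1 ∈ Complex.slitPlane}
  map_source' P hP := by
    have := sq_mem_slitPlane hP
    rwa [div_pow, P.2, P₀.2] at this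
  map_target' x hx := by
    have := csqrt_re_pos hx
    simpa [mul_div_cancel_left₀ _ h] using this
  left_inv' P hP := by
    ext1
    refine Prod.ext rfl ?_
    simp only
    rw [← P.2, ← P₀.2, ← div_pow, csqrt_of_sq hP, mul_div_cancel₀ _ h]
  right_inv' x hx := rfl
  open_source := isOpen_lt continuous_const (by fun_prop)
  open_target := Complex.isOpen_slitPlane.preimage
    ((differentiable_hPoly a X).continuous.div_const _)
  continuousOn_toFun := by fun_prop
  continuousOn_invFun := by
    refine Topology.IsEmbedding.subtypeVal.continuousOn_iff.2 ?_
    refine continuousOn_id.prodMk (continuousOn_const.mul ?_)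
    exact Complex.continuousOn_sqrt.comp
      ((differentiable_hPoly a X).continuous.div_const _).continuousOn (fun x hx => hx)

/-- The coordinate `w` near the ramification point `(X j, 0)`, with `x = X j + w²`. -/
def wChartAffine (j : Fin n) (h : hCofactor a X j (X j) ≠ 0) :
    OpenPartialHomeomorph (AffineCurve a X) ℂ where
  toFun P := P.1.2 / (Complex.sqrt (hCofactor a X j (X j)) *
    Complex.sqrt (hCofactor a X j P.1.1 / hCofactor a X j (X j)))
  invFun w := ⟨(X j + w ^ 2, w * (Complex.sqrt (hCofactor a X j (X j)) *
      Complex.sqrt (hCofactor a X j (X j + w ^ 2) / hCofactor a X j (X j)))), by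
    simp only [mul_pow, csqrt_sq]; rw [hPoly_eq_mul a X j]; field_simp; ring⟩
  source := {P | hCofactor a X j P.1.1 / hCofactor a X j (X j) ∈ Complex.slitPlane}
  target := {w | hCofactor a X j (X j + w ^ 2) / hCofactor a X j (X j) ∈ Complex.slitPlane}
  map_source' P hP := by
    have h1 := Complex.slitPlane_ne_zero hP
    have h2 : hCofactor a X j P.1.1 ≠ 0 := fun h0 => h1 (by simp [h0])
    have : X j + (P.1.2 / (Complex.sqrt (hCofactor a X j (X j)) *
      Complex.sqrt (hCofactor a X j P.1.1 / hCofactor a X j (X j)))) ^ 2 = P.1.1 := by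
      rw [div_pow, mul_pow, csqrt_sq, csqrt_sq, P.2, hPoly_eq_mul a X j]
      field_simp; ring
    simp only [Set.mem_ofPred_eq]; rw [this]; exact hP
  map_target' w hw := hw
  left_inv' P hP := by
    have h1 := Complex.slitPlane_ne_zero hP
    have h2 : hCofactor a X j P.1.1 ≠ 0 := fun h0 => h1 (by simp [h0])
    have : X j + (P.1.2 / (Complex.sqrt (hCofactor a X j (X j)) *
      Complex.sqrt (hCofactor a X j P.1.1 / hCofactor a X j (X j)))) ^ 2 = P.1.1 := by
      rw [div_pow, mul_pow, csqrt_sq, csqrt_sq, P.2, hPoly_eq_mul a X j]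
      field_simp; ring
    ext1
    refine Prod.ext this ?_
    simp only; rw [this]
    exact div_mul_cancel₀ _ (mul_ne_zero (csqrt_ne_zero h) (csqrt_ne_zero h1))
  right_inv' w hw := by
    have h1 := Complex.slitPlane_ne_zero hw
    exact mul_div_cancel_right₀ _ (mul_ne_zero (csqrt_ne_zero h) (csqrt_ne_zero h1))
  open_source := Complex.isOpen_slitPlane.preimage
    (((differentiable_hCofactor a X j).continuous.comp (by fun_prop)).div_const _)
  open_target := Complex.isOpen_slitPlane.preimage
    (((differentiable_hCofactor a X j).continuous.comp (by fun_prop)).div_const _)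
  continuousOn_toFun := by
    refine ContinuousOn.div (by fun_prop) (continuousOn_const.mul ?_) ?_
    · exact Complex.continuousOn_sqrt.comp
        (((differentiable_hCofactor a X j).continuous.comp (by fun_prop)).div_const _).continuousOn
        (fun x hx => hx)
    · intro P hP
      exact mul_ne_zero (csqrt_ne_zero h) (csqrt_ne_zero (Complex.slitPlane_ne_zero hP))
  continuousOn_invFun := by
    refine Topology.IsEmbedding.subtypeVal.continuousOn_iff.2 ?_
    refine ContinuousOn.prodMk (by fun_prop) (continuousOn_id.mul (continuousOn_const.mul ?_))
    exact Complex.continuousOn_sqrt.comp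
      (((differentiable_hCofactor a X j).continuous.comp (by fun_prop)).div_const _).continuousOn
      (fun x hx => hx)


lemma isCompact_affine_norm_le (R : ℝ) : IsCompact {P : AffineCurve a X | ‖P.1.1‖ ≤ R} := by
  rw [Topology.IsEmbedding.subtypeVal.isCompact_iff]
  obtain ⟨M, hM⟩ := (isCompact_closedBall (0 : ℂ) R).exists_bound_of_continuousOn
    (differentiable_hPoly a X).continuous.continuousOn
  refine ((isCompact_closedBall (0 : ℂ) R).prod
    (isCompact_closedBall (0 : ℂ) (M + 1))).of_isClosed_subset ?_ ?_
  · exact (isClosed_affine a X).isClosedEmbedding_subtypeVal.isClosedMap _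
      (isClosed_le (by fun_prop) continuous_const)
  · rintro _ ⟨P, hP, rfl⟩
    have hP' : P.1.1 ∈ Metric.closedBall (0 : ℂ) R := by simpa using hP
    refine ⟨hP', ?_⟩
    have h1 := hM _ hP'
    rw [← P.2, norm_pow] at h1
    simp only [mem_closedBall_zero_iff]
    nlinarith [norm_nonneg P.1.2]

lemma tendsto_norm_affine :
    Tendsto (fun P : AffineCurve a X => ‖P.1.1‖) (coclosedCompact _) atTop := by
  rw [tendsto_atTop]
  intro R
  refine hasBasis_coclosedCompact.mem_iff.2 ⟨_, ⟨isClosed_le (by fun_prop) continuous_const,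
    isCompact_affine_norm_le R⟩, ?_⟩
  intro P hP
  simp only [Set.mem_compl_iff, Set.mem_ofPred_eq, not_le] at hP
  exact hP.le

end Charts

section ChartAtInfinity

variable {g : ℕ} {a : ℂ} {X : Fin (2 * g + 1) → ℂ}

/-- The domain of the coordinate `u` at the point at infinity. -/
def infSource (a : ℂ) (X : Fin (2 * g + 1) → ℂ) : Set (OnePoint (AffineCurve a X)) :=
  {q | q.elim True fun P => P.1.1 ≠ 0 ∧ hReverse X (P.1.1)⁻¹ ∈ Complex.slitPlane}

/-- The point of the affine curve with `x = u⁻²` and coordinate `u ≠ 0`. -/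
def infParam (a : ℂ) (X : Fin (2 * g + 1) → ℂ) (u : ℂ) (hu : u ≠ 0) : AffineCurve a X :=
  ⟨((u ^ 2)⁻¹, (u⁻¹) ^ (2 * g + 1) * (Complex.sqrt a * Complex.sqrt (hReverse X (u ^ 2)))), by
    simp only [mul_pow, csqrt_sq]
    rw [hPoly_inv a X _ (pow_ne_zero 2 hu)]; ring⟩

/-- The coordinate `u` near infinity as a function of `(x, y)`. -/
def infFun (a : ℂ) (X : Fin (2 * g + 1) → ℂ) (P : ℂ × ℂ) : ℂ :=
  P.1 ^ g * (Complex.sqrt a * Complex.sqrt (hReverse X (P.1)⁻¹)) / P.2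

lemma infFun_sq (ha : a ≠ 0) (P : AffineCurve a X) (h0 : P.1.1 ≠ 0)
    (h : hReverse X (P.1.1)⁻¹ ∈ Complex.slitPlane) : infFun a X P.1 ^ 2 = (P.1.1)⁻¹ := by
  have h1 := Complex.slitPlane_ne_zero h
  have h2 := hPoly_inv a X _ (inv_ne_zero h0)
  rw [inv_inv] at h2
  unfold infFun
  rw [div_pow, P.2, h2, mul_pow, mul_pow, csqrt_sq, csqrt_sq, ← pow_mul, mul_comm g 2, pow_succ]
  generalize hReverse X (P.1.1)⁻¹ = t at h1
  field_simp

lemma affine_snd_ne_zero (ha : a ≠ 0) (P : AffineCurve a X) (h0 : P.1.1 ≠ 0)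
    (h : hReverse X (P.1.1)⁻¹ ∈ Complex.slitPlane) : P.1.2 ≠ 0 := by
  intro h1
  have h2 := infFun_sq ha P h0 h
  simp [infFun, h1] at h2
  exact h0 h2.symm

open Classical in
/-- The inverse of the coordinate `u` near infinity. -/
def infInv (a : ℂ) (X : Fin (2 * g + 1) → ℂ) (u : ℂ) : OnePoint (AffineCurve a X) :=
  if hu : u = 0 then OnePoint.infty else ((infParam a X u hu : AffineCurve a X) : OnePoint _)

lemma infInv_zero : infInv a X 0 = OnePoint.infty := by simp [infInv]

lemma infInv_ne {u : ℂ} (hu : u ≠ 0) : infInv a X u = infParam a X u hu := by simp [infInv, hu]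

/-- The coordinate `u` near the point at infinity, with `x = u⁻²`. -/
def infChart (ha : a ≠ 0) : OpenPartialHomeomorph (OnePoint (AffineCurve a X)) ℂ where
  toFun q := q.elim 0 fun P => infFun a X P.1
  invFun := infInv a X
  source := infSource a X
  target := {u | hReverse X (u ^ 2) ∈ Complex.slitPlane}
  map_source' q hq := by
    induction q using OnePoint.rec with
    | infty => simp [hReverse]
    | coe P =>
      obtain ⟨h0, h⟩ := hq
      simp only [OnePoint.elim_some, Set.mem_ofPred_eq]
      rw [infFun_sq ha P h0 h]; exact h
  map_target' u hu := by
    by_cases h : u = 0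
    · simp [h, infInv_zero, infSource]
    · simp only [infInv_ne h, infSource, Set.mem_ofPred_eq, OnePoint.elim_some, infParam]
      refine ⟨inv_ne_zero (pow_ne_zero 2 h), ?_⟩
      rw [inv_inv]; exact hu
  left_inv' q hq := by
    induction q using OnePoint.rec with
    | infty => simp [infInv_zero]
    | coe P =>
      obtain ⟨h0, h⟩ := hq
      have h1 := infFun_sq ha P h0 h
      have h2 : infFun a X P.1 ≠ 0 := by
        intro h3; rw [h3] at h1; simp at h1; exact h0 h1.symm
      have h4 := affine_snd_ne_zero ha P h0 h
      have h5 := csqrt_ne_zero ha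
      have h6 := csqrt_ne_zero (Complex.slitPlane_ne_zero h)
      simp only [OnePoint.elim_some]
      rw [infInv_ne h2, OnePoint.coe_eq_coe]
      ext1
      refine Prod.ext (by simp only [infParam]; rw [h1, inv_inv]) ?_
      simp only [infParam]
      rw [h1, pow_succ, pow_mul, inv_pow, h1, inv_inv]
      unfold infFun
      generalize Complex.sqrt (hReverse X (P.1.1)⁻¹) = t at h6
      field_simp
  right_inv' u hu := by
    by_cases h : u = 0
    · simp [h, infInv_zero]
    · have h5 := csqrt_ne_zero ha
      have h6 := csqrt_ne_zero (Complex.slitPlane_ne_zero hu)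
      simp only [infInv_ne h, OnePoint.elim_some, infParam, infFun, inv_inv]
      rw [pow_succ u⁻¹, pow_mul u⁻¹, inv_pow u 2]
      generalize Complex.sqrt (hReverse X (u ^ 2)) = t at h6
      field_simp
  open_source := by
    rw [OnePoint.isOpen_iff_of_mem' (by simp [infSource])]
    have hopen : IsOpen ((fun P : AffineCurve a X => (P : OnePoint (AffineCurve a X))) ⁻¹' infSource a X : Set (AffineCurve a X)) := by
      have : ((fun P : AffineCurve a X => (P : OnePoint (AffineCurve a X))) ⁻¹' infSource a X : Set (AffineCurve a X)) =
          {P | P.1.1 ≠ 0} ∩ (fun P => hReverse X (P.1.1)⁻¹) ⁻¹' Complex.slitPlane := rfl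
      rw [this]
      refine ContinuousOn.isOpen_inter_preimage ?_ ?_ Complex.isOpen_slitPlane
      · refine (differentiable_hReverse X).continuous.comp_continuousOn ?_
        exact ContinuousOn.inv₀ (by fun_prop) (fun P hP => hP)
      · exact isOpen_ne_fun (by fun_prop) continuous_const
    refine ⟨?_, hopen⟩
    have ev : ∀ᶠ P : AffineCurve a X in coclosedCompact _, (P : OnePoint _) ∈ infSource a X := by
      have t1 : Tendsto (fun P : AffineCurve a X => (P.1.1)⁻¹) (coclosedCompact _) (𝓝 0) := by
        rw [tendsto_zero_iff_norm_tendsto_zero]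
        simp_rw [norm_inv]
        exact tendsto_norm_affine.inv_tendsto_atTop
      have t2 := ((differentiable_hReverse X).continuous.tendsto 0).comp t1
      have t3 : hReverse X 0 ∈ Complex.slitPlane := by simp [hReverse]
      filter_upwards [t2 (Complex.isOpen_slitPlane.mem_nhds t3),
        tendsto_norm_affine.eventually_gt_atTop 0] with P h1 h2
      exact ⟨norm_pos_iff.1 h2, h1⟩
    obtain ⟨K, ⟨hK1, hK2⟩, hK3⟩ := hasBasis_coclosedCompact.mem_iff.1 ev
    refine hK2.of_isClosed_subset hopen.isClosed_compl ?_
    exact Set.compl_subset_comm.1 hK3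
  open_target := Complex.isOpen_slitPlane.preimage
    ((differentiable_hReverse X).continuous.comp (by fun_prop))
  continuousOn_toFun := by
    intro q hq
    induction q using OnePoint.rec with
    | infty =>
      rw [ContinuousWithinAt]
      simp only [OnePoint.elim_infty]
      rw [tendsto_zero_iff_norm_tendsto_zero]
      have key : ContinuousAt (fun q : OnePoint (AffineCurve a X) =>
          q.elim (0 : ℝ) fun P => Real.sqrt (‖P.1.1‖⁻¹)) OnePoint.infty := by
        rw [OnePoint.continuousAt_infty']
        have : Tendsto (fun P : AffineCurve a X => Real.sqrt (‖P.1.1‖⁻¹)) (coclosedCompact _)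
            (𝓝 (Real.sqrt 0)) :=
          (Real.continuous_sqrt.tendsto 0).comp tendsto_norm_affine.inv_tendsto_atTop
        simpa [Function.comp_def] using this
      refine (key.continuousWithinAt (s := infSource a X)).tendsto.congr' ?_
      filter_upwards [self_mem_nhdsWithin] with q hq
      induction q using OnePoint.rec with
      | infty => simp
      | coe P =>
        obtain ⟨h0, h⟩ := hq
        simp only [OnePoint.elim_some]
        rw [← norm_inv, ← infFun_sq ha P h0 h, norm_pow, Real.sqrt_sq (norm_nonneg _)]
    | coe P =>
      obtain ⟨h0, h⟩ := hq
      refine ContinuousAt.continuousWithinAt ?_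
      rw [OnePoint.continuousAt_coe]
      have h4 := affine_snd_ne_zero ha P h0 h
      have : ContinuousAt (infFun a X) P.1 := by
        unfold infFun
        refine ContinuousAt.div ((by fun_prop : ContinuousAt (fun P : ℂ × ℂ => P.1 ^ g) _).mul
          (continuousAt_const.mul ?_)) (by fun_prop) h4
        refine ContinuousAt.comp (g := Complex.sqrt)
          (Complex.continuousOn_sqrt.continuousAt (Complex.isOpen_slitPlane.mem_nhds h)) ?_
        refine ContinuousAt.comp (g := hReverse X)
          (differentiable_hReverse X).continuous.continuousAt ?_
        exact ContinuousAt.inv₀ (by fun_prop) h0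
      exact this.comp continuous_subtype_val.continuousAt
  continuousOn_invFun := by
    intro u hu
    refine ContinuousAt.continuousWithinAt ?_
    by_cases h : u = 0
    · subst h
      rw [ContinuousAt, infInv_zero]
      rw [Tendsto, OnePoint.le_nhds_infty]
      intro K _ hK
      obtain ⟨R, hR⟩ := hK.exists_bound_of_continuousOn
        (f := fun P : AffineCurve a X => P.1.1) (by fun_prop)
      have t : Tendsto (fun u : ℂ => ‖(u ^ 2)⁻¹‖) (𝓝[≠] 0) atTop := by
        have : Tendsto (fun u : ℂ => u ^ 2) (𝓝[≠] 0) (𝓝[≠] 0) := by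
          refine tendsto_nhdsWithin_of_tendsto_nhds_of_eventually_within _ ?_ ?_
          · exact tendsto_nhdsWithin_of_tendsto_nhds
              (by simpa using (continuous_pow (M := ℂ) 2).tendsto 0)
          · filter_upwards [self_mem_nhdsWithin] with u hu using pow_ne_zero 2 hu
        exact tendsto_norm_cobounded_atTop.comp
          (Filter.tendsto_inv₀_nhdsNE_zero.comp this)
      have t2 := t.eventually_gt_atTop R
      rw [eventually_nhdsWithin_iff] at t2
      rw [Filter.mem_map]
      filter_upwards [t2] with u hu
      by_cases h : u = 0
      · simp [h, infInv_zero]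
      · left
        rw [infInv_ne h]
        refine ⟨_, fun hm => ?_, rfl⟩
        exact absurd (hR _ hm) (not_le.2 (hu h))
    · have ho : IsOpen {u : ℂ | u ≠ 0} := isOpen_ne
      suffices hs : ContinuousOn (infInv a X)
          ({u : ℂ | u ≠ 0} ∩ {u | hReverse X (u ^ 2) ∈ Complex.slitPlane}) by
        refine hs.continuousAt (Filter.inter_mem (ho.mem_nhds h) (IsOpen.mem_nhds ?_ hu))
        exact Complex.isOpen_slitPlane.preimage
          ((differentiable_hReverse X).continuous.comp (by fun_prop))
      rw [continuousOn_iff_continuous_domRestrict]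
      have : (({u : ℂ | u ≠ 0} ∩ {u | hReverse X (u ^ 2) ∈ Complex.slitPlane}).domRestrict
          (infInv a X)) =
          fun u => ((infParam a X u.1 u.2.1 : AffineCurve a X) : OnePoint _) := by
        funext u
        simp only [Set.domRestrict_apply]
        rw [infInv_ne u.2.1]
      rw [this]
      refine OnePoint.continuous_coe.comp ?_
      refine Continuous.subtype_mk ?_ _
      have hi : ∀ u : ({u : ℂ | u ≠ 0} ∩ {u | hReverse X (u ^ 2) ∈ Complex.slitPlane} : Set ℂ),
        (u : ℂ) ≠ 0 := fun u => u.2.1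
      refine Continuous.prodMk ?_ (Continuous.mul ?_ (continuous_const.mul ?_))
      · exact Continuous.inv₀ (by fun_prop) (fun u => pow_ne_zero 2 (hi u))
      · exact (Continuous.inv₀ (by fun_prop) hi).pow _
      · exact Complex.continuousOn_sqrt.comp_continuous
          ((differentiable_hReverse X).continuous.comp (by fun_prop)) (fun u => u.2.2)


lemma hCofactor_ne_zero {n : ℕ} {a : ℂ} {X : Fin n → ℂ} (ha : a ≠ 0) (hX : Function.Injective X)
    (j : Fin n) : hCofactor a X j (X j) ≠ 0 := by
  unfold hCofactor
  refine mul_ne_zero ha (Finset.prod_ne_zero_iff.2 fun k hk => sub_ne_zero.2 fun h => ?_)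
  exact (Finset.mem_erase.1 hk).1 (hX h).symm

lemma exists_eq_of_snd_eq_zero {n : ℕ} {a : ℂ} {X : Fin n → ℂ} (ha : a ≠ 0)
    (P : AffineCurve a X) (h : P.1.2 = 0) : ∃ j, P.1.1 = X j := by
  have h1 := P.2
  rw [h, hPoly] at h1
  simp only [ne_eq, OfNat.ofNat_ne_zero, not_false_eq_true, zero_pow, zero_eq_mul, ha, false_or,
    Finset.prod_eq_zero_iff, Finset.mem_univ, true_and, sub_eq_zero] at h1
  exact h1

/-- The pair `(x, y)`, with the value `0` at infinity. -/
def curveCoord (q : OnePoint (AffineCurve a X)) : ℂ × ℂ := q.elim 0 Subtype.val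

/-- The coordinate `x` near a point with `y ≠ 0`, on the compactified curve. -/
def xChart (P : AffineCurve a X) (h : P.1.2 ≠ 0) :
    OpenPartialHomeomorph (OnePoint (AffineCurve a X)) ℂ :=
  (xChartAffine P h).lift_openEmbedding OnePoint.isOpenEmbedding_coe

/-- The coordinate `w` near the ramification point `(X j, 0)`, on the compactified curve. -/
def wChart (ha : a ≠ 0) (hX : Function.Injective X) (j : Fin (2 * g + 1)) :
    OpenPartialHomeomorph (OnePoint (AffineCurve a X)) ℂ :=
  (wChartAffine j (hCofactor_ne_zero ha hX j)).lift_openEmbedding OnePoint.isOpenEmbedding_coe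

/-- The atlas of the compactified curve. -/
inductive CurveChart (ha : a ≠ 0) (hX : Function.Injective X) :
    OpenPartialHomeomorph (OnePoint (AffineCurve a X)) ℂ → Prop
  | x (P : AffineCurve a X) (h : P.1.2 ≠ 0) : CurveChart ha hX (xChart P h)
  | w (j : Fin (2 * g + 1)) : CurveChart ha hX (wChart ha hX j)
  | inf : CurveChart ha hX (infChart ha)

open Classical in
/-- The preferred chart: `x` where `y ≠ 0`, `w` at the ramification points, `u` at infinity. -/
def curveChartAt (ha : a ≠ 0) (hX : Function.Injective X) (q : OnePoint (AffineCurve a X)) :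
    OpenPartialHomeomorph (OnePoint (AffineCurve a X)) ℂ :=
  q.elim (infChart ha) fun P =>
    if h : P.1.2 = 0 then wChart ha hX (exists_eq_of_snd_eq_zero ha P h).choose
    else xChart P h

lemma CurveChart.eq_of_infty_mem {ha : a ≠ 0} {hX : Function.Injective X}
    {e : OpenPartialHomeomorph (OnePoint (AffineCurve a X)) ℂ} (he : CurveChart ha hX e)
    (h : OnePoint.infty ∈ e.source) : e = infChart ha := by
  cases he with
  | x P hP => exact absurd h OnePoint.infty_notMem_image_coe
  | w j => exact absurd h OnePoint.infty_notMem_image_coe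
  | inf => rfl

lemma CurveChart.differentiableAt_symm {ha : a ≠ 0} {hX : Function.Injective X}
    {e : OpenPartialHomeomorph (OnePoint (AffineCurve a X)) ℂ} (he : CurveChart ha hX e)
    {u : ℂ} (hu : u ∈ e.target) (h : e.symm u ≠ OnePoint.infty) :
    DifferentiableAt ℂ (fun u => curveCoord (e.symm u)) u := by
  cases he with
  | x P hP =>
    change DifferentiableAt ℂ (fun x : ℂ =>
      (x, P.1.2 * Complex.sqrt (hPoly a X x / hPoly a X P.1.1))) u
    refine differentiableAt_id.prodMk ((differentiableAt_const _).mul ?_)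
    exact (Complex.differentiableAt_sqrt hu).comp u
      ((differentiable_hPoly a X).differentiableAt.div_const _)
  | w j =>
    change DifferentiableAt ℂ (fun w : ℂ => (X j + w ^ 2,
      w * (Complex.sqrt (hCofactor a X j (X j)) *
      Complex.sqrt (hCofactor a X j (X j + w ^ 2) / hCofactor a X j (X j))))) u
    refine DifferentiableAt.prodMk (by fun_prop) (differentiableAt_id.mul
      ((differentiableAt_const _).mul ?_))
    refine DifferentiableAt.comp (g := Complex.sqrt) u (Complex.differentiableAt_sqrt hu) ?_
    refine DifferentiableAt.div_const ?_ _
    exact (differentiable_hCofactor a X j).differentiableAt.comp u (by fun_prop)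
  | inf =>
    have h0 : u ≠ 0 := by
      rintro rfl; exact h infInv_zero
    have hev : (fun u => curveCoord ((infChart (X := X) ha).symm u)) =ᶠ[𝓝 u]
        fun u => ((u ^ 2)⁻¹, (u⁻¹) ^ (2 * g + 1) *
          (Complex.sqrt a * Complex.sqrt (hReverse X (u ^ 2)))) := by
      filter_upwards [isOpen_ne.mem_nhds h0] with v hv
      change curveCoord (infInv a X v) = _
      rw [infInv_ne hv]; rfl
    refine DifferentiableAt.congr_of_eventuallyEq ?_ hev
    refine DifferentiableAt.prodMk ?_ (DifferentiableAt.mul ?_ ((differentiableAt_const _).mul ?_))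
    · exact DifferentiableAt.inv (by fun_prop) (pow_ne_zero 2 h0)
    · exact (differentiableAt_inv h0).pow _
    · refine DifferentiableAt.comp (g := Complex.sqrt) u (Complex.differentiableAt_sqrt hu) ?_
      exact (differentiable_hReverse X).differentiableAt.comp u (by fun_prop)

lemma differentiableAt_div_of_ne {f h : ℂ × ℂ → ℂ} {P : ℂ × ℂ} (hf : DifferentiableAt ℂ f P)
    (hh : DifferentiableAt ℂ h P) (h0 : h P ≠ 0) : DifferentiableAt ℂ (fun Q => f Q / h Q) P := by
  simp only [div_eq_mul_inv]
  exact hf.mul ((differentiableAt_inv h0).comp P hh)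

lemma CurveChart.exists_formula {ha : a ≠ 0} {hX : Function.Injective X}
    {e : OpenPartialHomeomorph (OnePoint (AffineCurve a X)) ℂ} (he : CurveChart ha hX e) :
    ∃ F : ℂ × ℂ → ℂ, ∀ P : AffineCurve a X, e P = F P.1 ∧
      ((P : OnePoint (AffineCurve a X)) ∈ e.source → DifferentiableAt ℂ F P.1) := by
  cases he with
  | x P hP =>
    refine ⟨Prod.fst, fun Q => ⟨OpenPartialHomeomorph.lift_openEmbedding_apply _ _, fun _ => ?_⟩⟩
    fun_prop
  | w j =>
    refine ⟨fun P => P.2 / (Complex.sqrt (hCofactor a X j (X j)) *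
      Complex.sqrt (hCofactor a X j P.1 / hCofactor a X j (X j))), fun Q =>
      ⟨OpenPartialHomeomorph.lift_openEmbedding_apply _ _, ?_⟩⟩
    rintro ⟨Q', hQ', hQQ⟩
    obtain rfl := OnePoint.coe_injective hQQ
    have h1 := csqrt_ne_zero (Complex.slitPlane_ne_zero hQ')
    have h2 : DifferentiableAt ℂ
        (fun P : ℂ × ℂ => hCofactor a X j P.1 / hCofactor a X j (X j)) Q'.1 :=
      differentiableAt_div_of_ne (DifferentiableAt.comp (g := hCofactor a X j) Q'.1
        (differentiable_hCofactor a X j).differentiableAt differentiableAt_fst)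
        (differentiableAt_const _) (hCofactor_ne_zero ha hX j)
    have h3 := DifferentiableAt.comp (g := Complex.sqrt) Q'.1
      (Complex.differentiableAt_sqrt hQ') h2
    exact differentiableAt_div_of_ne differentiableAt_snd (h3.const_mul _)
      (mul_ne_zero (csqrt_ne_zero (hCofactor_ne_zero ha hX j)) h1)
  | inf =>
    refine ⟨infFun a X, fun Q => ⟨rfl, ?_⟩⟩
    rintro ⟨h0, h⟩
    have h2 : DifferentiableAt ℂ (fun P : ℂ × ℂ => hReverse X (P.1)⁻¹) Q.1 :=
      DifferentiableAt.comp (g := hReverse X) Q.1 (differentiable_hReverse X).differentiableAt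
        (DifferentiableAt.comp (g := fun z : ℂ => z⁻¹) Q.1 (differentiableAt_inv h0)
          differentiableAt_fst)
    have h3 := DifferentiableAt.comp (g := Complex.sqrt) Q.1
      (Complex.differentiableAt_sqrt h) h2
    exact differentiableAt_div_of_ne ((differentiableAt_fst.pow g).mul (h3.const_mul _))
      differentiableAt_snd (affine_snd_ne_zero ha Q h0 h)

lemma CurveChart.contDiffOn_trans {ha : a ≠ 0} {hX : Function.Injective X}
    {e e' : OpenPartialHomeomorph (OnePoint (AffineCurve a X)) ℂ}
    (he : CurveChart ha hX e) (he' : CurveChart ha hX e') :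
    ContDiffOn ℂ ω (e.symm ≫ₕ e') (e.symm ≫ₕ e').source := by
  refine DifferentiableOn.contDiffOn (fun u hu => ?_) (e.symm ≫ₕ e').open_source
  refine DifferentiableAt.differentiableWithinAt ?_
  rw [OpenPartialHomeomorph.trans_source] at hu
  have hu1 : u ∈ e.target := hu.1
  have hu2 : e.symm u ∈ e'.source := hu.2
  by_cases h : e.symm u = OnePoint.infty
  · have h1 := he.eq_of_infty_mem (h ▸ e.map_target hu1)
    have h2 := he'.eq_of_infty_mem (h ▸ hu2)
    subst h2; subst h1
    refine differentiableAt_id.congr_of_eventuallyEq ?_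
    filter_upwards [(infChart ha).open_target.mem_nhds hu1] with v hv
    exact (infChart ha).right_inv hv
  · obtain ⟨F, hF⟩ := he'.exists_formula
    have hev : (e.symm ≫ₕ e' : ℂ → ℂ) =ᶠ[𝓝 u] fun v => F (curveCoord (e.symm v)) := by
      have hc : ContinuousAt e.symm u := e.continuousAt_symm hu1
      filter_upwards [hc (OnePoint.isClosed_infty.isOpen_compl.mem_nhds h)] with v hv
      obtain ⟨P, hP⟩ := OnePoint.ne_infty_iff_exists.1 (show e.symm v ≠ OnePoint.infty from hv)
      change e' (e.symm v) = _
      rw [← hP]; exact (hF P).1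
    obtain ⟨P, hP⟩ := OnePoint.ne_infty_iff_exists.1 h
    have hd : DifferentiableAt ℂ F (curveCoord (e.symm u)) := by
      rw [← hP] at hu2 ⊢; exact (hF P).2 hu2
    exact (hd.comp u (he.differentiableAt_symm hu1 h)).congr_of_eventuallyEq hev

end ChartAtInfinity

/-- Configurations of `2g+1` pairwise different branch points. -/
abbrev Config (g : ℕ) : Type := {X : Fin (2 * g + 1) → ℂ // Function.Injective X}

/-- The compact hyperelliptic Riemann surface of the equation `y² = a ∏ (x - X j)`, which has one
point at infinity. -/
def hyperellipticCurve {g : ℕ} {a : ℂ} (ha : a ≠ 0) (X : Config g) : RiemannSurface :=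
  letI : ChartedSpace ℂ (OnePoint (AffineCurve a X.1)) :=
    { atlas := {e | CurveChart ha X.2 e}
      chartAt := curveChartAt ha X.2
      mem_chart_source := by
        intro q
        induction q using OnePoint.rec with
        | infty => simp [curveChartAt, infChart, infSource]
        | coe P =>
          simp only [curveChartAt, OnePoint.elim_some]
          split_ifs with h
          · refine ⟨P, ?_, rfl⟩
            have h1 := (exists_eq_of_snd_eq_zero ha P h).choose_spec
            simp only [wChartAffine, Set.mem_ofPred_eq]
            have h2 : hCofactor a X.1 (exists_eq_of_snd_eq_zero ha P h).choose P.1.1 /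
                hCofactor a X.1 (exists_eq_of_snd_eq_zero ha P h).choose
                  (X.1 (exists_eq_of_snd_eq_zero ha P h).choose) = 1 :=
              (congrArg (fun z => hCofactor a X.1 (exists_eq_of_snd_eq_zero ha P h).choose z /
                _) h1).trans (div_self (hCofactor_ne_zero ha X.2 _))
            rw [h2]
            exact Complex.one_mem_slitPlane
          · refine ⟨P, ?_, rfl⟩
            simp [xChartAffine, div_self h]
      chart_mem_atlas := by
        intro q
        induction q using OnePoint.rec with
        | infty => exact CurveChart.inf
        | coe P =>
          simp only [curveChartAt, OnePoint.elim_some]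
          split_ifs with h
          · exact CurveChart.w _
          · exact CurveChart.x P h }
  { carrier := OnePoint (AffineCurve a X.1)
    mfd := isManifold_of_contDiffOn _ _ _ fun e e' he he' => by
      simpa using CurveChart.contDiffOn_trans he he' }

/-! ### Riemann surfaces, conformal maps and metrics -/

abbrev plane : RiemannSurface := { carrier := ℂ }

instance (A : RiemannSurface) : MeasurableSpace A := borel A

instance (A : RiemannSurface) : BorelSpace A := ⟨rfl⟩

/-- `f` restricts to a conformal map (biholomorphic onto its image) on a neighbourhood of `p`. -/
def IsConformalGerm {A B : RiemannSurface} (f : A → B) (p : A) : Prop :=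
  ∃ U : Set A, IsOpen U ∧ p ∈ U ∧ MDifferentiableOn 𝓘(ℂ) 𝓘(ℂ) f U ∧ Set.InjOn f U

/-- Real bilinear forms on a tangent space, written in the coordinate `chartAt ℂ p`. -/
abbrev Form : Type := ℂ →L[ℝ] ℂ →L[ℝ] ℝ

/-- The real differential of `f` at `p`, in the coordinates `chartAt ℂ p` and `chartAt ℂ (f p)`. -/
def realDifferential {A B : RiemannSurface} (f : A → B) (p : A) : ℂ →L[ℝ] ℂ :=
  mfderiv 𝓘(ℝ, ℂ) 𝓘(ℝ, ℂ) f p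

/-- A metric compatible with the complex structure of `B` is a function `μ : B → ℝ`: at `q` the
metric is `μ q |dz|²` for the coordinate `z = chartAt ℂ q`. This is its pullback along `f`. -/
def metricPullback {A B : RiemannSurface} (μ : B → ℝ) (f : A → B) (p : A) : Form :=
  μ (f p) • (innerSL ℝ : Form).bilinearComp (realDifferential f p) (realDifferential f p)

/-- The metric in the chart `e`, as a form on the range of `e`. -/
def metricInChart {A : RiemannSurface} (μ : A → ℝ) (e : OpenPartialHomeomorph A ℂ) (u : ℂ) : Form :=
  metricPullback (A := plane) μ e.symm u

/-- The function `ρ` for which the metric is `ρ |dz|²` in the chart `z = e`. -/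
def conformalFactor {A : RiemannSurface} (μ : A → ℝ) (e : OpenPartialHomeomorph A ℂ) (u : ℂ) : ℝ :=
  metricInChart μ e u 1 1

/-- `μ` is a smooth Riemannian metric compatible with the complex structure. -/
def IsConformalMetric {A : RiemannSurface} (μ : A → ℝ) : Prop :=
  (∀ p, 0 < μ p) ∧ ∀ e ∈ atlas ℂ A, ContDiffOn ℝ ∞ (metricInChart μ e) e.target

/-- The Riemannian volume measure: the smallest measure that has density `ρ` in each chart in
which the metric is `ρ |dz|²`. -/
def riemannianVolume {A : RiemannSurface} (μ : A → ℝ) : Measure A :=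
  ⨆ e ∈ atlas ℂ A, Measure.map e.symm
    ((volume.restrict e.target).withDensity fun u => ENNReal.ofReal (conformalFactor μ e u))

/-- The scalar curvature `-ρ⁻¹ Δ log ρ` of the metric `ρ |dz|²` (twice the Gauss curvature). -/
def scalarCurvature {A : RiemannSurface} (μ : A → ℝ) (p : A) : ℝ :=
  -(Laplacian.laplacian (fun u => Real.log (conformalFactor μ (chartAt ℂ p) u)) (chartAt ℂ p p)) /
    conformalFactor μ (chartAt ℂ p) (chartAt ℂ p p)

/-- A smooth family, parametrised by `t ∈ U`, of metrics on the oriented surface underlying `A`.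
The metric with parameter `t` is given as the Riemann surface `B t` with the compatible metric
`μ t`, and identified with a metric on `A` through the orientation preserving diffeomorphism
`f t`. -/
structure IsSmoothFamily {E : Type} [NormedAddCommGroup E] [NormedSpace ℝ E] (U : Set E)
    (A : RiemannSurface) (B : E → RiemannSurface) (μ : ∀ t, B t → ℝ) (f : ∀ t, A ≃ₜ B t) :
    Prop where
  isOpen : IsOpen U
  metric : ∀ t ∈ U, IsConformalMetric (μ t)
  smooth : ∀ t ∈ U, ContMDiff 𝓘(ℝ, ℂ) 𝓘(ℝ, ℂ) ∞ (f t)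
  smooth_symm : ∀ t ∈ U, ContMDiff 𝓘(ℝ, ℂ) 𝓘(ℝ, ℂ) ∞ (f t).symm
  orientation : ∀ t ∈ U, ∀ p, 0 < (realDifferential (f t) p).det
  smooth_metric : ∀ e ∈ atlas ℂ A, ContDiffOn ℝ ∞
    (fun q : E × ℂ => metricPullback (A := plane) (μ q.1) (fun u => f q.1 (e.symm u)) q.2)
    (U ×ˢ e.target)

/-! ### Bundle functors -/

/-- A functor `Φ` from Riemann surfaces with conformal maps to filtered complex vector bundles
whose fibre is a quasi-finite vector space. As the functor is compatible with restriction to open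
subsets, its action on the fibre over `p` depends only on the germ of the conformal map at `p`:
`map f p q` is that action when `f` is conformal near `p` and `f p = q`. As every chart induces a
trivialisation of the bundle (through the translations of the plane), the smooth structure of the
bundles amounts to the smooth dependence of the action on the conformal map. -/
structure FBundleFunctor where
  Fiber : ∀ A : RiemannSurface, A → Type u
  [addCommGroup : ∀ A p, AddCommGroup (Fiber A p)]
  [module : ∀ A p, Module ℂ (Fiber A p)]
  fil : ∀ A p, ℕ → Submodule ℂ (Fiber A p)
  fil_mono : ∀ A p, Monotone (fil A p)
  fil_finite : ∀ A p i, FiniteDimensional ℂ (fil A p i)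
  fil_exhaust : ∀ A p (u : Fiber A p), ∃ i, u ∈ fil A p i
  infinite : ¬ FiniteDimensional ℂ (Fiber plane (0 : ℂ))
  map : ∀ {A B : RiemannSurface} (_ : A → B) (p : A) (q : B), Fiber A p →ₗ[ℂ] Fiber B q
  map_id : ∀ (A : RiemannSurface) (p : A), map (fun x : A => x) p p = LinearMap.id
  map_comp : ∀ {A B D : RiemannSurface} (f : A → B) (h : B → D) (p : A),
    IsConformalGerm f p → IsConformalGerm h (f p) →
      map (fun x => h (f x)) p (h (f p)) = map h (f p) (h (f p)) ∘ₗ map f p (f p)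
  map_congr : ∀ {A B : RiemannSurface} (f f' : A → B) (p : A),
    IsConformalGerm f p → f =ᶠ[𝓝 p] f' → map f p (f p) = map f' p (f p)
  map_fil : ∀ {A B : RiemannSurface} (f : A → B) (p : A), IsConformalGerm f p →
    ∀ i, ∀ u ∈ fil A p i, map f p (f p) u ∈ fil B (f p) i
  map_smooth : ∀ {E : Type} [NormedAddCommGroup E] [NormedSpace ℝ E] [FiniteDimensional ℝ E]
    (h : E → ℂ → ℂ) (t₀ : E), ContDiffAt ℝ ∞ (fun q : E × ℂ => h q.1 q.2) (t₀, 0) →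
    (∀ᶠ q : E × ℂ in 𝓝 (t₀, 0), DifferentiableAt ℂ (h q.1) q.2) → deriv (h t₀) 0 ≠ 0 →
    (∀ᶠ t in 𝓝 t₀, h t 0 = 0) →
    ∀ (v : Fiber plane (0 : ℂ)) (l : Fiber plane (0 : ℂ) →ₗ[ℂ] ℂ),
      ContDiffAt ℝ ∞ (fun t => l (map (A := plane) (B := plane) (h t) (0 : ℂ) (0 : ℂ) v)) t₀

attribute [instance] FBundleFunctor.addCommGroup FBundleFunctor.module

namespace FBundleFunctor

variable (Φ : FBundleFunctor.{u})

/-- The standard fibre. -/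
abbrev F : Type u := Φ.Fiber plane (0 : ℂ)

/-- Fields on `A` with their positions: the total space of the bundle on `A`. -/
abbrev Field (A : RiemannSurface) : Type u := Σ p : A, Φ.Fiber A p

/-- The action of a map that is conformal near the position of the field. -/
def push {A B : RiemannSurface} (f : A → B) (φ : Φ.Field A) : Φ.Field B :=
  ⟨f φ.1, Φ.map f φ.1 (f φ.1) φ.2⟩

/-- The field `v` placed at the point `s 0` by means of the parametrisation `s`. -/
def place {A : RiemannSurface} (s : ℂ → A) (v : Φ.F) : Φ.Field A :=
  ⟨s 0, Φ.map (A := plane) s (0 : ℂ) (s 0) v⟩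

/-- The field `v(z)` at `p` with respect to the coordinate `z = chartAt ℂ p`. -/
def localField (A : RiemannSurface) (p : A) (v : Φ.F) : Φ.Field A :=
  ⟨p, Φ.map (A := plane) (fun z : ℂ => (chartAt ℂ p).symm (z + chartAt ℂ p p)) (0 : ℂ) p v⟩

end FBundleFunctor

/-! ### Conformal field theories -/

/-- The points at which the fields sit are pairwise different. -/
def Separated {A : RiemannSurface} {V : A → Type u} {N : ℕ} (φ : Fin N → Σ p : A, V p) : Prop :=
  Function.Injective fun i => (φ i).1

/-- `A` is a compact Riemann surface of the topological type `S`, and `μ` a compatible metric. -/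
structure IsMetricSurface (S : Type) [TopologicalSpace S] (A : RiemannSurface) (μ : A → ℝ) :
    Prop where
  compact : CompactSpace A
  homeomorphic : Nonempty (A ≃ₜ S)
  metric : IsConformalMetric μ

/-- A rational conformal field theory on the compact Riemann surfaces of topological type `S`
(that is, of a fixed genus): a bundle functor, a state `corr` (the family of all `N`-point
functions) and the energy momentum field `T`. The value of `corr` matters only on
metric surfaces and at pairwise different positions. -/
structure ConformalFieldTheory (S : Type) [TopologicalSpace S] extends FBundleFunctor.{u} where
  /-- the central charge -/
  c : ℝ
  /-- the identity field -/
  one : ∀ A p, Fiber A p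
  /-- the `N`-point functions -/
  corr : ∀ (A : RiemannSurface) (_ : A → ℝ) {N : ℕ}, (Fin N → Σ p : A, Fiber A p) → ℂ
  /-- the section `T` of the tensor product of the field bundle with the symmetric square of the
  tangent bundle; `T A μ p B` is the dual pairing of `T` with the symmetric form `B` -/
  T : ∀ (A : RiemannSurface) (_ : A → ℝ) (p : A), Form →ₗ[ℝ] Fiber A p
  map_one : ∀ {A B : RiemannSurface} (f : A → B) (p : A), IsConformalGerm f p →
    map f p (f p) (one A p) = one B (f p)
  corr_one : ∀ (A : RiemannSurface) (μ : A → ℝ), IsMetricSurface S A μ →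
    ∀ {N : ℕ} (φ : Fin N → Σ p : A, Fiber A p) (q : A),
      Separated (Fin.cons ⟨q, one A q⟩ φ : Fin (N + 1) → Σ p : A, Fiber A p) →
      corr A μ (Fin.cons ⟨q, one A q⟩ φ : Fin (N + 1) → Σ p : A, Fiber A p) = corr A μ φ
  corr_perm : ∀ (A : RiemannSurface) (μ : A → ℝ), IsMetricSurface S A μ →
    ∀ {N : ℕ} (φ : Fin N → Σ p : A, Fiber A p) (π : Equiv.Perm (Fin N)), Separated φ →
      corr A μ (fun i => φ (π i)) = corr A μ φ
  corr_linear : ∀ (A : RiemannSurface) (μ : A → ℝ), IsMetricSurface S A μ →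
    ∀ {N : ℕ} (φ : Fin N → Σ p : A, Fiber A p) (i : Fin N), Separated φ →
      IsLinearMap ℂ fun w : Fiber A (φ i).1 => corr A μ (Function.update φ i ⟨(φ i).1, w⟩)
  /-- the `N`-point functions depend smoothly on the conformal structure, on the metric and on the
  positions of the fields: the field `v i` is placed by means of a conformal parametrisation
  `s t i` that depends smoothly on the parameter `t` -/
  corr_smooth : ∀ {E : Type} [NormedAddCommGroup E] [NormedSpace ℝ E] [FiniteDimensional ℝ E]
    (U : Set E) (A : RiemannSurface) (B : E → RiemannSurface) (μ : ∀ t, B t → ℝ)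
    (f : ∀ t, A ≃ₜ B t), CompactSpace A → Nonempty (A ≃ₜ S) → IsSmoothFamily U A B μ f →
    ∀ (N : ℕ) (s : ∀ t, Fin N → ℂ → B t) (v : Fin N → Fiber plane (0 : ℂ)), ∀ t₀ ∈ U,
      (∀ i, ContMDiffAt 𝓘(ℝ, E × ℂ) 𝓘(ℝ, ℂ) ∞ (fun q : E × ℂ => (f q.1).symm (s q.1 i q.2)) (t₀, 0)) →
      (∀ i, ∀ᶠ q : E × ℂ in 𝓝 (t₀, 0), MDifferentiableAt 𝓘(ℂ) 𝓘(ℂ) (s q.1 i) q.2) →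
      (∀ i, IsConformalGerm (A := plane) (s t₀ i) (0 : ℂ)) →
      (Function.Injective fun i => s t₀ i 0) →
      ContDiffAt ℝ ∞ (fun t => corr (B t) (μ t) fun i => toFBundleFunctor.place (s t i) (v i)) t₀
  /-- invariance under diffeomorphisms -/
  corr_invariant : ∀ (A B : RiemannSurface) (μ : A → ℝ) (ν : B → ℝ) (f : A ≃ₜ B),
    IsMetricSurface S A μ → IsMetricSurface S B ν → (∀ p, IsConformalGerm f p) →
    (∀ p, metricPullback ν f p = μ p • innerSL ℝ) →
    ∀ {N : ℕ} (φ : Fin N → Σ p : A, Fiber A p), Separated φ →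
      corr B ν (fun i => toFBundleFunctor.push f (φ i)) = corr A μ φ
  T_symm : ∀ (A : RiemannSurface) (μ : A → ℝ) (p : A) (B : Form), T A μ p B.flip = T A μ p B
  /-- `T` is a smooth section -/
  T_smooth : ∀ (A : RiemannSurface) (μ : A → ℝ), IsMetricSurface S A μ →
    (∃ i, ∀ p B, T A μ p B ∈ fil A p i) ∧
    ∀ e ∈ atlas ℂ A, ∀ (B : Form) (l : Fiber plane (0 : ℂ) →ₗ[ℂ] ℂ),
      ContDiffOn ℝ ∞ (fun u : ℂ => l (map (B := plane) (fun q => e q - u) (e.symm u) (0 : ℂ)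
        (T A μ (e.symm u) (B.bilinearComp (realDifferential (B := plane) e (e.symm u))
          (realDifferential (B := plane) e (e.symm u)))))) e.target
  /-- the Einstein derivative: when the metric varies in such a way that its conformal class is
  kept near the positions of the fields, the derivative of the `N`-point function is the integral
  of the `N+1`-point function of the pairing of `T` with the variation of the metric -/
  einstein_derivative : ∀ (U : Set ℝ) (A : RiemannSurface) (μA : A → ℝ)
    (B : ℝ → RiemannSurface) (μ : ∀ t, B t → ℝ) (f : ∀ t, A ≃ₜ B t),
    IsMetricSurface S A μA → IsSmoothFamily U A B μ f → (0 : ℝ) ∈ U →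
    (∀ p, metricPullback (μ 0) (f 0) p = μA p • innerSL ℝ) →
    ∀ {N : ℕ} (φ : Fin N → Σ p : A, Fiber A p), Separated φ →
      (∀ i, ∃ V ∈ 𝓝 (φ i).1, ∀ t ∈ U, MDifferentiableOn 𝓘(ℂ) 𝓘(ℂ) (f t) V) →
      HasDerivAt (fun t => corr (B t) (μ t) fun i => toFBundleFunctor.push (f t) (φ i))
        (∫ p, corr A μA (Fin.cons
          ⟨p, T A μA p (deriv (fun t => metricPullback (μ t) (f t) p) 0)⟩ φ :
            Fin (N + 1) → Σ p : A, Fiber A p) ∂(riemannianVolume μA)) 0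
  /-- the trace anomaly -/
  trace_anomaly : ∀ (A : RiemannSurface) (μ : A → ℝ), IsMetricSurface S A μ → ∀ p,
    T A μ p (μ p • innerSL ℝ) =
      ((-(c / (48 * Real.pi)) * scalarCurvature μ p : ℝ) : ℂ) • one A p

/-- The Wirtinger derivative `∂/∂z`. -/
def wirtinger (h : ℂ → ℂ) (u : ℂ) : ℂ :=
  (fderiv ℝ h u 1 - Complex.I * fderiv ℝ h u Complex.I) / 2

/-- The symmetric form `dx² - dy²`, the real part of `dz²`. -/
def reForm : Form :=
  (ContinuousLinearMap.compL ℝ ℂ ℂ ℝ Complex.reCLM).comp (ContinuousLinearMap.mul ℝ ℂ)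

/-- The symmetric form `dx dy + dy dx`, the imaginary part of `dz²`. -/
def imForm : Form :=
  (ContinuousLinearMap.compL ℝ ℂ ℂ ℝ Complex.imCLM).comp (ContinuousLinearMap.mul ℝ ℂ)

namespace ConformalFieldTheory

variable {S : Type} [TopologicalSpace S] (C : ConformalFieldTheory.{u} S)

/-- The component `T_zz = (T₀₀ - 2 i T₁₀ - T₁₁) / 4` of the energy momentum tensor in the
coordinate `z = chartAt ℂ p`. Indices are lowered with the metric `ρ |dz|²`, and the energy momentum
tensor is `-2 T`, so that the Einstein derivative is `-1/2` times its integral against `δG`. -/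
def Tzz (A : RiemannSurface) (μ : A → ℝ) (p : A) : C.Fiber A p :=
  (-2 * ((μ p : ℂ) ^ 2 / 4)) • (C.T A μ p reForm - Complex.I • C.T A μ p imForm)

/-- The Virasoro field `T(z)` in the coordinate `z = chartAt ℂ p`, defined by
`T(z) / 2π = T_zz - c / 24π (∂Γ - Γ² / 2)` with `Γ = ∂ log ρ` for the metric `ρ |dz|²`. -/
def virasoro (A : RiemannSurface) (μ : A → ℝ) (p : A) : C.Fiber A p :=
  let Γ : ℂ → ℂ := wirtinger fun u => (Real.log (conformalFactor μ (chartAt ℂ p) u) : ℂ)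
  let z : ℂ := chartAt ℂ p p
  (2 * Real.pi : ℂ) • (C.Tzz A μ p -
    ((C.c : ℂ) / (24 * Real.pi) * (wirtinger Γ z - Γ z ^ 2 / 2)) • C.one A p)

end ConformalFieldTheory

/-! ### The singular metric -/

/-- The profiles used to smooth the metric `|dx|²` at the branch points: `ρ` (a function of the
distance from a finite branch point) and `σ` (a function of the distance from the origin, for the
branch point at infinity). -/
structure Cutoff where
  ρ : ℝ → ℝ
  σ : ℝ → ℝ
  a : ℝ
  b : ℝ
  ρ_smooth : ContDiffOn ℝ ∞ ρ (Set.Ioi 0)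
  σ_smooth : ContDiffOn ℝ ∞ σ (Set.Ioi 0)
  ρ_pos : ∀ r, 0 < r → 0 < ρ r
  σ_pos : ∀ r, 0 < r → 0 < σ r
  ρ_eq_one : ∀ r, 1 ≤ r → ρ r = 1
  σ_eq_one : ∀ r, r ≤ 1 → σ r = 1
  ρ_core : ∀ r, 0 < r → r ≤ 1 / 2 → ρ r = a / r
  σ_core : ∀ r, 2 ≤ r → σ r = b / r ^ 3

section SingularState

variable {g : ℕ} {a : ℂ} (ha : a ≠ 0)

/-- A point of the affine curve as a point of the compact Riemann surface. -/
def curvePoint (X : Config g) (P : AffineCurve a X.1) : hyperellipticCurve ha X :=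
  (P : OnePoint (AffineCurve a X.1))

open Classical in
/-- The lift to the curve of the metric that is `|dx|²` for `|x - X j| ≥ δ` and `|x| ≤ 1 / δ`,
and is smoothed by the profiles elsewhere. The coordinates are `x` away from the branch points, `w`
with `x = X j + w²` at a finite branch point, and `u` with `x = u⁻²` at infinity. -/
def regularizedMetric (κ : Cutoff) (δ : ℝ) (X : Config g) : hyperellipticCurve ha X → ℝ :=
  fun q : OnePoint (AffineCurve a X.1) => q.elim (4 * κ.b / δ ^ 3) fun P =>
    if P.1.2 = 0 then 4 * κ.a * δ
    else (∏ j, κ.ρ (‖P.1.1 - X.1 j‖ / δ)) * κ.σ (δ * ‖P.1.1‖)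

variable {S : Type} [TopologicalSpace S] (C : ConformalFieldTheory.{u} S)

/-- The state for the singular metric: the renormalised limit of the `N`-point functions for the
regularised metrics. -/
def singularCorr (κ : Cutoff) (Z : ℝ → ℂ) (X : Config g) {N : ℕ}
    (φ : Fin N → C.Field (hyperellipticCurve ha X)) : ℂ :=
  limUnder (𝓝[>] (0 : ℝ)) fun δ =>
    Z δ * C.corr (hyperellipticCurve ha X) (regularizedMetric ha κ δ X) φ

/-- `Z` is a renormalisation factor, independent of the curve and of the fields, for which the
limits that define the singular state exist. -/
def IsRenormalization (κ : Cutoff) (Z : ℝ → ℂ) : Prop :=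
  ∀ (X : Config g) (N : ℕ) (φ : Fin N → C.Field (hyperellipticCurve ha X)), Separated φ →
    (∀ i, ∃ P : AffineCurve a X.1, P.1.2 ≠ 0 ∧ (φ i).1 = curvePoint ha X P) →
    ∃ L : ℂ, Tendsto (fun δ => Z δ *
      C.corr (hyperellipticCurve ha X) (regularizedMetric ha κ δ X) φ) (𝓝[>] (0 : ℝ)) (𝓝 L)

/-- The fields `v i` at the points `P i`, with respect to the coordinate `x`. -/
def fieldsAt (X : Config g) {N : ℕ} (P : Fin N → AffineCurve a X.1) (v : Fin N → C.F) :
    Fin N → C.Field (hyperellipticCurve ha X) :=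
  fun i => C.localField (hyperellipticCurve ha X) (curvePoint ha X (P i)) (v i)

open Classical in
/-- The singular `N`-point function of the fields `v i` at the points `P X i` as a function of the
branch points. -/
def singularNPoint (κ : Cutoff) (Z : ℝ → ℂ) {N : ℕ}
    (P : ∀ X : Config g, Fin N → AffineCurve a X.1) (v : Fin N → C.F)
    (X : Fin (2 * g + 1) → ℂ) : ℂ :=
  if h : Function.Injective X then
    singularCorr ha C κ Z ⟨X, h⟩ (fieldsAt ha C ⟨X, h⟩ (P ⟨X, h⟩) v)
  else 0

/-- The singular `N+1`-point function of the Virasoro field `T(x)` at `Q` and the fields `φ`. The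
Virasoro field is that of the metric regularised at scale `δ₀`, which is the singular metric near
`Q` when `δ₀` is small. -/
def singularVirasoroCorr (κ : Cutoff) (Z : ℝ → ℂ) (δ₀ : ℝ) (X : Config g)
    (Q : AffineCurve a X.1) {N : ℕ} (φ : Fin N → C.Field (hyperellipticCurve ha X)) : ℂ :=
  singularCorr ha C κ Z X (Fin.cons (⟨curvePoint ha X Q,
    C.virasoro (hyperellipticCurve ha X) (regularizedMetric ha κ δ₀ X) (curvePoint ha X Q)⟩ :
      C.Field (hyperellipticCurve ha X)) φ : Fin (N + 1) → C.Field (hyperellipticCurve ha X))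

end SingularState

/-- `γ` is a closed path on the curve that winds once, in the positive sense, around the
ramification point over `X j` and stays in the part of the curve over `|x - X j| < r`; its
projection to the `x`-plane then winds twice around `X j`. -/
structure IsLoopAround {n : ℕ} {a : ℂ} (X : Fin n → ℂ) (j : Fin n) (r : ℝ)
    (γ : ℝ → AffineCurve a X) : Prop where
  continuous : Continuous γ
  smooth : ContDiff ℝ 1 fun t => (γ t).1.1
  closed : γ 0 = γ 1
  avoids : ∀ t ∈ Set.Icc (0 : ℝ) 1, (γ t).1.1 ≠ X j
  mem : ∀ t ∈ Set.Icc (0 : ℝ) 1, ‖(γ t).1.1 - X j‖ < r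
  winding : ∫ t in (0 : ℝ)..1, deriv (fun t => (γ t).1.1) t / ((γ t).1.1 - X j) =
    2 * (2 * Real.pi * Complex.I)

end

/-!
The singular state is, locally in the branch points, a constant multiple of the state for a metric
regularised at a fixed scale `δ`, and for this smooth metric the derivative with respect to a branch
point is an Einstein derivative, which holomorphy of `T` turns into a contour integral.

*The singular state near `X`.* The trace anomaly, inserted into the Einstein derivative along a
path in a fixed conformal class, gives a differential equation by which the states of two
conformal metrics differ by a factor that does not depend on the fields
(`ConformalFieldTheory.corr_eq_weylFactor_mul`). For the metrics regularised at two scales this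
factor does not change when the branch points move, because the two metrics differ only near the
ramification points and infinity, where the motion is an isometry
(`Hyperelliptic.weylFactor_eq_of_shift`). The factor `Z(δ)` cancels the dependence on `δ`, so that
the singular `N`-point functions are a constant times those for a fixed small `δ`
(`Hyperelliptic.exists_singularCorr_eq`).

*The motion of the branch points.* A displacement `d` of the branch points is realised by the
diffeomorphism `x ↦ x + ∑ d j χ(x - X j)` of the plane, with a cutoff function `χ` that is `1` on the
disc of radius `R` and `0` outside of the disc of radius `2R`. It lifts to the curves
(`Hyperelliptic.curveHomeomorph`) and is a translation near the ramification points, near the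
positions of the fields and near infinity. Therefore the `N`-point functions are smooth in `d`, and
their derivative is the integral of `⟨(T, Ġ) φ …⟩` over annuli on which the metric is flat
(`Hyperelliptic.IsDeformation.hasDerivAt_corr`). There the trace of `T` vanishes, and the
`(1, 0)`-part of the derivative is the integral of `∂χ/∂z̄` times the pairing `t = (T, dz̄²)`
(`Hyperelliptic.holomorphic_deriv_movedCorr`).

*The contour integral.* Deformations of one sheet over a small disc do not change the `N`-point
functions, because they map the curve to itself. This says that `t` is holomorphic in the sense of
distributions, hence holomorphic (`ConformalFieldTheory.differentiableOn_stressCorr`). Loops around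
a ramification point lift to the universal covering of its punctured neighbourhood, so that all of
them have the same contour integral `∮ t dx` (`Hyperelliptic.exists_contour_integral_eq`). In polar
coordinates around the ramification point, the annulus integral is this contour integral times the
radial integral of the derivative of `χ`, which is `-1` (`integral_cutoffBar_mul`). Where the metric
is flat, the Virasoro field is `-π` times `t` (`ConformalFieldTheory.corr_virasoro`), which gives
the normalisation `1 / 2πi`.
-/

open scoped NNReal

noncomputable section

/-! ### Charts and differentials of a Riemann surface -/

namespace RiemannSurface

variable {A B D : RiemannSurface}

/-- The expression of a map in the preferred charts at `p` and `f p`. -/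
def inCharts (f : A → B) (p : A) (u : ℂ) : ℂ := chartAt ℂ (f p) (f ((chartAt ℂ p).symm u))

instance isManifold_real (A : RiemannSurface) : IsManifold 𝓘(ℝ, ℂ) ∞ A := by
  refine isManifold_of_contDiffOn _ _ _ fun e e' he he' => ?_
  have h1 : e.symm ≫ₕ e' ∈ contDiffGroupoid ω 𝓘(ℂ) :=
    HasGroupoid.compatible (G := contDiffGroupoid ω 𝓘(ℂ)) he he'
  have h2 := (contDiffGroupoid ω 𝓘(ℂ)).mem_iff_of_eqOnSource
    (e := e.symm ≫ₕ e') (e' := e.symm ≫ₕ e') (Setoid.refl _) |>.1 h1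
  rw [contDiffGroupoid, mem_groupoid_of_pregroupoid] at h2
  have h3 : ContDiffOn ℂ ω (e.symm ≫ₕ e') (e.symm ≫ₕ e').source := by
    simpa [contDiffPregroupoid] using h2.1
  have h4 : ContDiffOn ℝ ∞ (e.symm ≫ₕ e') (e.symm ≫ₕ e').source :=
    (h3.restrict_scalars ℝ).of_le le_top
  simpa using h4

lemma mdifferentiableAt_iff_inCharts {f : A → B} {p : A} :
    MDifferentiableAt 𝓘(ℝ, ℂ) 𝓘(ℝ, ℂ) f p ↔
      ContinuousAt f p ∧ DifferentiableAt ℝ (inCharts f p) (chartAt ℂ p p) := by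
  rw [mdifferentiableAt_iff]
  simp [writtenInExtChartAt, Function.comp_def, differentiableWithinAt_univ]
  intro _; rfl

lemma mdifferentiableAt_complex_iff_inCharts {f : A → B} {p : A} :
    MDifferentiableAt 𝓘(ℂ) 𝓘(ℂ) f p ↔
      ContinuousAt f p ∧ DifferentiableAt ℂ (inCharts f p) (chartAt ℂ p p) := by
  rw [mdifferentiableAt_iff]
  simp [writtenInExtChartAt, Function.comp_def, differentiableWithinAt_univ]
  intro _; rfl

lemma contMDiffAt_iff_inCharts {f : A → B} {p : A} :
    ContMDiffAt 𝓘(ℝ, ℂ) 𝓘(ℝ, ℂ) ∞ f p ↔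
      ContinuousAt f p ∧ ContDiffAt ℝ ∞ (inCharts f p) (chartAt ℂ p p) := by
  rw [contMDiffAt_iff]
  simp [Function.comp_def, contDiffWithinAt_univ]
  intro _; rfl

lemma realDifferential_eq_fderiv {f : A → B} {p : A} (hf : ContinuousAt f p) :
    realDifferential f p = fderiv ℝ (inCharts f p) (chartAt ℂ p p) := by
  by_cases h : MDifferentiableAt 𝓘(ℝ, ℂ) 𝓘(ℝ, ℂ) f p
  · refine (MDifferentiableAt.mfderiv h).trans ?_
    simp only [writtenInExtChartAt, Function.comp_def, mfld_simps, fderivWithin_univ]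
    rfl
  · refine (mfderiv_zero_of_not_mdifferentiableAt h).trans ?_
    rw [mdifferentiableAt_iff_inCharts] at h
    rw [fderiv_zero_of_not_differentiableAt fun h' => h ⟨hf, h'⟩]
    rfl

lemma mdifferentiableAt_real {f : A → B} {p : A} (hf : MDifferentiableAt 𝓘(ℂ) 𝓘(ℂ) f p) :
    MDifferentiableAt 𝓘(ℝ, ℂ) 𝓘(ℝ, ℂ) f p := by
  rw [mdifferentiableAt_complex_iff_inCharts] at hf
  exact mdifferentiableAt_iff_inCharts.2 ⟨hf.1, hf.2.restrictScalars ℝ⟩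

lemma realDifferential_comp {g : B → D} {f : A → B} {p : A}
    (hg : MDifferentiableAt 𝓘(ℝ, ℂ) 𝓘(ℝ, ℂ) g (f p))
    (hf : MDifferentiableAt 𝓘(ℝ, ℂ) 𝓘(ℝ, ℂ) f p) :
    realDifferential (fun x => g (f x)) p =
      (realDifferential g (f p)).comp (realDifferential f p) :=
  mfderiv_comp p hg hf

lemma realDifferential_congr {f f' : A → B} {p : A} (h : f =ᶠ[𝓝 p] f') :
    realDifferential f p = realDifferential f' p := by
  unfold realDifferential
  exact h.mfderiv_eq

lemma realDifferential_id (p : A) :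
    realDifferential (fun x : A => x) p = ContinuousLinearMap.id ℝ ℂ := mfderiv_id

lemma realDifferential_plane (f : ℂ → ℂ) (u : ℂ) :
    realDifferential (A := plane) (B := plane) f u = fderiv ℝ f u := mfderiv_eq_fderiv

end RiemannSurface

/-! ### Metrics in charts -/

lemma det_real_complex (L : ℂ →L[ℝ] ℂ) :
    L.det = (L 1).re * (L Complex.I).im - (L 1).im * (L Complex.I).re := by
  rw [ContinuousLinearMap.det, ← LinearMap.det_toMatrix Complex.basisOneI, Matrix.det_fin_two]
  simp [LinearMap.toMatrix_apply]
  ring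

lemma innerSL_complex_apply (z w : ℂ) : (innerSL ℝ : Form) z w = z.re * w.re + z.im * w.im := by
  simp [innerSL_apply_apply, Complex.inner]
  ring

lemma abs_det_of_isometric {L : ℂ →L[ℝ] ℂ} {c c' : ℝ} (hc : 0 ≤ c) (hc' : 0 < c')
    (h : c' • (innerSL ℝ : Form).bilinearComp L L = c • (innerSL ℝ : Form)) :
    |L.det| * c' = c := by
  have key (z w : ℂ) : c' * ((L z).re * (L w).re + (L z).im * (L w).im) =
      c * (z.re * w.re + z.im * w.im) := by
    have := congrArg (fun B : Form => B z w) h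
    change c' * ((innerSL ℝ : Form) (L z) (L w)) = c * ((innerSL ℝ : Form) z w) at this
    rwa [innerSL_complex_apply, innerSL_complex_apply] at this
  have h1 := key 1 1
  have h2 := key 1 Complex.I
  have h3 := key Complex.I Complex.I
  simp only [Complex.one_re, Complex.one_im, Complex.I_re, Complex.I_im, mul_one, mul_zero,
    add_zero, zero_add] at h1 h2 h3
  have h4 : (|L.det| * c') ^ 2 = c ^ 2 := by
    rw [mul_pow, sq_abs, det_real_complex]
    linear_combination (c' * ((L Complex.I).re * (L Complex.I).re
      + (L Complex.I).im * (L Complex.I).im)) * h1 + c * h3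
      - c' * ((L 1).re * (L Complex.I).re + (L 1).im * (L Complex.I).im) * h2
  exact (pow_left_inj₀ (mul_nonneg (abs_nonneg _) hc'.le) hc two_ne_zero).1 h4

namespace RiemannSurface

variable {A B D : RiemannSurface}

lemma mdifferentiableAt_chart {e : OpenPartialHomeomorph A ℂ} (he : e ∈ atlas ℂ A) {p : A}
    (hp : p ∈ e.source) : MDifferentiableAt (M' := plane) 𝓘(ℂ) 𝓘(ℂ) e p :=
  haveI : IsManifold 𝓘(ℂ) 1 A := IsManifold.of_le (n := ω) le_top
  mdifferentiableAt_atlas he hp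

lemma mdifferentiableAt_chart_symm {e : OpenPartialHomeomorph A ℂ} (he : e ∈ atlas ℂ A) {u : ℂ}
    (hu : u ∈ e.target) : MDifferentiableAt (M := plane) 𝓘(ℂ) 𝓘(ℂ) e.symm u :=
  haveI : IsManifold 𝓘(ℂ) 1 A := IsManifold.of_le (n := ω) le_top
  mdifferentiableAt_atlas_symm he hu

lemma realDifferential_apply {f : A → B} {p : A}
    (hf : MDifferentiableAt 𝓘(ℂ) 𝓘(ℂ) f p) (z : ℂ) :
    realDifferential f p z = deriv (inCharts f p) (chartAt ℂ p p) * z := by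
  rw [realDifferential_eq_fderiv hf.continuousAt]
  have h := (mdifferentiableAt_complex_iff_inCharts.1 hf).2
  rw [(h.hasFDerivAt.restrictScalars ℝ).fderiv]
  simp [mul_comm]

lemma metricPullback_comp (μ : D → ℝ) {g : B → D} {f : A → B} {p : A}
    (hg : MDifferentiableAt 𝓘(ℝ, ℂ) 𝓘(ℝ, ℂ) g (f p))
    (hf : MDifferentiableAt 𝓘(ℝ, ℂ) 𝓘(ℝ, ℂ) f p) :
    metricPullback μ (fun x => g (f x)) p = (metricPullback μ g (f p)).bilinearComp
      (realDifferential f p) (realDifferential f p) := by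
  unfold metricPullback
  rw [realDifferential_comp hg hf]
  rfl

lemma metricPullback_congr (μ : B → ℝ) {f f' : A → B} {p : A} (h : f =ᶠ[𝓝 p] f') :
    metricPullback μ f p = metricPullback μ f' p := by
  unfold metricPullback
  rw [realDifferential_congr h, h.eq_of_nhds]

lemma metricPullback_id (μ : A → ℝ) (p : A) :
    metricPullback μ (fun x => x) p = μ p • (innerSL ℝ : Form) := by
  unfold metricPullback
  rw [realDifferential_id]
  rfl

lemma bilinearComp_of_complex {L : ℂ →L[ℝ] ℂ} {d : ℂ} (hL : ∀ z, L z = d * z) :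
    (innerSL ℝ : Form).bilinearComp L L = ‖d‖ ^ 2 • (innerSL ℝ : Form) := by
  refine ContinuousLinearMap.ext fun z => ContinuousLinearMap.ext fun w => ?_
  change (innerSL ℝ : Form) (L z) (L w) = ‖d‖ ^ 2 * (innerSL ℝ : Form) z w
  rw [innerSL_complex_apply, innerSL_complex_apply, hL, hL, ← Complex.normSq_eq_norm_sq,
    Complex.normSq_apply]
  simp only [Complex.mul_re, Complex.mul_im]
  ring

lemma metricPullback_complex (μ : B → ℝ) {f : A → B} {p : A}
    (hf : MDifferentiableAt 𝓘(ℂ) 𝓘(ℂ) f p) :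
    metricPullback μ f p = (μ (f p) * ‖realDifferential f p 1‖ ^ 2) • (innerSL ℝ : Form) := by
  unfold metricPullback
  rw [bilinearComp_of_complex (realDifferential_apply hf), smul_smul,
    realDifferential_apply hf, mul_one]

lemma smul_innerSL_one_one (c : ℝ) : (c • (innerSL ℝ : Form)) 1 1 = c := by simp

lemma conformalFactor_eq (μ : A → ℝ) (e : OpenPartialHomeomorph A ℂ) (u : ℂ) :
    conformalFactor μ e u =
      μ (e.symm u) * ‖realDifferential (A := plane) e.symm u 1‖ ^ 2 := by
  simp [conformalFactor, metricInChart, metricPullback]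

lemma metricInChart_eq (μ : A → ℝ) {e : OpenPartialHomeomorph A ℂ} (he : e ∈ atlas ℂ A) {u : ℂ}
    (hu : u ∈ e.target) : metricInChart μ e u = conformalFactor μ e u • (innerSL ℝ : Form) := by
  rw [conformalFactor_eq]
  exact metricPullback_complex μ (mdifferentiableAt_chart_symm he hu)

lemma realDifferential_chart_symm_ne_zero {e : OpenPartialHomeomorph A ℂ} (he : e ∈ atlas ℂ A)
    {u : ℂ} (hu : u ∈ e.target) : realDifferential (A := plane) e.symm u 1 ≠ 0 := by
  have h1 := mdifferentiableAt_real (B := plane) (mdifferentiableAt_chart he (e.map_target hu))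
  have h2 := mdifferentiableAt_real (A := plane) (mdifferentiableAt_chart_symm he hu)
  have h3 := realDifferential_comp (A := plane) (D := plane) h1 h2
  have h4 : (fun x : plane => e (e.symm x)) =ᶠ[𝓝 (u : plane)] fun x => x := by
    filter_upwards [e.open_target.mem_nhds hu] with v hv using e.right_inv hv
  rw [realDifferential_congr h4, realDifferential_id] at h3
  intro h0
  have := congrArg (fun L : ℂ →L[ℝ] ℂ => L 1) h3
  simp [h0] at this

lemma conformalFactor_pos {μ : A → ℝ} (hμ : ∀ p, 0 < μ p) {e : OpenPartialHomeomorph A ℂ}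
    (he : e ∈ atlas ℂ A) {u : ℂ} (hu : u ∈ e.target) : 0 < conformalFactor μ e u := by
  rw [conformalFactor_eq]
  have := norm_pos_iff.2 (realDifferential_chart_symm_ne_zero he hu)
  have := hμ (e.symm u)
  positivity

lemma realDifferential_chart_eq_id {e : OpenPartialHomeomorph A ℂ} {p : A} (hp : p ∈ e.source)
    (h : chartAt ℂ p =ᶠ[𝓝 p] e) :
    realDifferential (B := plane) e p = ContinuousLinearMap.id ℝ ℂ := by
  rw [realDifferential_eq_fderiv (e.continuousAt hp)]
  have h1 := mem_chart_source ℂ p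
  have h2 : inCharts (B := plane) e p =ᶠ[𝓝 (chartAt ℂ p p)] fun u => u := by
    have hc := (chartAt ℂ p).continuousAt_symm (mem_chart_target ℂ p)
    rw [ContinuousAt, (chartAt ℂ p).left_inv h1] at hc
    filter_upwards [(chartAt ℂ p).open_target.mem_nhds (mem_chart_target ℂ p),
      hc.eventually h] with u hu hu'
    change e _ = u
    rw [← hu', (chartAt ℂ p).right_inv hu]
  rw [h2.fderiv_eq]; exact fderiv_fun_id

lemma realDifferential_chart_symm_eq_id {e : OpenPartialHomeomorph A ℂ} {u : ℂ}
    (hu : u ∈ e.target) (h : chartAt ℂ (e.symm u) =ᶠ[𝓝 (e.symm u)] e) :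
    realDifferential (A := plane) e.symm u = ContinuousLinearMap.id ℝ ℂ := by
  rw [realDifferential_eq_fderiv (e.continuousAt_symm hu)]
  have h2 : inCharts (A := plane) e.symm u =ᶠ[𝓝 u] fun u => u := by
    have hc := e.continuousAt_symm hu
    filter_upwards [e.open_target.mem_nhds hu, hc.eventually h] with v hv hv'
    change chartAt ℂ (e.symm u) (e.symm v) = v
    rw [hv', e.right_inv hv]
  exact h2.fderiv_eq.trans fderiv_fun_id

lemma conformalFactor_chartAt_self (μ : A → ℝ) (p : A) :
    conformalFactor μ (chartAt ℂ p) (chartAt ℂ p p) = μ p := by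
  rw [conformalFactor_eq, realDifferential_chart_symm_eq_id (mem_chart_target ℂ p)]
  · simp
  · rw [(chartAt ℂ p).left_inv (mem_chart_source ℂ p)]

lemma contDiffOn_conformalFactor {μ : A → ℝ} (hμ : IsConformalMetric μ)
    {e : OpenPartialHomeomorph A ℂ} (he : e ∈ atlas ℂ A) :
    ContDiffOn ℝ ∞ (conformalFactor μ e) e.target := by
  have := hμ.2 e he
  exact (this.clm_apply contDiffOn_const).clm_apply contDiffOn_const

end RiemannSurface

/-! ### The Riemannian volume -/

namespace RiemannSurface

variable {A B : RiemannSurface}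

/-- The measure on a Riemann surface that has density `ρ` in the chart `e` in which the metric is
`ρ |dz|²`, and vanishes outside the domain of that chart. -/
def chartMeasure (μ : A → ℝ) (e : OpenPartialHomeomorph A ℂ) : Measure A :=
  Measure.map e.symm
    ((volume.restrict e.target).withDensity fun u => ENNReal.ofReal (conformalFactor μ e u))

lemma riemannianVolume_eq (μ : A → ℝ) :
    riemannianVolume μ = ⨆ e ∈ atlas ℂ A, chartMeasure μ e := rfl

lemma chartMeasure_le (μ : A → ℝ) {e : OpenPartialHomeomorph A ℂ} (he : e ∈ atlas ℂ A) :
    chartMeasure μ e ≤ riemannianVolume μ := by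
  rw [riemannianVolume_eq]
  exact le_iSup₂ (f := fun e (_ : e ∈ atlas ℂ A) => chartMeasure μ e) e he

lemma aemeasurable_chart_symm (μ : A → ℝ) (e : OpenPartialHomeomorph A ℂ) :
    AEMeasurable e.symm ((volume.restrict e.target).withDensity
      fun u => ENNReal.ofReal (conformalFactor μ e u)) :=
  (e.continuousOn_symm.aemeasurable e.open_target.measurableSet).mono_ac
    (withDensity_absolutelyContinuous _ _)

lemma measurableSet_chart_preimage (e : OpenPartialHomeomorph A ℂ) {s : Set A}
    (hs : MeasurableSet s) : MeasurableSet (e.target ∩ e.symm ⁻¹' s) := by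
  have h := (continuousOn_iff_continuous_domRestrict.1 e.continuousOn_symm).measurable hs
  have := (MeasurableEmbedding.subtype_coe e.open_target.measurableSet).measurableSet_image.2 h
  convert this using 1
  ext u
  simp [Set.domRestrict, and_comm]

lemma chartMeasure_apply (μ : A → ℝ) (e : OpenPartialHomeomorph A ℂ) {s : Set A}
    (hs : MeasurableSet s) : chartMeasure μ e s =
      ∫⁻ u in e.target ∩ e.symm ⁻¹' s, ENNReal.ofReal (conformalFactor μ e u) := by
  rw [chartMeasure, Measure.map_apply_of_aemeasurable (aemeasurable_chart_symm μ e) hs,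
    withDensity_apply', Measure.restrict_restrict' e.open_target.measurableSet, Set.inter_comm]

/-- A homeomorphism that is isometric on a measurable set preserves the volume there, computed in
one chart on each side. -/
lemma chartMeasure_image {μ : A → ℝ} {ν : B → ℝ} (hμ : ∀ p, 0 < μ p) (hν : ∀ p, 0 < ν p)
    (f : A ≃ₜ B) {e : OpenPartialHomeomorph A ℂ} {e' : OpenPartialHomeomorph B ℂ}
    (he : e ∈ atlas ℂ A) (he' : e' ∈ atlas ℂ B) {s : Set A} (hs : MeasurableSet s)
    (hse : s ⊆ e.source) (hse' : f '' s ⊆ e'.source)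
    (hd : ∀ p ∈ s, MDifferentiableAt 𝓘(ℝ, ℂ) 𝓘(ℝ, ℂ) f p)
    (hf : ∀ p ∈ s, metricPullback ν f p = μ p • (innerSL ℝ : Form)) :
    chartMeasure ν e' (f '' s) = chartMeasure μ e s := by
  have hfs : MeasurableSet (f '' s) := f.measurableEmbedding.measurableSet_image.2 hs
  rw [chartMeasure_apply _ _ hs, chartMeasure_apply _ _ hfs]
  set T := e.target ∩ e.symm ⁻¹' s
  set τ : ℂ → ℂ := fun u => e' (f (e.symm u))
  have hT : MeasurableSet T := measurableSet_chart_preimage e hs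
  -- the change of variables by the coordinate expression `τ` of the homeomorphism
  have himg : e'.target ∩ e'.symm ⁻¹' (f '' s) = τ '' T := by
    ext u
    constructor
    · rintro ⟨hu, p, hp, hpu⟩
      refine ⟨e p, ⟨e.map_source (hse hp), ?_⟩, ?_⟩
      · simpa [e.left_inv (hse hp)] using hp
      · simp only [τ]; rw [e.left_inv (hse hp), hpu, e'.right_inv hu]
    · rintro ⟨v, ⟨hv, hvs⟩, rfl⟩
      have h1 : f (e.symm v) ∈ e'.source := hse' ⟨_, hvs, rfl⟩
      refine ⟨e'.map_source h1, ?_⟩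
      rw [Set.mem_preimage, e'.left_inv h1]
      exact ⟨_, hvs, rfl⟩
  have hd1 : ∀ u ∈ T, MDifferentiableAt (M := plane) 𝓘(ℝ, ℂ) 𝓘(ℝ, ℂ)
      (fun v => f (e.symm v)) u := fun u hu =>
    MDifferentiableAt.comp (M := plane) u (hd _ hu.2)
      (mdifferentiableAt_real (A := plane) (mdifferentiableAt_chart_symm he hu.1))
  have hd2 : ∀ u ∈ T, MDifferentiableAt (M' := plane) 𝓘(ℝ, ℂ) 𝓘(ℝ, ℂ) e' (f (e.symm u)) :=
    fun u hu => mdifferentiableAt_real (B := plane)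
      (mdifferentiableAt_chart he' (hse' ⟨_, hu.2, rfl⟩))
  have hd3 : ∀ u ∈ T, MDifferentiableAt (M := plane) (M' := plane) 𝓘(ℝ, ℂ) 𝓘(ℝ, ℂ) τ u :=
    fun u hu => MDifferentiableAt.comp (M := plane) (M'' := plane) u (hd2 u hu) (hd1 u hu)
  have hd4 : ∀ u ∈ T, DifferentiableAt ℝ τ u := fun u hu =>
    mdifferentiableAt_iff_differentiableAt.1 (hd3 u hu)
  have hinj : Set.InjOn τ T := by
    intro u hu v hv huv
    have h1 := e'.injOn (hse' ⟨_, hu.2, rfl⟩) (hse' ⟨_, hv.2, rfl⟩) huv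
    exact e.symm.injOn hu.1 hv.1 (f.injective h1)
  rw [himg, lintegral_image_eq_lintegral_abs_det_fderiv_mul volume hT
    (fun u hu => (hd4 u hu).hasFDerivAt.hasFDerivWithinAt) hinj]
  refine setLIntegral_congr_fun hT fun u hu => ?_
  have hp : f (e.symm u) ∈ e'.source := hse' ⟨_, hu.2, rfl⟩
  have ht := e'.map_source hp
  rw [← ENNReal.ofReal_mul (abs_nonneg _)]
  congr 1
  refine abs_det_of_isometric (conformalFactor_pos hμ he hu.1).le
    (conformalFactor_pos hν he' ht) ?_
  have h1 := metricPullback_comp (A := plane) ν (hd _ hu.2)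
    (mdifferentiableAt_real (A := plane) (mdifferentiableAt_chart_symm he hu.1))
  rw [hf _ hu.2] at h1
  have h2 : (fun v => f (e.symm v)) =ᶠ[𝓝 u] fun v => e'.symm (τ v) := by
    have hc : ContinuousAt (fun v => f (e.symm v)) u :=
      f.continuous.continuousAt.comp (e.continuousAt_symm hu.1)
    filter_upwards [hc.eventually (e'.open_source.mem_nhds hp)] with v hv
      using (e'.left_inv hv).symm
  have h3 := metricPullback_comp (A := plane) (B := plane) ν
    (mdifferentiableAt_real (A := plane) (mdifferentiableAt_chart_symm he' ht)) (hd3 u hu)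
  rw [metricPullback_congr (A := plane) ν h2, h3, realDifferential_plane] at h1
  have h4 : metricPullback (A := plane) ν e'.symm (τ u) =
      conformalFactor ν e' (τ u) • (innerSL ℝ : Form) := metricInChart_eq ν he' ht
  have h5 : metricPullback (A := plane) μ e.symm u =
      conformalFactor μ e u • (innerSL ℝ : Form) := metricInChart_eq μ he hu.1
  rw [h4] at h1
  rw [← h5]
  exact h1

lemma le_add_top_restrict_compl {α : Type*} [MeasurableSpace α] {m M : Measure α} {s : Set α}
    (h : ∀ t, MeasurableSet t → t ⊆ s → m t ≤ M t) :
    m ≤ M + (⊤ : Measure α).restrict sᶜ := by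
  refine Measure.le_iff.2 fun t ht => ?_
  by_cases hts : t ⊆ s
  · exact (h t ht hts).trans (by simp)
  · obtain ⟨x, hx, hxs⟩ := Set.not_subset.1 hts
    have : (⊤ : Measure α).restrict sᶜ t = ⊤ := by
      rw [Measure.restrict_apply ht, eq_top_iff]
      refine le_trans ?_ ((le_top : (⊤ : ENNReal) • Measure.dirac x ≤ ⊤) (t ∩ sᶜ))
      simp [hx, hxs]
    rw [Measure.add_apply, this]; simp

lemma restrict_top_compl_apply {α : Type*} [MeasurableSpace α] {s t : Set α}
    (ht : MeasurableSet t) (h : t ⊆ s) : (⊤ : Measure α).restrict sᶜ t = 0 := by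
  rw [Measure.restrict_apply ht]
  have : t ∩ sᶜ = ∅ := by ext x; simp; exact fun hx => h hx
  rw [this]; simp

lemma riemannianVolume_apply {μ : A → ℝ} (hμ : ∀ p, 0 < μ p) {e : OpenPartialHomeomorph A ℂ}
    (he : e ∈ atlas ℂ A) {s : Set A} (hs : MeasurableSet s) (hse : s ⊆ e.source) :
    riemannianVolume μ s = chartMeasure μ e s := by
  refine le_antisymm ?_ (chartMeasure_le μ he s)
  have h : riemannianVolume μ ≤ chartMeasure μ e + (⊤ : Measure A).restrict e.sourceᶜ := by
    rw [riemannianVolume_eq]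
    refine iSup₂_le fun e' he' =>
      le_add_top_restrict_compl fun t ht hte => ?_
    have h0 : chartMeasure μ e' t = chartMeasure μ e' (t ∩ e'.source) := by
      rw [chartMeasure_apply μ e' ht,
        chartMeasure_apply μ e' (ht.inter e'.open_source.measurableSet)]
      congr 2
      ext u
      simp only [Set.mem_inter_iff, Set.mem_preimage, and_congr_right_iff]
      exact fun hu => ⟨fun h => ⟨h, e'.map_target hu⟩, fun h => h.1⟩
    have h1 := chartMeasure_image (f := Homeomorph.refl A) hμ hμ he' he
      (s := t ∩ e'.source) (ht.inter e'.open_source.measurableSet) Set.inter_subset_right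
      (by simpa using Set.inter_subset_left.trans hte) (fun p _ => mdifferentiableAt_id)
      (fun p _ => metricPullback_id μ p)
    rw [h0, ← h1]
    exact measure_mono (by simp)
  refine (h s).trans ?_
  rw [Measure.add_apply, restrict_top_compl_apply hs hse, add_zero]

lemma restrict_riemannianVolume {μ : A → ℝ} (hμ : ∀ p, 0 < μ p)
    {e : OpenPartialHomeomorph A ℂ} (he : e ∈ atlas ℂ A) :
    (riemannianVolume μ).restrict e.source = chartMeasure μ e := by
  ext s hs
  rw [Measure.restrict_apply hs, riemannianVolume_apply hμ he
    (hs.inter e.open_source.measurableSet) Set.inter_subset_right, chartMeasure_apply _ _ hs,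
    chartMeasure_apply _ _ (hs.inter e.open_source.measurableSet)]
  congr 2
  ext u
  simp only [Set.mem_inter_iff, Set.mem_preimage, and_congr_right_iff]
  exact fun hu => ⟨fun h => h.1, fun h => ⟨h, e.map_target hu⟩⟩

/-- Finitely many charts cover a compact Riemann surface. -/
lemma exists_finset_atlas [CompactSpace A] :
    ∃ t : Finset A, ∀ p : A, ∃ q ∈ t, p ∈ (chartAt ℂ q).source := by
  obtain ⟨t, ht⟩ := isCompact_univ.elim_finite_subcover
    (fun q : A => (chartAt ℂ q).source) (fun q => (chartAt ℂ q).open_source)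
    (fun p _ => Set.mem_iUnion.2 ⟨p, mem_chart_source ℂ p⟩)
  exact ⟨t, fun p => by simpa using ht (Set.mem_univ p)⟩

lemma measure_ext_of_charts [CompactSpace A] {m m' : Measure A}
    (h : ∀ q : A, m.restrict (chartAt ℂ q).source = m'.restrict (chartAt ℂ q).source) :
    m = m' := by
  obtain ⟨t, ht⟩ := exists_finset_atlas (A := A)
  refine (Measure.ext_iff_of_biUnion_eq_univ (S := (t : Set A)) t.countable_toSet
    (s := fun q => (chartAt ℂ q).source) ?_).2 fun q _ => h q
  ext p; simpa using ht p

lemma restrict_riemannianVolume_of_isometry {μ : A → ℝ} {ν : B → ℝ}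
    [CompactSpace A] (hμ : ∀ p, 0 < μ p) (hν : ∀ p, 0 < ν p) (f : A ≃ₜ B) {W : Set A}
    (hW : IsOpen W) (hd : ∀ p ∈ W, MDifferentiableAt 𝓘(ℝ, ℂ) 𝓘(ℝ, ℂ) f p)
    (hf : ∀ p ∈ W, metricPullback ν f p = μ p • (innerSL ℝ : Form)) :
    (riemannianVolume ν).restrict (f '' W) =
      (Measure.map f (riemannianVolume μ)).restrict (f '' W) := by
  have : CompactSpace B := f.compactSpace
  have hfW : MeasurableSet (f '' W) := f.measurableEmbedding.measurableSet_image.2 hW.measurableSet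
  refine measure_ext_of_charts fun q => ?_
  rw [Measure.restrict_restrict (chartAt ℂ q).open_source.measurableSet,
    Measure.restrict_restrict (chartAt ℂ q).open_source.measurableSet]
  obtain ⟨t, ht⟩ := exists_finset_atlas (A := A)
  refine (Measure.ext_iff_of_biUnion_eq_univ (S := (t : Set A)) t.countable_toSet
    (s := fun q => f '' (chartAt ℂ q).source) ?_).2 fun q' _ => ?_
  · ext p
    obtain ⟨q', h1, h2⟩ := ht (f.symm p)
    simp only [Set.mem_iUnion, Set.mem_univ, iff_true]
    exact ⟨q', h1, f.symm p, h2, f.apply_symm_apply p⟩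
  have hq' : MeasurableSet (f '' (chartAt ℂ q').source) :=
    f.measurableEmbedding.measurableSet_image.2 (chartAt ℂ q').open_source.measurableSet
  ext s hs
  rw [Measure.restrict_restrict hq', Measure.restrict_restrict hq',
    Measure.restrict_apply hs, Measure.restrict_apply hs]
  set s' := s ∩ (f '' (chartAt ℂ q').source ∩ ((chartAt ℂ q).source ∩ f '' W)) with hs'
  have hm : MeasurableSet s' :=
    hs.inter (hq'.inter ((chartAt ℂ q).open_source.measurableSet.inter hfW))
  have hpre : MeasurableSet (f ⁻¹' s') := f.continuous.measurable hm
  have hf1 : f '' (f ⁻¹' s') = s' := Set.image_preimage_eq s' f.surjective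
  have hsub1 : f ⁻¹' s' ⊆ W := by
    rintro p ⟨_, _, _, w, hw, hwp⟩
    rwa [← f.injective hwp]
  have hsub2 : f ⁻¹' s' ⊆ (chartAt ℂ q').source := by
    rintro p ⟨_, ⟨w, hw, hwp⟩, _⟩
    rwa [← f.injective hwp]
  have hsub3 : s' ⊆ (chartAt ℂ q).source := fun p hp => hp.2.2.1
  rw [Measure.map_apply f.continuous.measurable hm,
    riemannianVolume_apply hμ (chart_mem_atlas ℂ q') hpre hsub2,
    riemannianVolume_apply hν (chart_mem_atlas ℂ q) hm hsub3]
  have := chartMeasure_image hμ hν f (chart_mem_atlas ℂ q') (chart_mem_atlas ℂ q) hpre hsub2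
    (by rw [hf1]; exact hsub3) (fun p hp => hd p (hsub1 hp)) (fun p hp => hf p (hsub1 hp))
  rwa [hf1] at this

lemma riemannianVolume_singleton {μ : A → ℝ} (hμ : ∀ p, 0 < μ p) (p : A) :
    riemannianVolume μ {p} = 0 := by
  rw [riemannianVolume_apply hμ (chart_mem_atlas ℂ p) (measurableSet_singleton p)
    (by simp), chartMeasure_apply _ _ (measurableSet_singleton p)]
  refine setLIntegral_measure_zero _ _ (measure_mono_null (t := {chartAt ℂ p p}) ?_ (by simp))
  rintro u ⟨hu, hup⟩
  simp only [Set.mem_preimage, Set.mem_singleton_iff] at hup ⊢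
  have := (chartAt ℂ p).right_inv hu
  rw [hup] at this
  exact this.symm

lemma nullSingletonClass_riemannianVolume {μ : A → ℝ} (hμ : ∀ p, 0 < μ p) :
    NullSingletonClass (riemannianVolume μ) := ⟨riemannianVolume_singleton hμ⟩

/-- No regularity of `F` is needed, as the inverse of a chart is a measurable embedding. -/
lemma integral_chartMeasure {μ : A → ℝ} (hμ : IsConformalMetric μ)
    {e : OpenPartialHomeomorph A ℂ} (he : e ∈ atlas ℂ A) (F : A → ℂ) :
    ∫ p, F p ∂(chartMeasure μ e) =
      ∫ u in e.target, (conformalFactor μ e u : ℂ) * F (e.symm u) := by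
  have hme : MeasurableSet e.target := e.open_target.measurableSet
  have hemb : MeasurableEmbedding (e.target.domRestrict e.symm) :=
    e.symm.isOpenEmbedding_restrict.measurableEmbedding
  set m := (volume.restrict e.target).withDensity
    fun u => ENNReal.ofReal (conformalFactor μ e u) with hm
  have h0 : m.restrict e.target = m := by
    rw [hm, restrict_withDensity hme, Measure.restrict_restrict hme, Set.inter_self]
  have h1 : chartMeasure μ e = Measure.map (e.target.domRestrict e.symm)
      (Measure.comap Subtype.val m) := by
    have h2 : m = Measure.map Subtype.val (Measure.comap (Subtype.val : e.target → ℂ) m) := by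
      rw [map_comap_subtype_coe hme, h0]
    ext s hs
    have h3 : AEMeasurable e.symm m := aemeasurable_chart_symm μ e
    rw [Measure.map_apply hemb.measurable hs, chartMeasure, Measure.map_apply_of_aemeasurable h3 hs,
      Measure.comap_apply _ Subtype.val_injective
        (fun t ht => (MeasurableEmbedding.subtype_coe hme).measurableSet_image.2 ht) _
        (hemb.measurable hs)]
    have h4 : Subtype.val '' (e.target.domRestrict e.symm ⁻¹' s) = e.symm ⁻¹' s ∩ e.target := by
      ext u; simp [Set.domRestrict]
    rw [h4, ← Measure.restrict_apply' hme, h0]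
  have hmeas : AEMeasurable (fun u => (conformalFactor μ e u).toNNReal)
      (volume.restrict e.target) :=
    ((contDiffOn_conformalFactor hμ he).continuousOn.aemeasurable hme).real_toNNReal
  rw [h1, hemb.integral_map]
  have h5 := integral_subtype_comap (μ := m) hme (fun u => F (e.symm u))
  refine h5.trans ?_
  rw [h0, hm]
  refine (integral_withDensity_eq_integral_smul₀ hmeas _).trans ?_
  refine setIntegral_congr_fun hme fun u hu => ?_
  simp only [NNReal.smul_def, Real.coe_toNNReal _ (conformalFactor_pos hμ.1 he hu).le]
  rw [Complex.real_smul]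

lemma integral_riemannianVolume_of_support {μ : A → ℝ} (hμ : IsConformalMetric μ)
    {e : OpenPartialHomeomorph A ℂ} (he : e ∈ atlas ℂ A) (F : A → ℂ)
    (hF : ∀ᵐ p ∂(riemannianVolume μ), p ∉ e.source → F p = 0) :
    ∫ p, F p ∂(riemannianVolume μ) =
      ∫ u in e.target, (conformalFactor μ e u : ℂ) * F (e.symm u) := by
  rw [← integral_chartMeasure hμ he F, ← restrict_riemannianVolume hμ.1 he,
    setIntegral_eq_integral_of_ae_compl_eq_zero hF]

lemma continuous_metric_div {μ ν : A → ℝ} (hμ : IsConformalMetric μ)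
    (hν : IsConformalMetric ν) : Continuous fun p => ν p / μ p := by
  rw [continuous_iff_continuousAt]
  intro q
  have hq := chart_mem_atlas ℂ q
  have h1 : ContinuousAt (fun p => conformalFactor ν (chartAt ℂ q) (chartAt ℂ q p) /
      conformalFactor μ (chartAt ℂ q) (chartAt ℂ q p)) q := by
    have hc := (chartAt ℂ q).continuousAt (mem_chart_source ℂ q)
    have ho := (chartAt ℂ q).open_target.mem_nhds (mem_chart_target ℂ q)
    refine ContinuousAt.div ?_ ?_ (conformalFactor_pos hμ.1 hq (mem_chart_target ℂ q)).ne'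
    · exact ContinuousAt.comp (g := conformalFactor ν (chartAt ℂ q))
        ((contDiffOn_conformalFactor hν hq).continuousOn.continuousAt ho) hc
    · exact ContinuousAt.comp (g := conformalFactor μ (chartAt ℂ q))
        ((contDiffOn_conformalFactor hμ hq).continuousOn.continuousAt ho) hc
  refine h1.congr ?_
  filter_upwards [(chartAt ℂ q).open_source.mem_nhds (mem_chart_source ℂ q)] with p hp
  have := norm_pos_iff.2 (realDifferential_chart_symm_ne_zero hq ((chartAt ℂ q).map_source hp))
  rw [conformalFactor_eq, conformalFactor_eq, (chartAt ℂ q).left_inv hp]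
  exact mul_div_mul_right _ _ (by positivity)

lemma riemannianVolume_eq_withDensity [CompactSpace A] {μ ν : A → ℝ} (hμ : IsConformalMetric μ)
    (hν : IsConformalMetric ν) : riemannianVolume ν =
      (riemannianVolume μ).withDensity fun p => ENNReal.ofReal (ν p / μ p) := by
  refine measure_ext_of_charts fun q => ?_
  have hq := chart_mem_atlas ℂ q
  set e := chartAt ℂ q
  have hme : MeasurableSet e.target := e.open_target.measurableSet
  have hmeas : Measurable fun p => ENNReal.ofReal (ν p / μ p) :=
    (continuous_metric_div hμ hν).measurable.ennreal_ofReal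
  rw [restrict_withDensity e.open_source.measurableSet, restrict_riemannianVolume hμ.1 hq,
    restrict_riemannianVolume hν.1 hq]
  ext s hs
  have hm2 : AEMeasurable (fun u => ENNReal.ofReal (conformalFactor μ e u))
      (volume.restrict e.target) :=
    ((contDiffOn_conformalFactor hμ hq).continuousOn.aemeasurable hme).ennreal_ofReal
  have hm3 : AEMeasurable e.symm (volume.restrict e.target) :=
    e.continuousOn_symm.aemeasurable hme
  rw [withDensity_apply _ hs, ← lintegral_indicator hs, chartMeasure_apply _ _ hs, chartMeasure,
    lintegral_map' (hmeas.indicator hs).aemeasurable (aemeasurable_chart_symm μ e)]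
  refine Eq.trans ?_ (lintegral_withDensity_eq_lintegral_mul₀ hm2
    ((hmeas.indicator hs).comp_aemeasurable hm3)).symm
  have h4 := measurableSet_chart_preimage e hs
  rw [← lintegral_indicator h4, ← lintegral_indicator hme]
  congr 1
  ext u
  by_cases hu : u ∈ e.target
  · by_cases hus : e.symm u ∈ s
    · have hmem : u ∈ e.target ∩ e.symm ⁻¹' s := ⟨hu, hus⟩
      rw [Set.indicator_of_mem hmem,
        Set.indicator_of_mem hu]
      simp only [Pi.mul_apply, Function.comp_apply]
      rw [Set.indicator_of_mem hus, ← ENNReal.ofReal_mul (conformalFactor_pos hμ.1 hq hu).le]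
      congr 1
      rw [conformalFactor_eq, conformalFactor_eq]
      have := hμ.1 (e.symm u)
      field_simp
    · have hmem : u ∉ e.target ∩ e.symm ⁻¹' s := fun h => hus h.2
      rw [Set.indicator_of_notMem hmem, Set.indicator_of_mem hu]
      simp only [Pi.mul_apply, Function.comp_apply]
      rw [Set.indicator_of_notMem hus, mul_zero]
  · have hmem : u ∉ e.target ∩ e.symm ⁻¹' s := fun h => hu h.1
    rw [Set.indicator_of_notMem hmem, Set.indicator_of_notMem hu]

end RiemannSurface

/-! ### Fields and conformal germs -/

namespace RiemannSurface

variable {A B : RiemannSurface}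

lemma contMDiffAt_chart_symm {e : OpenPartialHomeomorph A ℂ} (he : e ∈ atlas ℂ A) {u : ℂ}
    (hu : u ∈ e.target) : ContMDiffAt 𝓘(ℝ, ℂ) 𝓘(ℝ, ℂ) ∞ e.symm u :=
  contMDiffAt_symm_of_mem_maximalAtlas (IsManifold.subset_maximalAtlas he) hu

lemma isConformalGerm_chart {e : OpenPartialHomeomorph A ℂ} (he : e ∈ atlas ℂ A) {p : A}
    (hp : p ∈ e.source) (c : ℂ) : IsConformalGerm (B := plane) (fun q => e q - c) p := by
  refine ⟨e.source, e.open_source, hp, fun q hq => ?_, fun q hq q' hq' h => ?_⟩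
  · have h1 := mdifferentiableAt_chart he hq
    have h2 : MDifferentiableAt (M := plane) (M' := plane) 𝓘(ℂ) 𝓘(ℂ) (fun z : ℂ => z - c) (e q) :=
      mdifferentiableAt_iff_differentiableAt.2 (by fun_prop)
    exact (h2.comp (M' := plane) (M'' := plane) q h1).mdifferentiableWithinAt
  · exact e.injOn hq hq' (sub_left_injective h)

lemma isConformalGerm_chart_symm {e : OpenPartialHomeomorph A ℂ} (he : e ∈ atlas ℂ A) {c : ℂ}
    (hc : c ∈ e.target) : IsConformalGerm (A := plane) (fun z => e.symm (z + c)) (0 : ℂ) := by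
  refine ⟨(fun z : ℂ => z + c) ⁻¹' e.target, e.open_target.preimage (by fun_prop),
    by simpa using hc, fun z hz => ?_, fun z hz z' hz' h => ?_⟩
  · have h1 := mdifferentiableAt_chart_symm he hz
    have h2 : MDifferentiableAt (M := plane) (M' := plane) 𝓘(ℂ) 𝓘(ℂ) (fun z : ℂ => z + c) z :=
      mdifferentiableAt_iff_differentiableAt.2 (by fun_prop)
    exact (h1.comp (M := plane) (M' := plane) z h2).mdifferentiableWithinAt
  · exact add_left_injective c (e.symm.injOn hz hz' h)

end RiemannSurface

namespace FBundleFunctor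

open RiemannSurface

variable (Φ : FBundleFunctor.{u}) {A B D : RiemannSurface}

lemma map_comp_apply {f : A → B} {h : B → D} {p : A} {q : B} {r : D} (hq : f p = q) (hr : h q = r)
    (hf : IsConformalGerm f p) (hh : IsConformalGerm h q) (w : Φ.Fiber A p) :
    Φ.map (fun x => h (f x)) p r w = Φ.map h q r (Φ.map f p q w) := by
  subst hq; subst hr
  rw [Φ.map_comp f h p hf hh]; rfl

lemma map_congr_apply {f f' : A → B} {p : A} {q : B} (hq : f p = q) (hf : IsConformalGerm f p)
    (h : f =ᶠ[𝓝 p] f') (w : Φ.Fiber A p) : Φ.map f p q w = Φ.map f' p q w := by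
  subst hq
  rw [Φ.map_congr f f' p hf h]

lemma map_fil_mem {f : A → B} {p : A} {q : B} (hq : f p = q) (hf : IsConformalGerm f p) {i : ℕ}
    {w : Φ.Fiber A p} (hw : w ∈ Φ.fil A p i) : Φ.map f p q w ∈ Φ.fil B q i := by
  subst hq
  exact Φ.map_fil f p hf i w hw

lemma map_chart_symm_map_chart {e : OpenPartialHomeomorph A ℂ} (he : e ∈ atlas ℂ A) {p : A}
    (hp : p ∈ e.source) (w : Φ.Fiber A p) :
    Φ.map (A := plane) (fun z => e.symm (z + e p)) (0 : ℂ) p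
      (Φ.map (B := plane) (fun q => e q - e p) p (0 : ℂ) w) = w := by
  have h0 : (fun q => e q - e p) p = 0 := sub_self _
  have h1 : (fun z => e.symm (z + e p)) 0 = p := by simp [e.left_inv hp]
  rw [← Φ.map_comp_apply (B := plane) (q := (0 : ℂ)) h0 h1 (isConformalGerm_chart he hp _)
    (isConformalGerm_chart_symm he (e.map_source hp))]
  have h2 : (fun x => e.symm (e x - e p + e p)) =ᶠ[𝓝 p] fun x => x := by
    filter_upwards [e.open_source.mem_nhds hp] with q hq
    rw [sub_add_cancel, e.left_inv hq]
  rw [← Φ.map_congr_apply (f := fun x => x) rfl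
    ⟨Set.univ, isOpen_univ, trivial, fun _ _ => mdifferentiableAt_id.mdifferentiableWithinAt,
      Function.injective_id.injOn⟩ h2.symm, Φ.map_id]
  rfl

lemma sigma_map_eq {s : ℂ → A} {p : A} (h : s 0 = p) (v : Φ.F) :
    (⟨s 0, Φ.map (A := plane) s (0 : ℂ) (s 0) v⟩ : Φ.Field A) =
      ⟨p, Φ.map (A := plane) s (0 : ℂ) p v⟩ := by
  subst h; rfl

lemma place_eq_of_chart {e : OpenPartialHomeomorph A ℂ} {p : A}
    (hp : p ∈ e.source) (v : Φ.F) :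
    Φ.place (fun z => e.symm (z + e p)) v =
      ⟨p, Φ.map (A := plane) (fun z => e.symm (z + e p)) (0 : ℂ) p v⟩ :=
  Φ.sigma_map_eq (s := fun z => e.symm (z + e p)) (by simp [e.left_inv hp]) v

/-- A chart around `p` as a parametrisation centred at `p`. -/
def chartParam (p : A) (z : ℂ) : A := (chartAt ℂ p).symm (z + chartAt ℂ p p)

lemma chartParam_zero (p : A) : chartParam p 0 = p := by simp [chartParam]

lemma localField_eq_place (p : A) (v : Φ.F) :
    Φ.localField A p v = Φ.place (chartParam p) v :=
  (Φ.place_eq_of_chart (mem_chart_source ℂ p) v).symm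

lemma exists_eq_localField (φ : Φ.Field A) : ∃ v, φ = Φ.localField A φ.1 v := by
  obtain ⟨p, w⟩ := φ
  refine ⟨Φ.map (B := plane) (fun q => chartAt ℂ p q - chartAt ℂ p p) p (0 : ℂ) w, ?_⟩
  refine Sigma.ext rfl (heq_of_eq ?_)
  exact (Φ.map_chart_symm_map_chart (chart_mem_atlas ℂ p) (mem_chart_source ℂ p) w).symm

lemma isConformalGerm_chartParam (p : A) : IsConformalGerm (A := plane) (chartParam p) (0 : ℂ) :=
  isConformalGerm_chart_symm (chart_mem_atlas ℂ p) (mem_chart_target ℂ p)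

end FBundleFunctor

namespace RiemannSurface

variable {A : RiemannSurface}

lemma contMDiffAt_chartParam {E : Type} [NormedAddCommGroup E] [NormedSpace ℝ E] (p : A) (t : E) :
    ContMDiffAt 𝓘(ℝ, E × ℂ) 𝓘(ℝ, ℂ) ∞
      (fun q : E × ℂ => FBundleFunctor.chartParam p q.2) (t, 0) := by
  have h1 : ContMDiffAt 𝓘(ℝ, ℂ) 𝓘(ℝ, ℂ) ∞ (chartAt ℂ p).symm
      ((fun q : E × ℂ => q.2 + chartAt ℂ p p) (t, 0)) := by
    simpa using contMDiffAt_chart_symm (chart_mem_atlas ℂ p) (mem_chart_target ℂ p)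
  exact h1.comp (t, 0) (by
    rw [contMDiffAt_iff_contDiffAt]; fun_prop)

lemma eventually_mdifferentiableAt_chartParam {E : Type} [NormedAddCommGroup E] [NormedSpace ℝ E]
    (p : A) (t : E) : ∀ᶠ q : E × ℂ in 𝓝 (t, 0),
      MDifferentiableAt 𝓘(ℂ) 𝓘(ℂ) (FBundleFunctor.chartParam p) q.2 := by
  have h1 : ContinuousAt (fun q : E × ℂ => q.2 + chartAt ℂ p p) (t, 0) := by fun_prop
  have h2 : (fun q : E × ℂ => q.2 + chartAt ℂ p p) (t, 0) ∈ (chartAt ℂ p).target := by simp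
  filter_upwards [h1.eventually ((chartAt ℂ p).open_target.mem_nhds h2)] with q hq
  have h1 := mdifferentiableAt_chart_symm (chart_mem_atlas ℂ p) hq
  have h2 : MDifferentiableAt (M := ℂ) (M' := ℂ) 𝓘(ℂ) 𝓘(ℂ) (fun z : ℂ => z + chartAt ℂ p p) q.2 :=
    mdifferentiableAt_iff_differentiableAt.2 (by fun_prop)
  exact MDifferentiableAt.comp (M := ℂ) (M' := ℂ) q.2 h1 h2

lemma contDiffOn_form_iff {E : Type*} [NormedAddCommGroup E] [NormedSpace ℝ E] {F : E → Form}
    {s : Set E} : ContDiffOn ℝ ∞ F s ↔ ∀ z w, ContDiffOn ℝ ∞ (fun x => F x z w) s := by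
  rw [contDiffOn_clm_apply]
  exact forall_congr' fun z => contDiffOn_clm_apply

lemma contDiffOn_smul_form {E : Type*} [NormedAddCommGroup E] [NormedSpace ℝ E] {f : E → ℝ}
    {s : Set E} (hf : ContDiffOn ℝ ∞ f s) (B : Form) : ContDiffOn ℝ ∞ (fun x => f x • B) s :=
  contDiffOn_form_iff.2 fun z w => hf.mul (contDiffOn_const (c := B z w))

lemma contDiffOn_metricInChart_iff {μ : A → ℝ} {e : OpenPartialHomeomorph A ℂ}
    (he : e ∈ atlas ℂ A) : ContDiffOn ℝ ∞ (metricInChart μ e) e.target ↔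
      ContDiffOn ℝ ∞ (conformalFactor μ e) e.target := by
  constructor
  · intro h
    exact (h.clm_apply contDiffOn_const).clm_apply contDiffOn_const
  · intro h
    exact (contDiffOn_smul_form h _).congr fun u hu => metricInChart_eq μ he hu

/-! ### Change of the metric within its conformal class -/

/-- The geometric interpolation between two metrics of the same conformal class. -/
def weylPath (μ₀ μ₁ : A → ℝ) (s : ℝ) (p : A) : ℝ := μ₀ p * (μ₁ p / μ₀ p) ^ s

variable {μ₀ μ₁ : A → ℝ}

lemma weylPath_zero (μ₀ μ₁ : A → ℝ) : weylPath μ₀ μ₁ 0 = μ₀ := by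
  ext p; simp [weylPath]

lemma weylPath_one (h₀ : ∀ p, 0 < μ₀ p) : weylPath μ₀ μ₁ 1 = μ₁ := by
  ext p
  have := (h₀ p).ne'
  simp only [weylPath, Real.rpow_one]
  field_simp

lemma conformalFactor_weylPath {e : OpenPartialHomeomorph A ℂ} (he : e ∈ atlas ℂ A) {u : ℂ}
    (hu : u ∈ e.target) (s : ℝ) : conformalFactor (weylPath μ₀ μ₁ s) e u =
      conformalFactor μ₀ e u * (conformalFactor μ₁ e u / conformalFactor μ₀ e u) ^ s := by
  have := norm_pos_iff.2 (realDifferential_chart_symm_ne_zero he hu)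
  rw [conformalFactor_eq, conformalFactor_eq, conformalFactor_eq,
    mul_div_mul_right _ _ (by positivity), weylPath]
  ring

lemma weylPath_pos (h₀ : ∀ p, 0 < μ₀ p) (h₁ : ∀ p, 0 < μ₁ p) (s : ℝ) (p : A) :
    0 < weylPath μ₀ μ₁ s p :=
  mul_pos (h₀ p) (Real.rpow_pos_of_pos (div_pos (h₁ p) (h₀ p)) s)

lemma contDiffOn_weylPath (h₀ : IsConformalMetric μ₀) (h₁ : IsConformalMetric μ₁) (s₀ : ℝ)
    {e : OpenPartialHomeomorph A ℂ} (he : e ∈ atlas ℂ A) :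
    ContDiffOn ℝ ∞ (fun q : ℝ × ℂ => conformalFactor (weylPath μ₀ μ₁ (s₀ + q.1)) e q.2)
      (Set.univ ×ˢ e.target) := by
  have hs : ContDiffOn ℝ ∞ (fun q : ℝ × ℂ => q.2) (Set.univ ×ˢ e.target) := contDiff_snd.contDiffOn
  have hm : Set.MapsTo (fun q : ℝ × ℂ => q.2) (Set.univ ×ˢ e.target) e.target := fun q hq => hq.2
  have k0 := (contDiffOn_conformalFactor h₀ he).comp hs hm
  have k1 := (contDiffOn_conformalFactor h₁ he).comp hs hm
  have hp0 : ∀ q ∈ (Set.univ ×ˢ e.target : Set (ℝ × ℂ)), 0 < conformalFactor μ₀ e q.2 :=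
    fun q hq => conformalFactor_pos h₀.1 he hq.2
  have hp1 : ∀ q ∈ (Set.univ ×ˢ e.target : Set (ℝ × ℂ)), 0 < conformalFactor μ₁ e q.2 :=
    fun q hq => conformalFactor_pos h₁.1 he hq.2
  have k2 : ContDiffOn ℝ ∞ (fun q : ℝ × ℂ => (s₀ + q.1)) (Set.univ ×ˢ e.target) := by fun_prop
  refine (k0.mul ((k1.div k0 fun q hq => (hp0 q hq).ne').rpow k2
    fun q hq => (div_pos (hp1 q hq) (hp0 q hq)).ne')).congr fun q hq => ?_
  exact conformalFactor_weylPath he hq.2 _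

lemma isConformalMetric_weylPath (h₀ : IsConformalMetric μ₀) (h₁ : IsConformalMetric μ₁) (s : ℝ) :
    IsConformalMetric (weylPath μ₀ μ₁ s) := by
  refine ⟨weylPath_pos h₀.1 h₁.1 s, fun e he => (contDiffOn_metricInChart_iff he).2 ?_⟩
  have h := contDiffOn_weylPath h₀ h₁ s he
  have := h.comp (t := Set.univ ×ˢ e.target) (s := e.target) (f := fun u : ℂ => ((0 : ℝ), u))
    (by fun_prop) (fun u hu => ⟨trivial, hu⟩)
  simpa [Function.comp_def] using this

lemma det_id_pos : 0 < (ContinuousLinearMap.id ℝ ℂ).det := by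
  rw [det_real_complex]; simp

lemma isSmoothFamily_weylPath (h₀ : IsConformalMetric μ₀) (h₁ : IsConformalMetric μ₁) (s₀ : ℝ) :
    IsSmoothFamily Set.univ A (fun _ : ℝ => A) (fun t => weylPath μ₀ μ₁ (s₀ + t))
      (fun _ => Homeomorph.refl A) where
  isOpen := isOpen_univ
  metric t _ := isConformalMetric_weylPath h₀ h₁ _
  smooth _ _ := contMDiff_id
  smooth_symm _ _ := contMDiff_id
  orientation t _ p := by
    have : realDifferential (Homeomorph.refl A) p = ContinuousLinearMap.id ℝ ℂ :=
      realDifferential_id p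
    rw [this]; exact det_id_pos
  smooth_metric e he := by
    refine (contDiffOn_smul_form (contDiffOn_weylPath h₀ h₁ s₀ he) (innerSL ℝ : Form)).congr
      fun q hq => metricInChart_eq _ he hq.2

lemma isSmoothFamily_const {E : Type} [NormedAddCommGroup E] [NormedSpace ℝ E]
    {μ : A → ℝ} (hμ : IsConformalMetric μ) :
    IsSmoothFamily Set.univ A (fun _ : E => A) (fun _ => μ) (fun _ => Homeomorph.refl A) where
  isOpen := isOpen_univ
  metric t _ := hμ
  smooth _ _ := contMDiff_id
  smooth_symm _ _ := contMDiff_id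
  orientation t _ p := by
    have : realDifferential (Homeomorph.refl A) p = ContinuousLinearMap.id ℝ ℂ :=
      realDifferential_id p
    rw [this]; exact det_id_pos
  smooth_metric e he :=
    (hμ.2 e he).comp (contDiff_snd.contDiffOn) (fun q hq => hq.2)

end RiemannSurface

namespace RiemannSurface

variable {A : RiemannSurface} {μ₀ μ₁ : A → ℝ}

/-- The Laplacian of `log ρ` at `p` for the metric `ρ |dz|²`, in the coordinate
`z = chartAt ℂ p`. -/
def laplacianLog (μ : A → ℝ) (p : A) : ℝ :=
  Laplacian.laplacian (fun u => Real.log (conformalFactor μ (chartAt ℂ p) u)) (chartAt ℂ p p)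

lemma scalarCurvature_eq (μ : A → ℝ) (p : A) :
    scalarCurvature μ p = -laplacianLog μ p / μ p := by
  rw [scalarCurvature, conformalFactor_chartAt_self]; rfl

lemma laplacianLog_weylPath (h₀ : IsConformalMetric μ₀) (h₁ : IsConformalMetric μ₁) (s : ℝ)
    (p : A) : laplacianLog (weylPath μ₀ μ₁ s) p =
      (1 - s) * laplacianLog μ₀ p + s * laplacianLog μ₁ p := by
  have hp := chart_mem_atlas ℂ p
  have hu := mem_chart_target ℂ p
  set e := chartAt ℂ p
  have hnhds := e.open_target.mem_nhds hu
  have hc {μ : A → ℝ} (h : IsConformalMetric μ) :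
      ContDiffAt ℝ 2 (fun u => Real.log (conformalFactor μ e u)) (e p) :=
    (((contDiffOn_conformalFactor h hp).contDiffAt hnhds).of_le (by norm_cast)).log
      (conformalFactor_pos h.1 hp hu).ne'
  have h : (fun u => Real.log (conformalFactor (weylPath μ₀ μ₁ s) e u)) =ᶠ[𝓝 (e p)]
      (1 - s) • (fun u => Real.log (conformalFactor μ₀ e u)) +
        s • (fun u => Real.log (conformalFactor μ₁ e u)) := by
    filter_upwards [hnhds] with u hu
    have p0 := conformalFactor_pos h₀.1 hp hu
    have p1 := conformalFactor_pos h₁.1 hp hu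
    rw [conformalFactor_weylPath hp hu, Real.log_mul p0.ne' (Real.rpow_pos_of_pos
      (div_pos p1 p0) _).ne', Real.log_rpow (div_pos p1 p0), Real.log_div p1.ne' p0.ne']
    simp only [Pi.add_apply, Pi.smul_apply, smul_eq_mul]; ring
  unfold laplacianLog
  rw [(InnerProductSpace.laplacian_congr_nhds h).eq_of_nhds,
    ContDiffAt.laplacian_add (f₁ := (1 - s) • fun u => Real.log (conformalFactor μ₀ e u))
      (f₂ := s • fun u => Real.log (conformalFactor μ₁ e u)) ((hc h₀).const_smul (1 - s))
      ((hc h₁).const_smul s),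
    InnerProductSpace.laplacian_smul _ (hc h₀), InnerProductSpace.laplacian_smul _ (hc h₁)]
  simp [e]

/-- The logarithmic derivative of the `N`-point functions along the geometric interpolation from
`μ₀` to `μ₁`. -/
def weylRate (c : ℝ) (μ₀ μ₁ : A → ℝ) (s : ℝ) : ℝ :=
  ∫ p, c / (48 * Real.pi) * Real.log (μ₁ p / μ₀ p) *
    ((1 - s) * laplacianLog μ₀ p + s * laplacianLog μ₁ p) / μ₀ p ∂(riemannianVolume μ₀)

/-- The factor by which the `N`-point functions change between two metrics in the same conformal
class. -/
def weylFactor (c : ℝ) (μ₀ μ₁ : A → ℝ) : ℝ := Real.exp (∫ s in (0 : ℝ)..1, weylRate c μ₀ μ₁ s)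

end RiemannSurface

/-- Neither `f` nor `h` need be integrable: if `f + s h` is integrable for two values of `s`, it is
for all, and otherwise the integral has the value `0` for all but one value of `s`. -/
lemma exists_continuous_eq_integral_affine {α : Type*} [MeasurableSpace α] (m : Measure α)
    (f h : α → ℝ) : ∃ k : ℝ → ℝ, Continuous k ∧ ∃ s₀, ∀ s, s ≠ s₀ →
      ∫ p, (f p + s * h p) ∂m = k s := by
  by_cases H : ∃ s₁ s₂, s₁ ≠ s₂ ∧ Integrable (fun p => f p + s₁ * h p) m ∧
      Integrable (fun p => f p + s₂ * h p) m
  · obtain ⟨s₁, s₂, hs, h1, h2⟩ := H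
    have hh : Integrable h m := by
      have := (h1.sub h2).const_mul (s₁ - s₂)⁻¹
      refine this.congr (Eventually.of_forall fun p => ?_)
      have : s₁ - s₂ ≠ 0 := sub_ne_zero.2 hs
      simp only [Pi.sub_apply]; field_simp; ring
    have hf : Integrable f m := by
      have := h1.sub (hh.const_mul s₁)
      refine this.congr (Eventually.of_forall fun p => ?_)
      simp only [Pi.sub_apply]; ring
    refine ⟨fun s => (∫ p, f p ∂m) + s * ∫ p, h p ∂m, by fun_prop, 0, fun s _ => ?_⟩
    rw [integral_add hf (hh.const_mul s), integral_const_mul]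
  · push Not at H
    by_cases H1 : ∃ s₁, Integrable (fun p => f p + s₁ * h p) m
    · obtain ⟨s₁, h1⟩ := H1
      exact ⟨fun _ => 0, continuous_const, s₁, fun s hs => integral_undef (H s₁ s hs.symm h1)⟩
    · push Not at H1
      exact ⟨fun _ => 0, continuous_const, 0, fun s _ => integral_undef (H1 s)⟩

lemma eq_exp_mul_of_hasDerivAt {F : ℝ → ℂ} {c k : ℝ → ℝ} (hF : ContDiff ℝ 1 F)
    (hd : ∀ s, HasDerivAt F (c s * F s) s) (hk : Continuous k) {s₀ : ℝ}
    (hck : ∀ s, s ≠ s₀ → c s = k s) :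
    F 1 = (Real.exp (∫ s in (0 : ℝ)..1, c s) : ℝ) * F 0 := by
  have hFk : ∀ s, HasDerivAt F (k s * F s) s := by
    have h1 : deriv F = fun s => (k s : ℂ) * F s := by
      refine Continuous.ext_on (s := {s₀}ᶜ) (dense_compl_singleton s₀) (hF.continuous_deriv le_rfl)
        (by have := hF.continuous; fun_prop) fun s hs => ?_
      rw [(hd s).deriv, hck s hs]
    intro s
    have := (hF.differentiable one_ne_zero s).hasDerivAt
    rwa [h1] at this
  have hint : ∫ s in (0 : ℝ)..1, c s = ∫ s in (0 : ℝ)..1, k s := by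
    refine intervalIntegral.integral_congr_ae ?_
    have : ∀ᵐ s : ℝ, s ≠ s₀ := by simp [ae_iff]
    filter_upwards [this] with s hs _ using hck s hs
  set G : ℝ → ℂ := fun s => (Real.exp (-∫ x in (0 : ℝ)..s, k x) : ℝ) * F s
  have hG : ∀ s, HasDerivAt G 0 s := by
    intro s
    have h1 : HasDerivAt (fun s => ∫ x in (0 : ℝ)..s, k x) (k s) s :=
      intervalIntegral.integral_hasDerivAt_right (hk.intervalIntegrable _ _)
        hk.stronglyMeasurable.stronglyMeasurableAtFilter hk.continuousAt
    have h2 := (h1.neg.exp.ofReal_comp).mul (hFk s)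
    refine h2.congr_deriv ?_
    push_cast
    ring
  have hconst := is_const_of_deriv_eq_zero (fun s => (hG s).differentiableAt)
    (fun s => (hG s).deriv) 1 0
  simp only [G, intervalIntegral.integral_same, neg_zero, Real.exp_zero, Complex.ofReal_one,
    one_mul] at hconst
  rw [← hconst, ← mul_assoc, ← Complex.ofReal_mul, hint, ← Real.exp_add]
  simp

lemma deriv_smul_vector {V : Type*} [NormedAddCommGroup V] [NormedSpace ℝ V] {f : ℝ → ℝ}
    {f' t : ℝ} (hf : HasDerivAt f f' t) (v : V) : deriv (fun t => f t • v) t = f' • v :=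
  (hf.smul_const v).deriv

lemma deriv_smul_form {f : ℝ → ℝ} {f' t : ℝ} (hf : HasDerivAt f f' t) (B : Form) :
    deriv (fun t => f t • B) t = f' • B :=
  deriv_smul_vector (V := Form) hf B

lemma RiemannSurface.deriv_metricPullback_weylPath {A : RiemannSurface} {μ₀ μ₁ : A → ℝ}
    (h₀ : ∀ p, 0 < μ₀ p) (h₁ : ∀ p, 0 < μ₁ p) (s : ℝ) (p : A) :
    deriv (fun t => metricPullback (weylPath μ₀ μ₁ (s + t)) (Homeomorph.refl A) p) 0 =
      Real.log (μ₁ p / μ₀ p) • (weylPath μ₀ μ₁ s p • (innerSL ℝ : Form)) := by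
  have h6 : HasDerivAt (fun t => weylPath μ₀ μ₁ (s + t) p)
      (Real.log (μ₁ p / μ₀ p) * weylPath μ₀ μ₁ s p) 0 := by
    have h7 : HasDerivAt (fun t : ℝ => s + t) 1 0 := (hasDerivAt_id 0).const_add s
    refine ((h7.const_rpow (div_pos (h₁ p) (h₀ p))).const_mul (μ₀ p)).congr_deriv ?_
    simp only [weylPath, add_zero, mul_one]; ring
  have h8 : (fun t => metricPullback (weylPath μ₀ μ₁ (s + t)) (Homeomorph.refl A) p) =
      fun t => weylPath μ₀ μ₁ (s + t) p • (innerSL ℝ : Form) :=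
    funext fun t => metricPullback_id _ p
  rw [h8, deriv_smul_form h6]
  exact mul_smul _ _ _

namespace ConformalFieldTheory

open RiemannSurface

variable {S : Type} [TopologicalSpace S] (C : ConformalFieldTheory.{u} S)
  {A : RiemannSurface} {μ μ₀ μ₁ : A → ℝ}

lemma separated_cons {N : ℕ} {φ : Fin N → C.Field A} (hφ : Separated φ) {p : A}
    (hp : ∀ i, (φ i).1 ≠ p) (w : C.Fiber A p) :
    Separated (Fin.cons ⟨p, w⟩ φ : Fin (N + 1) → C.Field A) := by
  have h : (fun i => ((Fin.cons ⟨p, w⟩ φ : Fin (N + 1) → C.Field A) i).1) =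
      (Fin.cons p fun i => (φ i).1 : Fin (N + 1) → A) := by
    funext i
    refine Fin.cases rfl (fun i => rfl) i
  unfold Separated
  rw [h]
  exact Fin.cons_injective_iff.2 ⟨fun ⟨i, hi⟩ => hp i hi, hφ⟩

lemma corr_cons_smul (hA : IsMetricSurface S A μ) {N : ℕ} {φ : Fin N → C.Field A}
    (hφ : Separated φ) {p : A} (hp : ∀ i, (φ i).1 ≠ p) (z : ℂ) (w : C.Fiber A p) :
    C.corr A μ (Fin.cons ⟨p, z • w⟩ φ : Fin (N + 1) → C.Field A) =
      z * C.corr A μ (Fin.cons ⟨p, w⟩ φ : Fin (N + 1) → C.Field A) := by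
  have h := (C.corr_linear A μ hA _ 0 (C.separated_cons hφ hp w)).map_smul z w
  rw [Fin.update_cons_zero, Fin.update_cons_zero] at h
  exact h

lemma corr_cons_add (hA : IsMetricSurface S A μ) {N : ℕ} {φ : Fin N → C.Field A}
    (hφ : Separated φ) {p : A} (hp : ∀ i, (φ i).1 ≠ p) (w w' : C.Fiber A p) :
    C.corr A μ (Fin.cons ⟨p, w + w'⟩ φ : Fin (N + 1) → C.Field A) =
      C.corr A μ (Fin.cons ⟨p, w⟩ φ : Fin (N + 1) → C.Field A) +
      C.corr A μ (Fin.cons ⟨p, w'⟩ φ : Fin (N + 1) → C.Field A) := by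
  have h := (C.corr_linear A μ hA _ 0 (C.separated_cons hφ hp w)).map_add w w'
  rw [Fin.update_cons_zero, Fin.update_cons_zero, Fin.update_cons_zero] at h
  exact h

lemma corr_cons_one (hA : IsMetricSurface S A μ) {N : ℕ} {φ : Fin N → C.Field A}
    (hφ : Separated φ) {p : A} (hp : ∀ i, (φ i).1 ≠ p) :
    C.corr A μ (Fin.cons ⟨p, C.one A p⟩ φ : Fin (N + 1) → C.Field A) = C.corr A μ φ :=
  C.corr_one A μ hA φ p (C.separated_cons hφ hp _)

lemma ae_ne_position (hμ : ∀ p, 0 < μ p) {N : ℕ} (φ : Fin N → C.Field A) :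
    ∀ᵐ p ∂(riemannianVolume μ), ∀ i, (φ i).1 ≠ p := by
  have := nullSingletonClass_riemannianVolume hμ
  rw [ae_all_iff]
  intro i
  rw [ae_iff]
  simp

lemma T_smul (p : A) (r : ℝ) (B : Form) : C.T A μ p (r • B) = (r : ℂ) • C.T A μ p B :=
  ((C.T A μ p).map_smul r B).trans (Complex.coe_smul r _).symm

lemma T_metric (hA : IsMetricSurface S A μ) (p : A) : C.T A μ p (μ p • (innerSL ℝ : Form)) =
    ((-(C.c / (48 * Real.pi)) * scalarCurvature μ p : ℝ) : ℂ) • C.one A p :=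
  C.trace_anomaly A μ hA p

lemma contDiff_corr_weylPath (h₀ : IsMetricSurface S A μ₀) (h₁ : IsMetricSurface S A μ₁)
    {N : ℕ} {φ : Fin N → C.Field A} (hφ : Separated φ) :
    ContDiff ℝ ∞ fun s => C.corr A (weylPath μ₀ μ₁ s) φ := by
  choose v hv using fun i => C.toFBundleFunctor.exists_eq_localField (φ i)
  have hφv : φ = fun i => C.toFBundleFunctor.place (FBundleFunctor.chartParam (φ i).1) (v i) := by
    funext i
    rw [← C.toFBundleFunctor.localField_eq_place]
    exact hv i
  rw [contDiff_iff_contDiffAt]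
  intro s
  have hfam := isSmoothFamily_weylPath h₀.metric h₁.metric 0
  simp only [zero_add] at hfam
  have := C.corr_smooth Set.univ A (fun _ : ℝ => A) (weylPath μ₀ μ₁)
    (fun _ => Homeomorph.refl A) h₀.compact h₀.homeomorphic hfam N
    (fun _ i => FBundleFunctor.chartParam (φ i).1) v s trivial
    (fun i => contMDiffAt_chartParam _ _) (fun i => eventually_mdifferentiableAt_chartParam _ _)
    (fun i => FBundleFunctor.isConformalGerm_chartParam _)
    (by unfold Separated at hφ; simpa only [FBundleFunctor.chartParam_zero] using hφ)
  rw [← hφv] at this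
  exact this

lemma push_id {N : ℕ} (φ : Fin N → C.Field A) :
    (fun i => C.toFBundleFunctor.push (Homeomorph.refl A) (φ i)) = φ := by
  funext i
  refine Sigma.ext rfl (heq_of_eq ?_)
  have := C.map_id A (φ i).1
  exact congrArg (fun L => L (φ i).2) this

lemma hasDerivAt_corr_weylPath (h₀ : IsMetricSurface S A μ₀) (h₁ : IsMetricSurface S A μ₁)
    {N : ℕ} {φ : Fin N → C.Field A} (hφ : Separated φ) (s : ℝ) :
    HasDerivAt (fun s => C.corr A (weylPath μ₀ μ₁ s) φ)
      (weylRate C.c μ₀ μ₁ s * C.corr A (weylPath μ₀ μ₁ s) φ) s := by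
  have := h₀.compact
  set μ := weylPath μ₀ μ₁ s with hμ
  have hm : IsConformalMetric μ := isConformalMetric_weylPath h₀.metric h₁.metric s
  have hA : IsMetricSurface S A μ := ⟨h₀.compact, h₀.homeomorphic, hm⟩
  have hE := C.einstein_derivative Set.univ A μ (fun _ => A)
    (fun t => weylPath μ₀ μ₁ (s + t)) (fun _ => Homeomorph.refl A) hA
    (isSmoothFamily_weylPath h₀.metric h₁.metric s) trivial
    (fun p => by rw [add_zero]; exact metricPullback_id μ p) φ hφ
    (fun i => ⟨Set.univ, Filter.univ_mem, fun t _ => mdifferentiableOn_id⟩)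
  simp only [C.push_id] at hE
  have h3 : HasDerivAt (fun t : ℝ => t - s) 1 s := (hasDerivAt_id s).sub_const s
  have hE2 := HasDerivAt.scomp_of_eq (h := fun t : ℝ => t - s) s hE h3 (sub_self s).symm
  simp only [Function.comp_def, add_sub_cancel, one_smul] at hE2
  refine hE2.congr_deriv (Eq.symm ?_)
  -- the metric varies by multiples of itself, so that only the trace of `T` contributes
  have hval : ∀ᵐ p ∂(riemannianVolume μ), C.corr A μ (Fin.cons ⟨p, C.T A μ p
      (deriv (fun t => metricPullback (weylPath μ₀ μ₁ (s + t)) (Homeomorph.refl A) p) 0)⟩ φ :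
        Fin (N + 1) → C.Field A) =
      ((Real.log (μ₁ p / μ₀ p) * (-(C.c / (48 * Real.pi)) * scalarCurvature μ p) : ℝ) : ℂ) *
        C.corr A μ φ := by
    filter_upwards [C.ae_ne_position hm.1 φ] with p hp
    rw [deriv_metricPullback_weylPath h₀.metric.1 h₁.metric.1, C.T_smul,
      C.T_metric hA, smul_smul, C.corr_cons_smul hA hφ hp, C.corr_cons_one hA hφ hp]
    push_cast
    ring
  refine Eq.trans ?_ (integral_congr_ae hval).symm
  rw [integral_mul_const, integral_complex_ofReal]
  refine congrArg (fun r : ℝ => (r : ℂ) * C.corr A μ φ) ?_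
  -- the volume form is that of `μ₀` times `μ / μ₀`, which cancels the factor `1 / μ` of the curvature
  rw [weylRate, hμ, riemannianVolume_eq_withDensity h₀.metric hm]
  have hmeas : Measurable fun p => (μ p / μ₀ p).toNNReal :=
    (continuous_metric_div h₀.metric hm).measurable.real_toNNReal
  refine Eq.trans ?_ (integral_withDensity_eq_integral_smul hmeas _).symm
  refine integral_congr_ae (Eventually.of_forall fun p => ?_)
  have q0 := h₀.metric.1 p
  have q1 := hm.1 p
  simp only [NNReal.smul_def, Real.coe_toNNReal _ (div_pos q1 q0).le, smul_eq_mul]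
  rw [← hμ, scalarCurvature_eq, hμ, laplacianLog_weylPath h₀.metric h₁.metric, ← hμ]
  field_simp

/-- Metrics of the same conformal class define states that differ by a factor only: along the
geometric interpolation the `N`-point function solves a linear differential equation whose
coefficient does not depend on the fields. -/
theorem corr_eq_weylFactor_mul (h₀ : IsMetricSurface S A μ₀) (h₁ : IsMetricSurface S A μ₁)
    {N : ℕ} {φ : Fin N → C.Field A} (hφ : Separated φ) :
    C.corr A μ₁ φ = weylFactor C.c μ₀ μ₁ * C.corr A μ₀ φ := by
  obtain ⟨k, hk, s₀, hs⟩ := exists_continuous_eq_integral_affine (riemannianVolume μ₀)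
    (fun p => C.c / (48 * Real.pi) * Real.log (μ₁ p / μ₀ p) * laplacianLog μ₀ p / μ₀ p)
    (fun p => C.c / (48 * Real.pi) * Real.log (μ₁ p / μ₀ p) *
      (laplacianLog μ₁ p - laplacianLog μ₀ p) / μ₀ p)
  have := eq_exp_mul_of_hasDerivAt (c := weylRate C.c μ₀ μ₁)
    ((C.contDiff_corr_weylPath h₀ h₁ hφ).of_le (by exact_mod_cast le_top))
    (C.hasDerivAt_corr_weylPath h₀ h₁ hφ) hk (s₀ := s₀) (fun s hs' => by
      rw [← hs s hs', weylRate]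
      congr 1
      funext p
      ring_nf)
  rwa [weylPath_zero, weylPath_one h₀.metric.1] at this

end ConformalFieldTheory

/-! ### Coordinates on the hyperelliptic curve -/

namespace Hyperelliptic

open RiemannSurface

variable {g : ℕ} {a : ℂ} (ha : a ≠ 0) (X : Config g)

/-- The coordinate `x`, with the value `0` at infinity. -/
def xCoord (q : hyperellipticCurve ha X) : ℂ := (curveCoord (X := X.1) (a := a) q).1

/-- The affine points of the curve that are not ramification points. -/
def unramified : Set (hyperellipticCurve ha X) :=
  {q | ∃ P : AffineCurve a X.1, P.1.2 ≠ 0 ∧ q = curvePoint ha X P}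

/-- The point at infinity. -/
def infinityPoint : hyperellipticCurve ha X := (OnePoint.infty : OnePoint (AffineCurve a X.1))

/-- The chart `x` around the affine point `P`. -/
def coordChart (P : AffineCurve a X.1) (h : P.1.2 ≠ 0) :
    OpenPartialHomeomorph (hyperellipticCurve ha X) ℂ := xChart P h

/-- The chart `w` around the ramification point over `X j`. -/
def ramificationChart (j : Fin (2 * g + 1)) :
    OpenPartialHomeomorph (hyperellipticCurve ha X) ℂ := wChart ha X.2 j

/-- The chart `u` around the point at infinity. -/
def infinityChart : OpenPartialHomeomorph (hyperellipticCurve ha X) ℂ := infChart (X := X.1) ha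

lemma isOpenEmbedding_curvePoint : Topology.IsOpenEmbedding (curvePoint ha X) :=
  OnePoint.isOpenEmbedding_coe

lemma curvePoint_injective : Function.Injective (curvePoint ha X) :=
  (isOpenEmbedding_curvePoint ha X).injective

instance : CompactSpace (hyperellipticCurve ha X) :=
  inferInstanceAs (CompactSpace (OnePoint (AffineCurve a X.1)))

lemma eq_infinityPoint_or (q : hyperellipticCurve ha X) :
    q = infinityPoint ha X ∨ ∃ P, q = curvePoint ha X P := by
  by_cases h : q = infinityPoint ha X
  · exact Or.inl h
  · obtain ⟨P, hP⟩ := OnePoint.ne_infty_iff_exists.1 h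
    exact Or.inr ⟨P, hP.symm⟩

lemma curvePoint_ne_infinityPoint (P : AffineCurve a X.1) :
    curvePoint ha X P ≠ infinityPoint ha X := OnePoint.coe_ne_infty P

@[simp] lemma xCoord_curvePoint (P : AffineCurve a X.1) :
    xCoord ha X (curvePoint ha X P) = P.1.1 := rfl

lemma coordChart_mem_atlas (P : AffineCurve a X.1) (h : P.1.2 ≠ 0) :
    coordChart ha X P h ∈ atlas ℂ (hyperellipticCurve ha X) := CurveChart.x P h

lemma ramificationChart_mem_atlas (j : Fin (2 * g + 1)) :
    ramificationChart ha X j ∈ atlas ℂ (hyperellipticCurve ha X) := CurveChart.w j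

lemma infinityChart_mem_atlas :
    infinityChart ha X ∈ atlas ℂ (hyperellipticCurve ha X) := CurveChart.inf

lemma atlas_cases {e : OpenPartialHomeomorph (hyperellipticCurve ha X) ℂ}
    (he : e ∈ atlas ℂ (hyperellipticCurve ha X)) :
    (∃ P h, e = coordChart ha X P h) ∨ (∃ j, e = ramificationChart ha X j) ∨
      e = infinityChart ha X := by
  cases (he : CurveChart ha X.2 e) with
  | x P h => exact Or.inl ⟨P, h, rfl⟩
  | w j => exact Or.inr (Or.inl ⟨j, rfl⟩)
  | inf => exact Or.inr (Or.inr rfl)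

lemma chartAt_curvePoint {P : AffineCurve a X.1} (h : P.1.2 ≠ 0) :
    chartAt ℂ (curvePoint ha X P) = coordChart ha X P h := by
  change curveChartAt ha X.2 (P : OnePoint (AffineCurve a X.1)) = _
  simp only [curveChartAt, OnePoint.elim_some, dif_neg h]
  rfl

lemma chartAt_infinityPoint : chartAt ℂ (infinityPoint ha X) = infinityChart ha X := rfl

lemma chartAt_ramification {P : AffineCurve a X.1} {j : Fin (2 * g + 1)} (h : P.1.2 = 0)
    (hj : P.1.1 = X.1 j) : chartAt ℂ (curvePoint ha X P) = ramificationChart ha X j := by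
  change curveChartAt ha X.2 (P : OnePoint (AffineCurve a X.1)) = _
  simp only [curveChartAt, OnePoint.elim_some, dif_pos h]
  have h1 := (exists_eq_of_snd_eq_zero ha P h).choose_spec
  have h2 : (exists_eq_of_snd_eq_zero ha P h).choose = j := X.2 (h1.symm.trans hj)
  rw [h2]; rfl

lemma mem_coordChart_source {P Q : AffineCurve a X.1} {h : P.1.2 ≠ 0} :
    curvePoint ha X Q ∈ (coordChart ha X P h).source ↔ 0 < (Q.1.2 / P.1.2).re := by
  change (Q : OnePoint (AffineCurve a X.1)) ∈ OnePoint.some '' _ ↔ _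
  rw [OnePoint.coe_injective.mem_set_image]
  rfl

lemma mem_coordChart_source_self {P : AffineCurve a X.1} (h : P.1.2 ≠ 0) :
    curvePoint ha X P ∈ (coordChart ha X P h).source := by
  rw [mem_coordChart_source, div_self h]; simp

lemma exists_of_mem_coordChart_source {P : AffineCurve a X.1} {h : P.1.2 ≠ 0}
    {q : hyperellipticCurve ha X} (hq : q ∈ (coordChart ha X P h).source) :
    ∃ Q : AffineCurve a X.1, Q.1.2 ≠ 0 ∧ q = curvePoint ha X Q := by
  obtain ⟨Q, hQ, rfl⟩ := hq
  refine ⟨Q, fun h0 => ?_, rfl⟩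
  have : 0 < (Q.1.2 / P.1.2).re := hQ
  simp [h0] at this

lemma coordChart_apply (P Q : AffineCurve a X.1) (h : P.1.2 ≠ 0) :
    coordChart ha X P h (curvePoint ha X Q) = Q.1.1 :=
  OpenPartialHomeomorph.lift_openEmbedding_apply (xChartAffine P h) OnePoint.isOpenEmbedding_coe

lemma coordChart_eq_xCoord {P : AffineCurve a X.1} {h : P.1.2 ≠ 0}
    {q : hyperellipticCurve ha X} (hq : q ∈ (coordChart ha X P h).source) :
    coordChart ha X P h q = xCoord ha X q := by
  obtain ⟨Q, _, rfl⟩ := exists_of_mem_coordChart_source ha X hq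
  exact coordChart_apply ha X P Q h

/-- The point over `x` on the sheet of `P`. -/
lemma coordChart_symm_apply (P : AffineCurve a X.1) (h : P.1.2 ≠ 0) (x : ℂ) :
    (coordChart ha X P h).symm x = curvePoint ha X ((xChartAffine P h).symm x) := rfl

lemma xCoord_coordChart_symm (P : AffineCurve a X.1) (h : P.1.2 ≠ 0) (x : ℂ) :
    xCoord ha X ((coordChart ha X P h).symm x) = x := rfl

lemma isOpen_unramified : IsOpen (unramified ha X) := by
  have : unramified ha X = curvePoint ha X '' {P | P.1.2 ≠ 0} := by
    ext q; constructor
    · rintro ⟨P, h, rfl⟩; exact ⟨P, h, rfl⟩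
    · rintro ⟨P, h, rfl⟩; exact ⟨P, h, rfl⟩
  rw [this]
  exact (isOpenEmbedding_curvePoint ha X).isOpenMap _
    (isOpen_ne_fun (by fun_prop) continuous_const)

lemma curvePoint_mem_unramified {P : AffineCurve a X.1} :
    curvePoint ha X P ∈ unramified ha X ↔ P.1.2 ≠ 0 := by
  constructor
  · rintro ⟨Q, hQ, h⟩; rwa [curvePoint_injective ha X h]
  · exact fun h => ⟨P, h, rfl⟩

lemma chartAt_apply_eq_xCoord {q q' : hyperellipticCurve ha X} (hq : q ∈ unramified ha X)
    (hq' : q' ∈ (chartAt ℂ q).source) : chartAt ℂ q q' = xCoord ha X q' := by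
  obtain ⟨P, h, rfl⟩ := hq
  rw [chartAt_curvePoint ha X h] at hq' ⊢
  exact coordChart_eq_xCoord ha X hq'

lemma chartAt_eventuallyEq_xCoord {q : hyperellipticCurve ha X} (hq : q ∈ unramified ha X) :
    chartAt ℂ q =ᶠ[𝓝 q] xCoord ha X := by
  filter_upwards [(chartAt ℂ q).open_source.mem_nhds (mem_chart_source ℂ q)] with q' hq'
  exact chartAt_apply_eq_xCoord ha X hq hq'

lemma continuousAt_xCoord {q : hyperellipticCurve ha X} (hq : q ∈ unramified ha X) :
    ContinuousAt (xCoord ha X) q :=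
  ((chartAt ℂ q).continuousAt (mem_chart_source ℂ q)).congr (chartAt_eventuallyEq_xCoord ha X hq)

lemma mdifferentiableAt_xCoord {q : hyperellipticCurve ha X} (hq : q ∈ unramified ha X) :
    MDifferentiableAt (M' := plane) 𝓘(ℂ) 𝓘(ℂ) (xCoord ha X) q :=
  (mdifferentiableAt_chart (chart_mem_atlas ℂ q) (mem_chart_source ℂ q)).congr_of_eventuallyEq
    (chartAt_eventuallyEq_xCoord ha X hq).symm

lemma realDifferential_xCoord {q : hyperellipticCurve ha X} (hq : q ∈ unramified ha X) :
    realDifferential (B := plane) (xCoord ha X) q = ContinuousLinearMap.id ℝ ℂ := by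
  rw [realDifferential_congr (B := plane) (chartAt_eventuallyEq_xCoord ha X hq).symm]
  exact realDifferential_chart_eq_id (mem_chart_source ℂ q) EventuallyEq.rfl

lemma inCharts_eventuallyEq {A : RiemannSurface} {f : A → hyperellipticCurve ha X} {p : A}
    (hf : ContinuousAt f p) (hp : f p ∈ unramified ha X) :
    inCharts f p =ᶠ[𝓝 (chartAt ℂ p p)] inCharts (B := plane) (fun q => xCoord ha X (f q)) p := by
  have hc : ContinuousAt (fun u => f ((chartAt ℂ p).symm u)) (chartAt ℂ p p) := by
    refine ContinuousAt.comp (g := f) ?_ ((chartAt ℂ p).continuousAt_symm (mem_chart_target ℂ p))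
    rwa [(chartAt ℂ p).left_inv (mem_chart_source ℂ p)]
  have h0 : f ((chartAt ℂ p).symm (chartAt ℂ p p)) = f p := by
    rw [(chartAt ℂ p).left_inv (mem_chart_source ℂ p)]
  rw [ContinuousAt, h0] at hc
  exact hc.eventually (chartAt_eventuallyEq_xCoord ha X hp)

/-- Differentials of maps into the curve can be computed with the coordinate `x`. -/
lemma realDifferential_eq_xCoord {A : RiemannSurface} {f : A → hyperellipticCurve ha X} {p : A}
    (hf : ContinuousAt f p) (hp : f p ∈ unramified ha X) :
    realDifferential f p = realDifferential (B := plane) (fun q => xCoord ha X (f q)) p := by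
  rw [realDifferential_eq_fderiv hf, (inCharts_eventuallyEq ha X hf hp).fderiv_eq]
  exact (realDifferential_eq_fderiv (B := plane) ((continuousAt_xCoord ha X hp).comp hf)).symm

lemma mdifferentiableAt_of_xCoord {A : RiemannSurface} {f : A → hyperellipticCurve ha X} {p : A}
    (hf : ContinuousAt f p) (hp : f p ∈ unramified ha X)
    (h : MDifferentiableAt (M' := plane) 𝓘(ℂ) 𝓘(ℂ) (fun q => xCoord ha X (f q)) p) :
    MDifferentiableAt 𝓘(ℂ) 𝓘(ℂ) f p := by
  refine mdifferentiableAt_complex_iff_inCharts.2 ⟨hf, ?_⟩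
  exact (mdifferentiableAt_complex_iff_inCharts.1 h).2.congr_of_eventuallyEq
    (inCharts_eventuallyEq ha X hf hp)

lemma contMDiffAt_of_xCoord {A : RiemannSurface} {f : A → hyperellipticCurve ha X} {p : A}
    (hf : ContinuousAt f p) (hp : f p ∈ unramified ha X)
    (h : ContMDiffAt (M' := plane) 𝓘(ℝ, ℂ) 𝓘(ℝ, ℂ) ∞ (fun q => xCoord ha X (f q)) p) :
    ContMDiffAt 𝓘(ℝ, ℂ) 𝓘(ℝ, ℂ) ∞ f p := by
  refine contMDiffAt_iff_inCharts.2 ⟨hf, ?_⟩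
  exact (contMDiffAt_iff_inCharts.1 h).2.congr_of_eventuallyEq
    (inCharts_eventuallyEq ha X hf hp)

/-- The coordinate `x` in a chart. -/
def xInChart (e : OpenPartialHomeomorph (hyperellipticCurve ha X) ℂ) (u : ℂ) : ℂ :=
  xCoord ha X (e.symm u)

lemma isOpen_unramified_preimage (e : OpenPartialHomeomorph (hyperellipticCurve ha X) ℂ) :
    IsOpen (e.target ∩ e.symm ⁻¹' unramified ha X) :=
  e.continuousOn_symm.isOpen_inter_preimage e.open_target (isOpen_unramified ha X)

lemma differentiableOn_xInChart {e : OpenPartialHomeomorph (hyperellipticCurve ha X) ℂ}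
    (he : e ∈ atlas ℂ (hyperellipticCurve ha X)) :
    DifferentiableOn ℂ (xInChart ha X e) (e.target ∩ e.symm ⁻¹' unramified ha X) := by
  intro u hu
  have h1 := MDifferentiableAt.comp (M := plane) (M'' := plane) u
    (mdifferentiableAt_xCoord ha X hu.2) (mdifferentiableAt_chart_symm he hu.1)
  exact (mdifferentiableAt_iff_differentiableAt.1 h1).differentiableWithinAt

lemma conformalFactor_eq_xInChart (μ : hyperellipticCurve ha X → ℝ)
    {e : OpenPartialHomeomorph (hyperellipticCurve ha X) ℂ}
    {u : ℂ} (hu : u ∈ e.target)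
    (hu' : e.symm u ∈ unramified ha X) :
    conformalFactor μ e u = μ (e.symm u) * ‖fderiv ℝ (xInChart ha X e) u 1‖ ^ 2 := by
  rw [conformalFactor_eq,
    realDifferential_eq_xCoord (A := plane) ha X (e.continuousAt_symm hu) hu']
  exact congrArg (fun L : ℂ →L[ℝ] ℂ => μ (e.symm u) * ‖L 1‖ ^ 2) (realDifferential_plane _ u)

lemma conformalFactor_eq_deriv (μ : hyperellipticCurve ha X → ℝ)
    {e : OpenPartialHomeomorph (hyperellipticCurve ha X) ℂ}
    (he : e ∈ atlas ℂ (hyperellipticCurve ha X)) {u : ℂ} (hu : u ∈ e.target)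
    (hu' : e.symm u ∈ unramified ha X) :
    conformalFactor μ e u = μ (e.symm u) * ‖deriv (xInChart ha X e) u‖ ^ 2 := by
  rw [conformalFactor_eq_xInChart ha X μ hu hu']
  have h := (differentiableOn_xInChart ha X he).differentiableAt
    ((isOpen_unramified_preimage ha X e).mem_nhds ⟨hu, hu'⟩)
  rw [(h.hasFDerivAt.restrictScalars ℝ).fderiv]
  simp

end Hyperelliptic

/-! ### The regularised metrics -/

namespace Hyperelliptic

open RiemannSurface

/-- The function `M` for which the regularised metric is `M |dx|²`. -/
def planeMetric {n : ℕ} (κ : Cutoff) (δ : ℝ) (X : Fin n → ℂ) (x : ℂ) : ℝ :=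
  (∏ j, κ.ρ (‖x - X j‖ / δ)) * κ.σ (δ * ‖x‖)

/-- The scale `δ` is so small that the discs of radius `δ` around the branch points and the
outside of the disc of radius `1 / δ` do not overlap. -/
structure IsSmallScale {n : ℕ} (δ : ℝ) (X : Fin n → ℂ) : Prop where
  pos : 0 < δ
  separated : ∀ j k, j ≠ k → 2 * δ ≤ ‖X j - X k‖
  bounded : ∀ j, ‖X j‖ + δ ≤ 1 / δ

section Plane

variable {n : ℕ} {κ : Cutoff} {δ : ℝ} {X : Fin n → ℂ}

lemma IsSmallScale.other (h : IsSmallScale δ X) {j k : Fin n} (hjk : k ≠ j) {x : ℂ}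
    (hx : ‖x - X j‖ ≤ δ) : δ ≤ ‖x - X k‖ := by
  have h1 := h.separated j k hjk.symm
  have h2 : ‖X j - X k‖ ≤ ‖x - X j‖ + ‖x - X k‖ := by
    have : X j - X k = -(x - X j) + (x - X k) := by ring
    rw [this]; exact (norm_add_le _ _).trans (by rw [norm_neg])
  linarith

lemma IsSmallScale.norm_le (h : IsSmallScale δ X) {j : Fin n} {x : ℂ}
    (hx : ‖x - X j‖ ≤ δ) : δ * ‖x‖ ≤ 1 := by
  have h1 : ‖x‖ ≤ ‖x - X j‖ + ‖X j‖ := by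
    simpa using norm_add_le (x - X j) (X j)
  have h2 := h.bounded j
  have : ‖x‖ ≤ 1 / δ := by linarith
  rw [le_div_iff₀ h.pos] at this
  linarith

lemma IsSmallScale.far (h : IsSmallScale δ X) {x : ℂ} (hx : 1 ≤ δ * ‖x‖) (j : Fin n) :
    δ ≤ ‖x - X j‖ := by
  have h1 : ‖x‖ ≤ ‖x - X j‖ + ‖X j‖ := by
    simpa using norm_add_le (x - X j) (X j)
  have h2 := h.bounded j
  have : 1 / δ ≤ ‖x‖ := by rw [div_le_iff₀ h.pos]; linarith
  linarith

lemma rho_eq_one (hδ : 0 < δ) {z : ℂ} (hz : δ ≤ ‖z‖) : κ.ρ (‖z‖ / δ) = 1 :=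
  κ.ρ_eq_one _ ((one_le_div hδ).2 hz)

lemma planeMetric_near (h : IsSmallScale δ X) {j : Fin n} {x : ℂ} (hx : ‖x - X j‖ ≤ δ) :
    planeMetric κ δ X x = κ.ρ (‖x - X j‖ / δ) := by
  rw [planeMetric, κ.σ_eq_one _ (h.norm_le hx), mul_one]
  exact Finset.prod_eq_single j (fun k _ hk => rho_eq_one h.pos (h.other hk hx)) (by simp)

lemma planeMetric_of_far (hδ : 0 < δ) {x : ℂ} (hx : ∀ j, δ ≤ ‖x - X j‖) :
    planeMetric κ δ X x = κ.σ (δ * ‖x‖) := by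
  rw [planeMetric, Finset.prod_eq_one fun k _ => rho_eq_one hδ (hx k), one_mul]

lemma planeMetric_flat (hδ : 0 < δ) {x : ℂ} (hx : ∀ j, δ ≤ ‖x - X j‖) (hx' : δ * ‖x‖ ≤ 1) :
    planeMetric κ δ X x = 1 := by
  rw [planeMetric_of_far hδ hx, κ.σ_eq_one _ hx']

lemma sigma_pos (r : ℝ) : 0 < κ.σ r := by
  by_cases h : r ≤ 1
  · rw [κ.σ_eq_one r h]; exact one_pos
  · exact κ.σ_pos r (by linarith)

lemma planeMetric_pos (hδ : 0 < δ) {x : ℂ} (hx : ∀ j, x ≠ X j) : 0 < planeMetric κ δ X x := by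
  refine mul_pos (Finset.prod_pos fun j _ => κ.ρ_pos _ ?_) (sigma_pos _)
  have := norm_pos_iff.2 (sub_ne_zero.2 (hx j))
  positivity

lemma contDiffAt_planeMetric (hδ : 0 < δ) {x : ℂ} (hx : ∀ j, x ≠ X j) :
    ContDiffAt ℝ ∞ (planeMetric κ δ X) x := by
  unfold planeMetric
  refine ContDiffAt.mul (contDiffAt_prod fun j _ => ?_) ?_
  · have hne : x - X j ≠ 0 := sub_ne_zero.2 (hx j)
    have hpos : 0 < ‖x - X j‖ / δ := div_pos (norm_pos_iff.2 hne) hδ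
    refine ContDiffAt.comp (g := κ.ρ) x
      (κ.ρ_smooth.contDiffAt (isOpen_Ioi.mem_nhds hpos)) (ContDiffAt.div_const ?_ _)
    exact (contDiffAt_id.sub contDiffAt_const).norm ℝ hne
  · by_cases h0 : x = 0
    · have : (fun x : ℂ => κ.σ (δ * ‖x‖)) =ᶠ[𝓝 x] fun _ => 1 := by
        have hc : ContinuousAt (fun x : ℂ => δ * ‖x‖) x := by fun_prop
        have : (fun x : ℂ => δ * ‖x‖) x < 1 := by simp [h0]
        filter_upwards [hc.eventually (gt_mem_nhds this)] with y hy
        exact κ.σ_eq_one _ hy.le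
      exact contDiffAt_const.congr_of_eventuallyEq this
    · have hpos : 0 < δ * ‖x‖ := mul_pos hδ (norm_pos_iff.2 h0)
      refine ContDiffAt.comp (g := κ.σ) x
        (κ.σ_smooth.contDiffAt (isOpen_Ioi.mem_nhds hpos)) (contDiffAt_const.mul ?_)
      exact contDiffAt_id.norm ℝ h0

lemma cutoff_a_pos (κ : Cutoff) : 0 < κ.a := by
  have h1 := κ.ρ_core (1 / 2) (by norm_num) le_rfl
  have h2 := κ.ρ_pos (1 / 2) (by norm_num)
  rw [h1] at h2
  have : κ.a / (1 / 2) = 2 * κ.a := by ring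
  linarith

lemma cutoff_b_pos (κ : Cutoff) : 0 < κ.b := by
  have h1 := κ.σ_core 2 le_rfl
  have h2 := κ.σ_pos 2 (by norm_num)
  rw [h1] at h2
  have : κ.b / 2 ^ 3 = κ.b / 8 := by norm_num
  linarith

end Plane

variable {g : ℕ} {a : ℂ} (ha : a ≠ 0) (X : Config g) {κ : Cutoff} {δ : ℝ}

lemma snd_eq_zero_iff {a : ℂ} (ha : a ≠ 0) {n : ℕ} {X : Fin n → ℂ} (P : AffineCurve a X) :
    P.1.2 = 0 ↔ ∃ j, P.1.1 = X j := by
  refine ⟨exists_eq_of_snd_eq_zero ha P, fun ⟨j, hj⟩ => ?_⟩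
  have h := P.2
  rw [hPoly_eq_mul a X j, hj, sub_self, zero_mul] at h
  exact pow_eq_zero_iff two_ne_zero |>.1 h

lemma regularizedMetric_curvePoint {P : AffineCurve a X.1} (h : P.1.2 ≠ 0) :
    regularizedMetric ha κ δ X (curvePoint ha X P) = planeMetric κ δ X.1 P.1.1 := by
  simp only [regularizedMetric, curvePoint, OnePoint.elim_some, if_neg h, planeMetric]

lemma regularizedMetric_unramified {q : hyperellipticCurve ha X} (h : q ∈ unramified ha X) :
    regularizedMetric ha κ δ X q = planeMetric κ δ X.1 (xCoord ha X q) := by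
  obtain ⟨P, hP, rfl⟩ := h
  exact regularizedMetric_curvePoint ha X hP

lemma xCoord_ne {q : hyperellipticCurve ha X} (h : q ∈ unramified ha X) (j : Fin (2 * g + 1)) :
    xCoord ha X q ≠ X.1 j := by
  obtain ⟨P, hP, rfl⟩ := h
  exact fun h => hP ((snd_eq_zero_iff ha P).2 ⟨j, h⟩)

/-! The chart `w` at a ramification point. -/

lemma ramificationChart_symm_mem_unramified {j : Fin (2 * g + 1)} {w : ℂ}
    (hw : w ∈ (ramificationChart ha X j).target) (h0 : w ≠ 0) :
    (ramificationChart ha X j).symm w ∈ unramified ha X := by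
  refine ⟨(wChartAffine j (hCofactor_ne_zero ha X.2 j)).symm w, ?_, rfl⟩
  change w * _ ≠ 0
  exact mul_ne_zero h0 (mul_ne_zero (csqrt_ne_zero (hCofactor_ne_zero ha X.2 j))
    (csqrt_ne_zero (Complex.slitPlane_ne_zero hw)))

lemma zero_mem_ramificationChart_target (j : Fin (2 * g + 1)) :
    0 ∈ (ramificationChart ha X j).target := by
  change hCofactor a X.1 j (X.1 j + 0 ^ 2) / hCofactor a X.1 j (X.1 j) ∈ Complex.slitPlane
  have := hCofactor_ne_zero ha X.2 j
  simp [this]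

/-- The ramification point over `X j`. -/
def ramificationPoint (j : Fin (2 * g + 1)) : AffineCurve a X.1 :=
  ⟨(X.1 j, 0), by rw [hPoly_eq_mul a X.1 j]; simp⟩

lemma ramificationChart_symm_zero (j : Fin (2 * g + 1)) :
    (ramificationChart ha X j).symm 0 = curvePoint ha X (ramificationPoint X j) := by
  refine congrArg (curvePoint ha X) (Subtype.ext (Prod.ext ?_ ?_))
  · exact (by simp : X.1 j + (0 : ℂ) ^ 2 = X.1 j)
  · exact zero_mul _

lemma chartAt_ramificationPoint (j : Fin (2 * g + 1)) :
    chartAt ℂ (curvePoint ha X (ramificationPoint X j)) = ramificationChart ha X j :=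
  chartAt_ramification ha X rfl rfl

/-! The chart `u` at infinity. -/

lemma infinityChart_symm_zero : (infinityChart ha X).symm 0 = infinityPoint ha X := infInv_zero

lemma infinityChart_symm_of_ne {u : ℂ} (hu : u ≠ 0) :
    (infinityChart ha X).symm u = curvePoint ha X (infParam a X.1 u hu) := infInv_ne hu

lemma zero_mem_infinityChart_target : 0 ∈ (infinityChart ha X).target := by
  change hReverse X.1 (0 ^ 2) ∈ Complex.slitPlane
  simp [hReverse]

lemma infinityChart_symm_mem_unramified {u : ℂ} (hu : u ∈ (infinityChart ha X).target)
    (h0 : u ≠ 0) : (infinityChart ha X).symm u ∈ unramified ha X := by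
  refine ⟨_, ?_, infinityChart_symm_of_ne ha X h0⟩
  exact mul_ne_zero (pow_ne_zero _ (inv_ne_zero h0)) (mul_ne_zero (csqrt_ne_zero ha)
    (csqrt_ne_zero (Complex.slitPlane_ne_zero hu)))

lemma xInChart_infinityChart {u : ℂ} (h0 : u ≠ 0) :
    xInChart ha X (infinityChart ha X) u = (u ^ 2)⁻¹ := by
  rw [xInChart, infinityChart_symm_of_ne ha X h0]; rfl

/-- A chart takes at most the value `0` outside the unramified part, and then it is the preferred
chart there. -/
lemma eq_zero_of_notMem_unramified {e : OpenPartialHomeomorph (hyperellipticCurve ha X) ℂ}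
    (he : e ∈ atlas ℂ (hyperellipticCurve ha X)) {u : ℂ} (hu : u ∈ e.target)
    (hu' : e.symm u ∉ unramified ha X) :
    u = 0 ∧ ((∃ j, e = ramificationChart ha X j) ∨ e = infinityChart ha X) := by
  obtain ⟨P, h, rfl⟩ | ⟨j, rfl⟩ | rfl := atlas_cases ha X he
  · exact absurd (exists_of_mem_coordChart_source ha X ((coordChart ha X P h).map_target hu)) hu'
  · refine ⟨?_, Or.inl ⟨j, rfl⟩⟩
    by_contra h
    exact hu' (ramificationChart_symm_mem_unramified ha X hu h)
  · refine ⟨?_, Or.inr rfl⟩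
    by_contra h
    exact hu' (infinityChart_symm_mem_unramified ha X hu h)

lemma notMem_unramified_cases {q : hyperellipticCurve ha X} (hq : q ∉ unramified ha X) :
    q = infinityPoint ha X ∨ ∃ j, q = curvePoint ha X (ramificationPoint X j) := by
  obtain h | ⟨P, rfl⟩ := eq_infinityPoint_or ha X q
  · exact Or.inl h
  · rw [curvePoint_mem_unramified, not_not] at hq
    obtain ⟨j, hj⟩ := (snd_eq_zero_iff ha P).1 hq
    exact Or.inr ⟨j, congrArg _ (Subtype.ext (Prod.ext hj hq))⟩

lemma isOpen_target_mem_nhds {e : OpenPartialHomeomorph (hyperellipticCurve ha X) ℂ} {u : ℂ}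
    (hu : u ∈ e.target) : e.target ∈ 𝓝 u := e.open_target.mem_nhds hu

lemma conformalFactor_ramificationChart (hδ : IsSmallScale δ X.1) (j : Fin (2 * g + 1)) :
    ∀ᶠ w in 𝓝 (0 : ℂ), conformalFactor (regularizedMetric ha κ δ X) (ramificationChart ha X j) w =
      4 * κ.a * δ := by
  have h1 : ∀ᶠ w : ℂ in 𝓝 0, ‖w ^ 2‖ < δ / 2 := by
    have : ContinuousAt (fun w : ℂ => ‖w ^ 2‖) 0 := by fun_prop
    exact this.eventually (gt_mem_nhds (by simpa using half_pos hδ.pos))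
  filter_upwards [h1,
    isOpen_target_mem_nhds ha X (zero_mem_ramificationChart_target ha X j)] with w hw hwt
  by_cases h0 : w = 0
  · subst h0
    have h2 := conformalFactor_chartAt_self (regularizedMetric ha κ δ X)
      (curvePoint ha X (ramificationPoint X j))
    rw [chartAt_ramificationPoint, ← ramificationChart_symm_zero,
      (ramificationChart ha X j).right_inv hwt] at h2
    rw [h2, ramificationChart_symm_zero]
    simp [regularizedMetric, curvePoint, ramificationPoint]
  · have hu := ramificationChart_symm_mem_unramified ha X hwt h0
    have hx : xCoord ha X ((ramificationChart ha X j).symm w) = X.1 j + w ^ 2 := rfl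
    have hd : deriv (xInChart ha X (ramificationChart ha X j)) w = 2 * w := by
      have : xInChart ha X (ramificationChart ha X j) = fun w => X.1 j + w ^ 2 := rfl
      rw [this]; simp
    have hδ' := hδ.pos
    have hw0 : 0 < ‖w‖ := norm_pos_iff.2 h0
    have hw2 : 0 < ‖w ^ 2‖ / δ := by rw [norm_pow]; positivity
    rw [conformalFactor_eq_deriv ha X _ (ramificationChart_mem_atlas ha X j) hwt hu,
      regularizedMetric_unramified ha X hu, hx, planeMetric_near hδ (j := j)
      (by rw [add_sub_cancel_left]; linarith), add_sub_cancel_left, κ.ρ_core _ hw2 (by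
        rw [div_le_iff₀ hδ']; linarith), hd, norm_mul, norm_pow]
    simp only [Complex.norm_ofNat]
    field_simp
    ring

lemma conformalFactor_infinityChart (hδ : IsSmallScale δ X.1) :
    ∀ᶠ u in 𝓝 (0 : ℂ), conformalFactor (regularizedMetric ha κ δ X) (infinityChart ha X) u =
      4 * κ.b / δ ^ 3 := by
  have hδ' := hδ.pos
  have h1 : ∀ᶠ u : ℂ in 𝓝 0, ‖u‖ ^ 2 < δ / 2 := by
    have : ContinuousAt (fun w : ℂ => ‖w‖ ^ 2) 0 := by fun_prop
    exact this.eventually (gt_mem_nhds (by simpa using half_pos hδ.pos))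
  filter_upwards [h1,
    isOpen_target_mem_nhds ha X (zero_mem_infinityChart_target ha X)] with u hu hut
  by_cases h0 : u = 0
  · subst h0
    have h2 := conformalFactor_chartAt_self (regularizedMetric ha κ δ X) (infinityPoint ha X)
    rw [chartAt_infinityPoint, ← infinityChart_symm_zero,
      (infinityChart ha X).right_inv hut] at h2
    rw [h2, infinityChart_symm_zero]
    simp [regularizedMetric, infinityPoint]
  · have hm := infinityChart_symm_mem_unramified ha X hut h0
    have hx : xCoord ha X ((infinityChart ha X).symm u) = (u ^ 2)⁻¹ :=
      xInChart_infinityChart ha X h0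
    have hd : deriv (xInChart ha X (infinityChart ha X)) u = -(2 * u) / (u ^ 2) ^ 2 := by
      have : xInChart ha X (infinityChart ha X) =ᶠ[𝓝 u] fun u => (u ^ 2)⁻¹ := by
        filter_upwards [isOpen_ne.mem_nhds h0] with v hv using xInChart_infinityChart ha X hv
      rw [this.deriv_eq]
      have h3 : HasDerivAt (fun u : ℂ => u ^ 2) (2 * u) u := by simpa using hasDerivAt_pow 2 u
      exact (h3.inv (pow_ne_zero 2 h0)).deriv
    have hu0 : 0 < ‖u‖ := norm_pos_iff.2 h0
    have h2 : 2 ≤ δ * ‖(u ^ 2)⁻¹‖ := by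
      rw [norm_inv, norm_pow, ← div_eq_mul_inv, le_div_iff₀ (by positivity)]; linarith
    rw [conformalFactor_eq_deriv ha X _ (infinityChart_mem_atlas ha X) hut hm,
      regularizedMetric_unramified ha X hm, hx, planeMetric_of_far hδ'
      (hδ.far (by linarith)), κ.σ_core _ h2, hd, norm_div, norm_neg, norm_mul, norm_inv,
      norm_pow, norm_pow]
    simp only [Complex.norm_ofNat, norm_pow]
    field_simp
    ring

theorem isConformalMetric_regularizedMetric (hδ : IsSmallScale δ X.1) :
    IsConformalMetric (regularizedMetric ha κ δ X) := by
  have hδ' := hδ.pos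
  have hpa := cutoff_a_pos κ
  have hpb := cutoff_b_pos κ
  refine ⟨fun q => ?_, fun e he => (contDiffOn_metricInChart_iff he).2 fun u hu => ?_⟩
  · by_cases hq : q ∈ unramified ha X
    · rw [regularizedMetric_unramified ha X hq]
      exact planeMetric_pos hδ' (xCoord_ne ha X hq)
    · obtain rfl | ⟨j, rfl⟩ := notMem_unramified_cases ha X hq
      · simp only [regularizedMetric, infinityPoint, OnePoint.elim_infty]; positivity
      · simp only [regularizedMetric, curvePoint, ramificationPoint, OnePoint.elim_some, if_true]
        positivity
  · refine ContDiffAt.contDiffWithinAt ?_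
    by_cases hq : e.symm u ∈ unramified ha X
    · have ho := isOpen_unramified_preimage ha X e
      have hd := differentiableOn_xInChart ha X he
      have hmem := ho.mem_nhds ⟨hu, hq⟩
      have h1 : ContDiffAt ℝ ∞ (xInChart ha X e) u :=
        ((hd.contDiffOn ho (n := ∞)).contDiffAt hmem).restrict_scalars ℝ
      have h2 : ContDiffAt ℝ ∞ (deriv (xInChart ha X e)) u :=
        (((hd.deriv ho).contDiffOn ho (n := ∞)).contDiffAt hmem).restrict_scalars ℝ
      have h3 : ContDiffAt ℝ ∞ (fun v => planeMetric κ δ X.1 (xInChart ha X e v)) u :=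
        ContDiffAt.comp (g := planeMetric κ δ X.1) u
          (contDiffAt_planeMetric hδ' (xCoord_ne ha X hq)) h1
      refine (h3.mul (h2.norm_sq ℝ)).congr_of_eventuallyEq ?_
      filter_upwards [hmem] with v hv
      rw [conformalFactor_eq_deriv ha X _ he hv.1 hv.2, regularizedMetric_unramified ha X hv.2]
      rfl
    · obtain ⟨rfl, ⟨j, rfl⟩ | rfl⟩ := eq_zero_of_notMem_unramified ha X he hu hq
      · exact contDiffAt_const.congr_of_eventuallyEq (conformalFactor_ramificationChart ha X hδ j)
      · exact contDiffAt_const.congr_of_eventuallyEq (conformalFactor_infinityChart ha X hδ)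

end Hyperelliptic

/-! ### Diffeomorphisms and removable singularities -/

namespace RiemannSurface

variable {A B : RiemannSurface}

lemma contMDiff_symm_of_det {f : A ≃ₜ B} (hf : ContMDiff 𝓘(ℝ, ℂ) 𝓘(ℝ, ℂ) ∞ f)
    (hd : ∀ p, (realDifferential f p).det ≠ 0) : ContMDiff 𝓘(ℝ, ℂ) 𝓘(ℝ, ℂ) ∞ f.symm := by
  intro q
  obtain ⟨p, rfl⟩ := f.surjective q
  refine contMDiffAt_iff_inCharts.2 ⟨f.symm.continuous.continuousAt, ?_⟩
  have hc := f.continuous.continuousAt (x := p)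
  have h1 := (contMDiffAt_iff_inCharts.1 (hf p)).2
  let φ : OpenPartialHomeomorph ℂ ℂ :=
    (chartAt ℂ p).symm ≫ₕ f.toOpenPartialHomeomorph ≫ₕ chartAt ℂ (f p)
  have hs : φ.symm (chartAt ℂ (f p) (f p)) = chartAt ℂ p p := by
    change chartAt ℂ p (f.symm ((chartAt ℂ (f p)).symm (chartAt ℂ (f p) (f p)))) = _
    rw [(chartAt ℂ (f p)).left_inv (mem_chart_source ℂ _), f.symm_apply_apply]
  have ht : chartAt ℂ (f p) (f p) ∈ φ.target := by
    simp [φ]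
  have h2 : HasFDerivAt φ (realDifferential f p) (φ.symm (chartAt ℂ (f p) (f p))) := by
    rw [hs, realDifferential_eq_fderiv hc]
    exact (h1.differentiableAt (by simp)).hasFDerivAt
  have h3 := φ.contDiffAt_symm (n := ∞) (𝕜 := ℝ)
    (f₀' := (realDifferential f p).toContinuousLinearEquivOfDetNeZero (hd p)) ht
    (by simpa using h2) (by rw [hs]; exact h1)
  have h4 : inCharts f.symm (f p) = φ.symm := by
    funext u
    change chartAt ℂ (f.symm (f p)) _ = chartAt ℂ p _
    rw [f.symm_apply_apply]
    rfl
  rw [h4]; exact h3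

lemma differentiableAt_inCharts {f : A → B} {p : A} {u : ℂ} (hu : u ∈ (chartAt ℂ p).target)
    (hf : MDifferentiableAt 𝓘(ℂ) 𝓘(ℂ) f ((chartAt ℂ p).symm u))
    (hu' : f ((chartAt ℂ p).symm u) ∈ (chartAt ℂ (f p)).source) :
    DifferentiableAt ℂ (inCharts f p) u := by
  have h1 := mdifferentiableAt_chart_symm (chart_mem_atlas ℂ p) hu
  have h2 := mdifferentiableAt_chart (chart_mem_atlas ℂ (f p)) hu'
  have h3 := (h2.comp (M'' := plane) _ hf).comp (M := plane) (M'' := plane) u h1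
  exact mdifferentiableAt_iff_differentiableAt.1 h3

lemma tendsto_chart_symm (p : A) :
    Tendsto (chartAt ℂ p).symm (𝓝 (chartAt ℂ p p)) (𝓝 p) := by
  have := (chartAt ℂ p).continuousAt_symm (mem_chart_target ℂ p)
  rwa [ContinuousAt, (chartAt ℂ p).left_inv (mem_chart_source ℂ p)] at this

lemma eventually_chart_symm_mem (f : A → B) {p : A} (hf : ContinuousAt f p) :
    ∀ᶠ u in 𝓝 (chartAt ℂ p p), u ∈ (chartAt ℂ p).target ∧
      f ((chartAt ℂ p).symm u) ∈ (chartAt ℂ (f p)).source :=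
  (show ∀ᶠ u in 𝓝 (chartAt ℂ p p), u ∈ (chartAt ℂ p).target from
    (chartAt ℂ p).open_target.mem_nhds (mem_chart_target ℂ p)).and ((hf.tendsto.comp (tendsto_chart_symm p)).eventually
      ((chartAt ℂ (f p)).open_source.mem_nhds (mem_chart_source ℂ _)))

/-- A function on punctured neighbourhoods transported to a chart. -/
lemma eventually_chart_symm_punctured {p : A} {Q : A → Prop} (h : ∀ᶠ q in 𝓝[≠] p, Q q) :
    ∀ᶠ u in 𝓝 (chartAt ℂ p p), u ≠ chartAt ℂ p p → Q ((chartAt ℂ p).symm u) := by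
  rw [eventually_nhdsWithin_iff] at h
  filter_upwards [(tendsto_chart_symm p).eventually h,
    (chartAt ℂ p).open_target.mem_nhds (mem_chart_target ℂ p)] with u hu hut hne
  refine hu fun h0 => hne ?_
  rw [← (chartAt ℂ p).right_inv hut, h0]

/-- Removable singularities for continuous maps between Riemann surfaces. -/
lemma mdifferentiableAt_of_punctured {f : A → B} {p : A} (hc : ContinuousAt f p)
    (h : ∀ᶠ q in 𝓝[≠] p, MDifferentiableAt 𝓘(ℂ) 𝓘(ℂ) f q) :
    MDifferentiableAt 𝓘(ℂ) 𝓘(ℂ) f p := by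
  refine mdifferentiableAt_complex_iff_inCharts.2 ⟨hc, ?_⟩
  obtain ⟨s, hs, hs'⟩ := ((eventually_chart_symm_punctured h).and
    (eventually_chart_symm_mem f hc)).exists_mem
  refine ((Complex.differentiableOn_compl_singleton_and_continuousAt_iff hs).1
    ⟨fun u hu => ?_, ?_⟩).differentiableAt hs
  · obtain ⟨h1, h2, h3⟩ := hs' u hu.1
    exact (differentiableAt_inCharts h2 (h1 hu.2) h3).differentiableWithinAt
  · have h1 := (chartAt ℂ (f p)).continuousAt (mem_chart_source ℂ (f p))
    have h2 := hc.tendsto.comp (tendsto_chart_symm p)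
    rw [ContinuousAt, inCharts, (chartAt ℂ p).left_inv (mem_chart_source ℂ p)]
    exact h1.tendsto.comp h2

lemma contMDiffAt_of_eventually_mdifferentiableAt {f : A → B} {p : A}
    (h : ∀ᶠ q in 𝓝 p, MDifferentiableAt 𝓘(ℂ) 𝓘(ℂ) f q) :
    ContMDiffAt 𝓘(ℝ, ℂ) 𝓘(ℝ, ℂ) ∞ f p := by
  have hc := h.self_of_nhds.continuousAt
  refine contMDiffAt_iff_inCharts.2 ⟨hc, ?_⟩
  obtain ⟨s, hs, ho, hp⟩ := eventually_nhds_iff.1 (((tendsto_chart_symm p).eventually h).and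
    (eventually_chart_symm_mem f hc))
  have hd : DifferentiableOn ℂ (inCharts f p) s := fun u hu =>
    (differentiableAt_inCharts (hs u hu).2.1 (hs u hu).1 (hs u hu).2.2).differentiableWithinAt
  exact ((hd.contDiffOn ho (n := ∞)).contDiffAt (ho.mem_nhds hp)).restrict_scalars ℝ

lemma det_realDifferential_complex {f : A → B} {p : A} (hf : MDifferentiableAt 𝓘(ℂ) 𝓘(ℂ) f p) :
    (realDifferential f p).det = ‖realDifferential f p 1‖ ^ 2 := by
  rw [det_real_complex, realDifferential_apply hf, realDifferential_apply hf, mul_one,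
    ← Complex.normSq_eq_norm_sq, Complex.normSq_apply]
  simp

/-- The pullback of a metric along a holomorphic map, in charts. -/
lemma metricPullback_inCharts (ν : B → ℝ) {f : A → B} {p : A} {u : ℂ}
    (hu : u ∈ (chartAt ℂ p).target)
    (hf : MDifferentiableAt 𝓘(ℂ) 𝓘(ℂ) f ((chartAt ℂ p).symm u))
    (hu' : f ((chartAt ℂ p).symm u) ∈ (chartAt ℂ (f p)).source) :
    metricPullback (A := plane) ν (fun v => f ((chartAt ℂ p).symm v)) u =
      (conformalFactor ν (chartAt ℂ (f p)) (inCharts f p u) * ‖deriv (inCharts f p) u‖ ^ 2) •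
        (innerSL ℝ : Form) := by
  have h1 := mdifferentiableAt_chart_symm (chart_mem_atlas ℂ p) hu
  have h2 := differentiableAt_inCharts hu hf hu'
  have h3 : MDifferentiableAt (M := plane) 𝓘(ℂ) 𝓘(ℂ) (fun v => f ((chartAt ℂ p).symm v)) u :=
    hf.comp (M := plane) u h1
  have h4 : (fun v => f ((chartAt ℂ p).symm v)) =ᶠ[𝓝 u]
      fun v => (chartAt ℂ (f p)).symm (inCharts f p v) := by
    filter_upwards [(h3.continuousAt (M := plane)).eventually
      ((chartAt ℂ (f p)).open_source.mem_nhds hu')] with v hv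
    exact ((chartAt ℂ (f p)).left_inv hv).symm
  have h5 : MDifferentiableAt (M := plane) (M' := plane) 𝓘(ℂ) 𝓘(ℂ) (inCharts f p) u :=
    mdifferentiableAt_iff_differentiableAt.2 h2
  have h6 := mdifferentiableAt_chart_symm (chart_mem_atlas ℂ (f p))
    ((chartAt ℂ (f p)).map_source hu')
  rw [metricPullback_congr (A := plane) ν h4, metricPullback_comp (A := plane) (B := plane) ν
    (mdifferentiableAt_real (A := plane) h6) (mdifferentiableAt_real (A := plane) (B := plane) h5)]
  have h7 := metricInChart_eq ν (chart_mem_atlas ℂ (f p)) ((chartAt ℂ (f p)).map_source hu')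
  unfold metricInChart at h7
  have h8 : ∀ z, realDifferential (A := plane) (B := plane) (inCharts f p) u z =
    deriv (inCharts f p) u * z := realDifferential_apply (A := plane) (B := plane) h5
  refine (congrArg (fun b : Form => b.bilinearComp _ _) h7).trans ?_
  have h9 := bilinearComp_of_complex h8
  refine ContinuousLinearMap.ext fun z => ContinuousLinearMap.ext fun w => ?_
  have h10 := congrArg (fun b : Form => b z w) h9
  change conformalFactor ν (chartAt ℂ (f p)) (inCharts f p u) * _ =
    conformalFactor ν (chartAt ℂ (f p)) (inCharts f p u) * ‖deriv (inCharts f p) u‖ ^ 2 * _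
  rw [mul_assoc]
  exact congrArg _ h10

/-- A holomorphic map that is isometric on a punctured neighbourhood is isometric at the
puncture. -/
lemma metricPullback_of_punctured {μ : A → ℝ} {ν : B → ℝ} (hμ : IsConformalMetric μ)
    (hν : IsConformalMetric ν) {f : A → B} {p : A}
    (hf : ∀ᶠ q in 𝓝 p, MDifferentiableAt 𝓘(ℂ) 𝓘(ℂ) f q)
    (h : ∀ᶠ q in 𝓝[≠] p, metricPullback ν f q = μ q • (innerSL ℝ : Form)) :
    metricPullback ν f p = μ p • (innerSL ℝ : Form) := by
  have hp := hf.self_of_nhds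
  have hc := hp.continuousAt
  have hsm := contMDiffAt_of_eventually_mdifferentiableAt hf
  set e := chartAt ℂ p with he
  set F := inCharts f p with hF
  have hev := (tendsto_chart_symm p).eventually hf
  have hmem := eventually_chart_symm_mem f hc
  have hl : ContinuousAt (fun u => conformalFactor ν (chartAt ℂ (f p)) (F u) * ‖deriv F u‖ ^ 2)
      (e p) := by
    obtain ⟨s, hs, ho, hps⟩ := eventually_nhds_iff.1 (hev.and hmem)
    have hd : DifferentiableOn ℂ F s := fun u hu =>
      (differentiableAt_inCharts (hs u hu).2.1 (hs u hu).1 (hs u hu).2.2).differentiableWithinAt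
    have h1 : ContinuousAt F (e p) := (hd.differentiableAt (ho.mem_nhds hps)).continuousAt
    have h2 : ContinuousAt (deriv F) (e p) :=
      ((hd.deriv ho).differentiableAt (ho.mem_nhds hps)).continuousAt
    have h3 : F (e p) = chartAt ℂ (f p) (f p) := by
      rw [hF, inCharts, he, (chartAt ℂ p).left_inv (mem_chart_source ℂ p)]
    have h4 : ContinuousAt (conformalFactor ν (chartAt ℂ (f p))) (F (e p)) := by
      rw [h3]
      exact (contDiffOn_conformalFactor hν (chart_mem_atlas ℂ (f p))).continuousOn.continuousAt
        ((chartAt ℂ (f p)).open_target.mem_nhds (mem_chart_target ℂ _))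
    exact (ContinuousAt.comp (g := conformalFactor ν (chartAt ℂ (f p))) h4 h1).mul (h2.norm.pow 2)
  have hr : ContinuousAt (conformalFactor μ e) (e p) :=
    (contDiffOn_conformalFactor hμ (chart_mem_atlas ℂ p)).continuousOn.continuousAt
      (e.open_target.mem_nhds (mem_chart_target ℂ _))
  have hkey : ∀ᶠ u in 𝓝[≠] (e p), conformalFactor ν (chartAt ℂ (f p)) (F u) * ‖deriv F u‖ ^ 2 =
      conformalFactor μ e u := by
    rw [eventually_nhdsWithin_iff]
    filter_upwards [hev, hmem, eventually_chart_symm_punctured h] with u h1 h2 h3 h4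
    have h5 := metricPullback_inCharts ν h2.1 h1 h2.2
    have h6 := mdifferentiableAt_chart_symm (chart_mem_atlas ℂ p) h2.1
    rw [metricPullback_comp (A := plane) ν (mdifferentiableAt_real h1)
      (mdifferentiableAt_real (A := plane) h6), h3 h4] at h5
    have h7 := congrArg (fun b : Form => b 1 1) h5
    change μ (e.symm u) * (innerSL ℝ : Form) _ _ = _ * (innerSL ℝ : Form) 1 1 at h7
    rw [conformalFactor_eq μ]
    simpa using h7.symm
  -- both sides of `hkey` are continuous at the puncture
  have heq := tendsto_nhds_unique_of_eventuallyEq (hl.tendsto.mono_left nhdsWithin_le_nhds)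
    (hr.tendsto.mono_left nhdsWithin_le_nhds) hkey
  rw [metricPullback_complex ν hp, realDifferential_apply hp, mul_one]
  have h3 : F (e p) = chartAt ℂ (f p) (f p) := by
    rw [hF, inCharts, he, (chartAt ℂ p).left_inv (mem_chart_source ℂ p)]
  rw [h3, conformalFactor_chartAt_self, conformalFactor_chartAt_self] at heq
  rw [heq]

end RiemannSurface

/-! ### Deformations of the curve in the coordinate `x` -/

namespace Hyperelliptic

open RiemannSurface

variable {g : ℕ} {a : ℂ} (ha : a ≠ 0)

lemma finite_compl_unramified (X : Config g) : (unramified ha X)ᶜ.Finite := by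
  refine ((Set.finite_singleton (infinityPoint ha X)).union (Set.finite_range
    fun j => curvePoint ha X (ramificationPoint X j))).subset fun q hq => ?_
  obtain h | ⟨j, h⟩ := notMem_unramified_cases ha X hq
  · exact Or.inl h
  · exact Or.inr ⟨j, h.symm⟩

lemma eventually_mem_unramified (X : Config g) (p : hyperellipticCurve ha X) :
    ∀ᶠ q in 𝓝[≠] p, q ∈ unramified ha X := by
  rw [eventually_nhdsWithin_iff]
  have h : ((unramified ha X)ᶜ \ {p})ᶜ ∈ 𝓝 p :=
    ((finite_compl_unramified ha X).sdiff).isClosed.isOpen_compl.mem_nhds (by simp)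
  filter_upwards [h] with q hq hqp
  by_contra h0
  exact hq ⟨h0, hqp⟩

variable {X Y : Config g} {f : hyperellipticCurve ha X → hyperellipticCurve ha Y}

/-- The map `f` between curves is a translation in the coordinate `x` on the open set `V`. -/
structure IsTranslationOn (f : hyperellipticCurve ha X → hyperellipticCurve ha Y)
    (V : Set (hyperellipticCurve ha X)) : Prop where
  isOpen : IsOpen V
  exists_const : ∃ c, ∀ q ∈ V, q ∈ unramified ha X → xCoord ha Y (f q) = xCoord ha X q + c

variable {ha}

lemma mdifferentiableAt_of_translation (hf : Continuous f)
    (hun : ∀ p ∈ unramified ha X, f p ∈ unramified ha Y) {V : Set (hyperellipticCurve ha X)}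
    (hV : IsTranslationOn ha f V) {p : hyperellipticCurve ha X} (hp : p ∈ V) :
    MDifferentiableAt 𝓘(ℂ) 𝓘(ℂ) f p := by
  have key : ∀ q ∈ V, q ∈ unramified ha X → MDifferentiableAt 𝓘(ℂ) 𝓘(ℂ) f q := by
    intro q hq hqu
    obtain ⟨c, hc⟩ := hV.exists_const
    refine mdifferentiableAt_of_xCoord ha Y hf.continuousAt (hun q hqu) ?_
    have h1 : MDifferentiableAt (M := plane) (M' := plane) 𝓘(ℂ) 𝓘(ℂ) (fun z : ℂ => z + c)
        (xCoord ha X q) := mdifferentiableAt_iff_differentiableAt.2 (by fun_prop)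
    refine (h1.comp (M' := plane) (M'' := plane) q
      (mdifferentiableAt_xCoord ha X hqu)).congr_of_eventuallyEq ?_
    filter_upwards [hV.isOpen.mem_nhds hq, (isOpen_unramified ha X).mem_nhds hqu] with q' h1 h2
    exact hc q' h1 h2
  refine mdifferentiableAt_of_punctured hf.continuousAt ?_
  filter_upwards [eventually_mem_unramified ha X p,
    mem_nhdsWithin_of_mem_nhds (hV.isOpen.mem_nhds hp)] with q h1 h2 using key q h2 h1

lemma realDifferential_of_xCoord {p : hyperellipticCurve ha X}
    (hc : ContinuousAt f p) (hp : p ∈ unramified ha X) (hfp : f p ∈ unramified ha Y) {ψ : ℂ → ℂ}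
    (hψ : DifferentiableAt ℝ ψ (xCoord ha X p))
    (h : (fun q => xCoord ha Y (f q)) =ᶠ[𝓝 p] fun q => ψ (xCoord ha X q)) :
    realDifferential f p = fderiv ℝ ψ (xCoord ha X p) := by
  have h1 : MDifferentiableAt (M := plane) (M' := plane) 𝓘(ℝ, ℂ) 𝓘(ℝ, ℂ) ψ (xCoord ha X p) :=
    mdifferentiableAt_iff_differentiableAt.2 hψ
  rw [realDifferential_eq_xCoord ha Y hc hfp, realDifferential_congr (B := plane) h]
  have h2 := realDifferential_comp (B := plane) (D := plane) h1
    (mdifferentiableAt_real (B := plane) (mdifferentiableAt_xCoord ha X hp))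
  refine h2.trans ?_
  rw [realDifferential_xCoord ha X hp, realDifferential_plane]
  rfl

/-- A family of homeomorphisms of a fixed curve with curves with varying branch points that is
smooth in the coordinate `x`, preserves the density of the regularised metric with respect to
`|dx|²`, and is a translation in the coordinate `x` near the ramification points and infinity. -/
structure IsDeformation {E : Type} [NormedAddCommGroup E] [NormedSpace ℝ E] (κ : Cutoff) (δ : ℝ)
    (U : Set E) (X : Config g) (Y : E → Config g)
    (f : ∀ t, hyperellipticCurve ha X ≃ₜ hyperellipticCurve ha (Y t)) : Prop where
  isOpen : IsOpen U
  scale_base : IsSmallScale δ X.1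
  scale : ∀ t ∈ U, IsSmallScale δ (Y t).1
  unramified : ∀ t ∈ U, ∀ p ∈ unramified ha X, f t p ∈ unramified ha (Y t)
  metric : ∀ t ∈ U, ∀ p ∈ Hyperelliptic.unramified ha X,
    regularizedMetric ha κ δ (Y t) (f t p) = regularizedMetric ha κ δ X p
  smooth : ∀ t₀ ∈ U, ∀ p₀ ∈ Hyperelliptic.unramified ha X, ∃ Ψ : E × ℂ → ℂ,
    ContDiffAt ℝ ∞ Ψ (t₀, xCoord ha X p₀) ∧
    0 < (fderiv ℝ (fun x => Ψ (t₀, x)) (xCoord ha X p₀)).det ∧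
    ∀ᶠ q : E × hyperellipticCurve ha X in 𝓝 (t₀, p₀),
      xCoord ha (Y q.1) (f q.1 q.2) = Ψ (q.1, xCoord ha X q.2)
  ramified : ∀ p ∉ Hyperelliptic.unramified ha X, ∃ V, p ∈ V ∧
    ∀ t ∈ U, IsTranslationOn ha (f t) V

namespace IsDeformation

variable {E : Type} [NormedAddCommGroup E] [NormedSpace ℝ E] {κ : Cutoff} {δ : ℝ}
    {U : Set E} {X : Config g} {Y : E → Config g}
    {f : ∀ t, hyperellipticCurve ha X ≃ₜ hyperellipticCurve ha (Y t)}

variable (h : IsDeformation κ δ U X Y f)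

include h

lemma metricPullback_eq {t : E} (ht : t ∈ U) {p : hyperellipticCurve ha X}
    (hp : p ∈ Hyperelliptic.unramified ha X) {ψ : ℂ → ℂ}
    (hψ : DifferentiableAt ℝ ψ (xCoord ha X p))
    (hf : (fun q => xCoord ha (Y t) (f t q)) =ᶠ[𝓝 p] fun q => ψ (xCoord ha X q)) :
    metricPullback (regularizedMetric ha κ δ (Y t)) (f t) p = regularizedMetric ha κ δ X p •
      (innerSL ℝ : Form).bilinearComp (fderiv ℝ ψ (xCoord ha X p))
        (fderiv ℝ ψ (xCoord ha X p)) := by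
  unfold metricPullback
  rw [realDifferential_of_xCoord (f t).continuous.continuousAt hp (h.unramified t ht p hp) hψ hf,
    h.metric t ht p hp]

lemma metricPullback_of_translation {t : E} (ht : t ∈ U) {V : Set (hyperellipticCurve ha X)}
    (hV : IsTranslationOn ha (f t) V) {p : hyperellipticCurve ha X} (hp : p ∈ V) :
    metricPullback (regularizedMetric ha κ δ (Y t)) (f t) p =
      regularizedMetric ha κ δ X p • (innerSL ℝ : Form) := by
  have key : ∀ q ∈ V, q ∈ Hyperelliptic.unramified ha X →
      metricPullback (regularizedMetric ha κ δ (Y t)) (f t) q =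
        regularizedMetric ha κ δ X q • (innerSL ℝ : Form) := by
    intro q hq hqu
    obtain ⟨c, hc⟩ := hV.exists_const
    rw [h.metricPullback_eq ht hqu (ψ := fun x => x + c) (by fun_prop)]
    · rw [fderiv_add_const, fderiv_fun_id]; rfl
    · filter_upwards [hV.isOpen.mem_nhds hq, (isOpen_unramified ha X).mem_nhds hqu] with q' h1 h2
      exact hc q' h1 h2
  refine metricPullback_of_punctured (isConformalMetric_regularizedMetric ha X h.scale_base)
    (isConformalMetric_regularizedMetric ha (Y t) (h.scale t ht)) ?_ ?_
  · filter_upwards [hV.isOpen.mem_nhds hp] with q hq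
    exact mdifferentiableAt_of_translation (f t).continuous (h.unramified t ht) hV hq
  · filter_upwards [eventually_mem_unramified ha X p,
      mem_nhdsWithin_of_mem_nhds (hV.isOpen.mem_nhds hp)] with q h1 h2 using key q h2 h1

lemma contMDiff {t : E} (ht : t ∈ U) : ContMDiff 𝓘(ℝ, ℂ) 𝓘(ℝ, ℂ) ∞ (f t) ∧
    ∀ p, 0 < (realDifferential (f t) p).det := by
  rw [ContMDiff, ← forall_and]
  intro p
  have hc := (f t).continuous.continuousAt (x := p)
  by_cases hp : p ∈ Hyperelliptic.unramified ha X
  · obtain ⟨Ψ, h1, h2, h3⟩ := h.smooth t ht p hp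
    have h4 : (fun q => xCoord ha (Y t) (f t q)) =ᶠ[𝓝 p] fun q => Ψ (t, xCoord ha X q) := by
      have : Tendsto (fun q => (t, q)) (𝓝 p) (𝓝 (t, p)) := by
        exact Continuous.tendsto (by fun_prop) p
      exact this.eventually h3
    have h5 : ContDiffAt ℝ ∞ (fun x => Ψ (t, x)) (xCoord ha X p) :=
      h1.comp (xCoord ha X p) (contDiffAt_const.prodMk contDiffAt_id)
    refine ⟨contMDiffAt_of_xCoord ha (Y t) hc (h.unramified t ht p hp) ?_, ?_⟩
    · have h6 : ContMDiffAt (M := plane) (M' := plane) 𝓘(ℝ, ℂ) 𝓘(ℝ, ℂ) ∞ (fun x => Ψ (t, x))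
          (xCoord ha X p) := contMDiffAt_iff_contDiffAt.2 h5
      have h7 : ContMDiffAt (M' := plane) 𝓘(ℝ, ℂ) 𝓘(ℝ, ℂ) ∞ (xCoord ha X) p := by
        refine contMDiffAt_of_eventually_mdifferentiableAt (B := plane) ?_
        filter_upwards [(isOpen_unramified ha X).mem_nhds hp] with q hq
        exact mdifferentiableAt_xCoord ha X hq
      exact (h6.comp (M' := plane) (M'' := plane) p h7).congr_of_eventuallyEq h4
    · rw [realDifferential_of_xCoord hc hp (h.unramified t ht p hp)
        (h5.differentiableAt (by simp)) h4]
      exact h2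
  · obtain ⟨V, hp, hV⟩ := h.ramified p hp
    have hV := hV t ht
    have h1 : ∀ q ∈ V, MDifferentiableAt 𝓘(ℂ) 𝓘(ℂ) (f t) q := fun q hq =>
      mdifferentiableAt_of_translation (f t).continuous (h.unramified t ht) hV hq
    refine ⟨contMDiffAt_of_eventually_mdifferentiableAt ?_, ?_⟩
    · filter_upwards [hV.isOpen.mem_nhds hp] with q hq using h1 q hq
    · rw [det_realDifferential_complex (h1 p hp)]
      have h2 := h.metricPullback_of_translation ht hV hp
      rw [metricPullback_complex _ (h1 p hp)] at h2
      have h3 := congrArg (fun b : Form => b 1 1) h2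
      change ((_ : ℝ) • (innerSL ℝ : Form)) 1 1 = ((_ : ℝ) • (innerSL ℝ : Form)) 1 1 at h3
      rw [smul_innerSL_one_one, smul_innerSL_one_one] at h3
      have h4 := (isConformalMetric_regularizedMetric (κ := κ) ha X h.scale_base).1 p
      rw [← h3] at h4
      refine lt_of_le_of_ne (by positivity) fun h0 => ?_
      rw [← h0, mul_zero] at h4
      exact lt_irrefl _ h4

/-- In the coordinate `x` the metric pulled back by the homeomorphism is a smooth function of the
parameter, as the density is preserved; near the ramification points and infinity, where the
coordinate `x` cannot be used, the pulled back metric is constant. -/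
theorem isSmoothFamily : IsSmoothFamily U (hyperellipticCurve ha X)
    (fun t => hyperellipticCurve ha (Y t)) (fun t => regularizedMetric ha κ δ (Y t)) f where
  isOpen := h.isOpen
  metric t ht := isConformalMetric_regularizedMetric ha (Y t) (h.scale t ht)
  smooth t ht := (h.contMDiff ht).1
  smooth_symm t ht := contMDiff_symm_of_det (h.contMDiff ht).1 fun p => ((h.contMDiff ht).2 p).ne'
  orientation t ht := (h.contMDiff ht).2
  smooth_metric := by
    intro e he
    have hμ := isConformalMetric_regularizedMetric (κ := κ) ha X h.scale_base
    rw [contDiffOn_form_iff]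
    intro z w q hq
    obtain ⟨t₀, u₀⟩ := q
    obtain ⟨ht₀ : t₀ ∈ U, hu₀ : u₀ ∈ e.target⟩ := hq
    refine ContDiffAt.contDiffWithinAt ?_
    have hcomp : ∀ t ∈ U, ∀ u ∈ e.target, metricPullback (A := plane)
        (regularizedMetric ha κ δ (Y t)) (fun v => f t (e.symm v)) u =
        (metricPullback (regularizedMetric ha κ δ (Y t)) (f t) (e.symm u)).bilinearComp
          (realDifferential (A := plane) e.symm u) (realDifferential (A := plane) e.symm u) :=
      fun t ht u hu => metricPullback_comp (A := plane) _
        (((h.contMDiff ht).1 _).mdifferentiableAt (by simp))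
        (mdifferentiableAt_real (A := plane) (mdifferentiableAt_chart_symm he hu))
    have hU : ∀ᶠ q : E × ℂ in 𝓝 (t₀, u₀), q.1 ∈ U ∧ q.2 ∈ e.target :=
      (h.isOpen.prod e.open_target).mem_nhds ⟨ht₀, hu₀⟩
    have hcs : ContinuousAt (fun q : E × ℂ => (q.1, e.symm q.2)) (t₀, u₀) :=
      continuousAt_fst.prodMk ((e.continuousAt_symm hu₀).comp continuousAt_snd)
    by_cases hp : e.symm u₀ ∈ Hyperelliptic.unramified ha X
    · obtain ⟨Ψ, h1, -, h3⟩ := h.smooth t₀ ht₀ _ hp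
      have hxs : ContDiffAt ℝ ∞ (xInChart ha X e) u₀ :=
        (((differentiableOn_xInChart ha X he).contDiffOn (isOpen_unramified_preimage ha X e)
          (n := ∞)).contDiffAt ((isOpen_unramified_preimage ha X e).mem_nhds
            ⟨hu₀, hp⟩)).restrict_scalars ℝ
      -- the coordinate `x` of the image as a function of the parameter and of the point of the chart
      let G : E × ℂ → ℂ := fun q => Ψ (q.1, xInChart ha X e q.2)
      have hG : ContDiffAt ℝ ∞ G (t₀, u₀) :=
        ContDiffAt.comp (g := Ψ) (t₀, u₀) h1 (contDiffAt_fst.prodMk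
          (ContDiffAt.comp (g := xInChart ha X e) (t₀, u₀) hxs contDiffAt_snd))
      have hG' : ContDiffAt ℝ ∞ (fderiv ℝ G) (t₀, u₀) := hG.fderiv_right (by simp)
      have hd (z : ℂ) : ContDiffAt ℝ ∞ (fun q => fderiv ℝ G q (0, z)) (t₀, u₀) :=
        hG'.clm_apply contDiffAt_const
      have hin : ContDiffAt ℝ ∞ (fun q : E × ℂ => regularizedMetric ha κ δ X (e.symm q.2) *
          ((innerSL ℝ : Form) (fderiv ℝ G q (0, z)) (fderiv ℝ G q (0, w)))) (t₀, u₀) := by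
        have k1 : ContDiffAt ℝ ∞ (fun u => planeMetric κ δ X.1 (xInChart ha X e u)) u₀ :=
          ContDiffAt.comp (g := planeMetric κ δ X.1) u₀
            (contDiffAt_planeMetric h.scale_base.pos (xCoord_ne ha X hp)) hxs
        have k2 : ContDiffAt ℝ ∞ (fun u => regularizedMetric ha κ δ X (e.symm u)) u₀ := by
          refine k1.congr_of_eventuallyEq ?_
          filter_upwards [(isOpen_unramified_preimage ha X e).mem_nhds ⟨hu₀, hp⟩] with u hu
          exact regularizedMetric_unramified ha X hu.2
        have k3 : ContDiffAt ℝ ∞ (fun q : E × ℂ => regularizedMetric ha κ δ X (e.symm q.2))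
            (t₀, u₀) := ContDiffAt.comp (g := fun u => regularizedMetric ha κ δ X (e.symm u))
              (t₀, u₀) k2 contDiffAt_snd
        refine k3.mul ?_
        simp_rw [innerSL_complex_apply]
        have kre (z : ℂ) := Complex.reCLM.contDiff.contDiffAt.comp (t₀, u₀) (hd z)
        have kim (z : ℂ) := Complex.imCLM.contDiff.contDiffAt.comp (t₀, u₀) (hd z)
        exact ((kre z).mul (kre w)).add ((kim z).mul (kim w))
      refine hin.congr_of_eventuallyEq ?_
      have hev := hcs.eventually h3.eventually_nhds
      have hGd : ∀ᶠ q in 𝓝 (t₀, u₀), DifferentiableAt ℝ G q := by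
        filter_upwards [(hG.of_le (m := 1) (by norm_num)).eventually (by simp)] with q hq
        exact hq.differentiableAt (by simp)
      have hcu : ∀ᶠ q : E × ℂ in 𝓝 (t₀, u₀), e.symm q.2 ∈ Hyperelliptic.unramified ha X :=
        (continuousAt_snd.comp hcs).eventually ((isOpen_unramified ha X).mem_nhds hp)
      filter_upwards [hU, hev, hGd, hcu] with q hq hq' hGq hqu
      obtain ⟨t, u⟩ := q
      have hc : ContinuousAt (fun v => f t (e.symm v)) u :=
        ContinuousAt.comp (f := e.symm) (f t).continuous.continuousAt (e.continuousAt_symm hq.2)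
      have hx : (fun v => xCoord ha (Y t) (f t (e.symm v))) =ᶠ[𝓝 u] fun v => G (t, v) := by
        have : Tendsto (fun v => (t, e.symm v)) (𝓝 u) (𝓝 (t, e.symm u)) :=
          tendsto_const_nhds.prodMk_nhds (e.continuousAt_symm hq.2)
        exact this.eventually hq'
      have hfd : realDifferential (A := plane) (fun v => f t (e.symm v)) u =
          (fderiv ℝ G (t, u)).comp (ContinuousLinearMap.inr ℝ E ℂ) := by
        rw [realDifferential_eq_xCoord (A := plane) ha (Y t) hc (h.unramified t hq.1 _ hqu),
          realDifferential_plane, hx.fderiv_eq]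
        exact (hGq.hasFDerivAt.comp u (hasFDerivAt_prodMk_right t u)).fderiv
      change regularizedMetric ha κ δ (Y t) (f t (e.symm u)) * (innerSL ℝ : Form) (realDifferential
        (A := plane) (fun v => f t (e.symm v)) u z) (realDifferential
        (A := plane) (fun v => f t (e.symm v)) u w) = _
      rw [hfd, h.metric t hq.1 _ hqu]
      rfl
    · obtain ⟨V, hp, hV⟩ := h.ramified _ hp
      -- near a ramification point and near infinity the pulled back metric does not depend on `t`
      have h1 : ContDiffAt ℝ ∞ (fun q : E × ℂ => metricInChart (regularizedMetric ha κ δ X) e q.2 z w)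
          (t₀, u₀) := by
        have := (hμ.2 e he).contDiffAt (e.open_target.mem_nhds hu₀)
        have := (this.clm_apply (contDiffAt_const (c := z))).clm_apply (contDiffAt_const (c := w))
        exact ContDiffAt.comp (g := fun u => metricInChart (regularizedMetric ha κ δ X) e u z w)
          (t₀, u₀) this contDiffAt_snd
      refine h1.congr_of_eventuallyEq ?_
      have hcV : ∀ᶠ q : E × ℂ in 𝓝 (t₀, u₀), e.symm q.2 ∈ V :=
        (continuousAt_snd.comp hcs).eventually ((hV t₀ ht₀).isOpen.mem_nhds hp)
      filter_upwards [hU, hcV] with q hq hqV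
      rw [hcomp q.1 hq.1 q.2 hq.2, h.metricPullback_of_translation hq.1 (hV q.1 hq.1) hqV]
      rfl

end IsDeformation

end Hyperelliptic

/-! ### Motions of the plane -/

/-- The homeomorphism `x ↦ x + D x` of the plane for a contracting displacement `D`. -/
def displacementHomeomorph {K : ℝ≥0} {D : ℂ → ℂ} (hD : LipschitzWith K D) (hK : K < 1) : ℂ ≃ₜ ℂ :=
  ApproximatesLinearOn.toHomeomorph (𝕜 := ℝ) (f' := ContinuousLinearEquiv.refl ℝ ℂ) (c := K)
    (fun x => x + D x)
    (fun x _ y _ => by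
      have := hD.dist_le_mul x y
      rw [dist_eq_norm, dist_eq_norm] at this
      refine (le_of_eq ?_).trans this
      congr 1
      simp only [ContinuousLinearEquiv.coe_refl, ContinuousLinearMap.coe_id', id_eq]
      ring)
    (Or.inr (by
      have : ‖((ContinuousLinearEquiv.refl ℝ ℂ).symm : ℂ →L[ℝ] ℂ)‖₊ = 1 := by
        ext
        change ‖ContinuousLinearMap.id ℝ ℂ‖ = 1
        exact ContinuousLinearMap.norm_id
      rw [this, inv_one]; exact hK))

lemma displacementHomeomorph_apply {K : ℝ≥0} {D : ℂ → ℂ} (hD : LipschitzWith K D) (hK : K < 1)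
    (x : ℂ) : displacementHomeomorph hD hK x = x + D x := rfl

lemma det_id_add_pos {L : ℂ →L[ℝ] ℂ} (hL : ‖L‖ < 1) :
    0 < (ContinuousLinearMap.id ℝ ℂ + L).det := by
  have hne : ∀ s ∈ Set.Icc (0 : ℝ) 1, (ContinuousLinearMap.id ℝ ℂ + s • L).det ≠ 0 := by
    intro s hs h0
    obtain ⟨z, hz, hz0⟩ := Submodule.exists_mem_ne_zero_of_ne_bot
      (LinearMap.bot_lt_ker_of_det_eq_zero h0).ne'
    have h1 : z + s • L z = 0 := hz
    have h2 : ‖z‖ = s * ‖L z‖ := by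
      have := congrArg norm (eq_neg_of_add_eq_zero_left h1)
      rwa [norm_neg, norm_smul, Real.norm_of_nonneg hs.1] at this
    have h3 := L.le_opNorm z
    have h4 := norm_pos_iff.2 hz0
    nlinarith [hs.1, hs.2, norm_nonneg (L z)]
  have hc : ContinuousOn (fun s : ℝ => (ContinuousLinearMap.id ℝ ℂ + s • L).det)
      (Set.Icc 0 1) := by
    simp_rw [det_real_complex]
    refine Continuous.continuousOn ?_
    simp only [add_apply, smul_apply]
    fun_prop
  by_contra h
  have h1 := intermediate_value_Icc' zero_le_one hc
  obtain ⟨s, hs, hs0⟩ := h1 ⟨by simpa using h, by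
    change 0 ≤ (ContinuousLinearMap.id ℝ ℂ + (0 : ℝ) • L).det
    rw [det_real_complex]; simp⟩
  exact hne s hs hs0

lemma det_fderiv_displacement_pos {K : ℝ≥0} {D : ℂ → ℂ} (hD : LipschitzWith K D) (hK : K < 1)
    {x : ℂ} (h : DifferentiableAt ℝ D x) : 0 < (fderiv ℝ (fun x => x + D x) x).det := by
  rw [fderiv_fun_add differentiableAt_fun_id h, fderiv_fun_id]
  exact det_id_add_pos ((norm_fderiv_le_of_lipschitz ℝ hD).trans_lt (by exact_mod_cast hK))

/-- A smooth radial cutoff function that is `1` on the disc of radius `R` and `0` outside of the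
disc of radius `2R`. -/
def discCutoff (R : ℝ) (z : ℂ) : ℝ := Real.smoothTransition (2 - ‖z‖ ^ 2 / R ^ 2)

lemma contDiff_discCutoff (R : ℝ) : ContDiff ℝ ∞ (discCutoff R) :=
  Real.smoothTransition.contDiff.comp
    (contDiff_const.sub ((contDiff_norm_sq ℝ).div_const _))

lemma discCutoff_eq_one {R : ℝ} (hR : 0 < R) {z : ℂ} (hz : ‖z‖ ≤ R) : discCutoff R z = 1 := by
  refine Real.smoothTransition.one_of_one_le ?_
  have : ‖z‖ ^ 2 / R ^ 2 ≤ 1 := by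
    rw [div_le_one (by positivity)]; exact pow_le_pow_left₀ (norm_nonneg _) hz 2
  linarith

lemma discCutoff_eq_zero {R : ℝ} (hR : 0 < R) {z : ℂ} (hz : 2 * R ≤ ‖z‖) : discCutoff R z = 0 := by
  refine Real.smoothTransition.zero_of_nonpos ?_
  have : 2 ≤ ‖z‖ ^ 2 / R ^ 2 := by
    rw [le_div_iff₀ (by positivity)]; nlinarith
  linarith

lemma discCutoff_nonneg (R : ℝ) (z : ℂ) : 0 ≤ discCutoff R z := Real.smoothTransition.nonneg _

lemma discCutoff_le_one (R : ℝ) (z : ℂ) : discCutoff R z ≤ 1 := Real.smoothTransition.le_one _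

lemma hasCompactSupport_discCutoff {R : ℝ} (hR : 0 < R) : HasCompactSupport (discCutoff R) := by
  refine HasCompactSupport.intro (isCompact_closedBall (0 : ℂ) (2 * R)) fun z hz => ?_
  refine discCutoff_eq_zero hR ?_
  simpa using (not_le.1 (by simpa using hz)).le

section BranchShift

variable {n : ℕ} (X : Fin n → ℂ) (R : ℝ)

/-- The displacement that moves the disc of radius `R` around `X j` by the vector `d j` and is
supported in the discs of radius `2R`. -/
def branchShift (d : Fin n → ℂ) (x : ℂ) : ℂ := ∑ j, d j * (discCutoff R (x - X j) : ℂ)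

lemma contDiff_branchShift :
    ContDiff ℝ ∞ (fun q : (Fin n → ℂ) × ℂ => branchShift X R q.1 q.2) := by
  unfold branchShift
  refine ContDiff.sum fun j _ => ContDiff.mul ?_ ?_
  · exact (contDiff_apply ℝ ℂ j).comp contDiff_fst
  · exact Complex.ofRealCLM.contDiff.comp
      ((contDiff_discCutoff R).comp (contDiff_snd.sub contDiff_const))

/-- The discs of radius `4R` around the branch points are disjoint. -/
structure IsGoodRadius : Prop where
  pos : 0 < R
  separated : ∀ j k, j ≠ k → 8 * R ≤ ‖X j - X k‖

variable {X R} {d : Fin n → ℂ}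

lemma IsGoodRadius.other (h : IsGoodRadius X R) {j k : Fin n} (hjk : k ≠ j) {x : ℂ}
    (hx : ‖x - X j‖ ≤ 2 * R) : 6 * R ≤ ‖x - X k‖ := by
  have h1 := h.separated j k hjk.symm
  have h2 : ‖X j - X k‖ ≤ ‖x - X j‖ + ‖x - X k‖ := by
    have : X j - X k = -(x - X j) + (x - X k) := by ring
    rw [this]; exact (norm_add_le _ _).trans (by rw [norm_neg])
  linarith

lemma branchShift_near (h : IsGoodRadius X R) {j : Fin n} {x : ℂ} (hx : ‖x - X j‖ ≤ 2 * R) :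
    branchShift X R d x = d j * (discCutoff R (x - X j) : ℂ) := by
  refine Finset.sum_eq_single j (fun k _ hk => ?_) (by simp)
  have := h.pos
  rw [discCutoff_eq_zero h.pos (by linarith [h.other hk hx])]; simp

lemma branchShift_core (h : IsGoodRadius X R) {j : Fin n} {x : ℂ} (hx : ‖x - X j‖ ≤ R) :
    branchShift X R d x = d j := by
  have := h.pos
  rw [branchShift_near h (by linarith), discCutoff_eq_one h.pos hx]; simp

lemma branchShift_far (h : IsGoodRadius X R) {x : ℂ} (hx : ∀ j, 2 * R ≤ ‖x - X j‖) :
    branchShift X R d x = 0 := by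
  refine Finset.sum_eq_zero fun k _ => ?_
  rw [discCutoff_eq_zero h.pos (hx k)]; simp

lemma norm_branchShift_le (h : IsGoodRadius X R) (x : ℂ) : ‖branchShift X R d x‖ ≤ ‖d‖ := by
  by_cases hx : ∃ j, ‖x - X j‖ ≤ 2 * R
  · obtain ⟨j, hj⟩ := hx
    rw [branchShift_near h hj, norm_mul, Complex.norm_real,
      Real.norm_of_nonneg (discCutoff_nonneg _ _)]
    have h1 := norm_le_pi_norm d j
    nlinarith [discCutoff_nonneg R (x - X j), discCutoff_le_one R (x - X j), norm_nonneg (d j)]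
  · push Not at hx
    rw [branchShift_far h fun j => (hx j).le]; simp

variable (X R d) in
/-- The displacement `d` of the branch points is so small that the displacement of the plane is
contracting and preserves the sheets. -/
structure IsSmallShift : Prop where
  contracting : ∃ K : ℝ≥0, K < 1 ∧ LipschitzWith K (branchShift X R d)
  norm_le : 4 * ‖d‖ ≤ R

variable (X) in
lemma exists_isSmallShift (hR : 0 < R) : ∃ ε > 0, ∀ d : Fin n → ℂ, ‖d‖ < ε → IsSmallShift X R d := by
  obtain ⟨C, hC⟩ := ContDiff.lipschitzWith_of_hasCompactSupport (hasCompactSupport_discCutoff hR)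
    ((contDiff_discCutoff R).of_le (n := ∞) (m := 1) (by norm_num)) one_ne_zero
  refine ⟨min (R / 4) (1 / (n * C + 1)), lt_min (by positivity) (by positivity), fun d hd => ?_⟩
  have h1 := hd.trans_le (min_le_left _ _)
  have h2 := hd.trans_le (min_le_right _ _)
  rw [lt_div_iff₀ (by positivity)] at h2
  refine ⟨⟨n * ‖d‖₊ * C, ?_, ?_⟩, by linarith⟩
  · rw [← NNReal.coe_lt_coe]
    push_cast
    nlinarith [norm_nonneg d]
  · refine LipschitzWith.of_dist_le_mul fun x y => ?_
    rw [dist_eq_norm, branchShift, branchShift, ← Finset.sum_sub_distrib]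
    have : ∀ j ∈ Finset.univ, ‖d j * (discCutoff R (x - X j) : ℂ) -
        d j * (discCutoff R (y - X j) : ℂ)‖ ≤ ‖d‖ * (C * dist x y) := by
      intro j _
      rw [← mul_sub, norm_mul, ← Complex.ofReal_sub, Complex.norm_real]
      refine mul_le_mul (norm_le_pi_norm d j) ?_ (norm_nonneg _) (norm_nonneg _)
      have := hC.dist_le_mul (x - X j) (y - X j)
      rwa [dist_sub_right, dist_eq_norm (discCutoff R _)] at this
    refine (norm_sum_le_of_le _ this).trans (le_of_eq ?_)
    simp only [Finset.sum_const, Finset.card_univ, Fintype.card_fin, nsmul_eq_mul]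
    push_cast
    ring

lemma IsSmallShift.norm_apply_le (h : IsSmallShift X R d) (j : Fin n) : ‖d j‖ ≤ R / 4 := by
  have := norm_le_pi_norm d j
  linarith [h.norm_le]

/-- The ratio of `x - X k` before and after the motion. -/
def shiftRatio (X : Fin n → ℂ) (R : ℝ) (d : Fin n → ℂ) (k : Fin n) (x : ℂ) : ℂ :=
  1 + (branchShift X R d x - d k) / (x - X k)

/-- A square root of the factor by which the polynomial `p` is multiplied under the motion. -/
def sheetFactor (X : Fin n → ℂ) (R : ℝ) (d : Fin n → ℂ) (x : ℂ) : ℂ :=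
  ∏ k, Complex.sqrt (shiftRatio X R d k x)

lemma shiftRatio_core (h : IsGoodRadius X R) {k : Fin n} {x : ℂ} (hx : ‖x - X k‖ ≤ R) :
    shiftRatio X R d k x = 1 := by
  rw [shiftRatio, branchShift_core h hx]; simp

lemma shiftRatio_mem_slitPlane (h : IsGoodRadius X R) (hd : IsSmallShift X R d) (k : Fin n)
    (x : ℂ) : shiftRatio X R d k x ∈ Complex.slitPlane := by
  by_cases hx : ‖x - X k‖ ≤ R
  · rw [shiftRatio_core h hx]; exact Complex.one_mem_slitPlane
  · have hR := h.pos
    have h1 : ‖(branchShift X R d x - d k) / (x - X k)‖ ≤ 1 / 2 := by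
      rw [norm_div, div_le_iff₀ (by linarith)]
      have := norm_sub_le (branchShift X R d x) (d k)
      linarith [norm_branchShift_le (d := d) h x, norm_le_pi_norm d k, hd.norm_le]
    refine Or.inl ?_
    have h2 := Complex.abs_re_le_norm ((branchShift X R d x - d k) / (x - X k))
    have h3 := abs_le.1 (h2.trans h1)
    simp only [shiftRatio, Complex.add_re, Complex.one_re]
    linarith [h3.1]

lemma sheetFactor_ne_zero (h : IsGoodRadius X R) (hd : IsSmallShift X R d) (x : ℂ) :
    sheetFactor X R d x ≠ 0 :=
  Finset.prod_ne_zero_iff.2 fun k _ =>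
    csqrt_ne_zero (Complex.slitPlane_ne_zero (shiftRatio_mem_slitPlane h hd k x))

lemma continuous_branchShift : Continuous (branchShift X R d) :=
  (contDiff_branchShift X R).continuous.comp (by fun_prop : Continuous fun x : ℂ => (d, x))

lemma continuous_shiftRatio (h : IsGoodRadius X R) (k : Fin n) :
    Continuous (shiftRatio X R d k) := by
  rw [continuous_iff_continuousAt]
  intro x
  by_cases hx : x = X k
  · refine ContinuousAt.congr (f := fun _ => (1 : ℂ)) continuousAt_const ?_
    have : ∀ᶠ y in 𝓝 x, ‖y - X k‖ < R := by
      have hc : ContinuousAt (fun y => ‖y - X k‖) x := by fun_prop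
      exact hc.eventually (gt_mem_nhds (by simpa [hx] using h.pos))
    filter_upwards [this] with y hy
    exact (shiftRatio_core h hy.le).symm
  · refine continuousAt_const.add (ContinuousAt.div ?_ (by fun_prop) (sub_ne_zero.2 hx))
    exact continuous_branchShift.continuousAt.sub continuousAt_const

lemma continuous_sheetFactor (h : IsGoodRadius X R) (hd : IsSmallShift X R d) :
    Continuous (sheetFactor X R d) := by
  unfold sheetFactor
  refine continuous_finsetProd _ fun k _ => ?_
  rw [← continuousOn_univ]
  exact Complex.continuousOn_sqrt.comp (continuous_shiftRatio h k).continuousOn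
    fun x _ => shiftRatio_mem_slitPlane h hd k x

lemma hPoly_shift (a : ℂ) (h : IsGoodRadius X R) {Y : Fin n → ℂ} (hY : ∀ j, Y j = X j + d j)
    (x : ℂ) : hPoly a Y (x + branchShift X R d x) = hPoly a X x * sheetFactor X R d x ^ 2 := by
  unfold hPoly sheetFactor
  rw [← Finset.prod_pow, mul_assoc, ← Finset.prod_mul_distrib]
  congr 1
  refine Finset.prod_congr rfl fun k _ => ?_
  rw [csqrt_sq, hY, shiftRatio]
  by_cases hx : x = X k
  · subst hx
    rw [branchShift_core (j := k) h (by simpa using h.pos.le)]; simp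
  · have := sub_ne_zero.2 hx
    field_simp
    ring

end BranchShift

/-! ### The motion of the branch points -/

namespace Hyperelliptic

open RiemannSurface

section Affine

variable {n : ℕ} (a : ℂ) {X Y : Fin n → ℂ} {R : ℝ}

/-- The lift of the motion of the plane to the affine curves: `x ↦ x + D x`, and `y` is multiplied
by the square root of the factor by which `p` changes. -/
def affineHomeomorph (h : IsGoodRadius X R) (hs : IsSmallShift X R (Y - X)) :
    AffineCurve a X ≃ₜ AffineCurve a Y where
  toFun P := ⟨(P.1.1 + branchShift X R (Y - X) P.1.1, P.1.2 * sheetFactor X R (Y - X) P.1.1), by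
    change (P.1.2 * sheetFactor X R (Y - X) P.1.1) ^ 2 =
      hPoly a Y (P.1.1 + branchShift X R (Y - X) P.1.1)
    rw [hPoly_shift a h (fun j => by simp), mul_pow, P.2]⟩
  invFun Q :=
    let x := (displacementHomeomorph hs.contracting.choose_spec.2
      hs.contracting.choose_spec.1).symm Q.1.1
    ⟨(x, Q.1.2 / sheetFactor X R (Y - X) x), by
      have h1 : x + branchShift X R (Y - X) x = Q.1.1 :=
        (displacementHomeomorph hs.contracting.choose_spec.2
          hs.contracting.choose_spec.1).apply_symm_apply Q.1.1
      change (Q.1.2 / sheetFactor X R (Y - X) x) ^ 2 = hPoly a X x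
      have h2 := hPoly_shift (d := Y - X) (Y := Y) a h (fun j => by simp) x
      rw [h1] at h2
      rw [div_pow, Q.2, h2, mul_div_cancel_right₀]
      exact pow_ne_zero 2 (sheetFactor_ne_zero h hs x)⟩
  left_inv P := by
    have h1 : (displacementHomeomorph hs.contracting.choose_spec.2
      hs.contracting.choose_spec.1).symm (P.1.1 + branchShift X R (Y - X) P.1.1) = P.1.1 :=
        (displacementHomeomorph hs.contracting.choose_spec.2
          hs.contracting.choose_spec.1).symm_apply_apply P.1.1
    refine Subtype.ext (Prod.ext h1 ?_)
    simp only [h1]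
    exact mul_div_cancel_right₀ _ (sheetFactor_ne_zero h hs _)
  right_inv Q := by
    refine Subtype.ext (Prod.ext ?_ ?_)
    · exact (displacementHomeomorph hs.contracting.choose_spec.2
          hs.contracting.choose_spec.1).apply_symm_apply Q.1.1
    · exact div_mul_cancel₀ _ (sheetFactor_ne_zero h hs _)
  continuous_toFun := by
    have h1 : Continuous fun P : AffineCurve a X => P.1.1 := by fun_prop
    refine Continuous.subtype_mk (Continuous.prodMk ?_ ?_) _
    · exact h1.add (continuous_branchShift.comp h1)
    · exact (by fun_prop : Continuous fun P : AffineCurve a X => P.1.2).mul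
        ((continuous_sheetFactor h hs).comp h1)
  continuous_invFun := by
    have h1 : Continuous fun Q : AffineCurve a Y => (displacementHomeomorph
        hs.contracting.choose_spec.2 hs.contracting.choose_spec.1).symm Q.1.1 :=
      (Homeomorph.continuous _).comp (by fun_prop)
    refine Continuous.subtype_mk (Continuous.prodMk h1 ?_) _
    exact (by fun_prop : Continuous fun P : AffineCurve a Y => P.1.2).div
      ((continuous_sheetFactor h hs).comp h1) fun Q => sheetFactor_ne_zero h hs _

end Affine

variable {g : ℕ} {a : ℂ} (ha : a ≠ 0) {X Y : Config g} {R : ℝ}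

/-- The motion of the branch points as a homeomorphism of the compact curves. -/
def curveHomeomorph (h : IsGoodRadius X.1 R) (hs : IsSmallShift X.1 R (Y.1 - X.1)) :
    hyperellipticCurve ha X ≃ₜ hyperellipticCurve ha Y :=
  (affineHomeomorph a h hs).onePointCongr

lemma curveHomeomorph_curvePoint (h : IsGoodRadius X.1 R) (hs : IsSmallShift X.1 R (Y.1 - X.1))
    (P : AffineCurve a X.1) : curveHomeomorph ha h hs (curvePoint ha X P) =
      curvePoint ha Y (affineHomeomorph a h hs P) := rfl

/-- The configuration `Z` if it is near the configuration `X`, and `X` otherwise. -/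
def nearConfig (X : Config g) (ε : ℝ) (Z : Fin (2 * g + 1) → ℂ) : Config g :=
  open Classical in if h : ‖Z - X.1‖ < ε ∧ Function.Injective Z then ⟨Z, h.2⟩ else X

lemma injective_of_near (h : IsGoodRadius X.1 R) {Z : Fin (2 * g + 1) → ℂ}
    (hs : IsSmallShift X.1 R (Z - X.1)) : Function.Injective Z := by
  intro j k hjk
  by_contra hne
  have h1 := h.separated j k hne
  have h2 := hs.norm_apply_le j
  have h3 := hs.norm_apply_le k
  have h4 := h.pos
  have h5 : X.1 j - X.1 k = -(Z - X.1) j + (Z - X.1) k := by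
    simp only [Pi.sub_apply]; rw [hjk]; ring
  have h6 := norm_add_le (-(Z - X.1) j) ((Z - X.1) k)
  rw [← h5, norm_neg] at h6
  linarith

variable {ε : ℝ} {Z : Fin (2 * g + 1) → ℂ}

lemma nearConfig_val (h : IsGoodRadius X.1 R) (hε : ∀ d, ‖d‖ < ε → IsSmallShift X.1 R d)
    (hZ : ‖Z - X.1‖ < ε) : (nearConfig X ε Z).1 = Z := by
  rw [nearConfig, dif_pos ⟨hZ, injective_of_near h (hε _ hZ)⟩]

lemma isSmallShift_nearConfig (hε0 : 0 < ε) (hε : ∀ d, ‖d‖ < ε → IsSmallShift X.1 R d) :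
    IsSmallShift X.1 R ((nearConfig X ε Z).1 - X.1) := by
  refine hε _ ?_
  unfold nearConfig
  split_ifs with h
  · exact h.1
  · simpa using hε0

/-- The scale `δ` at which the metric is regularised is small when compared with the radius `R` of
the discs that are moved. -/
structure IsFineScale {n : ℕ} (X : Fin n → ℂ) (R δ : ℝ) : Prop where
  pos : 0 < δ
  le : 2 * δ ≤ R
  bounded : ∀ j, ‖X j‖ + 3 * R ≤ 1 / δ

section Metric

variable {n : ℕ} {X Y : Fin n → ℂ} {R δ : ℝ} {κ : Cutoff}

lemma IsFineScale.isSmallScale (hδ : IsFineScale X R δ) (h : IsGoodRadius X R)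
    (hs : IsSmallShift X R (Y - X)) : IsSmallScale δ Y := by
  have hR := h.pos
  have hYX (j : Fin n) : ‖Y j - X j‖ ≤ R / 4 := hs.norm_apply_le j
  refine ⟨hδ.pos, fun j k hjk => ?_, fun j => ?_⟩
  · have h1 := h.separated j k hjk
    have h5 : X j - X k = -(Y j - X j) + (Y k - X k) + (Y j - Y k) := by ring
    have h6 := norm_add₃_le (a := -(Y j - X j)) (b := Y k - X k) (c := Y j - Y k)
    rw [← h5, norm_neg] at h6
    linarith [hYX j, hYX k, hδ.le]
  · have h1 : ‖Y j‖ ≤ ‖X j‖ + ‖Y j - X j‖ := by simpa using norm_add_le (X j) (Y j - X j)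
    linarith [hYX j, hδ.le, hδ.bounded j]

/-- The motion of the plane preserves the density of the regularised metric: where the metric is not
flat, the motion is a translation that carries branch points to branch points. -/
lemma planeMetric_shift (hδ : IsFineScale X R δ) (h : IsGoodRadius X R)
    (hs : IsSmallShift X R (Y - X)) (x : ℂ) :
    planeMetric κ δ Y (x + branchShift X R (Y - X) x) = planeMetric κ δ X x := by
  have hR := h.pos
  have hδ0 := hδ.pos
  have hδR := hδ.le
  have hYX (j : Fin n) : ‖Y j - X j‖ ≤ R / 4 := hs.norm_apply_le j
  have hD : ‖branchShift X R (Y - X) x‖ ≤ R / 4 := by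
    linarith [norm_branchShift_le (d := Y - X) h x, hs.norm_le]
  -- a point at distance `r` from `X k` is at distance at least `r - R / 2` from `Y k` after the motion
  have hdist (k : Fin n) :
      ‖x - X k‖ - R / 2 ≤ ‖x + branchShift X R (Y - X) x - Y k‖ := by
    have h5 : x - X k = (x + branchShift X R (Y - X) x - Y k) + -(branchShift X R (Y - X) x)
      + (Y k - X k) := by ring
    have h6 := norm_add₃_le (a := x + branchShift X R (Y - X) x - Y k)
      (b := -(branchShift X R (Y - X) x)) (c := Y k - X k)
    rw [← h5, norm_neg] at h6
    linarith [hYX k]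
  have hbd (j : Fin n) (hj : ‖x - X j‖ ≤ 2 * R) : δ * ‖x‖ ≤ 1 ∧
      δ * ‖x + branchShift X R (Y - X) x‖ ≤ 1 := by
    have h1 : ‖x‖ ≤ ‖x - X j‖ + ‖X j‖ := by simpa using norm_add_le (x - X j) (X j)
    have h2 := norm_add_le x (branchShift X R (Y - X) x)
    have h3 := hδ.bounded j
    rw [mul_comm, ← le_div_iff₀ hδ0, mul_comm, ← le_div_iff₀ hδ0]
    constructor <;> linarith
  by_cases h1 : ∃ j, ‖x - X j‖ ≤ R
  · obtain ⟨j, hj⟩ := h1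
    obtain ⟨hb1, hb2⟩ := hbd j (by linarith)
    rw [planeMetric, planeMetric, κ.σ_eq_one _ hb1, κ.σ_eq_one _ hb2, mul_one, mul_one]
    refine Finset.prod_congr rfl fun k _ => ?_
    by_cases hk : k = j
    · subst hk
      rw [branchShift_core h hj, Pi.sub_apply, show x + (Y k - X k) - Y k = x - X k by ring]
    · have h2 := h.other hk (x := x) (by linarith)
      rw [rho_eq_one hδ0 (by linarith [hdist k]), rho_eq_one hδ0 (by linarith)]
  push Not at h1
  by_cases h2 : ∃ j, ‖x - X j‖ ≤ 2 * R
  · obtain ⟨j, hj⟩ := h2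
    obtain ⟨hb1, hb2⟩ := hbd j hj
    rw [planeMetric_flat hδ0 (fun k => by linarith [hdist k, h1 k]) hb2,
      planeMetric_flat hδ0 (fun k => by linarith [h1 k]) hb1]
  push Not at h2
  rw [branchShift_far h (fun k => (h2 k).le), add_zero,
    planeMetric_of_far (X := X) hδ0 (fun k => by linarith [h2 k]),
    planeMetric_of_far (X := Y) hδ0 (fun k => ?_)]
  have := hdist k
  rw [branchShift_far h (fun k => (h2 k).le), add_zero] at this
  linarith [h2 k]

end Metric

section Deformation

variable {κ : Cutoff} {δ : ℝ}

/-- The part of the curve over the disc of radius `R` around the branch point `X j`. -/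
def overDisc (X : Config g) (R : ℝ) (j : Fin (2 * g + 1)) : Set (hyperellipticCurve ha X) :=
  curvePoint ha X '' {P | ‖P.1.1 - X.1 j‖ < R}

/-- A neighbourhood of infinity: the part of the curve outside of the discs of radius `2R`. -/
def outsideDiscs (X : Config g) (R : ℝ) : Set (hyperellipticCurve ha X) :=
  (curvePoint ha X '' {P | ∃ j, ‖P.1.1 - X.1 j‖ ≤ 2 * R})ᶜ

lemma isOpen_overDisc (j : Fin (2 * g + 1)) : IsOpen (overDisc ha X R j) :=
  (isOpenEmbedding_curvePoint ha X).isOpenMap _ (isOpen_lt (by fun_prop) continuous_const)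

lemma isOpen_outsideDiscs : IsOpen (outsideDiscs ha X R) := by
  refine IsClosed.isOpen_compl (self := ?_)
  have h1 : {P : AffineCurve a X.1 | ∃ j, ‖P.1.1 - X.1 j‖ ≤ 2 * R} =
    ⋃ j, {P | ‖P.1.1 - X.1 j‖ ≤ 2 * R} := by ext; simp
  refine (IsCompact.image ?_ (isOpenEmbedding_curvePoint ha X).continuous).isClosed
  rw [h1]
  refine isCompact_iUnion fun j => ?_
  refine (isCompact_affine_norm_le (‖X.1 j‖ + 2 * R)).of_isClosed_subset
    (isClosed_le (by fun_prop) continuous_const) fun P hP => ?_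
  have h1 : ‖P.1.1‖ ≤ ‖P.1.1 - X.1 j‖ + ‖X.1 j‖ := by
    simpa using norm_add_le (P.1.1 - X.1 j) (X.1 j)
  have h2 : ‖P.1.1 - X.1 j‖ ≤ 2 * R := hP
  change ‖P.1.1‖ ≤ _
  linarith

lemma isTranslationOn_overDisc (h : IsGoodRadius X.1 R) (hs : IsSmallShift X.1 R (Y.1 - X.1))
    (j : Fin (2 * g + 1)) :
    IsTranslationOn ha (curveHomeomorph ha h hs) (overDisc ha X R j) := by
  refine ⟨isOpen_overDisc ha j, Y.1 j - X.1 j, ?_⟩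
  rintro _ ⟨P, hP, rfl⟩ -
  rw [curveHomeomorph_curvePoint, xCoord_curvePoint, xCoord_curvePoint]
  change P.1.1 + branchShift X.1 R (Y.1 - X.1) P.1.1 = _
  rw [branchShift_core h (le_of_lt hP)]; rfl

lemma isTranslationOn_outsideDiscs (h : IsGoodRadius X.1 R) (hs : IsSmallShift X.1 R (Y.1 - X.1)) :
    IsTranslationOn ha (curveHomeomorph ha h hs) (outsideDiscs ha X R) := by
  refine ⟨isOpen_outsideDiscs ha, 0, ?_⟩
  rintro q hq ⟨P, hP, rfl⟩
  rw [curveHomeomorph_curvePoint, xCoord_curvePoint, xCoord_curvePoint]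
  change P.1.1 + branchShift X.1 R (Y.1 - X.1) P.1.1 = _
  rw [branchShift_far h]
  intro j
  by_contra h0
  exact hq ⟨P, ⟨j, (not_le.1 h0).le⟩, rfl⟩

lemma unramified_curveHomeomorph (h : IsGoodRadius X.1 R) (hs : IsSmallShift X.1 R (Y.1 - X.1))
    {p : hyperellipticCurve ha X} (hp : p ∈ unramified ha X) :
    curveHomeomorph ha h hs p ∈ unramified ha Y := by
  obtain ⟨P, hP, rfl⟩ := hp
  rw [curveHomeomorph_curvePoint, curvePoint_mem_unramified]
  exact mul_ne_zero hP (sheetFactor_ne_zero h hs _)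

lemma xCoord_curveHomeomorph (h : IsGoodRadius X.1 R) (hs : IsSmallShift X.1 R (Y.1 - X.1))
    {p : hyperellipticCurve ha X} (hp : p ∈ unramified ha X) :
    xCoord ha Y (curveHomeomorph ha h hs p) =
      xCoord ha X p + branchShift X.1 R (Y.1 - X.1) (xCoord ha X p) := by
  obtain ⟨P, hP, rfl⟩ := hp
  rfl

lemma regularizedMetric_curveHomeomorph (hδ : IsFineScale X.1 R δ) (h : IsGoodRadius X.1 R)
    (hs : IsSmallShift X.1 R (Y.1 - X.1)) {p : hyperellipticCurve ha X}
    (hp : p ∈ unramified ha X) : regularizedMetric ha κ δ Y (curveHomeomorph ha h hs p) =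
      regularizedMetric ha κ δ X p := by
  rw [regularizedMetric_unramified ha Y (unramified_curveHomeomorph ha h hs hp),
    regularizedMetric_unramified ha X hp, xCoord_curveHomeomorph ha h hs hp,
    planeMetric_shift hδ h hs]

lemma exists_mem_of_notMem_unramified (h : IsGoodRadius X.1 R) {p : hyperellipticCurve ha X}
    (hp : p ∉ unramified ha X) : p ∈ outsideDiscs ha X R ∨ ∃ j, p ∈ overDisc ha X R j := by
  obtain rfl | ⟨j, rfl⟩ := notMem_unramified_cases ha X hp
  · left
    rintro ⟨P, -, hP⟩
    exact curvePoint_ne_infinityPoint ha X P hP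
  · right
    exact ⟨j, _, by simpa [ramificationPoint] using h.pos, rfl⟩

/-- A smooth motion of the branch points is a deformation of the curve. -/
theorem isDeformation_curveHomeomorph (hδ : IsFineScale X.1 R δ) (h : IsGoodRadius X.1 R)
    (hε0 : 0 < ε) (hε : ∀ d, ‖d‖ < ε → IsSmallShift X.1 R d)
    {E : Type} [NormedAddCommGroup E] [NormedSpace ℝ E] {ℓ : E → Fin (2 * g + 1) → ℂ}
    (hℓ : ContDiff ℝ ∞ ℓ) : IsDeformation κ δ {t | ‖ℓ t - X.1‖ < ε} X
      (fun t => nearConfig X ε (ℓ t))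
      (fun t => curveHomeomorph ha h (isSmallShift_nearConfig (Z := ℓ t) hε0 hε)) where
  isOpen := isOpen_lt (by have := hℓ.continuous; fun_prop) continuous_const
  scale_base := hδ.isSmallScale h (hε _ (by simpa using hε0))
  scale t ht := hδ.isSmallScale h (isSmallShift_nearConfig hε0 hε)
  unramified t ht p hp := unramified_curveHomeomorph ha h _ hp
  metric t ht p hp := regularizedMetric_curveHomeomorph ha hδ h _ hp
  smooth t₀ ht₀ p₀ hp₀ := by
    have hΨ : ContDiff ℝ ∞ (fun q : E × ℂ => q.2 + branchShift X.1 R (ℓ q.1 - X.1) q.2) :=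
      contDiff_snd.add ((contDiff_branchShift X.1 R).comp
        (((hℓ.comp contDiff_fst).sub contDiff_const).prodMk contDiff_snd))
    refine ⟨_, hΨ.contDiffAt, ?_, ?_⟩
    · obtain ⟨K, hK, hL⟩ := (hε _ ht₀).contracting
      refine det_fderiv_displacement_pos hL hK ?_
      have : ContDiff ℝ ∞ (fun x => branchShift X.1 R (ℓ t₀ - X.1) x) :=
        (contDiff_branchShift X.1 R).comp (contDiff_const.prodMk contDiff_id)
      exact this.contDiffAt.differentiableAt (by simp)
    · have hU : {t | ‖ℓ t - X.1‖ < ε} ∈ 𝓝 t₀ :=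
        (isOpen_lt (by have := hℓ.continuous; fun_prop) continuous_const).mem_nhds ht₀
      filter_upwards [prod_mem_nhds hU ((isOpen_unramified ha X).mem_nhds hp₀)] with q hq
      rw [xCoord_curveHomeomorph ha h _ hq.2, nearConfig_val h hε hq.1]
  ramified p hp := by
    obtain h1 | ⟨j, h1⟩ := exists_mem_of_notMem_unramified ha h hp
    · exact ⟨_, h1, fun t _ => isTranslationOn_outsideDiscs ha h _⟩
    · exact ⟨_, h1, fun t _ => isTranslationOn_overDisc ha h _ j⟩

end Deformation

end Hyperelliptic

/-! ### Smoothness of the energy momentum tensor inside correlation functions -/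

namespace ConformalFieldTheory

open RiemannSurface

variable {S : Type} [TopologicalSpace S] (C : ConformalFieldTheory.{u} S) {A : RiemannSurface}
  {μ : A → ℝ}

lemma corr_cons_sum (hA : IsMetricSurface S A μ) {N : ℕ} {φ : Fin N → C.Field A}
    (hφ : Separated φ) {p : A} (hp : ∀ i, (φ i).1 ≠ p) {ι : Type*} (s : Finset ι) (z : ι → ℂ)
    (w : ι → C.Fiber A p) :
    C.corr A μ (Fin.cons ⟨p, ∑ k ∈ s, z k • w k⟩ φ : Fin (N + 1) → C.Field A) =
      ∑ k ∈ s, z k * C.corr A μ (Fin.cons ⟨p, w k⟩ φ : Fin (N + 1) → C.Field A) := by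
  classical
  induction s using Finset.induction_on with
  | empty =>
    have := C.corr_cons_smul hA hφ hp 0 0
    simpa using this
  | insert k s hk ih =>
    rw [Finset.sum_insert hk, Finset.sum_insert hk, C.corr_cons_add hA hφ hp,
      C.corr_cons_smul hA hφ hp, ih]

/-- Moving one field with fixed components in a chart. -/
lemma contDiffAt_corr_place (hA : IsMetricSurface S A μ) {N : ℕ} {φ : Fin N → C.Field A}
    (hφ : Separated φ) {e : OpenPartialHomeomorph A ℂ} (he : e ∈ atlas ℂ A) {u₀ : ℂ}
    (hu₀ : u₀ ∈ e.target) (hp : ∀ i, (φ i).1 ≠ e.symm u₀) (v : C.F) :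
    ContDiffAt ℝ ∞ (fun u => C.corr A μ (Fin.cons
      (C.toFBundleFunctor.place (fun z => e.symm (z + u)) v) φ : Fin (N + 1) → C.Field A)) u₀ := by
  choose w hw using fun i => C.toFBundleFunctor.exists_eq_localField (φ i)
  have hcons (u : ℂ) : (Fin.cons (C.toFBundleFunctor.place (fun z => e.symm (z + u)) v) φ :
      Fin (N + 1) → C.Field A) = fun i => C.toFBundleFunctor.place
        ((Fin.cons (fun z => e.symm (z + u)) fun i => FBundleFunctor.chartParam (φ i).1 :
          Fin (N + 1) → ℂ → A) i) ((Fin.cons v w : Fin (N + 1) → C.F) i) := by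
    funext i
    refine Fin.cases rfl (fun i => ?_) i
    simp only [Fin.cons_succ]
    rw [← C.toFBundleFunctor.localField_eq_place]
    exact hw i
  simp_rw [hcons]
  have hfam : IsSmoothFamily Set.univ A (fun _ : ℂ => A) (fun _ => μ)
    (fun _ => Homeomorph.refl A) := isSmoothFamily_const hA.metric
  refine C.corr_smooth Set.univ A (fun _ : ℂ => A) (fun _ => μ) (fun _ => Homeomorph.refl A)
    hA.compact hA.homeomorphic hfam (N + 1)
    (fun u => (Fin.cons (fun z => e.symm (z + u)) fun i => FBundleFunctor.chartParam (φ i).1))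
    (Fin.cons v w) u₀ trivial (fun i => ?_) (fun i => ?_) (fun i => ?_) ?_
  · refine Fin.cases ?_ (fun i => ?_) i
    · have h1 : ContMDiffAt 𝓘(ℝ, ℂ) 𝓘(ℝ, ℂ) ∞ e.symm ((fun q : ℂ × ℂ => q.2 + q.1) (u₀, 0)) := by
        simpa using contMDiffAt_chart_symm he hu₀
      have h2 : ContMDiffAt 𝓘(ℝ, ℂ × ℂ) 𝓘(ℝ, ℂ) ∞ (fun q : ℂ × ℂ => q.2 + q.1) (u₀, 0) :=
        contMDiffAt_iff_contDiffAt.2 (contDiff_snd.add contDiff_fst).contDiffAt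
      have h3 := h1.comp (u₀, 0) h2
      exact h3
    · exact contMDiffAt_chartParam _ _
  · refine Fin.cases ?_ (fun i => ?_) i
    · have h1 : ContinuousAt (fun q : ℂ × ℂ => q.2 + q.1) (u₀, 0) := by fun_prop
      have h2 : (fun q : ℂ × ℂ => q.2 + q.1) (u₀, 0) ∈ e.target := by simpa using hu₀
      filter_upwards [h1.eventually (e.open_target.mem_nhds h2)] with q hq
      have h3 := mdifferentiableAt_chart_symm he hq
      have h4 : MDifferentiableAt (M := plane) (M' := plane) 𝓘(ℂ) 𝓘(ℂ) (fun z : ℂ => z + q.1) q.2 :=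
        mdifferentiableAt_iff_differentiableAt.2 (by fun_prop)
      have h5 := MDifferentiableAt.comp (M := plane) (M' := plane) (g := e.symm) q.2 h3 h4
      exact h5
    · exact eventually_mdifferentiableAt_chartParam _ _
  · refine Fin.cases ?_ (fun i => ?_) i
    · exact isConformalGerm_chart_symm he hu₀
    · exact FBundleFunctor.isConformalGerm_chartParam _
  · have h := C.separated_cons hφ hp (C.one A _)
    unfold Separated at h
    convert h using 2 with i
    refine Fin.cases ?_ (fun i => ?_) i
    · simp
    · simp [FBundleFunctor.chartParam_zero]

/-- The components of the energy momentum tensor in a chart are smooth inside the `N`-point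
functions, away from the other fields. -/
theorem contDiffAt_corr_T (hA : IsMetricSurface S A μ) {N : ℕ} {φ : Fin N → C.Field A}
    (hφ : Separated φ) {e : OpenPartialHomeomorph A ℂ} (he : e ∈ atlas ℂ A) {u₀ : ℂ}
    (hu₀ : u₀ ∈ e.target) (hp : ∀ i, (φ i).1 ≠ e.symm u₀) (B : Form) :
    ContDiffAt ℝ ∞ (fun u => C.corr A μ (Fin.cons ⟨e.symm u, C.T A μ (e.symm u)
      (B.bilinearComp (realDifferential (B := plane) e (e.symm u))
        (realDifferential (B := plane) e (e.symm u)))⟩ φ : Fin (N + 1) → C.Field A)) u₀ := by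
  obtain ⟨⟨i, hi⟩, hT⟩ := C.T_smooth A μ hA
  -- the components of `T` lie in a fixed finite dimensional subspace `W` of the standard fibre
  let W : Submodule ℂ C.F := C.fil plane (0 : ℂ) i
  have : FiniteDimensional ℂ W := C.fil_finite plane (0 : ℂ) i
  let b := Module.finBasis ℂ W
  choose l hl using fun k => LinearMap.exists_extend (b.coord k)
  let w : ∀ u : ℂ, C.Fiber A (e.symm u) := fun u => C.T A μ (e.symm u)
      (B.bilinearComp (realDifferential (B := plane) e (e.symm u))
        (realDifferential (B := plane) e (e.symm u)))
  let v : ℂ → C.F := fun u => C.map (B := plane) (fun q => e q - u) (e.symm u) (0 : ℂ) (w u)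
  have hv : ∀ u ∈ e.target, v u ∈ W := fun u hu => by
    have h0 : (fun q => e q - u) (e.symm u) = 0 := by simp [e.right_inv hu]
    exact C.toFBundleFunctor.map_fil_mem (B := plane) h0
      (isConformalGerm_chart he (e.map_target hu) u) (hi _ _)
  -- the coefficients in a basis of `W` are smooth, since `T` is a smooth section
  have hsum : ∀ u ∈ e.target, v u = ∑ k, l k (v u) • (b k : C.F) := fun u hu => by
    have h1 := congrArg (Subtype.val) (b.sum_repr ⟨v u, hv u hu⟩)
    rw [Submodule.coe_sum] at h1
    refine h1.symm.trans (Finset.sum_congr rfl fun k _ => ?_)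
    have h2 := congrArg (fun L => L ⟨v u, hv u hu⟩) (hl k)
    change l k (v u) = b.repr ⟨v u, hv u hu⟩ k at h2
    rw [h2]; rfl
  have hne : ∀ᶠ u in 𝓝 u₀, ∀ i, (φ i).1 ≠ e.symm u := by
    rw [eventually_all]
    intro i
    have h1 : {(φ i).1}ᶜ ∈ 𝓝 (e.symm u₀) := isOpen_compl_singleton.mem_nhds (hp i).symm
    filter_upwards [(e.continuousAt_symm hu₀) h1] with u hu h2
    exact hu h2.symm
  have hsm : ContDiffAt ℝ ∞ (fun u => ∑ k, l k (v u) * C.corr A μ (Fin.cons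
      (C.toFBundleFunctor.place (fun z => e.symm (z + u)) (b k : C.F)) φ :
        Fin (N + 1) → C.Field A)) u₀ := by
    refine ContDiffAt.sum fun k _ => ContDiffAt.mul ?_ (C.contDiffAt_corr_place hA hφ he hu₀ hp _)
    exact (hT e he B (l k)).contDiffAt (e.open_target.mem_nhds hu₀)
  refine hsm.congr_of_eventuallyEq ?_
  filter_upwards [hne, e.open_target.mem_nhds hu₀] with u hu hut
  have h1 : w u = ∑ k, l k (v u) •
      C.map (A := plane) (fun z => e.symm (z + u)) (0 : ℂ) (e.symm u) (b k : C.F) := by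
    have h2 := C.toFBundleFunctor.map_chart_symm_map_chart he (e.map_target hut) (w u)
    rw [e.right_inv hut] at h2
    rw [← h2]
    change C.map (A := plane) (fun z => e.symm (z + u)) (0 : ℂ) (e.symm u) (v u) = _
    conv_lhs => rw [hsum u hut]
    rw [map_sum]
    exact Finset.sum_congr rfl fun k _ => map_smul _ _ _
  change C.corr A μ (Fin.cons ⟨e.symm u, w u⟩ φ : Fin (N + 1) → C.Field A) = _
  rw [h1, C.corr_cons_sum hA hφ hu]
  refine Finset.sum_congr rfl fun k _ => ?_
  have h3 := C.toFBundleFunctor.place_eq_of_chart (e.map_target hut) (b k : C.F)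
  rw [e.right_inv hut] at h3
  rw [h3]

end ConformalFieldTheory

/-! ### Variations of the flat metric -/

/-- The Wirtinger derivative `∂/∂z̄`. -/
def wirtingerBar (h : ℂ → ℂ) (u : ℂ) : ℂ :=
  (fderiv ℝ h u 1 + Complex.I * fderiv ℝ h u Complex.I) / 2

lemma deriv_smul_add_smul_add_smul {V : Type*} [NormedAddCommGroup V] [NormedSpace ℝ V]
    {f₁ f₂ f₃ : ℝ → ℝ} {f₁' f₂' f₃' t : ℝ} (h₁ : HasDerivAt f₁ f₁' t) (h₂ : HasDerivAt f₂ f₂' t)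
    (h₃ : HasDerivAt f₃ f₃' t) (v₁ v₂ v₃ : V) :
    deriv (fun t => f₁ t • v₁ + f₂ t • v₂ + f₃ t • v₃) t = f₁' • v₁ + f₂' • v₂ + f₃' • v₃ :=
  (((h₁.smul_const v₁).add (h₂.smul_const v₂)).add (h₃.smul_const v₃)).deriv

lemma reForm_apply (z w : ℂ) : reForm z w = z.re * w.re - z.im * w.im := by
  change (z * w).re = _; simp

lemma imForm_apply (z w : ℂ) : imForm z w = z.re * w.im + z.im * w.re := by
  change (z * w).im = _; simp

/-- The Euclidean metric of the plane. -/
abbrev euclideanForm : Form := innerSL ℝ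

/-- The variation of the flat metric under the displacement with differential `L`: its part of
type `(0, 2)` is the `z̄`-derivative of the displacement. -/
lemma deriv_flat_metric (L : ℂ →L[ℝ] ℂ) :
    deriv (fun t : ℝ => euclideanForm.bilinearComp (ContinuousLinearMap.id ℝ ℂ + t • L)
      (ContinuousLinearMap.id ℝ ℂ + t • L)) 0 =
    (2 * ((L 1 - Complex.I * L Complex.I) / 2).re) • euclideanForm +
      (2 * ((L 1 + Complex.I * L Complex.I) / 2).re) • reForm +
      (2 * ((L 1 + Complex.I * L Complex.I) / 2).im) • imForm := by
  set p := (L 1 - Complex.I * L Complex.I) / 2 with hp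
  set q := (L 1 + Complex.I * L Complex.I) / 2 with hq
  -- the parts of `L` of type `(1, 0)` and `(0, 1)`
  have hL (z : ℂ) : L z = p * z + q * (starRingEnd ℂ) z := by
    have h1 : z = z.re • (1 : ℂ) + z.im • Complex.I := by
      simp [Complex.re_add_im]
    conv_lhs => rw [h1]
    rw [map_add, map_smul, map_smul, hp, hq]
    apply Complex.ext <;> simp <;> ring
  have hfun : (fun t : ℝ => euclideanForm.bilinearComp (ContinuousLinearMap.id ℝ ℂ + t • L)
      (ContinuousLinearMap.id ℝ ℂ + t • L)) = fun t : ℝ =>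
      ((1 + t * p.re) ^ 2 + (t * p.im) ^ 2 + t ^ 2 * (q.re ^ 2 + q.im ^ 2)) • euclideanForm +
      (2 * t * (q.re * (1 + t * p.re) + q.im * (t * p.im))) • reForm +
      (2 * t * (q.im * (1 + t * p.re) - q.re * (t * p.im))) • imForm := by
    funext t
    refine ContinuousLinearMap.ext fun z => ContinuousLinearMap.ext fun w => ?_
    change euclideanForm (z + t • L z) (w + t • L w) = _ * euclideanForm z w +
      _ * reForm z w + _ * imForm z w
    rw [innerSL_complex_apply, innerSL_complex_apply, reForm_apply, imForm_apply, hL, hL]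
    simp
    ring
  rw [hfun]
  have hid := hasDerivAt_id (0 : ℝ)
  refine deriv_smul_add_smul_add_smul (V := Form) ?_ ?_ ?_ _ _ _
  · have h1 : HasDerivAt (fun t : ℝ => 1 + t * p.re) p.re 0 := by
      simpa using (hid.mul_const p.re).const_add 1
    have h2 : HasDerivAt (fun t : ℝ => t * p.im) p.im 0 := by simpa using hid.mul_const p.im
    have h3 := ((h1.pow 2).add (h2.pow 2)).add ((hid.pow 2).mul_const (q.re ^ 2 + q.im ^ 2))
    refine h3.congr_deriv ?_
    simp
  · have h1 : HasDerivAt (fun t : ℝ => 2 * t) 2 0 := by simpa using hid.const_mul 2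
    have h2 : HasDerivAt (fun t : ℝ => q.re * (1 + t * p.re) + q.im * (t * p.im))
        (q.re * p.re + q.im * p.im) 0 := by
      have h3 := ((hid.mul_const p.re).const_add 1).const_mul q.re
      have h4 := (hid.mul_const p.im).const_mul q.im
      refine (h3.add h4).congr_deriv (by simp)
    refine (h1.mul h2).congr_deriv ?_
    simp
  · have h1 : HasDerivAt (fun t : ℝ => 2 * t) 2 0 := by simpa using hid.const_mul 2
    have h2 : HasDerivAt (fun t : ℝ => q.im * (1 + t * p.re) - q.re * (t * p.im))
        (q.im * p.re - q.re * p.im) 0 := by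
      have h3 := ((hid.mul_const p.re).const_add 1).const_mul q.im
      have h4 := (hid.mul_const p.im).const_mul q.re
      refine (h3.sub h4).congr_deriv (by simp)
    refine (h1.mul h2).congr_deriv ?_
    simp

namespace Hyperelliptic

open RiemannSurface

variable {g : ℕ} {a : ℂ} (ha : a ≠ 0) (X : Config g) {κ : Cutoff} {δ : ℝ}

/-! ### The flat part of the curve -/

lemma chartAt_eventuallyEq_coordChart {P : AffineCurve a X.1} {h : P.1.2 ≠ 0}
    {q : hyperellipticCurve ha X} (hq : q ∈ (coordChart ha X P h).source) :
    chartAt ℂ q =ᶠ[𝓝 q] coordChart ha X P h := by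
  have hu : q ∈ unramified ha X := exists_of_mem_coordChart_source ha X hq
  filter_upwards [chartAt_eventuallyEq_xCoord ha X hu,
    (coordChart ha X P h).open_source.mem_nhds hq] with q' h1 h2
  rw [h1, coordChart_eq_xCoord ha X h2]

lemma conformalFactor_coordChart (μ : hyperellipticCurve ha X → ℝ) {P : AffineCurve a X.1}
    {h : P.1.2 ≠ 0} {u : ℂ} (hu : u ∈ (coordChart ha X P h).target) :
    conformalFactor μ (coordChart ha X P h) u = μ ((coordChart ha X P h).symm u) := by
  rw [conformalFactor_eq, realDifferential_chart_symm_eq_id hu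
    (chartAt_eventuallyEq_coordChart ha X ((coordChart ha X P h).map_target hu))]
  simp

/-- The part of the plane on which the metric regularised at the scale `δ` is flat. -/
def flatPlane {n : ℕ} (δ : ℝ) (X : Fin n → ℂ) : Set ℂ := {x | (∀ j, δ < ‖x - X j‖) ∧ δ * ‖x‖ < 1}

lemma isOpen_flatPlane {n : ℕ} (δ : ℝ) (X : Fin n → ℂ) : IsOpen (flatPlane δ X) := by
  have : flatPlane δ X = (⋂ j, {x | δ < ‖x - X j‖}) ∩ {x | δ * ‖x‖ < 1} := by
    ext; simp [flatPlane]
  rw [this]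
  exact (isOpen_iInter_of_finite fun j => isOpen_lt continuous_const (by fun_prop)).inter
    (isOpen_lt (by fun_prop) continuous_const)

lemma planeMetric_of_mem_flatPlane {n : ℕ} {X : Fin n → ℂ} (hδ : 0 < δ) {x : ℂ}
    (hx : x ∈ flatPlane δ X) : planeMetric κ δ X x = 1 :=
  planeMetric_flat hδ (fun j => (hx.1 j).le) hx.2.le

/-- The part of the curve on which the metric regularised at the scale `δ` is flat, without the
positions of the fields `φ`. -/
def flatPart (δ : ℝ) {N : ℕ} {V : hyperellipticCurve ha X → Type u} (φ : Fin N → Σ p, V p) :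
    Set (hyperellipticCurve ha X) :=
  {q | q ∈ unramified ha X ∧ xCoord ha X q ∈ flatPlane δ X.1 ∧ ∀ i, (φ i).1 ≠ q}

section FlatPart

variable {N : ℕ} {V : hyperellipticCurve ha X → Type u} (φ : Fin N → Σ p, V p)

lemma isOpen_flatPart : IsOpen (flatPart ha X δ φ) := by
  rw [isOpen_iff_mem_nhds]
  rintro q ⟨h1, h2, h3⟩
  have h4 : ∀ᶠ q' in 𝓝 q, ∀ i, (φ i).1 ≠ q' := by
    rw [eventually_all]
    intro i
    have h1 : {(φ i).1}ᶜ ∈ 𝓝 q := isOpen_compl_singleton.mem_nhds (h3 i).symm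
    filter_upwards [h1] with u hu h2
    exact hu h2.symm
  filter_upwards [(isOpen_unramified ha X).mem_nhds h1, h4,
    (continuousAt_xCoord ha X h1) ((isOpen_flatPlane δ X.1).mem_nhds h2)] with q' h1 h2 h3
  exact ⟨h1, h3, h2⟩

variable {X φ}

lemma regularizedMetric_flat (hδ : 0 < δ) {q : hyperellipticCurve ha X}
    (hq : q ∈ flatPart ha X δ φ) : regularizedMetric ha κ δ X q = 1 := by
  rw [regularizedMetric_unramified ha X hq.1, planeMetric_of_mem_flatPlane hδ hq.2.1]

lemma conformalFactor_flat (hδ : 0 < δ) {q : hyperellipticCurve ha X}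
    (hq : q ∈ flatPart ha X δ φ) : conformalFactor (regularizedMetric ha κ δ X) (chartAt ℂ q)
      =ᶠ[𝓝 (chartAt ℂ q q)] fun _ => 1 := by
  have h1 := (tendsto_chart_symm q).eventually ((isOpen_flatPart ha X φ (δ := δ)).mem_nhds hq)
  have h2 := (chartAt ℂ q).open_target.mem_nhds (mem_chart_target ℂ q)
  obtain ⟨P, h, rfl⟩ := hq.1
  rw [chartAt_curvePoint ha X h] at h1 h2 ⊢
  filter_upwards [h1, h2] with u hu hut
  rw [conformalFactor_coordChart ha X _ hut]
  exact regularizedMetric_flat ha hδ hu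

lemma scalarCurvature_flat (hδ : 0 < δ) {q : hyperellipticCurve ha X}
    (hq : q ∈ flatPart ha X δ φ) : scalarCurvature (regularizedMetric ha κ δ X) q = 0 := by
  have h1 : (fun u => Real.log (conformalFactor (regularizedMetric ha κ δ X) (chartAt ℂ q) u))
      =ᶠ[𝓝 (chartAt ℂ q q)] fun _ => 0 := by
    filter_upwards [conformalFactor_flat ha hδ hq] with u hu
    rw [hu, Real.log_one]
  rw [scalarCurvature, (InnerProductSpace.laplacian_congr_nhds h1).self_of_nhds]
  simp

end FlatPart

end Hyperelliptic

namespace ConformalFieldTheory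

open RiemannSurface Hyperelliptic

variable {S : Type} [TopologicalSpace S] (C : ConformalFieldTheory.{u} S)

variable {g : ℕ} {a : ℂ} (ha : a ≠ 0) {X : Config g} {κ : Cutoff} {δ : ℝ} {N : ℕ}
  (φ : Fin N → C.Field (hyperellipticCurve ha X))

variable (κ δ) in
/-- The `N+1`-point function of the component `(T, B)` of the energy momentum tensor at `p`. -/
def tensorCorr (B : Form) (p : hyperellipticCurve ha X) : ℂ :=
  C.corr (hyperellipticCurve ha X) (regularizedMetric ha κ δ X)
    (Fin.cons ⟨p, C.T (hyperellipticCurve ha X) (regularizedMetric ha κ δ X) p B⟩ φ :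
      Fin (N + 1) → C.Field (hyperellipticCurve ha X))

variable (κ δ) in
/-- The `N+1`-point function of the pairing `(T, dz̄²)` of the energy momentum tensor, for the
coordinate `z = chartAt ℂ p`. -/
def stressCorr (p : hyperellipticCurve ha X) : ℂ :=
  C.tensorCorr ha κ δ φ reForm p - Complex.I * C.tensorCorr ha κ δ φ imForm p

variable {φ} (hA : IsMetricSurface S (hyperellipticCurve ha X) (regularizedMetric ha κ δ X))
  (hφ : Separated φ) (hδ : 0 < δ)

include hA hφ

lemma tensorCorr_add {p : hyperellipticCurve ha X} (hp : ∀ i, (φ i).1 ≠ p) (B B' : Form) :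
    C.tensorCorr ha κ δ φ (B + B') p =
      C.tensorCorr ha κ δ φ B p + C.tensorCorr ha κ δ φ B' p := by
  unfold tensorCorr
  rw [map_add, C.corr_cons_add hA hφ hp]

lemma tensorCorr_smul {p : hyperellipticCurve ha X} (hp : ∀ i, (φ i).1 ≠ p) (r : ℝ) (B : Form) :
    C.tensorCorr ha κ δ φ (r • B) p = r * C.tensorCorr ha κ δ φ B p := by
  unfold tensorCorr
  rw [C.T_smul, C.corr_cons_smul hA hφ hp]

lemma tensorCorr_zero {p : hyperellipticCurve ha X} (hp : ∀ i, (φ i).1 ≠ p) :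
    C.tensorCorr ha κ δ φ 0 p = 0 := by
  unfold tensorCorr
  rw [map_zero]
  have := C.corr_cons_smul hA hφ hp 0 0
  simpa using this

include hδ

/-- The trace of the energy momentum tensor vanishes where the metric is flat. -/
lemma tensorCorr_euclideanForm {p : hyperellipticCurve ha X} (hp : p ∈ flatPart ha X δ φ) :
    C.tensorCorr ha κ δ φ euclideanForm p = 0 := by
  have h1 := C.T_metric hA p
  rw [regularizedMetric_flat ha hδ hp, one_smul, scalarCurvature_flat ha hδ hp] at h1
  unfold tensorCorr
  rw [h1, C.corr_cons_smul hA hφ hp.2.2]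
  simp

/-- Where the metric is `|dx|²` the anomalous term of the Virasoro field vanishes, and what remains is
`2π T_zz = -π (T, dz̄²)`. -/
lemma corr_virasoro {p : hyperellipticCurve ha X} (hp : p ∈ flatPart ha X δ φ) :
    C.corr (hyperellipticCurve ha X) (regularizedMetric ha κ δ X)
      (Fin.cons ⟨p, C.virasoro (hyperellipticCurve ha X) (regularizedMetric ha κ δ X) p⟩ φ :
        Fin (N + 1) → C.Field (hyperellipticCurve ha X)) =
      -Real.pi * C.stressCorr ha κ δ φ p := by
  set Γ : ℂ → ℂ := wirtinger fun u =>
    (Real.log (conformalFactor (regularizedMetric ha κ δ X) (chartAt ℂ p) u) : ℂ) with hΓ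
  have h1 : Γ =ᶠ[𝓝 (chartAt ℂ p p)] fun _ => 0 := by
    filter_upwards [(conformalFactor_flat (κ := κ) ha hδ hp).eventually_nhds] with u hu
    have h2 : (fun u => (Real.log (conformalFactor (regularizedMetric ha κ δ X)
        (chartAt ℂ p) u) : ℂ)) =ᶠ[𝓝 u] fun _ => 0 := by
      filter_upwards [hu] with v hv
      rw [hv, Real.log_one, Complex.ofReal_zero]
    rw [hΓ, wirtinger, h2.fderiv_eq]
    simp
  have h3 : wirtinger Γ (chartAt ℂ p p) = 0 := by
    rw [wirtinger, h1.fderiv_eq]; simp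
  have h4 : C.virasoro (hyperellipticCurve ha X) (regularizedMetric ha κ δ X) p =
      (2 * Real.pi : ℂ) • C.Tzz (hyperellipticCurve ha X) (regularizedMetric ha κ δ X) p := by
    simp only [virasoro]
    rw [← hΓ, h3, h1.self_of_nhds]
    simp
  rw [h4, Tzz, regularizedMetric_flat ha hδ hp, smul_smul, C.corr_cons_smul hA hφ hp.2.2,
    sub_eq_add_neg, ← neg_smul, C.corr_cons_add hA hφ hp.2.2, C.corr_cons_smul hA hφ hp.2.2,
    stressCorr, tensorCorr, tensorCorr]
  push_cast
  ring

omit hδ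

lemma contDiffAt_tensorCorr {P : AffineCurve a X.1} (h : P.1.2 ≠ 0) {u₀ : ℂ}
    (hu₀ : u₀ ∈ (coordChart ha X P h).target)
    (hp : ∀ i, (φ i).1 ≠ (coordChart ha X P h).symm u₀) (B : Form) :
    ContDiffAt ℝ ∞ (fun u => C.tensorCorr ha κ δ φ B ((coordChart ha X P h).symm u)) u₀ := by
  refine (C.contDiffAt_corr_T hA hφ (coordChart_mem_atlas ha X P h) hu₀ hp
    B).congr_of_eventuallyEq ?_
  filter_upwards [(coordChart ha X P h).open_target.mem_nhds hu₀] with u hu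
  have h1 := (coordChart ha X P h).map_target hu
  rw [realDifferential_chart_eq_id h1 (chartAt_eventuallyEq_coordChart ha X h1)]
  rfl

lemma contDiffAt_stressCorr {P : AffineCurve a X.1} (h : P.1.2 ≠ 0) {u₀ : ℂ}
    (hu₀ : u₀ ∈ (coordChart ha X P h).target)
    (hp : ∀ i, (φ i).1 ≠ (coordChart ha X P h).symm u₀) :
    ContDiffAt ℝ ∞ (fun u => C.stressCorr ha κ δ φ ((coordChart ha X P h).symm u)) u₀ :=
  (C.contDiffAt_tensorCorr ha hA hφ h hu₀ hp _).sub
    (contDiffAt_const.mul (C.contDiffAt_tensorCorr ha hA hφ h hu₀ hp _))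

lemma continuousAt_tensorCorr {q : hyperellipticCurve ha X} (hq : q ∈ flatPart ha X δ φ) (B : Form) :
    ContinuousAt (C.tensorCorr ha κ δ φ B) q := by
  obtain ⟨P, h, rfl⟩ := hq.1
  have hs := mem_coordChart_source_self ha X h
  set e := coordChart ha X P h with he
  have h1 : ContinuousAt (fun u => C.tensorCorr ha κ δ φ B (e.symm u)) (e (curvePoint ha X P)) :=
    (C.contDiffAt_tensorCorr ha hA hφ h (e.map_source hs)
      (by rw [← he, e.left_inv hs]; exact hq.2.2) B).continuousAt
  have h2 := ContinuousAt.comp (f := e) h1 (e.continuousAt hs)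
  refine h2.congr ?_
  filter_upwards [e.open_source.mem_nhds hs] with q hq
  simp only [Function.comp, e.left_inv hq]

lemma continuousAt_stressCorr {q : hyperellipticCurve ha X} (hq : q ∈ flatPart ha X δ φ) :
    ContinuousAt (C.stressCorr ha κ δ φ) q :=
  (C.continuousAt_tensorCorr ha hA hφ hq _).sub
    (continuousAt_const.mul (C.continuousAt_tensorCorr ha hA hφ hq _))

end ConformalFieldTheory

/-! ### The Einstein derivative along a deformation -/

lemma deriv_const_smul_bilinearComp (L : ℂ →L[ℝ] ℂ) {Q : ℝ → Form}
    (hQ : Q =ᶠ[𝓝 0] fun t => (1 : ℝ) • euclideanForm.bilinearComp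
      (ContinuousLinearMap.id ℝ ℂ + t • L) (ContinuousLinearMap.id ℝ ℂ + t • L)) :
    deriv Q 0 = (2 * ((L 1 - Complex.I * L Complex.I) / 2).re) • euclideanForm +
      (2 * ((L 1 + Complex.I * L Complex.I) / 2).re) • reForm +
      (2 * ((L 1 + Complex.I * L Complex.I) / 2).im) • imForm := by
  rw [← deriv_flat_metric]
  refine Filter.EventuallyEq.deriv_eq (hQ.trans (Eventually.of_forall fun t => ?_))
  exact one_smul ℝ _

lemma deriv_eventually_const_form {Q : ℝ → Form} {B : Form} (hQ : ∀ᶠ t in 𝓝 0, Q t = B) :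
    deriv Q 0 = 0 :=
  (Filter.EventuallyEq.deriv_eq (f := fun _ => B) hQ).trans (deriv_const _ _)

namespace Hyperelliptic

open RiemannSurface

variable {g : ℕ} {a : ℂ} {ha : a ≠ 0} {S : Type} [TopologicalSpace S]
  {C : ConformalFieldTheory.{u} S} {X : Config g} {κ : Cutoff} {δ : ℝ} {N : ℕ}
  {φ : Fin N → C.Field (hyperellipticCurve ha X)}

/-- Along a deformation that is a translation in `x` off the flat part of the curve, and that has
the velocity `v` there, the derivative of an `N`-point function is the integral of the traceless part
of `T` paired with `b = ∂v/∂z̄`. The trace of `T` vanishes on the flat part. -/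
theorem IsDeformation.hasDerivAt_corr {U : Set ℝ} {Y : ℝ → Config g}
    {f : ∀ t, hyperellipticCurve ha X ≃ₜ hyperellipticCurve ha (Y t)}
    (h : IsDeformation κ δ U X Y f) (h0 : (0 : ℝ) ∈ U) (hf0 : IsTranslationOn ha (f 0) Set.univ)
    (hA : IsMetricSurface S (hyperellipticCurve ha X) (regularizedMetric ha κ δ X))
    (hφ : Separated φ) (hφf : ∀ i, ∃ V, (φ i).1 ∈ V ∧ ∀ t ∈ U, IsTranslationOn ha (f t) V)
    {b : hyperellipticCurve ha X → ℂ} (hb : ∀ p, p ∉ flatPart ha X δ φ → b p = 0)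
    (hV : ∀ p ∈ flatPart ha X δ φ, ∃ v : ℂ → ℂ, DifferentiableAt ℝ v (xCoord ha X p) ∧
      wirtingerBar v (xCoord ha X p) = b p ∧ ∀ t ∈ U,
        (fun q => xCoord ha (Y t) (f t q)) =ᶠ[𝓝 p] fun q => xCoord ha X q + t • v (xCoord ha X q))
    (hT : ∀ p, p ∉ flatPart ha X δ φ → (∀ i, (φ i).1 ≠ p) →
      ∃ V, p ∈ V ∧ ∀ t ∈ U, IsTranslationOn ha (f t) V) :
    HasDerivAt (fun t => C.corr (hyperellipticCurve ha (Y t)) (regularizedMetric ha κ δ (Y t))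
        fun i => C.toFBundleFunctor.push (f t) (φ i))
      (∫ p, 2 * (((b p).re : ℂ) * C.tensorCorr ha κ δ φ reForm p +
        ((b p).im : ℂ) * C.tensorCorr ha κ δ φ imForm p)
          ∂(riemannianVolume (regularizedMetric ha κ δ X))) 0 := by
  have hE := C.einstein_derivative U (hyperellipticCurve ha X) (regularizedMetric ha κ δ X)
    (fun t => hyperellipticCurve ha (Y t)) (fun t => regularizedMetric ha κ δ (Y t)) f hA
    h.isSmoothFamily h0 (fun p => h.metricPullback_of_translation h0 hf0 trivial) φ hφ
    (fun i => by
      obtain ⟨V, hV, hVt⟩ := hφf i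
      refine ⟨V, (hVt 0 h0).isOpen.mem_nhds hV, fun t ht p hp => ?_⟩
      exact (mdifferentiableAt_of_translation (f t).continuous (h.unramified t ht) (hVt t ht)
        hp).mdifferentiableWithinAt)
  refine hE.congr_deriv (integral_congr_ae ?_)
  have hU : U ∈ 𝓝 (0 : ℝ) := h.isOpen.mem_nhds h0
  filter_upwards [C.ae_ne_position hA.metric.1 φ] with p hp
  change C.tensorCorr ha κ δ φ _ p = _
  by_cases hpf : p ∈ flatPart ha X δ φ
  · obtain ⟨v, hv, hvb, hvf⟩ := hV p hpf
    rw [deriv_const_smul_bilinearComp (fderiv ℝ v (xCoord ha X p)),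
      C.tensorCorr_add ha hA hφ hp, C.tensorCorr_add ha hA hφ hp, C.tensorCorr_smul ha hA hφ hp,
      C.tensorCorr_smul ha hA hφ hp, C.tensorCorr_smul ha hA hφ hp,
      C.tensorCorr_euclideanForm ha hA hφ h.scale_base.pos hpf, ← hvb, wirtingerBar]
    · push_cast
      ring
    · filter_upwards [hU] with t ht
      have hfd : fderiv ℝ (fun x => x + t • v x) (xCoord ha X p) =
          ContinuousLinearMap.id ℝ ℂ + t • fderiv ℝ v (xCoord ha X p) :=
        ((hasFDerivAt_id _).add (hv.hasFDerivAt.const_smul t)).fderiv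
      rw [h.metricPullback_eq ht hpf.1 (ψ := fun x => x + t • v x)
        (differentiableAt_fun_id.add (hv.const_smul t)) (hvf t ht),
        regularizedMetric_flat ha h.scale_base.pos hpf, hfd]
  · obtain ⟨V, hpV, hVt⟩ := hT p hpf hp
    rw [hb p hpf, deriv_eventually_const_form (B := regularizedMetric ha κ δ X p • euclideanForm),
      C.tensorCorr_zero ha hA hφ hp]
    · simp
    · filter_upwards [hU] with t ht
      exact h.metricPullback_of_translation ht (hVt t ht) hpV

end Hyperelliptic

/-! ### Deformations supported in one chart -/

/-- The homeomorphism that is `ψ` in the chart `e` and the identity elsewhere, for a homeomorphism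
`ψ` of the plane that is the identity outside of a compact part of the range of the chart. -/
def chartHomeomorph {A : Type*} [TopologicalSpace A] [T2Space A] (e : OpenPartialHomeomorph A ℂ)
    {K : Set ℂ} (hK : IsCompact K) (hKe : K ⊆ e.target) (ψ : ℂ ≃ₜ ℂ) (hψ : ∀ x ∉ K, ψ x = x) :
    A ≃ₜ A :=
  have key : ∀ ψ : ℂ ≃ₜ ℂ, (∀ x ∉ K, ψ x = x) → ∀ x ∈ e.target, ψ x ∈ e.target := by
    intro ψ hψ x hx
    by_contra h
    have h1 : ψ (ψ x) = ψ x := hψ _ fun h' => h (hKe h')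
    exact h (by rw [ψ.injective h1]; exact hx)
  have hcont : ∀ ψ : ℂ ≃ₜ ℂ, (∀ x ∉ K, ψ x = x) →
      Continuous (open Classical in fun p => if p ∈ e.source then e.symm (ψ (e p)) else p) := by
    intro ψ hψ
    rw [continuous_iff_continuousAt]
    intro p
    by_cases hp : p ∈ e.source
    · have h1 : ContinuousAt (fun p => e.symm (ψ (e p))) p :=
        ContinuousAt.comp (g := e.symm) (f := fun p => ψ (e p))
          (e.continuousAt_symm (key ψ hψ _ (e.map_source hp)))
          (ψ.continuous.continuousAt.comp (e.continuousAt hp))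
      refine h1.congr ?_
      filter_upwards [e.open_source.mem_nhds hp] with q hq
      rw [if_pos hq]
    · have h1 : IsClosed (e.symm '' K) := (hK.image_of_continuousOn
        (e.continuousOn_symm.mono hKe)).isClosed
      -- near points outside of the chart the map is the identity, as the image of `K` is closed
      have h2 : p ∉ e.symm '' K := by
        rintro ⟨x, hx, rfl⟩; exact hp (e.map_target (hKe hx))
      refine continuousAt_id.congr ?_
      filter_upwards [h1.isOpen_compl.mem_nhds h2] with q hq
      split_ifs with hqe
      · rw [hψ, e.left_inv hqe]; rfl
        exact fun h => hq ⟨e q, h, e.left_inv hqe⟩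
      · rfl
  have hsymm : ∀ x ∉ K, ψ.symm x = x := fun x hx => by
    conv_lhs => rw [← hψ x hx]
    exact ψ.symm_apply_apply x
  { toFun := open Classical in fun p => if p ∈ e.source then e.symm (ψ (e p)) else p
    invFun := open Classical in fun p => if p ∈ e.source then e.symm (ψ.symm (e p)) else p
    left_inv := fun p => by
      by_cases hp : p ∈ e.source
      · have h1 := key ψ hψ _ (e.map_source hp)
        dsimp only
        rw [if_pos hp, if_pos (e.map_target h1), e.right_inv h1, ψ.symm_apply_apply, e.left_inv hp]
      · dsimp only
        rw [if_neg hp, if_neg hp]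
    right_inv := fun p => by
      by_cases hp : p ∈ e.source
      · have h1 := key ψ.symm hsymm _ (e.map_source hp)
        dsimp only
        rw [if_pos hp, if_pos (e.map_target h1), e.right_inv h1, ψ.apply_symm_apply, e.left_inv hp]
      · dsimp only
        rw [if_neg hp, if_neg hp]
    continuous_toFun := hcont ψ hψ
    continuous_invFun := hcont ψ.symm hsymm }

section ChartHomeomorph

variable {A : Type*} [TopologicalSpace A] [T2Space A] (e : OpenPartialHomeomorph A ℂ)
    {K : Set ℂ} (hK : IsCompact K) (hKe : K ⊆ e.target) (ψ : ℂ ≃ₜ ℂ) (hψ : ∀ x ∉ K, ψ x = x)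

lemma chartHomeomorph_apply_of_mem {p : A} (hp : p ∈ e.source) :
    chartHomeomorph e hK hKe ψ hψ p = e.symm (ψ (e p)) := if_pos hp

lemma chartHomeomorph_apply_of_notMem_image {p : A} (hp : p ∉ e.symm '' K) :
    chartHomeomorph e hK hKe ψ hψ p = p := by
  by_cases hpe : p ∈ e.source
  · rw [chartHomeomorph_apply_of_mem e hK hKe ψ hψ hpe, hψ, e.left_inv hpe]
    exact fun h => hp ⟨e p, h, e.left_inv hpe⟩
  · exact if_neg hpe

lemma homeomorph_mem_of_eq_self_off {K : Set ℂ} (ψ : ℂ ≃ₜ ℂ) (hψ : ∀ x ∉ K, ψ x = x) {x : ℂ}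
    (hx : x ∈ K) : ψ x ∈ K := by
  by_contra h
  have h1 : ψ (ψ x) = ψ x := hψ _ h
  rw [ψ.injective h1] at h
  exact h hx

end ChartHomeomorph

namespace Hyperelliptic

open RiemannSurface

variable {g : ℕ} {a : ℂ} (ha : a ≠ 0) {X : Config g} {κ : Cutoff} {δ : ℝ}

section

variable {D : ℂ → ℂ} {c : ℝ≥0} (hc : LipschitzWith c D)

include hc in
lemma lipschitzWith_smul_real (t : ℝ) : LipschitzWith (‖t‖₊ * c) (fun x => t • D x) := by
  refine LipschitzWith.of_dist_le_mul fun x y => ?_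
  have := hc.dist_le_mul x y
  rw [dist_eq_norm, ← smul_sub, norm_smul, ← dist_eq_norm]
  push_cast
  rw [mul_assoc]
  exact mul_le_mul_of_nonneg_left this (norm_nonneg t)

open Classical in
/-- The deformation `x ↦ x + t D x` on one sheet over the support of `D`. -/
def sheetHomeomorph {P : AffineCurve a X.1} (h : P.1.2 ≠ 0) (hD : HasCompactSupport D)
    (hDe : tsupport D ⊆ (coordChart ha X P h).target) (t : ℝ) :
    hyperellipticCurve ha X ≃ₜ hyperellipticCurve ha X :=
  if ht : ‖t‖₊ * c < 1 then
    chartHomeomorph (coordChart ha X P h) hD.isCompact hDe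
      (displacementHomeomorph (lipschitzWith_smul_real hc t) ht) (fun x hx => by
        rw [displacementHomeomorph_apply, image_eq_zero_of_notMem_tsupport hx]; simp)
  else Homeomorph.refl _

end

section

variable {D : ℂ → ℂ} {c : ℝ≥0} (hc : LipschitzWith c D) {P : AffineCurve a X.1} (h : P.1.2 ≠ 0)
    (hD : HasCompactSupport D) (hDe : tsupport D ⊆ (coordChart ha X P h).target)

lemma sheetHomeomorph_of_notMem (t : ℝ) {q : hyperellipticCurve ha X}
    (hq : q ∉ (coordChart ha X P h).symm '' tsupport D) :
    sheetHomeomorph ha hc h hD hDe t q = q := by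
  unfold sheetHomeomorph
  split_ifs with ht
  · exact chartHomeomorph_apply_of_notMem_image _ _ _ _ _ hq
  · rfl

lemma sheetHomeomorph_of_mem {t : ℝ} (ht : ‖t‖₊ * c < 1) {q : hyperellipticCurve ha X}
    (hq : q ∈ (coordChart ha X P h).source) :
    xCoord ha X (sheetHomeomorph ha hc h hD hDe t q) = xCoord ha X q + t • D (xCoord ha X q) := by
  unfold sheetHomeomorph
  rw [dif_pos ht, chartHomeomorph_apply_of_mem _ _ _ _ _ hq, xCoord_coordChart_symm,
    displacementHomeomorph_apply, coordChart_eq_xCoord ha X hq]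

lemma sheetHomeomorph_mem_unramified (t : ℝ) {q : hyperellipticCurve ha X}
    (hq : q ∈ unramified ha X) : sheetHomeomorph ha hc h hD hDe t q ∈ unramified ha X := by
  by_cases hqD : q ∈ (coordChart ha X P h).symm '' tsupport D
  · have hqe : q ∈ (coordChart ha X P h).source := by
      obtain ⟨x, hx, rfl⟩ := hqD
      exact (coordChart ha X P h).map_target (hDe hx)
    unfold sheetHomeomorph
    split_ifs with ht
    · rw [chartHomeomorph_apply_of_mem _ _ _ _ _ hqe]
      refine exists_of_mem_coordChart_source ha X ((coordChart ha X P h).map_target ?_)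
      obtain ⟨x, hx, rfl⟩ := hqD
      rw [(coordChart ha X P h).right_inv (hDe hx)]
      refine hDe (homeomorph_mem_of_eq_self_off _ (fun x hx => ?_) hx)
      rw [displacementHomeomorph_apply, image_eq_zero_of_notMem_tsupport hx]; simp
    · exact hq
  · rw [sheetHomeomorph_of_notMem ha hc h hD hDe t hqD]; exact hq

include hD hDe in
lemma isClosed_sheet_support : IsClosed ((coordChart ha X P h).symm '' tsupport D) :=
  (hD.isCompact.image_of_continuousOn ((coordChart ha X P h).continuousOn_symm.mono hDe)).isClosed

lemma isTranslationOn_sheetHomeomorph (t : ℝ) : IsTranslationOn ha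
    (sheetHomeomorph ha hc h hD hDe t) ((coordChart ha X P h).symm '' tsupport D)ᶜ :=
  ⟨(isClosed_sheet_support ha h hD hDe).isOpen_compl, 0, fun q hq _ => by
    rw [sheetHomeomorph_of_notMem ha hc h hD hDe t hq, add_zero]⟩

lemma metric_sheetHomeomorph (hδ : 0 < δ) (hDf : tsupport D ⊆ flatPlane δ X.1) (t : ℝ)
    {q : hyperellipticCurve ha X} (hq : q ∈ unramified ha X) :
    regularizedMetric ha κ δ X (sheetHomeomorph ha hc h hD hDe t q) =
      regularizedMetric ha κ δ X q := by
  by_cases hqD : q ∈ (coordChart ha X P h).symm '' tsupport D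
  · have hqe : q ∈ (coordChart ha X P h).source := by
      obtain ⟨x, hx, rfl⟩ := hqD
      exact (coordChart ha X P h).map_target (hDe hx)
    rw [regularizedMetric_unramified ha X (sheetHomeomorph_mem_unramified ha hc h hD hDe t hq),
      regularizedMetric_unramified ha X hq]
    obtain ⟨x, hx, rfl⟩ := hqD
    rw [xCoord_coordChart_symm, planeMetric_of_mem_flatPlane hδ (hDf hx)]
    by_cases ht : ‖t‖₊ * c < 1
    · rw [sheetHomeomorph_of_mem ha hc h hD hDe ht hqe, xCoord_coordChart_symm]
      refine planeMetric_of_mem_flatPlane hδ (hDf ?_)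
      refine homeomorph_mem_of_eq_self_off (displacementHomeomorph (lipschitzWith_smul_real hc t)
        ht) (fun x hx => ?_) hx
      rw [displacementHomeomorph_apply, image_eq_zero_of_notMem_tsupport hx]; simp
    · unfold sheetHomeomorph
      rw [dif_neg ht]
      exact planeMetric_of_mem_flatPlane hδ (hDf hx)
  · rw [sheetHomeomorph_of_notMem ha hc h hD hDe t hqD]

theorem isDeformation_sheetHomeomorph (hδ : IsSmallScale δ X.1) (hDs : ContDiff ℝ ∞ D)
    (hDf : tsupport D ⊆ flatPlane δ X.1) : IsDeformation κ δ {t : ℝ | ‖t‖₊ * c < 1} X (fun _ => X)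
      (sheetHomeomorph ha hc h hD hDe) where
  isOpen := isOpen_lt (by fun_prop) continuous_const
  scale_base := hδ
  scale t _ := hδ
  unramified t _ p hp := sheetHomeomorph_mem_unramified ha hc h hD hDe t hp
  metric t _ p hp := metric_sheetHomeomorph ha hc h hD hDe hδ.pos hDf t hp
  smooth t₀ ht₀ p₀ hp₀ := by
    have hU : {t : ℝ | ‖t‖₊ * c < 1} ∈ 𝓝 t₀ :=
      (isOpen_lt (by fun_prop) continuous_const).mem_nhds ht₀
    by_cases hp : p₀ ∈ (coordChart ha X P h).source
    · refine ⟨fun q => q.2 + q.1 • D q.2, ?_, ?_, ?_⟩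
      · exact (contDiff_snd.add (contDiff_fst.smul (hDs.comp contDiff_snd))).contDiffAt
      · exact det_fderiv_displacement_pos (lipschitzWith_smul_real hc t₀) ht₀
          ((hDs.contDiffAt.differentiableAt (by simp)).const_smul t₀)
      · filter_upwards [prod_mem_nhds hU ((coordChart ha X P h).open_source.mem_nhds hp)] with q hq
        exact sheetHomeomorph_of_mem ha hc h hD hDe hq.1 hq.2
    · refine ⟨fun q => q.2, contDiffAt_snd, ?_, ?_⟩
      · rw [fderiv_fun_id]; exact det_id_pos
      · have h2 : p₀ ∉ (coordChart ha X P h).symm '' tsupport D := by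
          rintro ⟨x, hx, rfl⟩; exact hp ((coordChart ha X P h).map_target (hDe hx))
        filter_upwards [prod_mem_nhds hU
          ((isClosed_sheet_support ha h hD hDe).isOpen_compl.mem_nhds h2)] with q hq
        rw [sheetHomeomorph_of_notMem ha hc h hD hDe _ hq.2]
  ramified p hp := by
    refine ⟨_, ?_, fun t _ => isTranslationOn_sheetHomeomorph ha hc h hD hDe t⟩
    rintro ⟨x, hx, rfl⟩
    exact hp (exists_of_mem_coordChart_source ha X ((coordChart ha X P h).map_target (hDe hx)))

end

end Hyperelliptic

/-! ### Holomorphy of the energy momentum tensor -/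

lemma integrable_mul_of_tsupport_subset {k G : ℂ → ℂ} {Ω : Set ℂ} (hk : Continuous k)
    (hkc : HasCompactSupport k) (hkΩ : tsupport k ⊆ Ω) (hG : ContinuousOn G Ω) :
    Integrable (fun x => k x * G x) := by
  have h1 : IntegrableOn (fun x => k x * G x) (tsupport k) :=
    (hk.continuousOn.mul (hG.mono hkΩ)).integrableOn_compact hkc.isCompact
  refine (integrableOn_iff_integrable_of_support_subset fun x hx => ?_).1 h1
  exact subset_tsupport _ fun h0 => hx (by simp [h0])

lemma tsupport_wirtingerBar_subset (D : ℂ → ℂ) : tsupport (wirtingerBar D) ⊆ tsupport D := by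
  refine closure_minimal (fun x hx => ?_) (isClosed_tsupport D)
  by_contra h
  refine hx ?_
  have h1 : D =ᶠ[𝓝 x] fun _ => 0 := notMem_tsupport_iff_eventuallyEq.1 h
  rw [wirtingerBar, h1.fderiv_eq]; simp

lemma continuous_wirtingerBar {D : ℂ → ℂ} (hD : ContDiff ℝ ∞ D) : Continuous (wirtingerBar D) := by
  have h := hD.continuous_fderiv (by simp)
  have h1 (v : ℂ) : Continuous fun x => fderiv ℝ D x v := h.clm_apply continuous_const
  unfold wirtingerBar
  exact ((h1 1).add (continuous_const.mul (h1 Complex.I))).div_const _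

/-- A smooth function that is holomorphic in the sense of distributions is holomorphic. -/
lemma differentiableOn_of_integral_wirtingerBar {Ω : Set ℂ} (hΩ : IsOpen Ω) {G : ℂ → ℂ}
    (hG : ContDiffOn ℝ ∞ G Ω) (h : ∀ χ : ℂ → ℝ, ContDiff ℝ ∞ χ → HasCompactSupport χ →
      tsupport χ ⊆ Ω → ∫ x, wirtingerBar (fun x => (χ x : ℂ)) x * G x = 0) :
    DifferentiableOn ℂ G Ω := by
  have hGd : ∀ x ∈ Ω, DifferentiableAt ℝ G x := fun x hx =>
    (hG.contDiffAt (hΩ.mem_nhds hx)).differentiableAt (by simp)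
  have hG' : ContinuousOn (fderiv ℝ G) Ω := hG.continuousOn_fderiv_of_isOpen hΩ (by simp)
  have hG'v (v : ℂ) : ContinuousOn (fun x => fderiv ℝ G x v) Ω := hG'.clm_apply continuousOn_const
  have hW : ContinuousOn (wirtingerBar G) Ω :=
    ((hG'v 1).add (continuousOn_const.mul (hG'v Complex.I))).div_const _
  have hae : ∀ᵐ x : ℂ, x ∈ Ω → wirtingerBar G x = 0 := by
    refine hΩ.ae_eq_zero_of_integral_contDiff_smul_eq_zero
      (hW.locallyIntegrableOn hΩ.measurableSet) fun χ hχ hχc hχΩ => ?_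
    set k : ℂ → ℂ := fun x => (χ x : ℂ) with hk
    have hks : ContDiff ℝ ∞ k := Complex.ofRealCLM.contDiff.comp hχ
    have hkt : tsupport k = tsupport χ := by
      unfold tsupport
      congr 1
      ext x; simp [hk]
    have hkc : HasCompactSupport k := by rw [HasCompactSupport, hkt]; exact hχc
    have hkv (v : ℂ) : Continuous fun x => fderiv ℝ k x v :=
      (hks.continuous_fderiv (by simp)).clm_apply continuous_const
    have hkvs (v : ℂ) : tsupport (fun x => fderiv ℝ k x v) ⊆ tsupport k :=
      tsupport_fderiv_apply_subset ℝ v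
    have hkvc (v : ℂ) : HasCompactSupport fun x => fderiv ℝ k x v :=
      hkc.of_isClosed_subset (isClosed_tsupport _) (hkvs v)
    -- integration by parts moves the `z̄`-derivative from the test function to `G`
    have hibp (v : ℂ) : ∫ x, k x * fderiv ℝ G x v = -∫ x, fderiv ℝ k x v * G x :=
      integral_mul_fderiv_eq_neg_fderiv_mul_of_integrable
        (integrable_mul_of_tsupport_subset (hkv v) (hkvc v) ((hkvs v).trans (hkt ▸ hχΩ))
          hG.continuousOn)
        (integrable_mul_of_tsupport_subset hks.continuous hkc (hkt ▸ hχΩ) (hG'v v))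
        (integrable_mul_of_tsupport_subset hks.continuous hkc (hkt ▸ hχΩ) hG.continuousOn)
        (fun x _ => hks.contDiffAt.differentiableAt (by simp))
        (fun x hx => hGd x (hχΩ (hkt ▸ hx)))
    have hi1 (v : ℂ) := integrable_mul_of_tsupport_subset hks.continuous hkc
      (hkt ▸ hχΩ) (hG'v v)
    have hi2 (v : ℂ) := integrable_mul_of_tsupport_subset (hkv v) (hkvc v)
      ((hkvs v).trans (hkt ▸ hχΩ)) hG.continuousOn
    have h1 : ∫ x, χ x • wirtingerBar G x = ((∫ x, k x * fderiv ℝ G x 1) +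
        Complex.I * ∫ x, k x * fderiv ℝ G x Complex.I) / 2 := by
      rw [← integral_const_mul, ← integral_add (hi1 1) ((hi1 Complex.I).const_mul _),
        ← integral_div]
      refine integral_congr_ae (Eventually.of_forall fun x => ?_)
      simp only [wirtingerBar, hk, Complex.real_smul]
      ring
    have h2 : ∫ x, wirtingerBar k x * G x = ((∫ x, fderiv ℝ k x 1 * G x) +
        Complex.I * ∫ x, fderiv ℝ k x Complex.I * G x) / 2 := by
      rw [← integral_const_mul, ← integral_add (hi2 1) ((hi2 Complex.I).const_mul _),
        ← integral_div]
      refine integral_congr_ae (Eventually.of_forall fun x => ?_)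
      simp only [wirtingerBar]
      ring
    have h3 := h χ hχ hχc hχΩ
    rw [h2] at h3
    rw [h1, hibp, hibp]
    linear_combination -h3
  have hzero : ∀ x ∈ Ω, wirtingerBar G x = 0 := by
    have h1 : wirtingerBar G =ᵐ[volume.restrict Ω] fun _ => 0 :=
      (ae_restrict_iff' hΩ.measurableSet).2 hae
    exact Measure.eqOn_open_of_ae_eq h1 hΩ hW continuousOn_const
  intro x hx
  refine DifferentiableAt.differentiableWithinAt ?_
  refine differentiableAt_complex_iff_differentiableAt_real.2 ⟨hGd x hx, ?_⟩
  have h1 := hzero x hx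
  rw [wirtingerBar, div_eq_zero_iff] at h1
  have h2 := h1.resolve_right two_ne_zero
  rw [smul_eq_mul]
  linear_combination (-Complex.I) * h2 + (fderiv ℝ G x Complex.I) * Complex.I_mul_I

namespace ConformalFieldTheory

open RiemannSurface Hyperelliptic

variable {S : Type} [TopologicalSpace S] (C : ConformalFieldTheory.{u} S)

lemma push_eq_self {A : RiemannSurface} {f : A → A} {ψ : C.Field A} (h : f =ᶠ[𝓝 ψ.1] fun x => x) :
    C.toFBundleFunctor.push f ψ = ψ := by
  obtain ⟨p, w⟩ := ψ
  have h0 : f p = p := h.self_of_nhds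
  have hid : IsConformalGerm (fun x : A => x) p :=
    ⟨Set.univ, isOpen_univ, trivial, mdifferentiableOn_id, fun _ _ _ _ h => h⟩
  have h1 := C.toFBundleFunctor.map_congr_apply (q := p) rfl hid h.symm w
  rw [C.map_id] at h1
  unfold FBundleFunctor.push
  simp only
  rw [h0, ← h1]
  rfl

variable {g : ℕ} {a : ℂ} (ha : a ≠ 0) {X : Config g} {κ : Cutoff} {δ : ℝ} {N : ℕ}
  {φ : Fin N → C.Field (hyperellipticCurve ha X)}
  (hA : IsMetricSurface S (hyperellipticCurve ha X) (regularizedMetric ha κ δ X))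
  (hφ : Separated φ) (hδ : IsSmallScale δ X.1)

include hA hφ hδ

/-- The `N`-point functions are invariant under a deformation of one sheet, since it maps the curve to
itself and fixes the fields; so their derivative along the deformation is zero. -/
lemma integral_wirtingerBar_tensorCorr {P : AffineCurve a X.1} (h : P.1.2 ≠ 0) {D : ℂ → ℂ}
    (hDs : ContDiff ℝ ∞ D) (hD : HasCompactSupport D)
    (hDΩ : tsupport D ⊆ (coordChart ha X P h).target ∩
      (coordChart ha X P h).symm ⁻¹' flatPart ha X δ φ) :
    ∫ u, (((wirtingerBar D u).re : ℂ) *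
        C.tensorCorr ha κ δ φ reForm ((coordChart ha X P h).symm u) +
      ((wirtingerBar D u).im : ℂ) *
        C.tensorCorr ha κ δ φ imForm ((coordChart ha X P h).symm u)) = 0 := by
  classical
  obtain ⟨c, hc⟩ := ContDiff.lipschitzWith_of_hasCompactSupport hD
    (hDs.of_le (n := ∞) (m := 1) (by norm_num)) one_ne_zero
  set e := coordChart ha X P h with he
  have hDe : tsupport D ⊆ e.target := fun x hx => (hDΩ hx).1
  have hfam := isDeformation_sheetHomeomorph (κ := κ) ha hc h hD hDe hδ hDs
    (fun x hx => (hDΩ hx).2.2.1)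
  have hoff : ∀ p, p ∉ flatPart ha X δ φ → p ∈ (e.symm '' tsupport D)ᶜ := by
    rintro _ hp ⟨x, hx, rfl⟩
    exact hp (hDΩ hx).2
  have hposn (i : Fin N) : (φ i).1 ∈ (e.symm '' tsupport D)ᶜ :=
    hoff _ fun h => h.2.2 i rfl
  set b : hyperellipticCurve ha X → ℂ := fun p =>
    if p ∈ e.source then wirtingerBar D (e p) else 0 with hb
  have hb0 : ∀ p, p ∉ e.symm '' tsupport D → b p = 0 := by
    intro p hp
    simp only [hb]
    split_ifs with hpe
    · refine image_eq_zero_of_notMem_tsupport fun h => hp ?_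
      exact ⟨e p, tsupport_wirtingerBar_subset D h, e.left_inv hpe⟩
    · rfl
  have hder := hfam.hasDerivAt_corr (C := C) (φ := φ) (b := b) (by simp)
    ⟨isOpen_univ, 0, fun q _ hq => ?_⟩ hA hφ
    (fun i => ⟨_, hposn i, fun t _ => isTranslationOn_sheetHomeomorph ha hc h hD hDe t⟩)
    (fun p hp => hb0 p (hoff p hp)) (fun p hp => ?_)
    (fun p hp _ => ⟨_, hoff p hp, fun t _ => isTranslationOn_sheetHomeomorph ha hc h hD hDe t⟩)
  · have hpush (t : ℝ) : (fun i => C.toFBundleFunctor.push (sheetHomeomorph ha hc h hD hDe t)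
        (φ i)) = φ := by
      funext i
      refine C.push_eq_self ?_
      filter_upwards [(isClosed_sheet_support ha h hD hDe).isOpen_compl.mem_nhds (hposn i)] with q hq
      exact sheetHomeomorph_of_notMem ha hc h hD hDe t hq
    simp only [hpush] at hder
    have h0 := hder.unique (hasDerivAt_const _ _)
    rw [integral_riemannianVolume_of_support hA.metric (coordChart_mem_atlas ha X P h)] at h0
    · rw [← he] at h0
      have h1 : ∀ u, u ∉ tsupport D → wirtingerBar D u = 0 := fun u hu =>
        image_eq_zero_of_notMem_tsupport fun h => hu (tsupport_wirtingerBar_subset D h)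
      have h2 : ∫ u in e.target, (conformalFactor (regularizedMetric ha κ δ X) e u : ℂ) *
          (2 * (((b (e.symm u)).re : ℂ) * C.tensorCorr ha κ δ φ reForm (e.symm u) +
            ((b (e.symm u)).im : ℂ) * C.tensorCorr ha κ δ φ imForm (e.symm u))) =
          ∫ u in e.target, 2 * (((wirtingerBar D u).re : ℂ) *
              C.tensorCorr ha κ δ φ reForm (e.symm u) +
            ((wirtingerBar D u).im : ℂ) * C.tensorCorr ha κ δ φ imForm (e.symm u)) := by
        refine setIntegral_congr_fun e.open_target.measurableSet fun u hu => ?_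
        have hbu : b (e.symm u) = wirtingerBar D u := by
          simp only [hb, if_pos (e.map_target hu), e.right_inv hu]
        simp only [hbu]
        by_cases huD : u ∈ tsupport D
        · rw [conformalFactor_coordChart ha X _ hu, regularizedMetric_flat ha hδ.pos (hDΩ huD).2]
          simp
        · rw [h1 u huD]; simp
      rw [h2, setIntegral_eq_integral_of_forall_compl_eq_zero, integral_const_mul] at h0
      · exact (mul_eq_zero.1 h0).resolve_left two_ne_zero
      · intro u hu
        rw [h1 u fun h => hu (hDe h)]; simp
    · refine Eventually.of_forall fun p hp => ?_
      have : b p = 0 := by simp only [hb]; rw [if_neg hp]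
      rw [this]; simp
  · by_cases hq' : q ∈ e.symm '' tsupport D
    · have hqe : q ∈ e.source := by
        obtain ⟨x, hx, rfl⟩ := hq'
        exact e.map_target (hDe hx)
      rw [sheetHomeomorph_of_mem ha hc h hD hDe (by simp) hqe]; simp
    · rw [sheetHomeomorph_of_notMem ha hc h hD hDe 0 hq', add_zero]
  · by_cases hpe : p ∈ e.source
    · refine ⟨D, hDs.contDiffAt.differentiableAt (by simp), ?_, fun t ht => ?_⟩
      · simp only [hb]
        rw [if_pos hpe, ← coordChart_eq_xCoord ha X hpe]
      · filter_upwards [e.open_source.mem_nhds hpe] with q hq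
        exact sheetHomeomorph_of_mem ha hc h hD hDe ht hq
    · have hpD : p ∈ (e.symm '' tsupport D)ᶜ := by
        rintro ⟨x, hx, rfl⟩; exact hpe (e.map_target (hDe hx))
      refine ⟨fun _ => 0, differentiableAt_const _, ?_, fun t _ => ?_⟩
      · simp only [hb, if_neg hpe, wirtingerBar]; simp
      · filter_upwards [(isClosed_sheet_support ha h hD hDe).isOpen_compl.mem_nhds hpD] with q hq
        rw [sheetHomeomorph_of_notMem ha hc h hD hDe t hq]; simp

/-- Where the metric is flat, the conservation of energy and momentum says that `T` is
holomorphic inside the `N`-point functions. -/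
theorem differentiableOn_stressCorr {P : AffineCurve a X.1} (h : P.1.2 ≠ 0) :
    DifferentiableOn ℂ (fun u => C.stressCorr ha κ δ φ ((coordChart ha X P h).symm u))
      ((coordChart ha X P h).target ∩ (coordChart ha X P h).symm ⁻¹' flatPart ha X δ φ) := by
  set e := coordChart ha X P h with he
  have ho : IsOpen (e.target ∩ e.symm ⁻¹' flatPart ha X δ φ) :=
    e.continuousOn_symm.isOpen_inter_preimage e.open_target (isOpen_flatPart ha X φ)
  refine differentiableOn_of_integral_wirtingerBar ho (fun u hu =>
    (C.contDiffAt_stressCorr ha hA hφ h hu.1 hu.2.2.2).contDiffWithinAt) fun χ hχ hχc hχΩ => ?_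
  set k : ℂ → ℂ := fun x => (χ x : ℂ) with hk
  have hks : ContDiff ℝ ∞ k := Complex.ofRealCLM.contDiff.comp hχ
  have hkt : tsupport k = tsupport χ := by
    unfold tsupport
    congr 1
    ext x; simp [hk]
  have hkc : HasCompactSupport k := by rw [HasCompactSupport, hkt]; exact hχc
  have hcT (B : Form) : ContinuousOn (fun u => C.tensorCorr ha κ δ φ B (e.symm u))
      (e.target ∩ e.symm ⁻¹' flatPart ha X δ φ) := fun u hu =>
    (C.contDiffAt_tensorCorr ha hA hφ h hu.1 hu.2.2.2 B).continuousAt.continuousWithinAt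
  have hIk : wirtingerBar (fun x => Complex.I * k x) = fun x => Complex.I * wirtingerBar k x := by
    funext x
    have : fderiv ℝ (fun x => Complex.I * k x) x = Complex.I • fderiv ℝ k x :=
      fderiv_const_mul (hks.contDiffAt.differentiableAt (by simp)) _
    simp only [wirtingerBar, this, smul_apply, smul_eq_mul]
    ring
  have hIt : tsupport (fun x => Complex.I * k x) = tsupport χ := by
    rw [← hkt]
    unfold tsupport
    congr 1
    ext x; simp
  have hw := continuous_wirtingerBar hks
  -- the displacements `χ` and `i χ` together give the complex linear statement
  have h1 := C.integral_wirtingerBar_tensorCorr ha hA hφ hδ h hks hkc (hkt ▸ hχΩ)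
  have h2 := C.integral_wirtingerBar_tensorCorr ha hA hφ hδ h (contDiff_const.mul hks)
    (D := fun x => Complex.I * k x) (by rw [HasCompactSupport, hIt]; exact hχc) (hIt ▸ hχΩ)
  rw [hIk] at h2
  have hre (r : ℂ → ℂ) (hr : Continuous r) (hr0 : ∀ x, wirtingerBar k x = 0 → r x = 0) (B : Form) :
      Integrable fun u => r u * C.tensorCorr ha κ δ φ B (e.symm u) := by
    have hsub : tsupport r ⊆ tsupport χ := by
      rw [← hkt]
      refine Set.Subset.trans (closure_mono fun x hx => ?_) (tsupport_wirtingerBar_subset k)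
      exact fun h0 => hx (hr0 x h0)
    exact integrable_mul_of_tsupport_subset hr (hχc.of_isClosed_subset (isClosed_tsupport _) hsub)
      (hsub.trans hχΩ) (hcT B)
  have hcre : Continuous fun u => ((wirtingerBar k u).re : ℂ) := by fun_prop
  have hcim : Continuous fun u => ((wirtingerBar k u).im : ℂ) := by fun_prop
  have i1 := hre _ hcre (fun x hx => by simp [hx]) reForm
  have i2 := hre _ hcim (fun x hx => by simp [hx]) imForm
  have i3 := hre _ hcre (fun x hx => by simp [hx]) imForm
  have i4 := hre _ hcim (fun x hx => by simp [hx]) reForm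
  have h3 : ∀ u, wirtingerBar k u * C.stressCorr ha κ δ φ (e.symm u) =
      (((wirtingerBar k u).re : ℂ) * C.tensorCorr ha κ δ φ reForm (e.symm u) +
        ((wirtingerBar k u).im : ℂ) * C.tensorCorr ha κ δ φ imForm (e.symm u)) -
      Complex.I * (((Complex.I * wirtingerBar k u).re : ℂ) *
          C.tensorCorr ha κ δ φ reForm (e.symm u) +
        ((Complex.I * wirtingerBar k u).im : ℂ) * C.tensorCorr ha κ δ φ imForm (e.symm u)) := by
    intro u
    rw [stressCorr]
    have h4 := (Complex.re_add_im (wirtingerBar k u)).symm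
    simp only [Complex.mul_re, Complex.I_re, Complex.I_im, zero_mul, one_mul, zero_sub,
      Complex.mul_im, zero_add, Complex.ofReal_neg]
    linear_combination (C.tensorCorr ha κ δ φ reForm (e.symm u) -
      Complex.I * C.tensorCorr ha κ δ φ imForm (e.symm u)) * h4 -
      ((wirtingerBar k u).im : ℂ) * C.tensorCorr ha κ δ φ imForm (e.symm u) * Complex.I_mul_I
  simp_rw [h3]
  rw [integral_sub, integral_const_mul, h1, h2]
  · simp
  · exact i1.add i2
  · refine Integrable.const_mul ?_ _
    simp only [Complex.mul_re, Complex.I_re, Complex.I_im, zero_mul, one_mul, zero_sub,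
      Complex.mul_im, zero_add, Complex.ofReal_neg, neg_mul]
    exact i4.neg.add i3

end ConformalFieldTheory

/-! ### Independence of the normalisation from the branch points -/

lemma laplacian_comp_add_right (f : ℂ → ℝ) (c x : ℂ) :
    Laplacian.laplacian (fun z => f (z + c)) x = Laplacian.laplacian f (x + c) := by
  rw [InnerProductSpace.laplacian_eq_iteratedFDeriv_complexPlane,
    InnerProductSpace.laplacian_eq_iteratedFDeriv_complexPlane]
  simp only [iteratedFDeriv_comp_add_right]

namespace Hyperelliptic

open RiemannSurface

variable {g : ℕ} {a : ℂ} {ha : a ≠ 0} {X Y : Config g} {κ : Cutoff} {δ : ℝ}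

lemma laplacianLog_regularizedMetric {p : hyperellipticCurve ha X} (hp : p ∈ unramified ha X) :
    laplacianLog (regularizedMetric ha κ δ X) p =
      Laplacian.laplacian (fun x => Real.log (planeMetric κ δ X.1 x)) (xCoord ha X p) := by
  obtain ⟨P, h, rfl⟩ := hp
  unfold laplacianLog
  rw [chartAt_curvePoint ha X h, coordChart_apply, xCoord_curvePoint]
  refine (InnerProductSpace.laplacian_congr_nhds ?_).eq_of_nhds
  have h0 : P.1.1 ∈ (coordChart ha X P h).target := by
    have := (coordChart ha X P h).map_source (mem_coordChart_source_self ha X h)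
    rwa [coordChart_apply] at this
  filter_upwards [(coordChart ha X P h).open_target.mem_nhds h0] with u hu
  rw [conformalFactor_coordChart ha X _ hu, regularizedMetric_unramified ha X
    (exists_of_mem_coordChart_source ha X ((coordChart ha X P h).map_target hu)),
    xCoord_coordChart_symm]

lemma laplacianLog_of_translation {f : hyperellipticCurve ha X → hyperellipticCurve ha Y}
    {V : Set (hyperellipticCurve ha X)} (hV : IsTranslationOn ha f V)
    (hun : ∀ p ∈ unramified ha X, f p ∈ unramified ha Y)
    (hm : ∀ p ∈ unramified ha X, regularizedMetric ha κ δ Y (f p) = regularizedMetric ha κ δ X p)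
    {p : hyperellipticCurve ha X} (hp : p ∈ V) (hpu : p ∈ unramified ha X) :
    laplacianLog (regularizedMetric ha κ δ Y) (f p) =
      laplacianLog (regularizedMetric ha κ δ X) p := by
  obtain ⟨c, hc⟩ := hV.exists_const
  rw [laplacianLog_regularizedMetric hpu, laplacianLog_regularizedMetric (hun p hpu), hc p hp hpu,
    ← laplacian_comp_add_right]
  refine (InnerProductSpace.laplacian_congr_nhds ?_).eq_of_nhds
  obtain ⟨P, h, rfl⟩ := hpu
  set e := coordChart ha X P h with he
  have h0 : P.1.1 ∈ e.target := by
    have := e.map_source (mem_coordChart_source_self ha X h)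
    rwa [he, coordChart_apply] at this
  have h1 : e.symm P.1.1 ∈ V := by
    have := e.left_inv (mem_coordChart_source_self ha X h)
    rw [he, coordChart_apply] at this
    rw [he, this]; exact hp
  filter_upwards [e.open_target.mem_nhds h0,
    (e.continuousAt_symm h0) (hV.isOpen.mem_nhds h1)] with u hu huV
  have hu' : e.symm u ∈ unramified ha X := exists_of_mem_coordChart_source ha X (e.map_target hu)
  have h2 := hm _ hu'
  rw [regularizedMetric_unramified ha Y (hun _ hu'), hc _ huV hu',
    regularizedMetric_unramified ha X hu', he, xCoord_coordChart_symm] at h2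
  rw [h2]

lemma ae_mem_unramified (hδ : IsSmallScale δ X.1) :
    ∀ᵐ p ∂(riemannianVolume (regularizedMetric ha κ δ X)), p ∈ unramified ha X := by
  have := nullSingletonClass_riemannianVolume
    (isConformalMetric_regularizedMetric (κ := κ) ha X hδ).1
  exact (finite_compl_unramified ha X).countable.measure_zero _

variable {E : Type} [NormedAddCommGroup E] [NormedSpace ℝ E] {δ₀ : ℝ}
    {U : Set E} {Z : E → Config g}
    {f : ∀ t, hyperellipticCurve ha X ≃ₜ hyperellipticCurve ha (Z t)}

/-- The integrand of the logarithmic derivative of the state with respect to the metric is supported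
where the two metrics differ. If the deformation is a translation there, it preserves the
integral. -/
lemma IsDeformation.weylRate_eq (h₀ : IsDeformation κ δ₀ U X Z f)
    (h₁ : IsDeformation κ δ U X Z f) {t : E} (ht : t ∈ U) {W : Set (hyperellipticCurve ha X)}
    (hW : ∀ p ∈ W, ∃ V ⊆ W, p ∈ V ∧ IsTranslationOn ha (f t) V)
    (hWc : ∀ p ∉ W, p ∈ Hyperelliptic.unramified ha X →
      regularizedMetric ha κ δ X p = regularizedMetric ha κ δ₀ X p) (c s : ℝ) :
    weylRate c (regularizedMetric ha κ δ₀ (Z t)) (regularizedMetric ha κ δ (Z t)) s =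
      weylRate c (regularizedMetric ha κ δ₀ X) (regularizedMetric ha κ δ X) s := by
  have hX := isConformalMetric_regularizedMetric (κ := κ) ha X h₀.scale_base
  have hZ := isConformalMetric_regularizedMetric (κ := κ) ha (Z t) (h₀.scale t ht)
  have hWo : IsOpen W := by
    rw [isOpen_iff_mem_nhds]
    intro p hp
    obtain ⟨V, h1, h2, h3⟩ := hW p hp
    exact mem_of_superset (h3.isOpen.mem_nhds h2) h1
  have hiso := restrict_riemannianVolume_of_isometry hX.1 hZ.1 (f t) hWo
    (fun p _ => ((h₀.contMDiff ht).1 p).mdifferentiableAt (by simp))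
    (fun p hp => by
      obtain ⟨V, -, h2, h3⟩ := hW p hp
      exact h₀.metricPullback_of_translation ht h3 h2)
  set FZ : hyperellipticCurve ha (Z t) → ℝ := fun q => c / (48 * Real.pi) *
    Real.log (regularizedMetric ha κ δ (Z t) q / regularizedMetric ha κ δ₀ (Z t) q) *
    ((1 - s) * laplacianLog (regularizedMetric ha κ δ₀ (Z t)) q +
      s * laplacianLog (regularizedMetric ha κ δ (Z t)) q) / regularizedMetric ha κ δ₀ (Z t) q
    with hFZ
  set FX : hyperellipticCurve ha X → ℝ := fun q => c / (48 * Real.pi) *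
    Real.log (regularizedMetric ha κ δ X q / regularizedMetric ha κ δ₀ X q) *
    ((1 - s) * laplacianLog (regularizedMetric ha κ δ₀ X) q +
      s * laplacianLog (regularizedMetric ha κ δ X) q) / regularizedMetric ha κ δ₀ X q
    with hFX
  change ∫ q, FZ q ∂_ = ∫ p, FX p ∂_
  -- where the metrics agree the logarithm of their quotient vanishes
  have hmem : ∀ q ∉ f t '' W, q ∉ f t '' (Hyperelliptic.unramified ha X)ᶜ → FZ q = 0 := by
    intro q hq hq'
    obtain ⟨p, rfl⟩ := (f t).surjective q
    have hp : p ∉ W := fun h => hq ⟨p, h, rfl⟩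
    have hpu : p ∈ Hyperelliptic.unramified ha X := by
      by_contra h; exact hq' ⟨p, h, rfl⟩
    have h3 : regularizedMetric ha κ δ (Z t) (f t p) = regularizedMetric ha κ δ₀ (Z t) (f t p) := by
      rw [h₀.metric t ht p hpu, h₁.metric t ht p hpu, hWc p hp hpu]
    simp only [hFZ]
    rw [h3, div_self (hZ.1 _).ne', Real.log_one]
    simp
  have hfin : (f t '' (Hyperelliptic.unramified ha X)ᶜ).Finite :=
    (finite_compl_unramified ha X).image _
  have hae : ∀ᵐ q ∂(riemannianVolume (regularizedMetric ha κ δ₀ (Z t))), q ∉ f t '' W → FZ q = 0 := by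
    have := nullSingletonClass_riemannianVolume hZ.1
    have h4 : ∀ᵐ q ∂(riemannianVolume (regularizedMetric ha κ δ₀ (Z t))),
        q ∉ f t '' (Hyperelliptic.unramified ha X)ᶜ := by
      exact measure_eq_zero_iff_ae_notMem.1 (hfin.countable.measure_zero _)
    filter_upwards [h4] with q h5 h6 using hmem q h6 h5
  have hem := (f t).measurableEmbedding
  calc ∫ q, FZ q ∂(riemannianVolume (regularizedMetric ha κ δ₀ (Z t)))
      = ∫ q in f t '' W, FZ q ∂(riemannianVolume (regularizedMetric ha κ δ₀ (Z t))) :=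
        (setIntegral_eq_integral_of_ae_compl_eq_zero hae).symm
    _ = ∫ p in W, FZ (f t p) ∂(riemannianVolume (regularizedMetric ha κ δ₀ X)) := by
        rw [hiso, hem.setIntegral_map, Set.preimage_image_eq _ (f t).injective]
    _ = ∫ p in W, FX p ∂(riemannianVolume (regularizedMetric ha κ δ₀ X)) := by
        refine integral_congr_ae ?_
        filter_upwards [ae_restrict_of_ae (ae_mem_unramified h₀.scale_base),
          ae_restrict_mem hWo.measurableSet] with p hp hpW
        obtain ⟨V, -, h2, h3⟩ := hW p hpW
        simp only [hFZ, hFX]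
        rw [h₀.metric t ht p hp, h₁.metric t ht p hp,
          laplacianLog_of_translation h3 (h₀.unramified t ht) (h₀.metric t ht) h2 hp,
          laplacianLog_of_translation h3 (h₁.unramified t ht) (h₁.metric t ht) h2 hp]
    _ = ∫ p, FX p ∂(riemannianVolume (regularizedMetric ha κ δ₀ X)) := by
        refine setIntegral_eq_integral_of_ae_compl_eq_zero ?_
        filter_upwards [ae_mem_unramified (κ := κ) (ha := ha) h₀.scale_base] with p hp hpW
        simp only [hFX]
        rw [hWc p hpW hp, div_self (hX.1 _).ne', Real.log_one]
        simp

/-- The factor between the states at two scales does not change when the branch points move. -/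
lemma weylFactor_eq_of_shift {R ε : ℝ} (h₀ : IsFineScale X.1 R δ₀) (h₁ : IsFineScale X.1 R δ)
    (h : IsGoodRadius X.1 R) (hε0 : 0 < ε) (hε : ∀ d, ‖d‖ < ε → IsSmallShift X.1 R d)
    (hY : ‖Y.1 - X.1‖ < ε) (c : ℝ) :
    weylFactor c (regularizedMetric ha κ δ₀ Y) (regularizedMetric ha κ δ Y) =
      weylFactor c (regularizedMetric ha κ δ₀ X) (regularizedMetric ha κ δ X) := by
  have hYn : nearConfig X ε Y.1 = Y := Subtype.ext (nearConfig_val h hε hY)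
  have d₀ := isDeformation_curveHomeomorph (κ := κ) ha h₀ h hε0 hε
    (ℓ := fun t : Fin (2 * g + 1) → ℂ => t) contDiff_id
  have d₁ := isDeformation_curveHomeomorph (κ := κ) ha h₁ h hε0 hε
    (ℓ := fun t : Fin (2 * g + 1) → ℂ => t) contDiff_id
  have hR := h.pos
  unfold weylFactor
  refine congrArg (fun k : ℝ → ℝ => Real.exp (∫ s in (0 : ℝ)..1, k s)) (funext fun s => ?_)
  have := d₀.weylRate_eq d₁ (t := Y.1) hY
    (W := outsideDiscs ha X R ∪ ⋃ j, overDisc ha X R j) ?_ ?_ c s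
  · rwa [hYn] at this
  · rintro p (hp | hp)
    · exact ⟨_, Set.subset_union_left, hp, isTranslationOn_outsideDiscs ha h _⟩
    · obtain ⟨j, hj⟩ := Set.mem_iUnion.1 hp
      exact ⟨_, fun q hq => Or.inr (Set.mem_iUnion.2 ⟨j, hq⟩), hj,
        isTranslationOn_overDisc ha h _ j⟩
  · intro p hp hpu
    have hp1 : p ∉ outsideDiscs ha X R := fun h => hp (Or.inl h)
    have hp2 : ∀ j, p ∉ overDisc ha X R j := fun j h => hp (Or.inr (Set.mem_iUnion.2 ⟨j, h⟩))
    rw [outsideDiscs, Set.notMem_compl_iff] at hp1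
    obtain ⟨P, ⟨j, hj⟩, rfl⟩ := hp1
    have hP (k) : R ≤ ‖P.1.1 - X.1 k‖ := by
      by_contra h0
      exact hp2 k ⟨P, not_le.1 h0, rfl⟩
    have hb {δ : ℝ} (hδ : IsFineScale X.1 R δ) : planeMetric κ δ X.1 P.1.1 = 1 := by
      refine planeMetric_flat hδ.pos (fun k => by linarith [hP k, hδ.le, hδ.pos]) ?_
      have h1 : ‖P.1.1‖ ≤ ‖P.1.1 - X.1 j‖ + ‖X.1 j‖ := by
        simpa using norm_add_le (P.1.1 - X.1 j) (X.1 j)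
      have h2 := hδ.bounded j
      have h3 : ‖P.1.1‖ ≤ 1 / δ := by linarith
      rw [le_div_iff₀ hδ.pos] at h3
      linarith
    rw [regularizedMetric_unramified ha X hpu, regularizedMetric_unramified ha X hpu,
      xCoord_curvePoint, hb h₀, hb h₁]

lemma eventually_isFineScale {n : ℕ} (X : Fin n → ℂ) {R : ℝ} (hR : 0 < R) :
    ∀ᶠ δ in 𝓝[>] (0 : ℝ), IsFineScale X R δ := by
  have h1 : ∀ᶠ δ in 𝓝[>] (0 : ℝ), ∀ j, ‖X j‖ + 3 * R ≤ 1 / δ := by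
    rw [eventually_all]
    intro j
    have := tendsto_inv_nhdsGT_zero (𝕜 := ℝ)
    filter_upwards [this.eventually_ge_atTop (‖X j‖ + 3 * R)] with δ hδ
    rwa [one_div]
  filter_upwards [self_mem_nhdsWithin, h1,
    mem_nhdsWithin_of_mem_nhds (Iio_mem_nhds (by positivity : (0 : ℝ) < R / 2))] with δ h2 h3 h4
  exact ⟨h2, by have : δ < R / 2 := h4; linarith, h3⟩

variable {S : Type} [TopologicalSpace S]

lemma isMetricSurface (hδ : IsSmallScale δ X.1) (hX : Nonempty (hyperellipticCurve ha X ≃ₜ S)) :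
    IsMetricSurface S (hyperellipticCurve ha X) (regularizedMetric ha κ δ X) :=
  ⟨inferInstance, hX, isConformalMetric_regularizedMetric ha X hδ⟩

/-- Near a configuration of branch points the singular state is a constant multiple of the state for
the metric that is regularised at a fixed scale. -/
theorem exists_singularCorr_eq (C : ConformalFieldTheory.{u} S) {Z : ℝ → ℂ}
    (hZ : IsRenormalization (g := g) ha C κ Z) {R ε : ℝ}
    (h₀ : IsFineScale X.1 R δ₀)
    (h : IsGoodRadius X.1 R) (hε0 : 0 < ε) (hε : ∀ d, ‖d‖ < ε → IsSmallShift X.1 R d)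
    (hX : Nonempty (hyperellipticCurve ha X ≃ₜ S)) :
    ∃ K : ℂ, ∀ Y : Config g, ‖Y.1 - X.1‖ < ε → ∀ (N : ℕ)
      (φ : Fin N → C.Field (hyperellipticCurve ha Y)), Separated φ →
      (∀ i, (φ i).1 ∈ unramified ha Y) → singularCorr ha C κ Z Y φ =
        K * C.corr (hyperellipticCurve ha Y) (regularizedMetric ha κ δ₀ Y) φ := by
  have hcorr : ∀ Y : Config g, ‖Y.1 - X.1‖ < ε → ∀ (N : ℕ)
      (φ : Fin N → C.Field (hyperellipticCurve ha Y)), Separated φ →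
      ∀ᶠ δ in 𝓝[>] (0 : ℝ), Z δ *
        C.corr (hyperellipticCurve ha Y) (regularizedMetric ha κ δ Y) φ =
        (Z δ * weylFactor C.c (regularizedMetric ha κ δ₀ X) (regularizedMetric ha κ δ X)) *
        C.corr (hyperellipticCurve ha Y) (regularizedMetric ha κ δ₀ Y) φ := by
    intro Y hY N φ hφ
    filter_upwards [eventually_isFineScale X.1 h.pos] with δ hδ
    have hs := hε _ hY
    obtain ⟨k⟩ := hX
    have hY' : Nonempty (hyperellipticCurve ha Y ≃ₜ S) :=
      ⟨(curveHomeomorph ha h hs).symm.trans k⟩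
    rw [C.corr_eq_weylFactor_mul (isMetricSurface (h₀.isSmallScale h hs) hY')
      (isMetricSurface (hδ.isSmallScale h hs) hY') hφ,
      weylFactor_eq_of_shift h₀ hδ h hε0 hε hY]
    ring
  -- one `N`-point function that is not zero determines the limit of the renormalised factor
  by_cases H : ∃ Y : Config g, ‖Y.1 - X.1‖ < ε ∧ ∃ (N : ℕ)
      (φ : Fin N → C.Field (hyperellipticCurve ha Y)), Separated φ ∧
      (∀ i, (φ i).1 ∈ unramified ha Y) ∧
        C.corr (hyperellipticCurve ha Y) (regularizedMetric ha κ δ₀ Y) φ ≠ 0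
  · obtain ⟨Y, hY, N, φ, hφ, hφu, hne⟩ := H
    obtain ⟨L, hL⟩ := hZ Y N φ hφ hφu
    have hK : Tendsto (fun δ => Z δ * weylFactor C.c (regularizedMetric ha κ δ₀ X)
        (regularizedMetric ha κ δ X)) (𝓝[>] (0 : ℝ)) (𝓝 (L /
          C.corr (hyperellipticCurve ha Y) (regularizedMetric ha κ δ₀ Y) φ)) := by
      refine ((hL.congr' (hcorr Y hY N φ hφ)).div_const _).congr fun δ => ?_
      field_simp
    refine ⟨L / C.corr (hyperellipticCurve ha Y) (regularizedMetric ha κ δ₀ Y) φ,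
      fun Y' hY' N' φ' hφ' hφu' => ?_⟩
    exact ((hK.mul_const _).congr' (EventuallyEq.symm (hcorr Y' hY' N' φ' hφ'))).limUnder_eq
  -- if all these `N`-point functions vanish, so do the singular ones, and any constant will do
  · push Not at H
    refine ⟨0, fun Y' hY' N' φ' hφ' hφu' => ?_⟩
    rw [zero_mul]
    refine (tendsto_const_nhds.congr' ?_).limUnder_eq
    filter_upwards [hcorr Y' hY' N' φ' hφ'] with δ hδ
    rw [hδ, H Y' hY' N' φ' hφ' hφu', mul_zero]

end Hyperelliptic

/-! ### Differentiability in the branch points -/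

lemma IsConformalGerm.comp {A B D : RiemannSurface} {f : B → D} {s : A → B} {p : A}
    (hf : IsConformalGerm f (s p)) (hs : IsConformalGerm s p) :
    IsConformalGerm (fun z => f (s z)) p := by
  obtain ⟨V, hV, hpV, hfV, hiV⟩ := hf
  obtain ⟨U, hU, hpU, hsU, hiU⟩ := hs
  refine ⟨U ∩ s ⁻¹' V, hsU.continuousOn.isOpen_inter_preimage hU hV, ⟨hpU, hpV⟩,
    hfV.comp (hsU.mono Set.inter_subset_left) fun z hz => hz.2, fun z hz z' hz' h => ?_⟩
  exact hiU hz.1 hz'.1 (hiV hz.2 hz'.2 h)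

namespace Hyperelliptic

open RiemannSurface

variable {g : ℕ} {a : ℂ} {ha : a ≠ 0} {X Y : Config g}

lemma isConformalGerm_of_translation {f : hyperellipticCurve ha X ≃ₜ hyperellipticCurve ha Y}
    (hun : ∀ p ∈ unramified ha X, f p ∈ unramified ha Y) {V : Set (hyperellipticCurve ha X)}
    (hV : IsTranslationOn ha f V) {p : hyperellipticCurve ha X} (hp : p ∈ V) :
    IsConformalGerm f p :=
  ⟨V, hV.isOpen, hp, fun _ hq => (mdifferentiableAt_of_translation f.continuous hun hV
    hq).mdifferentiableWithinAt, f.injective.injOn⟩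

lemma push_eq_place (Φ : FBundleFunctor.{u}) {A B : RiemannSurface} {f : A → B} {p : A}
    (hf : IsConformalGerm f p) (v : Φ.F) :
    Φ.push f (Φ.localField A p v) = Φ.place (fun z => f (FBundleFunctor.chartParam p z)) v := by
  have h0 := FBundleFunctor.chartParam_zero p
  refine Eq.symm ((Φ.sigma_map_eq (s := fun z => f (FBundleFunctor.chartParam p z))
    (p := f p) (by rw [h0]) v).trans ?_)
  refine Sigma.ext rfl (heq_of_eq ?_)
  exact Φ.map_comp_apply (A := plane) (p := (0 : ℂ)) h0 rfl
    (FBundleFunctor.isConformalGerm_chartParam p) hf v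

/-- Translations in the coordinate `x` carry fields with respect to this coordinate to each other. -/
lemma push_localField_of_translation (Φ : FBundleFunctor.{u})
    {f : hyperellipticCurve ha X ≃ₜ hyperellipticCurve ha Y}
    (hun : ∀ p ∈ unramified ha X, f p ∈ unramified ha Y) {V : Set (hyperellipticCurve ha X)}
    (hV : IsTranslationOn ha f V) {p : hyperellipticCurve ha X} (hp : p ∈ V)
    (hpu : p ∈ unramified ha X) (v : Φ.F) :
    Φ.push f (Φ.localField _ p v) = Φ.localField _ (f p) v := by
  have hg := isConformalGerm_of_translation hun hV hp
  rw [push_eq_place Φ hg, Φ.localField_eq_place]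
  have h0 := FBundleFunctor.chartParam_zero p
  have h1 : (fun z => f (FBundleFunctor.chartParam p z)) =ᶠ[𝓝 (0 : ℂ)]
      FBundleFunctor.chartParam (f p) := by
    obtain ⟨c, hc⟩ := hV.exists_const
    have hcont : ContinuousAt (FBundleFunctor.chartParam p) (0 : ℂ) := by
      have : ContinuousAt (fun z : ℂ => (chartAt ℂ p).symm (z + chartAt ℂ p p)) 0 :=
        ContinuousAt.comp (g := (chartAt ℂ p).symm) (by
          simpa using (chartAt ℂ p).continuousAt_symm (mem_chart_target ℂ p)) (by fun_prop)
      exact this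
    have htend : Tendsto (FBundleFunctor.chartParam p) (𝓝 (0 : ℂ)) (𝓝 p) := by
      have := hcont.tendsto; rwa [h0] at this
    have htar : ∀ᶠ z : ℂ in 𝓝 0, z + chartAt ℂ p p ∈ (chartAt ℂ p).target := by
      have : ContinuousAt (fun z : ℂ => z + chartAt ℂ p p) 0 := by fun_prop
      exact this.eventually ((chartAt ℂ p).open_target.mem_nhds (by simp))
    have hs := (f.continuous.tendsto p).eventually
      ((chartAt ℂ (f p)).open_source.mem_nhds (mem_chart_source ℂ (f p)))
    filter_upwards [htend.eventually (hV.isOpen.mem_nhds hp),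
      htend.eventually ((isOpen_unramified ha X).mem_nhds hpu), htend.eventually hs, htar]
      with z h1 h2 h3 h4
    -- in the coordinate `x` both sides are translations
    have h5 : chartAt ℂ (f p) (f (FBundleFunctor.chartParam p z)) = z + chartAt ℂ (f p) (f p) := by
      rw [chartAt_apply_eq_xCoord ha Y (hun p hpu) h3, hc _ h1 h2,
        chartAt_apply_eq_xCoord ha Y (hun p hpu) (mem_chart_source ℂ _), hc p hp hpu]
      have h6 : chartAt ℂ p (FBundleFunctor.chartParam p z) = z + chartAt ℂ p p :=
        (chartAt ℂ p).right_inv h4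
      have h7 : FBundleFunctor.chartParam p z ∈ (chartAt ℂ p).source :=
        (chartAt ℂ p).map_target h4
      rw [chartAt_apply_eq_xCoord ha X hpu h7,
        chartAt_apply_eq_xCoord ha X hpu (mem_chart_source ℂ _)] at h6
      rw [h6]
      ring
    change _ = (chartAt ℂ (f p)).symm (z + chartAt ℂ (f p) (f p))
    rw [← h5, (chartAt ℂ (f p)).left_inv h3]
  have hgc : IsConformalGerm (A := plane) (fun z => f (FBundleFunctor.chartParam p z)) (0 : ℂ) :=
    IsConformalGerm.comp (A := plane) (s := FBundleFunctor.chartParam p) (by rw [h0]; exact hg)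
      (FBundleFunctor.isConformalGerm_chartParam p)
  refine (Φ.sigma_map_eq (s := fun z => f (FBundleFunctor.chartParam p z)) (p := f p)
    (by rw [h0]) v).trans (Eq.trans ?_ (Φ.sigma_map_eq (s := FBundleFunctor.chartParam (f p))
      (FBundleFunctor.chartParam_zero (f p)) v).symm)
  refine Sigma.ext rfl (heq_of_eq ?_)
  exact Φ.map_congr_apply (A := plane) (p := (0 : ℂ)) (by rw [h0]) hgc h1 v

variable {S : Type} [TopologicalSpace S] {C : ConformalFieldTheory.{u} S} {κ : Cutoff} {δ : ℝ}
  {N : ℕ} {φ : Fin N → C.Field (hyperellipticCurve ha X)}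

theorem IsDeformation.contDiffAt_corr {E : Type} [NormedAddCommGroup E] [NormedSpace ℝ E]
    [FiniteDimensional ℝ E] {U : Set E} {Z : E → Config g}
    {f : ∀ t, hyperellipticCurve ha X ≃ₜ hyperellipticCurve ha (Z t)}
    (h : IsDeformation κ δ U X Z f) {t₀ : E} (ht₀ : t₀ ∈ U)
    (hX : Nonempty (hyperellipticCurve ha X ≃ₜ S))
    (hφ : Separated φ) (hφf : ∀ i, ∃ V, (φ i).1 ∈ V ∧ ∀ t ∈ U, IsTranslationOn ha (f t) V) :
    ContDiffAt ℝ ∞ (fun t => C.corr (hyperellipticCurve ha (Z t))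
      (regularizedMetric ha κ δ (Z t)) fun i => C.toFBundleFunctor.push (f t) (φ i)) t₀ := by
  choose v hv using fun i => C.toFBundleFunctor.exists_eq_localField (φ i)
  have hs (i : Fin N) (t : E) (ht : t ∈ U) : IsConformalGerm (f t) (φ i).1 := by
    obtain ⟨V, h1, h2⟩ := hφf i
    exact isConformalGerm_of_translation (h.unramified t ht) (h2 t ht) h1
  have key := C.corr_smooth U (hyperellipticCurve ha X) (fun t => hyperellipticCurve ha (Z t))
    (fun t => regularizedMetric ha κ δ (Z t)) f inferInstance hX h.isSmoothFamily N
    (fun t i z => f t (FBundleFunctor.chartParam (φ i).1 z)) v t₀ ht₀ ?_ ?_ ?_ ?_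
  · refine key.congr_of_eventuallyEq ?_
    filter_upwards [h.isOpen.mem_nhds ht₀] with t ht
    refine congrArg _ (funext fun i => ?_)
    rw [← push_eq_place C.toFBundleFunctor (hs i t ht), ← hv i]
  · intro i
    simp only [Homeomorph.symm_apply_apply]
    exact contMDiffAt_chartParam _ _
  · intro i
    obtain ⟨V, h1, h2⟩ := hφf i
    have hc : ContinuousAt (fun q : E × ℂ => FBundleFunctor.chartParam (φ i).1 q.2) (t₀, 0) :=
      (contMDiffAt_chartParam (φ i).1 t₀).continuousAt
    have h0 : FBundleFunctor.chartParam (φ i).1 0 ∈ V := by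
      rwa [FBundleFunctor.chartParam_zero]
    filter_upwards [hc.eventually ((h2 t₀ ht₀).isOpen.mem_nhds h0),
      eventually_mdifferentiableAt_chartParam (φ i).1 t₀,
      continuousAt_fst.eventually (h.isOpen.mem_nhds ht₀)] with q h3 h4 h5
    exact MDifferentiableAt.comp (M := plane) (g := f q.1) q.2 (mdifferentiableAt_of_translation
      (f q.1).continuous (h.unramified q.1 h5) (h2 q.1 h5) h3) h4
  · intro i
    exact IsConformalGerm.comp (A := plane) (s := FBundleFunctor.chartParam (φ i).1)
      (by rw [FBundleFunctor.chartParam_zero]; exact hs i t₀ ht₀)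
      (FBundleFunctor.isConformalGerm_chartParam _)
  · simp only [FBundleFunctor.chartParam_zero]
    exact (f t₀).injective.comp hφ

section Fields

variable {R : ℝ}

lemma continuousAt_sheetFactor_zero {n : ℕ} (X : Fin n → ℂ) (x : ℂ) :
    ContinuousAt (fun d => sheetFactor X R d x) 0 := by
  unfold sheetFactor
  refine tendsto_finsetProd _ fun k _ => ?_
  have h1 : shiftRatio X R 0 k x = 1 := by simp [shiftRatio, branchShift]
  have hb : Continuous fun d => branchShift X R d x := by unfold branchShift; fun_prop
  have h2 : Continuous fun d => shiftRatio X R d k x := by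
    unfold shiftRatio
    exact continuous_const.add ((hb.sub (continuous_apply k)).div_const _)
  have h3 : ContinuousAt Complex.sqrt (shiftRatio X R 0 k x) := by
    rw [h1]
    exact (Complex.differentiableAt_sqrt Complex.one_mem_slitPlane).continuousAt
  exact ContinuousAt.comp (f := fun d => shiftRatio X R d k x) h3 h2.continuousAt

lemma sheetFactor_zero {n : ℕ} (X : Fin n → ℂ) (x : ℂ) : sheetFactor X R 0 x = 1 := by
  have h1 (k) : shiftRatio X R 0 k x = 1 := by simp [shiftRatio, branchShift]
  unfold sheetFactor
  simp only [h1]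
  simp

/-- A point over a fixed `x` that depends continuously on the branch points moves along with the
curve. -/
lemma eventually_eq_affineHomeomorph (ha : a ≠ 0) (h : IsGoodRadius X.1 R)
    {P : ∀ Y : Config g, AffineCurve a Y.1} {x : ℂ}
    (hPx : ∀ Y, (P Y).1.1 = x) (hPy : ContinuousAt (fun Y : Config g => (P Y).1.2) X)
    (hx : ∀ j, 2 * R ≤ ‖x - X.1 j‖) :
    ∀ᶠ Y in 𝓝 X, ∀ hs : IsSmallShift X.1 R (Y.1 - X.1), affineHomeomorph a h hs (P X) = P Y := by
  have hy : (P X).1.2 ≠ 0 := by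
    intro h0
    obtain ⟨j, hj⟩ := (snd_eq_zero_iff ha (P X)).1 h0
    have h1 := hx j
    rw [← hPx X, hj, sub_self, norm_zero] at h1
    linarith [h.pos]
  have hc : ContinuousAt (fun Y : Config g => (P Y).1.2 /
      ((P X).1.2 * sheetFactor X.1 R (Y.1 - X.1) x)) X := by
    refine hPy.div (continuousAt_const.mul ?_) ?_
    · refine ContinuousAt.comp (g := fun d => sheetFactor X.1 R d x) ?_ (by fun_prop)
      rw [sub_self]
      exact continuousAt_sheetFactor_zero X.1 x
    · rw [sub_self, sheetFactor_zero, mul_one]; exact hy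
  have h1 : 0 < ((P X).1.2 / ((P X).1.2 * sheetFactor X.1 R (X.1 - X.1) x)).re := by
    rw [sub_self, sheetFactor_zero, mul_one, div_self hy]; simp
  filter_upwards [(Complex.continuous_re.continuousAt.comp hc).eventually (lt_mem_nhds h1)]
    with Y hY hs
  have hx' : (affineHomeomorph a h hs (P X)).1.1 = x := by
    change (P X).1.1 + branchShift X.1 R (Y.1 - X.1) (P X).1.1 = x
    rw [hPx, branchShift_far h hx, add_zero]
  have hy' : (affineHomeomorph a h hs (P X)).1.2 =
      (P X).1.2 * sheetFactor X.1 R (Y.1 - X.1) x := by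
    change (P X).1.2 * sheetFactor X.1 R (Y.1 - X.1) (P X).1.1 = _
    rw [hPx]
  refine Subtype.ext (Prod.ext (hx'.trans (hPx Y).symm) ?_)
  have h2 := (affineHomeomorph a h hs (P X)).2
  rw [hx', ← hPx Y, ← (P Y).2] at h2
  -- the two points lie over the same `x`; the continuity of `y` excludes the other sheet
  refine (sq_eq_sq_iff_eq_or_eq_neg.1 h2).resolve_right fun h3 => ?_
  rw [hy'] at h3
  have h4 : 0 < ((P Y).1.2 / ((P X).1.2 * sheetFactor X.1 R (Y.1 - X.1) x)).re := hY
  rw [h3] at h4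
  by_cases h5 : (P Y).1.2 = 0
  · simp [h5] at h4
  · rw [div_neg, div_self h5] at h4
    norm_num at h4

end Fields

end Hyperelliptic

/-! ### The derivative with respect to a branch point as an integral over an annulus -/

/-- The part of type `(1, 0)` of a real linear form is complex linear. -/
lemma holomorphic_part_eq_sum {n : ℕ} (L : (Fin n → ℂ) →L[ℝ] ℂ) (ξ : Fin n → ℂ) :
    (L ξ - Complex.I * L (Complex.I • ξ)) / 2 =
      ∑ j, (L (Pi.single j 1) - Complex.I * L (Pi.single j Complex.I)) / 2 * ξ j := by
  have h1 (ξ : Fin n → ℂ) : L ξ = ∑ j, ((ξ j).re • L (Pi.single j 1) +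
      (ξ j).im • L (Pi.single j Complex.I)) := by
    have h2 : ξ = ∑ j, ((ξ j).re • (Pi.single j 1 : Fin n → ℂ) +
        (ξ j).im • (Pi.single j Complex.I : Fin n → ℂ)) := by
      conv_lhs => rw [← Finset.univ_sum_single ξ]
      refine Finset.sum_congr rfl fun j _ => ?_
      rw [← Pi.single_smul, ← Pi.single_smul, ← Pi.single_add]
      congr 1
      simp [Complex.re_add_im]
    conv_lhs => rw [h2]
    simp only [map_sum, map_add, map_smul]
  rw [h1 ξ, h1 (Complex.I • ξ), Finset.mul_sum, ← Finset.sum_sub_distrib, Finset.sum_div]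
  refine Finset.sum_congr rfl fun j _ => ?_
  have h3 := Complex.re_add_im (ξ j)
  simp only [Pi.smul_apply, smul_eq_mul, Complex.mul_re, Complex.mul_im, Complex.I_re,
    Complex.I_im, Complex.real_smul]
  simp only [zero_mul, one_mul, zero_sub, zero_add, Complex.ofReal_neg]
  linear_combination (L (Pi.single j 1) - Complex.I * L (Pi.single j Complex.I)) / 2 * h3 +
    (L (Pi.single j Complex.I) * ((ξ j).im : ℂ) / 2) * Complex.I_mul_I

section Cutoff

variable (R : ℝ)

/-- The `z̄`-derivative of the cutoff function of a disc. -/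
def cutoffBar (z : ℂ) : ℂ := wirtingerBar (fun z => (discCutoff R z : ℂ)) z

lemma continuous_cutoffBar : Continuous (cutoffBar R) :=
  continuous_wirtingerBar (Complex.ofRealCLM.contDiff.comp (contDiff_discCutoff R))

variable {R} in
lemma cutoffBar_eq_zero (hR : 0 < R) {z : ℂ} (hz : ‖z‖ < R ∨ 2 * R < ‖z‖) : cutoffBar R z = 0 := by
  have h1 : ∃ c : ℂ, (fun z => (discCutoff R z : ℂ)) =ᶠ[𝓝 z] fun _ => c := by
    obtain h | h := hz
    · refine ⟨1, ?_⟩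
      have : ContinuousAt (fun y : ℂ => ‖y‖) z := by fun_prop
      filter_upwards [this.eventually (gt_mem_nhds h)] with y hy
      rw [discCutoff_eq_one hR hy.le, Complex.ofReal_one]
    · refine ⟨0, ?_⟩
      have : ContinuousAt (fun y : ℂ => ‖y‖) z := by fun_prop
      filter_upwards [this.eventually (lt_mem_nhds h)] with y hy
      rw [discCutoff_eq_zero hR (le_of_lt hy), Complex.ofReal_zero]
  obtain ⟨c, hc⟩ := h1
  rw [cutoffBar, wirtingerBar, hc.fderiv_eq]
  simp

lemma wirtingerBar_branchShift_single {n : ℕ} (X : Fin n → ℂ) (j : Fin n) (c x : ℂ) :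
    wirtingerBar (branchShift X R (Pi.single j c)) x = c * cutoffBar R (x - X j) := by
  have h1 : branchShift X R (Pi.single j c) = fun x => c * (discCutoff R (x - X j) : ℂ) := by
    funext x
    rw [branchShift, Finset.sum_eq_single j]
    · simp
    · intro k _ hk; simp [hk]
    · simp
  have h2 : Differentiable ℝ (fun z => (discCutoff R z : ℂ)) :=
    (Complex.ofRealCLM.contDiff.comp (contDiff_discCutoff R)).differentiable (by simp)
  have h3 : fderiv ℝ (fun x => c * (discCutoff R (x - X j) : ℂ)) x =
      c • fderiv ℝ (fun z => (discCutoff R z : ℂ)) (x - X j) := by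
    have h4 : DifferentiableAt ℝ (fun x => (discCutoff R (x - X j) : ℂ)) x :=
      (h2 (x - X j)).comp x (differentiableAt_id.sub_const (X j))
    rw [fderiv_const_mul h4]
    exact congrArg (c • ·) (fderiv_comp_sub (f := fun z => (discCutoff R z : ℂ)) (X j))
  rw [wirtingerBar, h1, h3, cutoffBar, wirtingerBar, smul_apply, smul_apply, smul_eq_mul,
    smul_eq_mul]
  ring

end Cutoff

namespace Hyperelliptic

open RiemannSurface

variable {g : ℕ} {a : ℂ} {ha : a ≠ 0} {X : Config g} {S : Type} [TopologicalSpace S]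
  {κ : Cutoff} {δ R ε : ℝ} {N : ℕ}

variable (C : ConformalFieldTheory.{u} S) (κ δ) in
/-- The `N`-point function on the curve with branch points `Z` near `X`, for the regularised metric
and for the fields `φ` transported from the curve with branch points `X`. -/
def movedCorr (h : IsGoodRadius X.1 R) (hε0 : 0 < ε) (hε : ∀ d, ‖d‖ < ε → IsSmallShift X.1 R d)
    (φ : Fin N → C.Field (hyperellipticCurve ha X)) (Z : Fin (2 * g + 1) → ℂ) : ℂ :=
  C.corr (hyperellipticCurve ha (nearConfig X ε Z))
    (regularizedMetric ha κ δ (nearConfig X ε Z)) fun i =>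
      C.toFBundleFunctor.push (curveHomeomorph ha h (isSmallShift_nearConfig hε0 hε)) (φ i)

variable {C : ConformalFieldTheory.{u} S} {φ : Fin N → C.Field (hyperellipticCurve ha X)}
  (h : IsGoodRadius X.1 R) (hε0 : 0 < ε) (hε : ∀ d, ‖d‖ < ε → IsSmallShift X.1 R d)
  (hδ : IsFineScale X.1 R δ) (hX : Nonempty (hyperellipticCurve ha X ≃ₜ S))
  (hφ : Separated φ) (hφu : ∀ i, (φ i).1 ∈ unramified ha X)
  (hφx : ∀ i j, 2 * R < ‖xCoord ha X (φ i).1 - X.1 j‖)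

lemma mem_outsideDiscs {p : hyperellipticCurve ha X} (hp : p ∈ unramified ha X)
    (hx : ∀ j, 2 * R < ‖xCoord ha X p - X.1 j‖) : p ∈ outsideDiscs ha X R := by
  obtain ⟨P, hP, rfl⟩ := hp
  rintro ⟨Q, ⟨j, hj⟩, hQ⟩
  obtain rfl := curvePoint_injective ha X hQ
  exact (hx j).not_ge hj

include hδ hX hφ hφu hφx

lemma contDiffAt_movedCorr : ContDiffAt ℝ ∞ (movedCorr κ δ C h hε0 hε φ) X.1 :=
  (isDeformation_curveHomeomorph (κ := κ) ha hδ h hε0 hε (ℓ := fun Z => Z)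
    contDiff_id).contDiffAt_corr (by simpa using hε0) hX hφ fun i =>
      ⟨_, mem_outsideDiscs (hφu i) (hφx i), fun _ _ => isTranslationOn_outsideDiscs ha h _⟩

lemma hasDerivAt_movedCorr (j : Fin (2 * g + 1)) (c : ℂ) :
    open Classical in
    HasDerivAt (fun t : ℝ => movedCorr κ δ C h hε0 hε φ
        (X.1 + t • (Pi.single j c : Fin (2 * g + 1) → ℂ)))
      (∫ p, 2 * (((if p ∈ flatPart ha X δ φ then c * cutoffBar R (xCoord ha X p - X.1 j)
          else 0 : ℂ).re : ℂ) * C.tensorCorr ha κ δ φ reForm p +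
        ((if p ∈ flatPart ha X δ φ then c * cutoffBar R (xCoord ha X p - X.1 j)
          else 0 : ℂ).im : ℂ) * C.tensorCorr ha κ δ φ imForm p)
        ∂(riemannianVolume (regularizedMetric ha κ δ X))) 0 := by
  have hR := h.pos
  have hδ0 := hδ.pos
  have hδR := hδ.le
  have hnc (t : ℝ) (ht : ‖X.1 + t • (Pi.single j c : Fin (2 * g + 1) → ℂ) - X.1‖ < ε) :
      (nearConfig X ε (X.1 + t • (Pi.single j c : Fin (2 * g + 1) → ℂ))).1 - X.1 =
        t • (Pi.single j c : Fin (2 * g + 1) → ℂ) := by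
    rw [nearConfig_val h hε ht]; simp
  have h0 : (0 : ℝ) ∈ {t : ℝ | ‖X.1 + t • (Pi.single j c : Fin (2 * g + 1) → ℂ) - X.1‖ < ε} := by
    simpa using hε0
  have hsm (t : ℝ) (x : ℂ) : branchShift X.1 R (t • Pi.single j c) x =
      t • branchShift X.1 R (Pi.single j c) x := by
    simp only [branchShift, Finset.smul_sum, Pi.smul_apply, smul_mul_assoc]
  have hd := isDeformation_curveHomeomorph (κ := κ) ha hδ h hε0 hε
    (ℓ := fun t : ℝ => X.1 + t • (Pi.single j c : Fin (2 * g + 1) → ℂ)) (by fun_prop)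
  refine hd.hasDerivAt_corr h0 ?_ (isMetricSurface hd.scale_base hX) hφ
    (fun i => ⟨_, mem_outsideDiscs (hφu i) (hφx i),
      fun _ _ => isTranslationOn_outsideDiscs ha h _⟩) (fun p hp => if_neg hp) ?_ ?_
  · refine ⟨isOpen_univ, 0, fun q _ hq => ?_⟩
    rw [xCoord_curveHomeomorph ha h _ hq, hnc 0 h0, hsm]
    simp
  · intro p hp
    refine ⟨branchShift X.1 R (Pi.single j c), ?_, ?_, ?_⟩
    · have : ContDiff ℝ ∞ (fun x => branchShift X.1 R (Pi.single j c) x) :=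
        (contDiff_branchShift X.1 R).comp (contDiff_const.prodMk contDiff_id)
      exact this.contDiffAt.differentiableAt (by simp)
    · rw [wirtingerBar_branchShift_single, if_pos hp]
    · intro t ht
      filter_upwards [(isOpen_unramified ha X).mem_nhds hp.1] with q hq
      rw [xCoord_curveHomeomorph ha h _ hq, hnc t ht, hsm]
  · intro p hp hpφ
    have : p ∈ outsideDiscs ha X R ∨ ∃ k, p ∈ overDisc ha X R k := by
      by_cases hpu : p ∈ unramified ha X
      · by_cases hk : ∃ k, ‖xCoord ha X p - X.1 k‖ ≤ δ
        · obtain ⟨k, hk⟩ := hk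
          obtain ⟨P, hP, rfl⟩ := hpu
          exact Or.inr ⟨k, P, lt_of_le_of_lt hk (by linarith), rfl⟩
        · push Not at hk
          refine Or.inl (mem_outsideDiscs hpu fun k => ?_)
          have h1 : 1 ≤ δ * ‖xCoord ha X p‖ := by
            by_contra h2
            exact hp ⟨hpu, ⟨hk, not_le.1 h2⟩, hpφ⟩
          have h2 : 1 / δ ≤ ‖xCoord ha X p‖ := by rw [div_le_iff₀ hδ0]; linarith
          have h3 : ‖xCoord ha X p‖ ≤ ‖xCoord ha X p - X.1 k‖ + ‖X.1 k‖ := by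
            simpa using norm_add_le (xCoord ha X p - X.1 k) (X.1 k)
          linarith [hδ.bounded k]
      · exact exists_mem_of_notMem_unramified ha h hpu
    obtain h1 | ⟨k, h1⟩ := this
    · exact ⟨_, h1, fun _ _ => isTranslationOn_outsideDiscs ha h _⟩
    · exact ⟨_, h1, fun _ _ => isTranslationOn_overDisc ha h _ k⟩

omit h hε0 hε hX hφ hφu in
lemma mem_flatPart_of_annulus (j : Fin (2 * g + 1)) (h : IsGoodRadius X.1 R)
    {p : hyperellipticCurve ha X} (hp : p ∈ unramified ha X)
    (h1 : R ≤ ‖xCoord ha X p - X.1 j‖) (h2 : ‖xCoord ha X p - X.1 j‖ ≤ 2 * R) :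
    p ∈ flatPart ha X δ φ := by
  have hR := h.pos
  have hδ0 := hδ.pos
  have hδR := hδ.le
  refine ⟨hp, ⟨fun k => ?_, ?_⟩, fun i hi => ?_⟩
  · by_cases hk : k = j
    · subst hk; linarith
    · linarith [h.other hk h2]
  · have h3 : ‖xCoord ha X p‖ ≤ ‖xCoord ha X p - X.1 j‖ + ‖X.1 j‖ := by
      simpa using norm_add_le (xCoord ha X p - X.1 j) (X.1 j)
    rw [mul_comm, ← lt_div_iff₀ hδ0]
    linarith [hδ.bounded j]
  · have := hφx i j
    rw [hi] at this
    linarith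

/-- The discs of radius `2R` lie in the domains of the charts at the ramification points. -/
def IsChartRadius (a : ℂ) {n : ℕ} (X : Fin n → ℂ) (R : ℝ) : Prop :=
  ∀ j x, ‖x - X j‖ ≤ 2 * R → hCofactor a X j x / hCofactor a X j (X j) ∈ Complex.slitPlane

variable (hRc : IsChartRadius a X.1 R)

include hRc

/-- The derivative is concentrated on the annulus around the branch point that moves. -/
theorem holomorphic_deriv_movedCorr (j : Fin (2 * g + 1)) :
    (fderiv ℝ (movedCorr κ δ C h hε0 hε φ) X.1 (Pi.single j 1) -
      Complex.I * fderiv ℝ (movedCorr κ δ C h hε0 hε φ) X.1 (Pi.single j Complex.I)) / 2 =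
    ∫ w in (ramificationChart ha X j).target, 4 * (‖w‖ ^ 2 : ℝ) * cutoffBar R (w ^ 2) *
      C.stressCorr ha κ δ φ ((ramificationChart ha X j).symm w) := by
  have hR := h.pos
  have hA := isMetricSurface (κ := κ) (X := X) (ha := ha)
    (hδ.isSmallScale h (hε _ (by simpa using hε0))) hX
  set e := ramificationChart ha X j with he
  have hemem : e ∈ atlas ℂ (hyperellipticCurve ha X) := ramificationChart_mem_atlas ha X j
  have hflat {w : ℂ} (hw : w ∈ e.target) (h0 : cutoffBar R (w ^ 2) ≠ 0) :
      e.symm w ∈ flatPart ha X δ φ := by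
    have h1 : ¬ (‖w ^ 2‖ < R ∨ 2 * R < ‖w ^ 2‖) := fun h1 => h0 (cutoffBar_eq_zero hR h1)
    push Not at h1
    have hw0 : w ≠ 0 := by
      rintro rfl
      have := h1.1
      rw [zero_pow two_ne_zero, norm_zero] at this
      linarith
    have h2 : xCoord ha X (e.symm w) = X.1 j + w ^ 2 := rfl
    refine mem_flatPart_of_annulus hδ hφx j h
      (ramificationChart_symm_mem_unramified ha X hw hw0) ?_ ?_
    · rw [h2, add_sub_cancel_left]; exact h1.1
    · rw [h2, add_sub_cancel_left]; exact h1.2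
  have hint (c : ℂ) : fderiv ℝ (movedCorr κ δ C h hε0 hε φ) X.1 (Pi.single j c) =
      ∫ w in e.target, (4 * (‖w‖ ^ 2 : ℝ) * 2 *
        (((c * cutoffBar R (w ^ 2)).re : ℂ) * C.tensorCorr ha κ δ φ reForm (e.symm w) +
        ((c * cutoffBar R (w ^ 2)).im : ℂ) * C.tensorCorr ha κ δ φ imForm (e.symm w)) : ℂ) := by
    classical
    have h1 := hasDerivAt_movedCorr (κ := κ) h hε0 hε hδ hX hφ hφu hφx j c
    have h2 : HasDerivAt (fun t : ℝ => X.1 + t • (Pi.single j c : Fin (2 * g + 1) → ℂ))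
        (Pi.single j c) 0 := by
      simpa using ((hasDerivAt_id (0 : ℝ)).smul_const
        (Pi.single j c : Fin (2 * g + 1) → ℂ)).const_add X.1
    have h3 := ((contDiffAt_movedCorr (κ := κ) h hε0 hε hδ hX hφ hφu hφx).differentiableAt
      (by simp)).hasFDerivAt.comp_hasDerivAt_of_eq (0 : ℝ) h2 (by simp)
    -- in the coordinate `w` with `x = X j + w²` the flat metric `|dx|²` is `4 |w|² |dw|²`
    rw [h3.unique h1, integral_riemannianVolume_of_support hA.metric hemem]
    · refine setIntegral_congr_fun e.open_target.measurableSet fun w hw => ?_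
      by_cases h0 : cutoffBar R (w ^ 2) = 0
      · have h4 : xCoord ha X (e.symm w) - X.1 j = w ^ 2 := by
          change X.1 j + w ^ 2 - X.1 j = _; ring
        simp only [h4, h0]
        simp
      · have h4 : xCoord ha X (e.symm w) - X.1 j = w ^ 2 := by
          change X.1 j + w ^ 2 - X.1 j = _; ring
        have h5 := hflat hw h0
        have h6 : conformalFactor (regularizedMetric ha κ δ X) e w = 4 * ‖w‖ ^ 2 := by
          rw [conformalFactor_eq_deriv ha X _ hemem hw h5.1, regularizedMetric_flat ha hδ.pos h5]
          have h7 : xInChart ha X e = fun w => X.1 j + w ^ 2 := rfl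
          have h8 : HasDerivAt (fun w : ℂ => X.1 j + w ^ 2) (2 * w) w := by
            simpa using (hasDerivAt_pow 2 w).const_add (X.1 j)
          rw [h7, h8.deriv, norm_mul, Complex.norm_ofNat]
          ring
        simp only [h4, if_pos h5, h6]
        push_cast
        ring
    · refine Eventually.of_forall fun p hp => ?_
      have h4 : (if p ∈ flatPart ha X δ φ then c * cutoffBar R (xCoord ha X p - X.1 j)
          else 0 : ℂ) = 0 := by
        split_ifs with h5
        · obtain ⟨P, hP, rfl⟩ := h5.1
          rw [cutoffBar_eq_zero hR, mul_zero]
          right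
          by_contra h6
          exact hp ⟨P, hRc j _ (not_lt.1 h6), rfl⟩
        · rfl
      rw [h4]; simp
  set Ω : Set ℂ := e.target ∩ {w | w ≠ 0} ∩ e.symm ⁻¹' flatPart ha X δ φ with hΩ
  have hkc (l : ℂ →L[ℝ] ℝ) : Continuous fun w : ℂ => (4 * (‖w‖ ^ 2 : ℝ) *
      (l (cutoffBar R (w ^ 2)) : ℂ) : ℂ) := by
    have h1 : Continuous fun w : ℂ => cutoffBar R (w ^ 2) :=
      (continuous_cutoffBar R).comp (by fun_prop)
    exact (continuous_const.mul (Complex.continuous_ofReal.comp (by fun_prop))).mul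
      (Complex.continuous_ofReal.comp (l.continuous.comp h1))
  have hcl : IsClosed {w : ℂ | R ≤ ‖w ^ 2‖ ∧ ‖w ^ 2‖ ≤ 2 * R} := by
    have h1 : Continuous fun w : ℂ => ‖w ^ 2‖ := by fun_prop
    exact (isClosed_le continuous_const h1).inter (isClosed_le h1 continuous_const)
  have hks (l : ℂ →L[ℝ] ℝ) : tsupport (fun w : ℂ => (4 * (‖w‖ ^ 2 : ℝ) *
      (l (cutoffBar R (w ^ 2)) : ℂ) : ℂ)) ⊆ {w | R ≤ ‖w ^ 2‖ ∧ ‖w ^ 2‖ ≤ 2 * R} := by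
    refine closure_minimal (fun w hw => ?_) hcl
    by_contra h1
    refine hw ?_
    have h2 : ‖w ^ 2‖ < R ∨ 2 * R < ‖w ^ 2‖ := by
      by_contra h3
      push Not at h3
      exact h1 h3
    simp only [cutoffBar_eq_zero hR h2, map_zero, Complex.ofReal_zero, mul_zero]
  have hcs (l : ℂ →L[ℝ] ℝ) : HasCompactSupport (fun w : ℂ => (4 * (‖w‖ ^ 2 : ℝ) *
      (l (cutoffBar R (w ^ 2)) : ℂ) : ℂ)) := by
    refine (isCompact_closedBall (0 : ℂ) (1 + 2 * R)).of_isClosed_subset (isClosed_tsupport _)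
      fun w hw => ?_
    have h1 := (hks l hw).2
    rw [norm_pow] at h1
    rw [mem_closedBall_zero_iff]
    nlinarith [norm_nonneg w]
  have hsub : {w : ℂ | R ≤ ‖w ^ 2‖ ∧ ‖w ^ 2‖ ≤ 2 * R} ⊆
      e.target ∩ e.symm ⁻¹' flatPart ha X δ φ := by
    rintro w ⟨h1, h2⟩
    have hw : w ∈ e.target := by
      change hCofactor a X.1 j (X.1 j + w ^ 2) / hCofactor a X.1 j (X.1 j) ∈ Complex.slitPlane
      exact hRc j _ (by rwa [add_sub_cancel_left])
    have hw0 : w ≠ 0 := by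
      rintro rfl
      rw [zero_pow two_ne_zero, norm_zero] at h1
      linarith
    refine ⟨hw, mem_flatPart_of_annulus hδ hφx j h
      (ramificationChart_symm_mem_unramified ha X hw hw0) ?_ ?_⟩
    · change R ≤ ‖X.1 j + w ^ 2 - X.1 j‖
      rw [add_sub_cancel_left]; exact h1
    · change ‖X.1 j + w ^ 2 - X.1 j‖ ≤ _
      rw [add_sub_cancel_left]; exact h2
  have hI (l : ℂ →L[ℝ] ℝ) (B : Form) : Integrable (fun w : ℂ => (4 * (‖w‖ ^ 2 : ℝ) *
      (l (cutoffBar R (w ^ 2)) : ℂ)) * C.tensorCorr ha κ δ φ B (e.symm w)) := by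
    refine integrable_mul_of_tsupport_subset (hkc l) (hcs l) ((hks l).trans hsub) fun w hw => ?_
    exact (ContinuousAt.comp (C.continuousAt_tensorCorr ha hA hφ hw.2 B)
      (e.continuousAt_symm hw.1)).continuousWithinAt
  have hJ (c : ℂ) : IntegrableOn (fun w : ℂ => (4 * (‖w‖ ^ 2 : ℝ) * 2 *
        (((c * cutoffBar R (w ^ 2)).re : ℂ) * C.tensorCorr ha κ δ φ reForm (e.symm w) +
        ((c * cutoffBar R (w ^ 2)).im : ℂ) * C.tensorCorr ha κ δ φ imForm (e.symm w)) : ℂ))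
        e.target := by
    have h1 := (hI (Complex.reCLM.comp (ContinuousLinearMap.mul ℝ ℂ c)) reForm).const_mul 2
    have h2 := (hI (Complex.imCLM.comp (ContinuousLinearMap.mul ℝ ℂ c)) imForm).const_mul 2
    refine ((h1.add h2).integrableOn).congr_fun (fun w _ => ?_) e.open_target.measurableSet
    change 2 * (4 * _ * ((c * cutoffBar R (w ^ 2)).re : ℂ) * _) +
      2 * (4 * _ * ((c * cutoffBar R (w ^ 2)).im : ℂ) * _) = _
    ring
  -- the combination of the displacements `1` and `i` leaves the pairing `(T, dz̄²)`
  rw [hint 1, hint Complex.I, ← integral_const_mul, ← integral_sub (hJ 1)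
    ((hJ Complex.I).const_mul _), ← integral_div]
  refine integral_congr_ae (Eventually.of_forall fun w => ?_)
  simp only [ConformalFieldTheory.stressCorr, one_mul, Complex.mul_re, Complex.mul_im,
    Complex.I_re, Complex.I_im, zero_mul, zero_sub, zero_add, Complex.ofReal_neg]
  have h3 := Complex.re_add_im (cutoffBar R (w ^ 2))
  set r : ℂ := ((cutoffBar R (w ^ 2)).re : ℂ)
  set s : ℂ := ((cutoffBar R (w ^ 2)).im : ℂ)
  rw [← h3]
  linear_combination (-(4 * (‖w‖ ^ 2 : ℝ) : ℂ) * s * C.tensorCorr ha κ δ φ imForm (e.symm w)) *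
    -Complex.I_mul_I

end Hyperelliptic

/-! ### Loops around a ramification point -/

namespace Hyperelliptic

section Sheet

variable {n : ℕ} (a : ℂ) (X : Fin n → ℂ) (j : Fin n)

/-- A square root of `p(x) / (x - X j)` as a function of `z = x - X j`. -/
def cofactorRoot (z : ℂ) : ℂ :=
  Complex.sqrt (hCofactor a X j (X j)) *
    ∏ k ∈ Finset.univ.erase j, Complex.sqrt (1 + z / (X j - X k))

variable {X} in
lemma cofactorRoot_sq (hX : Function.Injective X) (z : ℂ) :
    cofactorRoot a X j z ^ 2 = hCofactor a X j (X j + z) := by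
  unfold cofactorRoot hCofactor
  rw [mul_pow, csqrt_sq, ← Finset.prod_pow, mul_assoc, ← Finset.prod_mul_distrib]
  congr 1
  refine Finset.prod_congr rfl fun k hk => ?_
  have h1 : X j - X k ≠ 0 := sub_ne_zero.2 fun h => (Finset.mem_erase.1 hk).1 (hX h).symm
  rw [csqrt_sq]
  field_simp
  ring

variable {X j} {r : ℝ}

lemma one_add_div_mem_slitPlane (hr : ∀ k, k ≠ j → r ≤ ‖X k - X j‖) {z : ℂ} (hz : ‖z‖ < r)
    {k : Fin n} (hk : k ≠ j) : 1 + z / (X j - X k) ∈ Complex.slitPlane := by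
  have h1 := hr k hk
  rw [norm_sub_rev] at h1
  have h2 : ‖z / (X j - X k)‖ < 1 := by
    rw [norm_div, div_lt_one (by linarith [norm_nonneg z])]
    linarith
  have h3 := abs_lt.1 ((Complex.abs_re_le_norm (z / (X j - X k))).trans_lt h2)
  refine Or.inl ?_
  simp only [Complex.add_re, Complex.one_re]
  linarith [h3.1]

lemma continuousAt_cofactorRoot (hr : ∀ k, k ≠ j → r ≤ ‖X k - X j‖) {z : ℂ} (hz : ‖z‖ < r) :
    ContinuousAt (cofactorRoot a X j) z := by
  unfold cofactorRoot
  refine continuousAt_const.mul (tendsto_finsetProd _ fun k hk => ?_)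
  exact ContinuousAt.comp (g := Complex.sqrt) (Complex.differentiableAt_sqrt
    (one_add_div_mem_slitPlane hr hz (Finset.mem_erase.1 hk).1)).continuousAt (by fun_prop)

lemma cofactorRoot_ne_zero {a : ℂ} (ha : a ≠ 0) (hX : Function.Injective X)
    (hr : ∀ k, k ≠ j → r ≤ ‖X k - X j‖) {z : ℂ} (hz : ‖z‖ < r) : cofactorRoot a X j z ≠ 0 :=
  mul_ne_zero (csqrt_ne_zero (hCofactor_ne_zero ha hX j)) (Finset.prod_ne_zero_iff.2 fun _ hk =>
    csqrt_ne_zero (Complex.slitPlane_ne_zero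
      (one_add_div_mem_slitPlane hr hz (Finset.mem_erase.1 hk).1)))

variable (X j) in
/-- The parametrisation of the punctured neighbourhood of the ramification point over `X j` by its
universal covering: `ζ` is a logarithm of `x - X j`. -/
def logParam (hX : Function.Injective X) (ζ : ℂ) : AffineCurve a X :=
  ⟨(X j + Complex.exp ζ, Complex.exp (ζ / 2) * cofactorRoot a X j (Complex.exp ζ)), by
    change (Complex.exp (ζ / 2) * cofactorRoot a X j (Complex.exp ζ)) ^ 2 = hPoly a X _
    rw [mul_pow, cofactorRoot_sq a j hX, hPoly_eq_mul a X j, ← Complex.exp_nat_mul,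
      show ((2 : ℕ) : ℂ) * (ζ / 2) = ζ by push_cast; ring, add_sub_cancel_left]⟩

variable (hX : Function.Injective X)

lemma logParam_fst (ζ : ℂ) : (logParam a X j hX ζ).1.1 = X j + Complex.exp ζ := rfl

lemma logParam_add_two_pi (ζ : ℂ) :
    (logParam a X j hX (ζ + 2 * Real.pi * Complex.I)).1.2 = -(logParam a X j hX ζ).1.2 := by
  change Complex.exp ((ζ + 2 * Real.pi * Complex.I) / 2) * cofactorRoot a X j (Complex.exp _) =
    -(Complex.exp (ζ / 2) * cofactorRoot a X j (Complex.exp ζ))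
  rw [Complex.exp_periodic, add_div, Complex.exp_add,
    show 2 * (Real.pi : ℂ) * Complex.I / 2 = Real.pi * Complex.I by ring, Complex.exp_pi_mul_I]
  ring

lemma logParam_add_four_pi (ζ : ℂ) :
    logParam a X j hX (ζ + 2 * (2 * Real.pi * Complex.I)) = logParam a X j hX ζ := by
  have h1 : ζ + 2 * (2 * Real.pi * Complex.I) =
    ζ + 2 * Real.pi * Complex.I + 2 * Real.pi * Complex.I := by ring
  refine Subtype.ext (Prod.ext ?_ ?_)
  · rw [logParam_fst, logParam_fst, h1, Complex.exp_periodic, Complex.exp_periodic]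
  · rw [h1, logParam_add_two_pi, logParam_add_two_pi, neg_neg]

lemma continuousAt_logParam (hr : ∀ k, k ≠ j → r ≤ ‖X k - X j‖) {ζ : ℂ}
    (hζ : ‖Complex.exp ζ‖ < r) : ContinuousAt (logParam a X j hX) ζ := by
  refine Topology.IsInducing.subtypeVal.continuousAt_iff.2 ?_
  refine ContinuousAt.prodMk (by fun_prop) (ContinuousAt.mul (by fun_prop) ?_)
  exact ContinuousAt.comp (g := cofactorRoot a X j) (continuousAt_cofactorRoot a hr hζ)
    (by fun_prop)

lemma logParam_snd_ne_zero {a : ℂ} (ha : a ≠ 0) (hr : ∀ k, k ≠ j → r ≤ ‖X k - X j‖) {ζ : ℂ}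
    (hζ : ‖Complex.exp ζ‖ < r) : (logParam a X j hX ζ).1.2 ≠ 0 :=
  mul_ne_zero (Complex.exp_ne_zero _) (cofactorRoot_ne_zero ha hX hr hζ)

/-- Every path that does not meet the ramification point lifts to the universal covering. -/
lemma exists_lift_logParam {a : ℂ} (ha : a ≠ 0) (hr : ∀ k, k ≠ j → r ≤ ‖X k - X j‖)
    {γ : ℝ → AffineCurve a X} (hγ : IsLoopAround X j r γ) :
    ∃ Λ : ℝ → ℂ, (∀ t ∈ Set.Icc (0 : ℝ) 1, logParam a X j hX (Λ t) = γ t) ∧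
      (∀ t ∈ Set.Icc (0 : ℝ) 1, HasDerivWithinAt Λ
        (deriv (fun t => (γ t).1.1) t / ((γ t).1.1 - X j)) (Set.Icc 0 1) t) ∧
      Λ 1 = Λ 0 + 2 * (2 * Real.pi * Complex.I) := by
  set x : ℝ → ℂ := fun t => (γ t).1.1 with hx
  have hxd : ∀ t, HasDerivAt x (deriv x t) t := fun t =>
    ((hγ.smooth.differentiable one_ne_zero) t).hasDerivAt
  have hx0 : ∀ t ∈ Set.Icc (0 : ℝ) 1, x t - X j ≠ 0 := fun t ht => sub_ne_zero.2 (hγ.avoids t ht)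
  have hdc : ContinuousOn (fun t => deriv x t / (x t - X j)) (Set.Icc 0 1) :=
    ((hγ.smooth.continuous_deriv le_rfl).continuousOn).div
      ((hγ.smooth.continuous.continuousOn).sub continuousOn_const) hx0
  -- the logarithm at the start of the path is chosen on the sheet of `γ 0`
  obtain ⟨ζ₀, hζ₀⟩ : ∃ ζ₀, logParam a X j hX ζ₀ = γ 0 := by
    have h0 := hx0 0 (by simp)
    have h1 : X j + Complex.exp (Complex.log (x 0 - X j)) = x 0 := by
      rw [Complex.exp_log h0]; ring
    have h2 : (logParam a X j hX (Complex.log (x 0 - X j))).1.2 ^ 2 = (γ 0).1.2 ^ 2 := by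
      rw [(logParam a X j hX (Complex.log (x 0 - X j))).2, (γ 0).2, logParam_fst, h1]
    obtain h3 | h3 := sq_eq_sq_iff_eq_or_eq_neg.1 h2
    · exact ⟨Complex.log (x 0 - X j), Subtype.ext (Prod.ext h1 h3)⟩
    · refine ⟨Complex.log (x 0 - X j) + 2 * Real.pi * Complex.I, Subtype.ext (Prod.ext ?_ ?_)⟩
      · rw [logParam_fst, Complex.exp_periodic]; exact h1
      · rw [logParam_add_two_pi, h3, neg_neg]
  set Λ : ℝ → ℂ := fun t => ζ₀ + ∫ s in (0 : ℝ)..t, deriv x s / (x s - X j) with hΛ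
  have hΛd : ∀ t ∈ Set.Icc (0 : ℝ) 1, HasDerivWithinAt Λ (deriv x t / (x t - X j))
      (Set.Icc 0 1) t := by
    intro t ht
    have : Fact (t ∈ Set.Icc (0 : ℝ) 1) := ⟨ht⟩
    refine HasDerivWithinAt.const_add _ ?_
    refine intervalIntegral.integral_hasDerivWithinAt_right ?_ ?_ (hdc t ht)
    · refine ContinuousOn.intervalIntegrable ?_
      rw [Set.uIcc_of_le ht.1]
      exact hdc.mono (Set.Icc_subset_Icc_right ht.2)
    · exact hdc.stronglyMeasurableAtFilter_nhdsWithin measurableSet_Icc t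
  have hexp : ∀ t ∈ Set.Icc (0 : ℝ) 1, Complex.exp (Λ t) = x t - X j := by
    have h1 : ∀ t ∈ Set.Icc (0 : ℝ) 1, HasDerivWithinAt
        (fun t => (x t - X j) * Complex.exp (-Λ t)) 0 (Set.Icc 0 1) t := by
      intro t ht
      have h2 := (((hxd t).hasDerivWithinAt (s := Set.Icc (0 : ℝ) 1)).sub_const (X j)).mul
        ((hΛd t ht).neg.cexp)
      refine h2.congr_deriv ?_
      have := hx0 t ht
      field_simp
      ring
    intro t ht
    have h3 := constant_of_has_deriv_right_zero (f := fun t => (x t - X j) * Complex.exp (-Λ t))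
      (a := 0) (b := 1) (fun t ht => (h1 t ht).continuousWithinAt)
      (fun t ht => ((h1 t ⟨ht.1, ht.2.le⟩).mono_of_mem_nhdsWithin
        (Icc_mem_nhdsGE_of_mem ht))) t ht
    have h4 : Complex.exp ζ₀ = x 0 - X j := by
      have h5 : X j + Complex.exp ζ₀ = x 0 :=
        congrArg (fun P : AffineCurve a X => P.1.1) hζ₀
      rw [← h5]; ring
    simp only [hΛ, intervalIntegral.integral_same, add_zero] at h3
    rw [← h4, ← Complex.exp_add, add_neg_cancel, Complex.exp_zero] at h3
    have h5 : Complex.exp (Λ t) * Complex.exp (-Λ t) = 1 := by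
      rw [← Complex.exp_add, add_neg_cancel, Complex.exp_zero]
    have h6 : (x t - X j) * Complex.exp (-Λ t) = 1 := h3
    exact mul_right_cancel₀ (Complex.exp_ne_zero (-Λ t)) (h5.trans h6.symm)
  refine ⟨Λ, ?_, hΛd, ?_⟩
  · -- the two lifts of the projected path agree at the start, and the quotient of their values of
    -- `y` is continuous with values `1` and `-1`
    have hfst : ∀ t ∈ Set.Icc (0 : ℝ) 1, (logParam a X j hX (Λ t)).1.1 = (γ t).1.1 := by
      intro t ht
      rw [logParam_fst, hexp t ht]; ring
    have hnorm : ∀ t ∈ Set.Icc (0 : ℝ) 1, ‖Complex.exp (Λ t)‖ < r := by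
      intro t ht
      rw [hexp t ht]; exact hγ.mem t ht
    have hne : ∀ t ∈ Set.Icc (0 : ℝ) 1, (logParam a X j hX (Λ t)).1.2 ≠ 0 := fun t ht =>
      logParam_snd_ne_zero hX ha hr (hnorm t ht)
    have hsq : ∀ t ∈ Set.Icc (0 : ℝ) 1,
        ((γ t).1.2 / (logParam a X j hX (Λ t)).1.2) ^ 2 = 1 := by
      intro t ht
      rw [div_pow, (γ t).2, (logParam a X j hX (Λ t)).2, hfst t ht]
      refine div_self ?_
      rw [← (γ t).2]
      have h1 : (γ t).1.2 ^ 2 = (logParam a X j hX (Λ t)).1.2 ^ 2 := by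
        rw [(γ t).2, (logParam a X j hX (Λ t)).2, hfst t ht]
      rw [h1]
      exact pow_ne_zero 2 (hne t ht)
    have hcont : ContinuousOn (fun t => (γ t).1.2 / (logParam a X j hX (Λ t)).1.2)
        (Set.Icc 0 1) := by
      intro t ht
      have h1 : ContinuousAt (fun ζ => (logParam a X j hX ζ).1.2) (Λ t) :=
        ((continuous_snd.comp continuous_subtype_val).continuousAt).comp
          (continuousAt_logParam a hX hr (hnorm t ht))
      have h2 : Continuous fun t => (γ t).1.2 :=
        (continuous_snd.comp continuous_subtype_val).comp hγ.continuous
      exact (h2.continuousWithinAt).div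
        (h1.comp_continuousWithinAt (hΛd t ht).continuousWithinAt) (hne t ht)
    have hone : ∀ t ∈ Set.Icc (0 : ℝ) 1, (γ t).1.2 / (logParam a X j hX (Λ t)).1.2 = 1 := by
      have h0 : (γ 0).1.2 / (logParam a X j hX (Λ 0)).1.2 = 1 := by
        have : logParam a X j hX (Λ 0) = γ 0 := by
          rw [hΛ]; simp only [intervalIntegral.integral_same, add_zero]; exact hζ₀
        have h1 := hne 0 (by simp)
        rw [this] at h1 ⊢
        exact div_self h1
      intro t ht
      obtain h1 | h1 := isPreconnected_Icc.eq_one_or_eq_neg_one_of_sq_eq hcont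
        (fun t ht => hsq t ht)
      · exact h1 ht
      · have h2 := h1 (show (0 : ℝ) ∈ Set.Icc (0 : ℝ) 1 by simp)
        simp only [Pi.neg_apply, Pi.one_apply] at h2
        rw [h0] at h2
        norm_num at h2
    intro t ht
    refine Subtype.ext (Prod.ext (hfst t ht) ?_)
    exact ((div_eq_one_iff_eq (hne t ht)).1 (hone t ht)).symm
  · simp only [hΛ, intervalIntegral.integral_same, add_zero]
    rw [hγ.winding]

end Sheet

end Hyperelliptic

/-! ### Contour integrals of holomorphic functions around a ramification point -/

namespace Hyperelliptic

section Contour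

variable {n : ℕ} {a : ℂ} {X : Fin n → ℂ} {j : Fin n} {r ρ₀ ρ₁ : ℝ}

/-- The function `τ` on the affine curve is holomorphic in the coordinate `x` over the annulus
`ρ₀ < |x - X j| < ρ₁`. -/
def IsHolomorphicOver (X : Fin n → ℂ) (j : Fin n) (ρ₀ ρ₁ : ℝ) (τ : AffineCurve a X → ℂ) : Prop :=
  ∀ P (h : P.1.2 ≠ 0), ρ₀ < ‖P.1.1 - X j‖ → ‖P.1.1 - X j‖ < ρ₁ →
    DifferentiableAt ℂ (fun x => τ ((xChartAffine P h).symm x)) P.1.1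

lemma differentiableAt_comp_logParam (ha : a ≠ 0) (hX : Function.Injective X)
    (hr : ∀ k, k ≠ j → r ≤ ‖X k - X j‖) (hρ : ρ₁ ≤ r) {τ : AffineCurve a X → ℂ}
    (hτ : IsHolomorphicOver X j ρ₀ ρ₁ τ) {ζ : ℂ} (h0 : ρ₀ < ‖Complex.exp ζ‖)
    (h1 : ‖Complex.exp ζ‖ < ρ₁) : DifferentiableAt ℂ (fun ζ => τ (logParam a X j hX ζ)) ζ := by
  have hy := logParam_snd_ne_zero hX ha hr (h1.trans_le hρ)
  have hz : (logParam a X j hX ζ).1.1 - X j = Complex.exp ζ := by rw [logParam_fst]; ring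
  have h2 := hτ (logParam a X j hX ζ) hy (by rwa [hz]) (by rwa [hz])
  have h3 : DifferentiableAt ℂ (fun ζ => X j + Complex.exp ζ) ζ := by fun_prop
  refine (DifferentiableAt.comp (g := fun x => τ ((xChartAffine _ hy).symm x)) ζ h2
    h3).congr_of_eventuallyEq ?_
  have h4 : logParam a X j hX ζ ∈ (xChartAffine _ hy).source := by
    change 0 < ((logParam a X j hX ζ).1.2 / (logParam a X j hX ζ).1.2).re
    rw [div_self hy]; simp
  filter_upwards [(continuousAt_logParam a hX hr (h1.trans_le hρ)).eventually
    ((xChartAffine _ hy).open_source.mem_nhds h4)] with ζ' h5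
  exact (congrArg τ ((xChartAffine _ hy).left_inv h5)).symm

/-- The contour integral of a holomorphic function does not depend on the loop around the
ramification point: it is the increment of a primitive on the universal covering over a period. -/
theorem exists_contour_integral_eq (ha : a ≠ 0) (hX : Function.Injective X)
    (hr : ∀ k, k ≠ j → r ≤ ‖X k - X j‖) (hρ : ρ₁ ≤ r) {τ : AffineCurve a X → ℂ}
    (hτ : IsHolomorphicOver X j ρ₀ ρ₁ τ) : ∃ J : ℂ, ∀ γ : ℝ → AffineCurve a X,
      IsLoopAround X j r γ →
      (∀ t ∈ Set.Icc (0 : ℝ) 1, ρ₀ < ‖(γ t).1.1 - X j‖ ∧ ‖(γ t).1.1 - X j‖ < ρ₁) →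
      ∫ t in (0 : ℝ)..1, τ (γ t) * deriv (fun t => (γ t).1.1) t = J := by
  set W : Set ℂ := {ζ | ρ₀ < Real.exp ζ.re ∧ Real.exp ζ.re < ρ₁} with hW
  have hWo : IsOpen W := by
    have h1 : Continuous fun ζ : ℂ => Real.exp ζ.re := by fun_prop
    exact (isOpen_lt continuous_const h1).inter (isOpen_lt h1 continuous_const)
  have hWc : Convex ℝ W := by
    have h1 : Convex ℝ (Real.exp ⁻¹' Set.Ioo ρ₀ ρ₁) :=
      (Set.ordConnected_Ioo.preimage_mono Real.exp_monotone).convex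
    exact h1.linear_preimage Complex.reLm
  have hWp {ζ : ℂ} (hζ : ζ ∈ W) : ζ + 2 * (2 * Real.pi * Complex.I) ∈ W := by
    have : (ζ + 2 * (2 * Real.pi * Complex.I)).re = ζ.re := by simp
    simpa only [hW, Set.mem_ofPred_eq, this] using hζ
  set H : ℂ → ℂ := fun ζ => τ (logParam a X j hX ζ) * Complex.exp ζ with hH
  have hHd : DifferentiableOn ℂ H W := fun ζ hζ =>
    ((differentiableAt_comp_logParam ha hX hr hρ hτ (by rw [Complex.norm_exp]; exact hζ.1)
      (by rw [Complex.norm_exp]; exact hζ.2)).mul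
        Complex.differentiable_exp.differentiableAt).differentiableWithinAt
  -- the period is `4πi` as a loop around the ramification point winds twice around `X j`
  have hHp (ζ : ℂ) : H (ζ + 2 * (2 * Real.pi * Complex.I)) = H ζ := by
    simp only [hH, logParam_add_four_pi]
    have : ζ + 2 * (2 * Real.pi * Complex.I) =
      ζ + 2 * Real.pi * Complex.I + 2 * Real.pi * Complex.I := by ring
    rw [this, Complex.exp_periodic, Complex.exp_periodic]
  obtain ⟨G, hG⟩ := hWc.exists_forall_hasDerivWithinAt hHd
  have hG' : ∀ ζ ∈ W, HasDerivAt G (H ζ) ζ := fun ζ hζ => (hG ζ hζ).hasDerivAt (hWo.mem_nhds hζ)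
  -- the derivative of the increment vanishes, and `W` is connected
  have hJ : ∃ J, ∀ ζ ∈ W, G (ζ + 2 * (2 * Real.pi * Complex.I)) - G ζ = J := by
    have hd : ∀ ζ ∈ W, HasDerivAt (fun ζ => G (ζ + 2 * (2 * Real.pi * Complex.I)) - G ζ) 0 ζ := by
      intro ζ hζ
      have h1 := ((hG' _ (hWp hζ)).comp_add_const ζ (2 * (2 * Real.pi * Complex.I))).sub (hG' ζ hζ)
      rwa [hHp, sub_self] at h1
    by_cases hne : W.Nonempty
    · obtain ⟨ζ₁, h1⟩ := hne
      refine ⟨_, fun ζ hζ => hWo.is_const_of_deriv_eq_zero hWc.isPreconnected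
        (fun ζ hζ => (hd ζ hζ).differentiableAt.differentiableWithinAt)
        (fun ζ hζ => (hd ζ hζ).deriv) hζ h1⟩
    · exact ⟨0, fun ζ hζ => absurd ⟨ζ, hζ⟩ hne⟩
  obtain ⟨J, hJ⟩ := hJ
  refine ⟨J, fun γ hγ hb => ?_⟩
  obtain ⟨Λ, h1, h2, h3⟩ := exists_lift_logParam hX ha hr hγ
  have hexp : ∀ t ∈ Set.Icc (0 : ℝ) 1, Complex.exp (Λ t) = (γ t).1.1 - X j := by
    intro t ht
    rw [← h1 t ht, logParam_fst]; ring
  have hΛW : ∀ t ∈ Set.Icc (0 : ℝ) 1, Λ t ∈ W := by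
    intro t ht
    have := hb t ht
    rwa [← hexp t ht, Complex.norm_exp] at this
  have hΛc : ContinuousOn Λ (Set.Icc 0 1) := fun t ht => (h2 t ht).continuousWithinAt
  have hdc : ContinuousOn (fun t => deriv (fun t => (γ t).1.1) t / ((γ t).1.1 - X j))
      (Set.Icc 0 1) :=
    ((hγ.smooth.continuous_deriv le_rfl).continuousOn).div
      ((hγ.smooth.continuous.continuousOn).sub continuousOn_const)
      fun t ht => sub_ne_zero.2 (hγ.avoids t ht)
  have hFTC := intervalIntegral.integral_eq_sub_of_hasDeriv_right_of_le zero_le_one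
    (f := fun t => G (Λ t))
    (f' := fun t => H (Λ t) * (deriv (fun t => (γ t).1.1) t / ((γ t).1.1 - X j)))
    (fun t ht => ((hG' _ (hΛW t ht)).continuousAt.comp_continuousWithinAt (hΛc t ht)))
    (fun t ht => by
      have h4 := (hG' _ (hΛW t ⟨ht.1.le, ht.2.le⟩)).comp_hasDerivWithinAt t
        (h2 t ⟨ht.1.le, ht.2.le⟩)
      exact h4.mono_of_mem_nhdsWithin (mem_nhdsWithin_of_mem_nhds (Icc_mem_nhds ht.1 ht.2)))
    (ContinuousOn.intervalIntegrable (by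
      rw [Set.uIcc_of_le zero_le_one]
      exact (hHd.continuousOn.comp hΛc hΛW).mul hdc))
  rw [h3, hJ _ (hΛW 0 (by simp))] at hFTC
  rw [← hFTC]
  refine intervalIntegral.integral_congr fun t ht => ?_
  rw [Set.uIcc_of_le zero_le_one] at ht
  have h4 := sub_ne_zero.2 (hγ.avoids t ht)
  simp only [hH]
  rw [h1 t ht, hexp t ht]
  field_simp

/-- The circle of radius `s` in the coordinate `w` at the ramification point over `X j`. -/
def ramificationCircle (ha : a ≠ 0) (hX : Function.Injective X) (j : Fin n) (s t : ℝ) :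
    AffineCurve a X :=
  (wChartAffine j (hCofactor_ne_zero ha hX j)).symm
    (s * Complex.exp ((2 * Real.pi * t - Real.pi : ℝ) * Complex.I))

lemma ramificationCircle_fst (ha : a ≠ 0) (hX : Function.Injective X) (s t : ℝ) :
    (ramificationCircle ha hX j s t).1.1 =
      X j + (s * Complex.exp ((2 * Real.pi * t - Real.pi : ℝ) * Complex.I)) ^ 2 := rfl

lemma hasDerivAt_ramificationCircle (ha : a ≠ 0) (hX : Function.Injective X) (s t : ℝ) :
    HasDerivAt (fun t => (ramificationCircle ha hX j s t).1.1) (2 * (2 * Real.pi * Complex.I) *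
      (s * Complex.exp ((2 * Real.pi * t - Real.pi : ℝ) * Complex.I)) ^ 2) t := by
  simp only [ramificationCircle_fst]
  have h1 : HasDerivAt (fun t : ℝ => 2 * Real.pi * t - Real.pi) (2 * Real.pi) t := by
    simpa using ((hasDerivAt_id t).const_mul (2 * Real.pi)).sub_const Real.pi
  have h2 := ((((h1.ofReal_comp.mul_const Complex.I).cexp).const_mul (s : ℂ)).pow 2).const_add (X j)
  refine h2.congr_deriv ?_
  push_cast
  ring

lemma norm_ramificationCircle (ha : a ≠ 0) (hX : Function.Injective X) (s t : ℝ) :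
    ‖(ramificationCircle ha hX j s t).1.1 - X j‖ = s ^ 2 := by
  rw [ramificationCircle_fst, add_sub_cancel_left, norm_pow, norm_mul, Complex.norm_exp_ofReal_mul_I,
    Complex.norm_real, mul_one, Real.norm_eq_abs, sq_abs]

lemma isLoopAround_ramificationCircle (ha : a ≠ 0) (hX : Function.Injective X) {R s : ℝ}
    (hRc : IsChartRadius a X R) (hs0 : s ≠ 0) (hs : s ^ 2 ≤ 2 * R) (hsr : s ^ 2 < r) :
    IsLoopAround X j r (ramificationCircle ha hX j s) where
  continuous := by
    have hw : Continuous fun t : ℝ =>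
      (s * Complex.exp ((2 * Real.pi * t - Real.pi : ℝ) * Complex.I) : ℂ) := by fun_prop
    rw [continuous_iff_continuousAt]
    intro t
    refine ContinuousAt.comp (OpenPartialHomeomorph.continuousAt_symm _ ?_) hw.continuousAt
    refine hRc j _ ?_
    rw [← ramificationCircle_fst ha hX, norm_ramificationCircle]
    exact hs
  smooth := by
    simp only [ramificationCircle_fst]
    have h1 : ContDiff ℝ 1 fun t : ℝ => 2 * Real.pi * t - Real.pi := by fun_prop
    exact contDiff_const.add ((contDiff_const.mul
      ((Complex.ofRealCLM.contDiff.comp h1).mul contDiff_const).cexp).pow 2)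
  closed := by
    unfold ramificationCircle
    congr 2
    have h1 : ((2 * Real.pi * 1 - Real.pi : ℝ) * Complex.I : ℂ) =
      ((2 * Real.pi * 0 - Real.pi : ℝ) * Complex.I : ℂ) + 2 * Real.pi * Complex.I := by
      push_cast; ring
    rw [h1, Complex.exp_periodic]
  avoids t _ := by
    rw [← sub_ne_zero, ← norm_pos_iff, norm_ramificationCircle]
    positivity
  mem t _ := by rw [norm_ramificationCircle]; exact hsr
  winding := by
    have h1 : ∀ t : ℝ, deriv (fun t => (ramificationCircle ha hX j s t).1.1) t /
        ((ramificationCircle ha hX j s t).1.1 - X j) = 2 * (2 * Real.pi * Complex.I) := by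
      intro t
      rw [(hasDerivAt_ramificationCircle ha hX s t).deriv, ramificationCircle_fst,
        add_sub_cancel_left, mul_div_cancel_right₀]
      exact pow_ne_zero 2 (mul_ne_zero (by exact_mod_cast hs0) (Complex.exp_ne_zero _))
    simp only [h1]
    simp

end Contour

end Hyperelliptic

/-! ### The annulus integral as a contour integral -/

section Annulus

variable {R : ℝ}

lemma cutoffBar_eq (R : ℝ) (z : ℂ) : cutoffBar R z =
    (deriv (fun v : ℝ => Real.smoothTransition (2 - v / R ^ 2)) (‖z‖ ^ 2) : ℝ) * z := by
  have h1 : Differentiable ℝ fun v : ℝ => Real.smoothTransition (2 - v / R ^ 2) :=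
    (Real.smoothTransition.contDiff (n := 1)).differentiable (by simp) |>.comp (by fun_prop)
  have h2 := (h1 (‖z‖ ^ 2)).hasDerivAt.comp_hasFDerivAt z (hasStrictFDerivAt_norm_sq z).hasFDerivAt
  have h3 := Complex.ofRealCLM.hasFDerivAt.comp z h2
  have h4 : fderiv ℝ (fun z => (discCutoff R z : ℂ)) z = _ := h3.fderiv
  rw [cutoffBar, wirtingerBar, h4]
  set d := deriv (fun v : ℝ => Real.smoothTransition (2 - v / R ^ 2)) (‖z‖ ^ 2)
  have h5 : inner ℝ z (1 : ℂ) = z.re := by simp [Complex.inner]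
  have h6 : inner ℝ z Complex.I = z.im := by simp [Complex.inner]
  simp [h5, h6]
  linear_combination (d : ℂ) * Complex.re_add_im z

/-- In polar coordinates the radial integrand is the derivative of the cutoff function. -/
lemma hasDerivAt_discCutoff_sq (R s : ℝ) : HasDerivAt (fun s : ℝ => discCutoff R ((s : ℂ) ^ 2))
    (deriv (fun v : ℝ => Real.smoothTransition (2 - v / R ^ 2)) (s ^ 4) * (4 * s ^ 3)) s := by
  have h1 : Differentiable ℝ fun v : ℝ => Real.smoothTransition (2 - v / R ^ 2) :=
    (Real.smoothTransition.contDiff (n := 1)).differentiable (by simp) |>.comp (by fun_prop)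
  have h2 := (h1 (s ^ 4)).hasDerivAt.comp s (hasDerivAt_pow 4 s)
  have h3 : (fun s : ℝ => discCutoff R ((s : ℂ) ^ 2)) =
      (fun v : ℝ => Real.smoothTransition (2 - v / R ^ 2)) ∘ fun s => s ^ 4 := by
    funext s
    simp only [discCutoff, Function.comp, norm_pow, Complex.norm_real, Real.norm_eq_abs, sq_abs]
    ring_nf
  rw [h3]
  simpa using h2

lemma integral_deriv_discCutoff_sq (hR : 0 < R) :
    ∫ s in Set.Ioi (0 : ℝ), deriv (fun s : ℝ => discCutoff R ((s : ℂ) ^ 2)) s = -1 := by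
  have h1 : ContDiff ℝ 1 fun s : ℝ => discCutoff R ((s : ℂ) ^ 2) :=
    ((contDiff_discCutoff R).of_le (n := ∞) (by norm_num)).comp (Complex.ofRealCLM.contDiff.pow 2)
  have h2 : HasCompactSupport fun s : ℝ => discCutoff R ((s : ℂ) ^ 2) := by
    refine HasCompactSupport.of_support_subset_isCompact
      (isCompact_closedBall (0 : ℝ) (1 + 2 * R)) fun s hs => ?_
    rw [mem_closedBall_zero_iff]
    by_contra h
    refine hs (discCutoff_eq_zero hR ?_)
    rw [norm_pow, Complex.norm_real]
    nlinarith [norm_nonneg s]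
  rw [h2.integral_Ioi_deriv_eq h1 0, discCutoff_eq_one hR (by simpa using hR.le)]

/-- If all circles about the origin give the same contour integral `J`, then so does every annulus,
up to a factor: the radial integral of the derivative of the cutoff function is `-1`. -/
theorem integral_cutoffBar_mul (hR : 0 < R) {T : ℂ → ℂ}
    (hT : ∀ w, R ≤ ‖w ^ 2‖ → ‖w ^ 2‖ ≤ 2 * R → ContinuousAt T w) {J : ℂ}
    (hJ : ∀ s : ℝ, 0 < s → R ≤ s ^ 2 → s ^ 2 ≤ 2 * R →
      ∫ t in (0 : ℝ)..1, T (s * Complex.exp ((2 * Real.pi * t - Real.pi : ℝ) * Complex.I)) *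
        (2 * (2 * Real.pi * Complex.I) *
          (s * Complex.exp ((2 * Real.pi * t - Real.pi : ℝ) * Complex.I)) ^ 2) = J) :
    ∫ w : ℂ, 4 * (‖w‖ ^ 2 : ℝ) * cutoffBar R (w ^ 2) * T w = -J / (2 * Complex.I) := by
  set K : ℂ → ℂ := fun w => 4 * (‖w‖ ^ 2 : ℝ) * cutoffBar R (w ^ 2) * T w with hK
  have hKs (w : ℂ) (hw : ‖w ^ 2‖ < R ∨ 2 * R < ‖w ^ 2‖) : K w = 0 := by
    simp only [hK, cutoffBar_eq_zero hR hw, mul_zero, zero_mul]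
  have hcl : IsClosed {w : ℂ | R ≤ ‖w ^ 2‖ ∧ ‖w ^ 2‖ ≤ 2 * R} := by
    have h1 : Continuous fun w : ℂ => ‖w ^ 2‖ := by fun_prop
    exact (isClosed_le continuous_const h1).inter (isClosed_le h1 continuous_const)
  have hKt : tsupport K ⊆ {w : ℂ | R ≤ ‖w ^ 2‖ ∧ ‖w ^ 2‖ ≤ 2 * R} := by
    refine closure_minimal (fun w hw => ?_) hcl
    by_contra h1
    refine hw (hKs w ?_)
    by_contra h3
    push Not at h3
    exact h1 h3
  have hKc : Continuous K := by
    refine continuous_of_tsupport fun w hw => ?_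
    have h1 : Continuous fun w : ℂ => 4 * ((‖w‖ ^ 2 : ℝ) : ℂ) * cutoffBar R (w ^ 2) :=
      (continuous_const.mul (Complex.continuous_ofReal.comp (by fun_prop))).mul
        ((continuous_cutoffBar R).comp (by fun_prop))
    exact h1.continuousAt.mul (hT w (hKt hw).1 (hKt hw).2)
  have hpol (p : ℝ × ℝ) : Complex.polarCoord.symm p = p.1 * Complex.exp (p.2 * Complex.I) := by
    rw [Complex.polarCoord_symm_apply, Complex.exp_mul_I]
    push_cast; rfl
  have hnorm (s θ : ℝ) : ‖((s : ℂ) * Complex.exp (θ * Complex.I)) ^ 2‖ = s ^ 2 := by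
    rw [norm_pow, norm_mul, Complex.norm_exp_ofReal_mul_I, mul_one, Complex.norm_real,
      Real.norm_eq_abs, sq_abs]
  have hgc : Continuous fun p : ℝ × ℝ => p.1 • K (Complex.polarCoord.symm p) := by
    simp only [hpol]
    exact continuous_fst.smul (hKc.comp ((Complex.continuous_ofReal.comp continuous_fst).mul
      (((Complex.continuous_ofReal.comp continuous_snd).mul continuous_const).cexp)))
  have hint : IntegrableOn (fun p : ℝ × ℝ => p.1 • K (Complex.polarCoord.symm p))
      (Set.Ioi 0 ×ˢ Set.Ioo (-Real.pi) Real.pi) := by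
    have h1 : IntegrableOn (fun p : ℝ × ℝ => p.1 • K (Complex.polarCoord.symm p))
        (Set.Icc 0 (1 + 2 * R) ×ˢ Set.Icc (-Real.pi) Real.pi) :=
      hgc.continuousOn.integrableOn_compact (isCompact_Icc.prod isCompact_Icc)
    refine h1.of_forall_sdiff_eq_zero (measurableSet_Ioi.prod measurableSet_Ioo) ?_
    rintro ⟨s, θ⟩ ⟨⟨h2, h3⟩, h4⟩
    have h5 : 1 + 2 * R < s := by
      by_contra h6
      exact h4 ⟨⟨(Set.mem_Ioi.1 h2).le, not_lt.1 h6⟩, h3.1.le, h3.2.le⟩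
    simp only [hpol]
    rw [hKs _ (Or.inr ?_), smul_zero]
    rw [hnorm]
    nlinarith
  rw [← Complex.integral_comp_polarCoord_symm]
  change ∫ p in Set.Ioi (0 : ℝ) ×ˢ Set.Ioo (-Real.pi) Real.pi, _ = _
  rw [Measure.volume_eq_prod, setIntegral_prod _ (by rwa [← Measure.volume_eq_prod])]
  have hinner : ∀ s ∈ Set.Ioi (0 : ℝ), ∫ θ in Set.Ioo (-Real.pi) Real.pi,
      s • K (Complex.polarCoord.symm (s, θ)) =
        ((deriv (fun s : ℝ => discCutoff R ((s : ℂ) ^ 2)) s : ℝ) : ℂ) * (J / (2 * Complex.I)) := by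
    intro s hs
    have hs0 : 0 < s := hs
    have hq (θ : ℝ) : cutoffBar R ((s * Complex.exp (θ * Complex.I)) ^ 2) =
        (deriv (fun v : ℝ => Real.smoothTransition (2 - v / R ^ 2)) (s ^ 4) : ℝ) *
          (s * Complex.exp (θ * Complex.I)) ^ 2 := by
      rw [cutoffBar_eq, hnorm, ← pow_mul]
    rw [(hasDerivAt_discCutoff_sq R s).deriv]
    set d := deriv (fun v : ℝ => Real.smoothTransition (2 - v / R ^ 2)) (s ^ 4)
    -- on the circle of radius `s` the factor `∂χ/∂z̄` is a constant times `w²`, as is `dx/dt`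
    by_cases hsR : R ≤ s ^ 2 ∧ s ^ 2 ≤ 2 * R
    · have h1 := hJ s hs0 hsR.1 hsR.2
      have h2 := intervalIntegral.smul_integral_comp_mul_sub (a := 0) (b := 1)
        (f := fun θ : ℝ => T (s * Complex.exp (θ * Complex.I)) *
          (2 * (2 * Real.pi * Complex.I) * (s * Complex.exp (θ * Complex.I)) ^ 2))
        (2 * Real.pi) Real.pi
      simp only [h1] at h2
      have h3 (θ : ℝ) : s • K (Complex.polarCoord.symm (s, θ)) =
          (4 * s ^ 3 * d / (2 * (2 * Real.pi * Complex.I)) : ℂ) *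
            (T (s * Complex.exp (θ * Complex.I)) *
              (2 * (2 * Real.pi * Complex.I) * (s * Complex.exp (θ * Complex.I)) ^ 2)) := by
        have h4 : ‖(s : ℂ) * Complex.exp (θ * Complex.I)‖ = s := by
          rw [norm_mul, Complex.norm_exp_ofReal_mul_I, mul_one, Complex.norm_real,
            Real.norm_of_nonneg hs0.le]
        have h5 : (Real.pi : ℂ) ≠ 0 := by exact_mod_cast Real.pi_ne_zero
        simp only [hpol, hK, hq, h4, Complex.real_smul]
        field_simp [Complex.I_ne_zero]
        push_cast
        ring
      simp only [h3]
      rw [← integral_Ioc_eq_integral_Ioo, ← intervalIntegral.integral_of_le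
        (by linarith [Real.pi_pos]), intervalIntegral.integral_const_mul]
      have h6 : 2 * Real.pi * 0 - Real.pi = -Real.pi := by ring
      have h7 : 2 * Real.pi * 1 - Real.pi = Real.pi := by ring
      rw [h6, h7] at h2
      rw [← h2, Complex.real_smul]
      have h5 : (Real.pi : ℂ) ≠ 0 := by exact_mod_cast Real.pi_ne_zero
      push_cast
      field_simp [Complex.I_ne_zero]
      try ring
    · have hd : d = 0 := by
        have h1 := hq 0
        rw [cutoffBar_eq_zero hR (by rw [hnorm]; by_contra h3; push Not at h3; exact hsR h3)] at h1
        have h2 := mul_eq_zero.1 h1.symm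
        simpa [hs0.ne'] using h2
      have h2 (θ : ℝ) : K (Complex.polarCoord.symm (s, θ)) = 0 := by
        refine hKs _ ?_
        rw [hpol, hnorm]
        by_contra h3
        push Not at h3
        exact hsR h3
      simp only [h2, hd]
      simp
  rw [setIntegral_congr_fun measurableSet_Ioi hinner, integral_mul_const, integral_complex_ofReal,
    integral_deriv_discCutoff_sq hR]
  push_cast
  ring

end Annulus

/-! ### The differential of the singular state -/

namespace Hyperelliptic

open RiemannSurface

variable {g : ℕ} {a : ℂ} {ha : a ≠ 0} {X : Config g} {S : Type} [TopologicalSpace S]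
  {κ : Cutoff} {δ R ε : ℝ} {N : ℕ}

lemma exists_isChartRadius {n : ℕ} (ha : a ≠ 0) {X : Fin n → ℂ} (hX : Function.Injective X) :
    ∀ᶠ R in 𝓝[>] (0 : ℝ), IsChartRadius a X R := by
  have h1 : ∀ᶠ R in 𝓝[>] (0 : ℝ), ∀ j, ∀ x, ‖x - X j‖ ≤ 2 * R →
      hCofactor a X j x / hCofactor a X j (X j) ∈ Complex.slitPlane := by
    rw [eventually_all]
    intro j
    have hc : ContinuousAt (fun x => hCofactor a X j x / hCofactor a X j (X j)) (X j) := by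
      unfold hCofactor
      fun_prop
    have h2 : hCofactor a X j (X j) / hCofactor a X j (X j) ∈ Complex.slitPlane := by
      rw [div_self (hCofactor_ne_zero ha hX j)]
      exact Complex.one_mem_slitPlane
    obtain ⟨η, hη, h3⟩ := Metric.eventually_nhds_iff.1
      (hc.eventually (Complex.isOpen_slitPlane.mem_nhds h2))
    filter_upwards [mem_nhdsWithin_of_mem_nhds (Iio_mem_nhds (half_pos hη))] with R hR x hx
    refine h3 ?_
    have : R < η / 2 := hR
    rw [dist_eq_norm]
    linarith
  exact h1

lemma eventually_isGoodRadius {n : ℕ} {X : Fin n → ℂ} (hX : Function.Injective X) :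
    ∀ᶠ R in 𝓝[>] (0 : ℝ), IsGoodRadius X R := by
  have h1 : ∀ᶠ R in 𝓝[>] (0 : ℝ), ∀ j k, j ≠ k → 8 * R ≤ ‖X j - X k‖ := by
    simp only [eventually_all]
    intro j k hjk
    have h2 : 0 < ‖X j - X k‖ / 8 := div_pos (norm_pos_iff.2 (sub_ne_zero.2 (hX.ne hjk))) (by simp)
    filter_upwards [mem_nhdsWithin_of_mem_nhds (Iio_mem_nhds h2)] with R hR
    have : R < ‖X j - X k‖ / 8 := hR
    linarith
  filter_upwards [self_mem_nhdsWithin, h1] with R h2 h3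
  exact ⟨h2, h3⟩

/-- A loop around a ramification point lies over an annulus with positive inner radius and with
outer radius smaller than that of the given disc. -/
lemma exists_annulus {n : ℕ} {X : Fin n → ℂ} {j : Fin n} {r s : ℝ} {γ : ℝ → AffineCurve a X}
    (hγ : IsLoopAround X j r γ) (hs : s < r) : ∃ m > 0, ∃ ρ, s < ρ ∧ ρ < r ∧
      ∀ t ∈ Set.Icc (0 : ℝ) 1, m < ‖(γ t).1.1 - X j‖ ∧ ‖(γ t).1.1 - X j‖ < ρ := by
  have hc : ContinuousOn (fun t => ‖(γ t).1.1 - X j‖) (Set.Icc (0 : ℝ) 1) :=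
    (hγ.smooth.continuous.sub continuous_const).norm.continuousOn
  have hne : (Set.Icc (0 : ℝ) 1).Nonempty := ⟨0, by simp⟩
  obtain ⟨t₀, ht₀, h0⟩ := isCompact_Icc.exists_isMinOn hne hc
  obtain ⟨t₁, ht₁, h1⟩ := isCompact_Icc.exists_isMaxOn hne hc
  have h2 : 0 < ‖(γ t₀).1.1 - X j‖ := norm_pos_iff.2 (sub_ne_zero.2 (hγ.avoids t₀ ht₀))
  obtain ⟨ρ, h3, h4⟩ := exists_between (max_lt hs (hγ.mem t₁ ht₁))
  exact ⟨‖(γ t₀).1.1 - X j‖ / 2, half_pos h2, ρ, (le_max_left _ _).trans_lt h3, h4, fun t ht =>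
    ⟨(half_lt_self h2).trans_le (h0 ht), (h1 ht).trans_lt ((le_max_right _ _).trans_lt h3)⟩⟩

section Annulus

variable {j : Fin (2 * g + 1)} {r ρ : ℝ} {C : ConformalFieldTheory.{u} S}
  {φ : Fin N → C.Field (hyperellipticCurve ha X)} (hδ0 : 0 < δ)
  (hr : ∀ k, k ≠ j → r ≤ ‖X.1 k - X.1 j‖) (hφr : ∀ i, r ≤ ‖xCoord ha X (φ i).1 - X.1 j‖)
  (hδr : δ ≤ r - ρ) (hδρ : ‖X.1 j‖ + ρ ≤ 1 / δ)

include hδ0 hr hφr hδr hδρ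

lemma curvePoint_mem_flatPart {P : AffineCurve a X.1} (h1 : δ < ‖P.1.1 - X.1 j‖)
    (h2 : ‖P.1.1 - X.1 j‖ < ρ) : curvePoint ha X P ∈ flatPart ha X δ φ := by
  have hk (k) : δ < ‖P.1.1 - X.1 k‖ := by
    by_cases hkj : k = j
    · rwa [hkj]
    · have h3 := hr k hkj
      have h4 : ‖X.1 k - X.1 j‖ ≤ ‖P.1.1 - X.1 j‖ + ‖P.1.1 - X.1 k‖ := by
        rw [show X.1 k - X.1 j = (P.1.1 - X.1 j) - (P.1.1 - X.1 k) by ring]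
        exact norm_sub_le _ _
      linarith
  refine ⟨⟨P, fun h0 => ?_, rfl⟩, ⟨hk, ?_⟩, fun i hi => ?_⟩
  · obtain ⟨k, h3⟩ := (snd_eq_zero_iff ha P).1 h0
    have h4 := hk k
    rw [h3, sub_self, norm_zero] at h4
    linarith
  · have h3 : ‖P.1.1‖ ≤ ‖P.1.1 - X.1 j‖ + ‖X.1 j‖ := by
      simpa using norm_add_le (P.1.1 - X.1 j) (X.1 j)
    rw [xCoord_curvePoint, mul_comm, ← lt_div_iff₀ hδ0]
    linarith
  · have h3 := hφr i
    rw [hi, xCoord_curvePoint] at h3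
    linarith

/-- The stress tensor inside the `N`-point function is holomorphic over an annulus in the flat part
of the curve. -/
lemma isHolomorphicOver_stressCorr (hS : IsSmallScale δ X.1)
    (hX : Nonempty (hyperellipticCurve ha X ≃ₜ S)) (hφ : Separated φ) :
    IsHolomorphicOver X.1 j δ ρ fun P => C.stressCorr ha κ δ φ (curvePoint ha X P) := by
  intro P h h1 h2
  have hs := mem_coordChart_source_self ha X h
  have h3 := (coordChart ha X P h).map_source hs
  have h4 := (coordChart ha X P h).left_inv hs
  rw [coordChart_apply] at h3 h4
  have h5 := (coordChart ha X P h).continuousOn_symm.isOpen_inter_preimage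
    (coordChart ha X P h).open_target (isOpen_flatPart (δ := δ) ha X φ)
  have h6 : P.1.1 ∈ (coordChart ha X P h).target ∩
      (coordChart ha X P h).symm ⁻¹' flatPart ha X δ φ := by
    refine ⟨h3, ?_⟩
    rw [Set.mem_preimage, h4]
    exact curvePoint_mem_flatPart hδ0 hr hφr hδr hδρ h1 h2
  have h7 := (C.differentiableOn_stressCorr ha (κ := κ) (isMetricSurface hS hX) hφ hS
    h).differentiableAt (h5.mem_nhds h6)
  simpa only [coordChart_symm_apply] using h7

end Annulus

/-- The holomorphic derivative with respect to the branch point `X j` is a contour integral of the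
stress tensor around the ramification point. -/
theorem holomorphic_deriv_movedCorr_eq_contour {C : ConformalFieldTheory.{u} S}
    {φ : Fin N → C.Field (hyperellipticCurve ha X)} (h : IsGoodRadius X.1 R) (hε0 : 0 < ε)
    (hε : ∀ d, ‖d‖ < ε → IsSmallShift X.1 R d) (hδ : IsFineScale X.1 R δ)
    (hX : Nonempty (hyperellipticCurve ha X ≃ₜ S)) (hφ : Separated φ)
    (hφu : ∀ i, (φ i).1 ∈ unramified ha X)
    (hφx : ∀ i j, 2 * R < ‖xCoord ha X (φ i).1 - X.1 j‖) (hRc : IsChartRadius a X.1 R)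
    {j : Fin (2 * g + 1)} {r ρ : ℝ} (hr : ∀ k, k ≠ j → r ≤ ‖X.1 k - X.1 j‖)
    (hφr : ∀ i, r ≤ ‖xCoord ha X (φ i).1 - X.1 j‖) (hRρ : 2 * R < ρ) (hδr : δ ≤ r - ρ)
    (hδρ : ‖X.1 j‖ + ρ ≤ 1 / δ) {γ : ℝ → AffineCurve a X.1} (hγ : IsLoopAround X.1 j r γ)
    (hγb : ∀ t ∈ Set.Icc (0 : ℝ) 1, δ < ‖(γ t).1.1 - X.1 j‖ ∧ ‖(γ t).1.1 - X.1 j‖ < ρ) :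
    (fderiv ℝ (movedCorr κ δ C h hε0 hε φ) X.1 (Pi.single j 1) -
      Complex.I * fderiv ℝ (movedCorr κ δ C h hε0 hε φ) X.1 (Pi.single j Complex.I)) / 2 =
    -(∫ t in (0 : ℝ)..1, C.stressCorr ha κ δ φ (curvePoint ha X (γ t)) *
      deriv (fun t => (γ t).1.1) t) / (2 * Complex.I) := by
  have hR := h.pos
  have hδ0 := hδ.pos
  have hδR := hδ.le
  have hS : IsSmallScale δ X.1 := hδ.isSmallScale h (hε _ (by simpa using hε0))
  have hA := isMetricSurface (κ := κ) (ha := ha) hS hX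
  set e := ramificationChart ha X j with he
  obtain ⟨J, hJ⟩ := exists_contour_integral_eq ha X.2 hr (by linarith : ρ ≤ r)
    (isHolomorphicOver_stressCorr (κ := κ) hδ0 hr hφr hδr hδρ hS hX hφ)
  rw [holomorphic_deriv_movedCorr h hε0 hε hδ hX hφ hφu hφx hRc j, hJ γ hγ hγb,
    setIntegral_eq_integral_of_forall_compl_eq_zero]
  · refine integral_cutoffBar_mul hR (fun w h1 h2 => ?_) fun s hs h1 h2 => ?_
    · have hw : w ∈ e.target := hRc j _ (by rwa [add_sub_cancel_left])
      refine ContinuousAt.comp (C.continuousAt_stressCorr ha hA hφ ?_) (e.continuousAt_symm hw)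
      have hw0 : w ≠ 0 := by
        rintro rfl
        rw [zero_pow two_ne_zero, norm_zero] at h1
        linarith
      refine mem_flatPart_of_annulus hδ hφx j h
        (ramificationChart_symm_mem_unramified ha X hw hw0) ?_ ?_
      · change R ≤ ‖X.1 j + w ^ 2 - X.1 j‖
        rw [add_sub_cancel_left]; exact h1
      · change ‖X.1 j + w ^ 2 - X.1 j‖ ≤ _
        rw [add_sub_cancel_left]; exact h2
    · rw [← hJ (ramificationCircle ha X.2 j s)
        (isLoopAround_ramificationCircle ha X.2 hRc hs.ne' h2 (by linarith)) fun t _ => by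
          rw [norm_ramificationCircle]; constructor <;> linarith]
      refine intervalIntegral.integral_congr fun t _ => ?_
      rw [(hasDerivAt_ramificationCircle ha X.2 s t).deriv]
      rfl
  · intro w hw
    rw [cutoffBar_eq_zero hR, mul_zero, zero_mul]
    by_contra h1
    push Not at h1
    exact hw (hRc j _ (by rw [add_sub_cancel_left]; exact h1.2))

/-- Near a configuration of branch points the singular `N`-point function of fields at points with
fixed `x` is a constant multiple of the `N`-point function of fields that move with the curve. -/
lemma exists_singularNPoint_eventuallyEq (C : ConformalFieldTheory.{u} S) {Z : ℝ → ℂ}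
    (hZ : IsRenormalization (g := g) ha C κ Z) (hδ : IsFineScale X.1 R δ)
    (h : IsGoodRadius X.1 R) (hε0 : 0 < ε) (hε : ∀ d, ‖d‖ < ε → IsSmallShift X.1 R d)
    (hX : Nonempty (hyperellipticCurve ha X ≃ₜ S)) (v : Fin N → C.F) {x : Fin N → ℂ}
    {P : ∀ Y : Config g, Fin N → AffineCurve a Y.1} (hPx : ∀ Y i, (P Y i).1.1 = x i)
    (hPy : ∀ i, ContinuousAt (fun Y : Config g => (P Y i).1.2) X)
    (hP : Function.Injective (P X)) (hx : ∀ i j, 2 * R < ‖x i - X.1 j‖)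
    (hu : ∀ i, curvePoint ha X (P X i) ∈ unramified ha X) :
    ∃ K : ℂ, (∀ (N : ℕ) (φ : Fin N → C.Field (hyperellipticCurve ha X)), Separated φ →
      (∀ i, (φ i).1 ∈ unramified ha X) → singularCorr ha C κ Z X φ =
        K * C.corr (hyperellipticCurve ha X) (regularizedMetric ha κ δ X) φ) ∧
      singularNPoint ha C κ Z P v =ᶠ[𝓝 X.1] fun Y =>
        K * movedCorr κ δ C h hε0 hε (fieldsAt ha C X (P X) v) Y := by
  obtain ⟨K, hK⟩ := exists_singularCorr_eq C hZ hδ h hε0 hε hX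
  refine ⟨K, hK X (by simpa using hε0), ?_⟩
  have h1 : ∀ᶠ Y in 𝓝 X, ∀ i, ∀ hs : IsSmallShift X.1 R (Y.1 - X.1),
      affineHomeomorph a h hs (P X i) = P Y i :=
    eventually_all.2 fun i => eventually_eq_affineHomeomorph ha h (P := fun Y => P Y i)
      (fun Y => hPx Y i) (hPy i) fun j => (hx i j).le
  rw [nhds_subtype_eq_comap, eventually_comap] at h1
  have h2 : ∀ᶠ y in 𝓝 X.1, ‖y - X.1‖ < ε := by
    have : ContinuousAt (fun y : Fin (2 * g + 1) → ℂ => ‖y - X.1‖) X.1 := by fun_prop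
    exact this.eventually (gt_mem_nhds (by simpa using hε0))
  filter_upwards [h1, h2] with y hy1 hy2
  have hinj := injective_of_near h (hε _ hy2)
  have hn : nearConfig X ε y = ⟨y, hinj⟩ := Subtype.ext (nearConfig_val h hε hy2)
  have hi := hy1 ⟨y, hinj⟩ rfl
  rw [singularNPoint, dif_pos hinj]
  unfold movedCorr
  generalize_proofs hs
  revert hs
  rw [hn]
  intro hs
  have hf : fieldsAt ha C ⟨y, hinj⟩ (P ⟨y, hinj⟩) v = fun i => C.toFBundleFunctor.push
      (curveHomeomorph ha h hs) (fieldsAt ha C X (P X) v i) := by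
    funext i
    have h3 : curvePoint ha X (P X i) ∈ outsideDiscs ha X R :=
      mem_outsideDiscs (hu i) fun j => by rw [xCoord_curvePoint, hPx]; exact hx i j
    refine Eq.trans ?_ (push_localField_of_translation C.toFBundleFunctor
      (fun p hp => unramified_curveHomeomorph ha h hs hp) (isTranslationOn_outsideDiscs ha h hs)
      h3 (hu i) (v i)).symm
    rw [curveHomeomorph_curvePoint, hi]
    rfl
  have hp (i) : (fieldsAt ha C ⟨y, hinj⟩ (P ⟨y, hinj⟩) v i).1 =
      curveHomeomorph ha h hs (curvePoint ha X (P X i)) := by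
    rw [curveHomeomorph_curvePoint, hi]
    rfl
  rw [hK ⟨y, hinj⟩ hy2 N, ← hf]
  · intro i k hik
    simp only [hp] at hik
    exact hP (curvePoint_injective ha X ((curveHomeomorph ha h hs).injective hik))
  · intro i
    rw [hp]
    exact unramified_curveHomeomorph ha h hs (hu i)

end Hyperelliptic

theorem mainTheorem2 {g : ℕ} (hg : 1 ≤ g) {a : ℂ} (ha : a ≠ 0) (X₀ : Config g)
    (C : ConformalFieldTheory.{u} (hyperellipticCurve ha X₀))
    (κ : Cutoff) (Z : ℝ → ℂ) (hZ : IsRenormalization (g := g) ha C κ Z)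
    {N : ℕ} (v : Fin N → C.F) (x : Fin N → ℂ)
    (P : ∀ X : Config g, Fin N → AffineCurve a X.1)
    (hPx : ∀ X i, (P X i).1.1 = x i)
    (hPy : ∀ i, ContinuousAt (fun X : Config g => (P X i).1.2) X₀)
    (hP : Function.Injective (P X₀))
    (r : Fin (2 * g + 1) → ℝ)
    (hr : ∀ j, (∀ k, k ≠ j → r j ≤ ‖X₀.1 k - X₀.1 j‖) ∧ ∀ i, r j ≤ ‖x i - X₀.1 j‖)
    (γ : Fin (2 * g + 1) → ℝ → AffineCurve a X₀.1)
    (hγ : ∀ j, IsLoopAround X₀.1 j (r j) (γ j)) :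
    DifferentiableAt ℝ (singularNPoint ha C κ Z P v) X₀.1 ∧
    ∀ᶠ δ₀ in 𝓝[>] (0 : ℝ),
      (∀ j, IntervalIntegrable (fun t =>
        singularVirasoroCorr ha C κ Z δ₀ X₀ (γ j t) (fieldsAt ha C X₀ (P X₀) v) *
          deriv (fun t => (γ j t).1.1) t) volume 0 1) ∧
      ∀ ξ : Fin (2 * g + 1) → ℂ,
        (fderiv ℝ (singularNPoint ha C κ Z P v) X₀.1 ξ -
          Complex.I * fderiv ℝ (singularNPoint ha C κ Z P v) X₀.1 (Complex.I • ξ)) / 2 =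
        ∑ j, (1 / (2 * Real.pi * Complex.I) * ∫ t in (0 : ℝ)..1,
          singularVirasoroCorr ha C κ Z δ₀ X₀ (γ j t) (fieldsAt ha C X₀ (P X₀) v) *
            deriv (fun t => (γ j t).1.1) t) * ξ j := by
  open Hyperelliptic in
  have hr0 (j) : 0 < r j := (norm_nonneg _).trans_lt ((hγ j).mem 0 (by simp))
  obtain ⟨R, hRr, h, hRc⟩ : ∃ R, (∀ j, 2 * R < r j) ∧ IsGoodRadius X₀.1 R ∧
      IsChartRadius a X₀.1 R := by
    have h1 : ∀ᶠ R in 𝓝[>] (0 : ℝ), ∀ j, 2 * R < r j := by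
      rw [eventually_all]
      intro j
      filter_upwards [mem_nhdsWithin_of_mem_nhds (Iio_mem_nhds (half_pos (hr0 j)))] with R hR
      have : R < r j / 2 := hR
      linarith
    exact (h1.and ((eventually_isGoodRadius X₀.2).and (exists_isChartRadius ha X₀.2))).exists
  obtain ⟨ε, hε0, hε⟩ := exists_isSmallShift X₀.1 h.pos
  have hX : Nonempty (hyperellipticCurve ha X₀ ≃ₜ hyperellipticCurve ha X₀) :=
    ⟨Homeomorph.refl _⟩
  have hx (i j) : 2 * R < ‖x i - X₀.1 j‖ := (hRr j).trans_le ((hr j).2 i)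
  have hu (i) : curvePoint ha X₀ (P X₀ i) ∈ unramified ha X₀ := by
    refine ⟨_, fun h0 => ?_, rfl⟩
    obtain ⟨j, hj⟩ := (snd_eq_zero_iff ha _).1 h0
    have h1 := hx i j
    rw [← hPx X₀ i, hj, sub_self, norm_zero] at h1
    linarith [h.pos]
  set φ := fieldsAt ha C X₀ (P X₀) v with hφdef
  have hφ : Separated φ := fun i k hik => hP (curvePoint_injective ha X₀ hik)
  have hφx : ∀ i j, 2 * R < ‖xCoord ha X₀ (φ i).1 - X₀.1 j‖ := fun i j => by
    change 2 * R < ‖(P X₀ i).1.1 - X₀.1 j‖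
    rw [hPx]; exact hx i j
  have hφr (j i) : r j ≤ ‖xCoord ha X₀ (φ i).1 - X₀.1 j‖ := by
    change r j ≤ ‖(P X₀ i).1.1 - X₀.1 j‖
    rw [hPx]; exact (hr j).2 i
  have hdiff {δ : ℝ} (hδ : IsFineScale X₀.1 R δ) :
      DifferentiableAt ℝ (movedCorr κ δ C h hε0 hε φ) X₀.1 :=
    (contDiffAt_movedCorr h hε0 hε hδ hX hφ hu hφx).differentiableAt (by simp)
  refine ⟨?_, ?_⟩
  · obtain ⟨δ, hδ⟩ := (eventually_isFineScale X₀.1 h.pos).exists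
    obtain ⟨K, -, hK⟩ := exists_singularNPoint_eventuallyEq C hZ hδ h hε0 hε hX v hPx hPy hP hx hu
    exact ((hdiff hδ).const_mul K).congr_of_eventuallyEq hK
  -- `δ` has to be so small that the annuli containing the loops lie in the flat part
  choose m hm ρ hRρ hρr hγb using fun j => exists_annulus (hγ j) (hRr j)
  have hev : ∀ᶠ δ in 𝓝[>] (0 : ℝ), ∀ j, δ < m j ∧ δ ≤ r j - ρ j ∧ ‖X₀.1 j‖ + ρ j ≤ 1 / δ := by
    rw [eventually_all]
    intro j
    filter_upwards [mem_nhdsWithin_of_mem_nhds (Iio_mem_nhds (hm j)),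
      mem_nhdsWithin_of_mem_nhds (Iio_mem_nhds (sub_pos.2 (hρr j))),
      tendsto_inv_nhdsGT_zero.eventually_ge_atTop (‖X₀.1 j‖ + ρ j)] with δ h1 h2 h3
    exact ⟨h1, le_of_lt h2, by rwa [one_div]⟩
  filter_upwards [eventually_isFineScale X₀.1 h.pos, hev] with δ hδ hδm
  have hδ0 := hδ.pos
  have hS : IsSmallScale δ X₀.1 := hδ.isSmallScale h (hε _ (by simpa using hε0))
  have hA := isMetricSurface (κ := κ) (ha := ha) hS hX
  have hγδ (j) : ∀ t ∈ Set.Icc (0 : ℝ) 1,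
      δ < ‖(γ j t).1.1 - X₀.1 j‖ ∧ ‖(γ j t).1.1 - X₀.1 j‖ < ρ j := fun t ht =>
    ⟨(hδm j).1.trans (hγb j t ht).1, (hγb j t ht).2⟩
  have hflat (j) (t) (ht : t ∈ Set.Icc (0 : ℝ) 1) :
      curvePoint ha X₀ (γ j t) ∈ flatPart ha X₀ δ φ :=
    curvePoint_mem_flatPart hδ0 (hr j).1 (hφr j) (hδm j).2.1 (hδm j).2.2 (hγδ j t ht).1
      (hγδ j t ht).2
  obtain ⟨K, hKX, hK⟩ := exists_singularNPoint_eventuallyEq C hZ hδ h hε0 hε hX v hPx hPy hP hx hu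
  have hvir (j) (t) (ht : t ∈ Set.Icc (0 : ℝ) 1) :
      singularVirasoroCorr ha C κ Z δ X₀ (γ j t) φ * deriv (fun t => (γ j t).1.1) t =
        (K * -Real.pi) * (C.stressCorr ha κ δ φ (curvePoint ha X₀ (γ j t)) *
          deriv (fun t => (γ j t).1.1) t) := by
    rw [singularVirasoroCorr, hKX, C.corr_virasoro ha hA hφ hδ0 (hflat j t ht)]
    · ring
    · exact C.separated_cons hφ (hflat j t ht).2.2 _
    · intro i
      refine Fin.cases (hflat j t ht).1 (fun i => ?_) i
      exact hu i
  have hcont (j) : IntervalIntegrable (fun t => C.stressCorr ha κ δ φ (curvePoint ha X₀ (γ j t)) *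
      deriv (fun t => (γ j t).1.1) t) volume 0 1 := by
    refine ContinuousOn.intervalIntegrable fun t ht => ?_
    rw [Set.uIcc_of_le zero_le_one] at ht
    refine ContinuousAt.continuousWithinAt (ContinuousAt.mul ?_
      ((hγ j).smooth.continuous_deriv le_rfl).continuousAt)
    exact ContinuousAt.comp (f := fun t => curvePoint ha X₀ (γ j t))
      (C.continuousAt_stressCorr ha hA hφ (hflat j t ht))
      ((isOpenEmbedding_curvePoint ha X₀).continuous.comp (hγ j).continuous).continuousAt
  refine ⟨fun j => ?_, fun ξ => ?_⟩
  · refine ((hcont j).const_mul (K * -Real.pi)).congr fun t ht => ?_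
    rw [Set.uIoc_of_le zero_le_one] at ht
    exact (hvir j t ⟨ht.1.le, ht.2⟩).symm
  · rw [hK.fderiv_eq, fderiv_const_mul (hdiff hδ), holomorphic_part_eq_sum]
    refine Finset.sum_congr rfl fun j _ => ?_
    congr 1
    have h1 := holomorphic_deriv_movedCorr_eq_contour (κ := κ) h hε0 hε hδ hX hφ hu hφx hRc (hr j).1
      (hφr j) (hRρ j) (hδm j).2.1 (hδm j).2.2 (hγ j) (hγδ j)
    have h2 : ∫ t in (0 : ℝ)..1, singularVirasoroCorr ha C κ Z δ X₀ (γ j t) φ *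
        deriv (fun t => (γ j t).1.1) t = (K * -Real.pi) * ∫ t in (0 : ℝ)..1,
          C.stressCorr ha κ δ φ (curvePoint ha X₀ (γ j t)) * deriv (fun t => (γ j t).1.1) t := by
      rw [← intervalIntegral.integral_const_mul]
      refine intervalIntegral.integral_congr fun t ht => ?_
      rw [Set.uIcc_of_le zero_le_one] at ht
      exact hvir j t ht
    rw [h2]
    have h3 : (Real.pi : ℂ) ≠ 0 := by exact_mod_cast Real.pi_ne_zero
    have h4 : ∀ z w : ℂ, (K * z - Complex.I * (K * w)) / 2 = K * ((z - Complex.I * w) / 2) := by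
      intro z w; ring
    simp only [smul_apply, smul_eq_mul]
    -- the factor `K · (-π) / 2πi` agrees with the factor `-K / 2i` of the annulus integral
    rw [h4, h1]
    field_simp

end
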